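/- Work on the torus $\mathbb T=\mathbb R/2\pi\mathbb Z$ with real-valued functions, $\hat f(k)=(2\pi)^{-1}\int_{\mathbb T} f(x)e^{-ikx}\,dx$, $\|\cdot\|=\|\cdot\|_{L^2(\mathbb T)}$, $D=\mathcal F^{-1}|\xi|\mathcal F$, $\langle D\rangle=\mathcal F^{-1}(1+\xi^2)^{1/2}\mathcal F$, $\|f\|_{H^s}=2^{-1/2}(\|f\|^2+\|D^sf\|^2)^{1/2}$ for $s\ge 0$, $\|f\|_{H^{-1}}=\|\langle D\rangle^{-1}f\|$, and let $\mathcal H$ be the Hilbert transform, with symbol $-i\,\mathrm{sgn}(\xi)$ (and $0$ at $\xi=0$). Fix $c_1,\dots,c_7\in\mathbb R$ and put $$K(u)=\mathcal H\partial_x^3u+c_1u\partial_x^2u+c_2(\partial_xu)^2+c_3(\mathcal H\partial_xu)^2+c_4\mathcal H(u\mathcal H\partial_x^2u)+c_5\mathcal H(u^2\partial_xu)+c_6u\mathcal H(u\partial_xu)+c_7u^2\mathcal H\partial_xu-u^4 .$$ Let $\psi\in C^\infty(\mathbb R)$ with $0\le\psi\le1$, $\psi=1$ on $|\xi|\ge2$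 and $\psi=0$ on $|\xi|\le1$, and let $Jf=\mathcal F^{-1}\big(\tfrac{\psi(\xi)}{|\xi|}\hat f\big)$. Put $\lambda_1=-\tfrac{c_1}{2}+2c_2+\tfrac{c_4}{2}$, $\lambda_2=-c_4$, $\lambda_3=-2c_5-c_6$, $\lambda_4=-5c_1+4c_2+5c_4$. For $\kappa>0$ and $f,g\in H^1(\mathbb T)$, with $w=f-g$, define $$E(f,g)=\tfrac12\|w\|^2+\tfrac12\|w\|_{H^{-1}}^2\big(1+\kappa\|f\|^2+\kappa\|f\|^4\big)+\tfrac{\lambda_1}{4}\int_{\mathbb T} f\,(\mathcal Hw)\,\mathcal HJw\,dx+\tfrac{\lambda_2}{4}\int_{\mathbb T}(\mathcal H\partial_xf)(Jw)^2dx+\tfrac{\lambda_1\lambda_4+4\lambda_3}{32}\int_{\mathbb T}f^2(Jw)^2dx .$$ Call $\kappa$ admissible if, for all $f,g\in H^1(\mathbb T)$, $$E(f,g)\le\|f-g\|_{H^{-1}}^2\big(1+\kappa\|f\|^2+\kappa\|f\|^4\big)+\|f-g\|^2\le4E(f,g).$$ Finally let $I_s(f,g)=1+\|f\|_{H^s}+\|g\|_{H^s}$.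 **Proposition (energy estimate in $L^2$).** All sufficiently large $\kappa$ are admissible. Moreover, let $\kappa>0$ be admissible and let $s_0>7/2$. Then there is a constant $C>0$, depending only on $s_0$ (and on the fixed data $c_1,\dots,c_7,\psi,\kappa$), such that the following holds for all $T>0$ and $\varepsilon_1,\varepsilon_2\in(0,1)$. Let $u_j\in C([0,T];H^{s_0}(\mathbb T))\cap C((0,T);H^{s_0+1}(\mathbb T))$, $j=1,2$, satisfy $$\partial_tu_j=\partial_xK(u_j)-\varepsilon_j\partial_x^4u_j\quad\text{on }[0,T]$$ in the sense of distributions in $x$. Then $t\mapsto E(u_1(t),u_2(t))$ is differentiable on $[0,T]$ (one-sidedly at the end points), and for every $t\in[0,T]$ $$\frac{d}{dt}E(u_1(t),u_2(t))\le C\,I_{s_0}(u_1(t),u_2(t))^7\,E(u_1(t),u_2(t))+\max\{\varepsilon_1^2,\varepsilon_2^2\}\,\|u_2(t)\|_{H^{s_0+1}}^2 ,$$ where the right-hand side is read as $+\infty$ if $u_2(t)\notin H^{s_0+1}(\mathbb T)$, which can happen only for $t\in\{0,T\}$. -/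

import Mathlib

open MeasureTheory Filter Topology Set

noncomputable section

namespace BO4

instance two_pi_pos_fact : Fact (0 < 2 * Real.pi) := ⟨Real.two_pi_pos⟩

/-- The torus `ℝ / 2πℤ`; its `volume` is Lebesgue measure, of total mass `2π`. -/
abbrev Torus : Type := AddCircle (2 * Real.pi)

/-- Fourier coefficient `(2π)⁻¹ ∫ f(x) e^{-ikx} dx` of a real function on the torus. -/
def coeff (f : Torus → ℝ) (k : ℤ) : ℂ := fourierCoeff (fun x => (f x : ℂ)) k

/-- The `L²` Fourier multiplier with symbol `m`: the `L²` function whose `k`-th Fourier coefficient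
is `m k * coeff f k` (and `0` if there is no such function). All the symbols used below satisfy
`m (-k) = conj (m k)`, so that this function is real. -/
def mult (m : ℤ → ℂ) (f : Torus → ℝ) : Torus → ℝ :=
  open Classical in
  if h : Memℓp (fun k : ℤ => m k * coeff f k) 2 then
    fun x => ((fourierBasis (T := 2 * Real.pi)).repr.symm ⟨fun k => m k * coeff f k, h⟩ x).re
  else 0

/-- The derivative `∂ₓⁿ`. -/
def dx (n : ℕ) : (Torus → ℝ) → Torus → ℝ := mult fun k => (Complex.I * (k : ℂ)) ^ n

/-- The Hilbert transform, with symbol `-i sgn(k)`. -/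
def hilb : (Torus → ℝ) → Torus → ℝ := mult fun k => -Complex.I * (Int.sign k : ℂ)

/-- The operator `D^s`, with symbol `|k|^s`. -/
def absD (s : ℝ) : (Torus → ℝ) → Torus → ℝ := mult fun k => ((|(k : ℝ)| ^ s : ℝ) : ℂ)

/-- The operator `⟨D⟩⁻¹`, with symbol `(1 + k²)^{-1/2}`. -/
def invJap : (Torus → ℝ) → Torus → ℝ := mult fun k => (((√(1 + (k : ℝ) ^ 2))⁻¹ : ℝ) : ℂ)

/-- A smooth function with values in `[0,1]`, equal to `1` on `|ξ| ≥ 2` and to `0` on `|ξ| ≤ 1`. -/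
structure IsLowCut (ψ : ℝ → ℝ) : Prop where
  smooth : ContDiff ℝ (⊤ : ℕ∞) ψ
  nonneg : ∀ ξ, 0 ≤ ψ ξ
  le_one : ∀ ξ, ψ ξ ≤ 1
  eq_one : ∀ ξ, 2 ≤ |ξ| → ψ ξ = 1
  eq_zero : ∀ ξ, |ξ| ≤ 1 → ψ ξ = 0

/-- The operator `J`, with symbol `ψ(k) / |k|` (which is `0` at `k = 0`). -/
def opJ (ψ : ℝ → ℝ) : (Torus → ℝ) → Torus → ℝ := mult fun k => ((ψ k / |(k : ℝ)| : ℝ) : ℂ)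

/-- The norm of `L²(𝕋)`. -/
def l2norm (f : Torus → ℝ) : ℝ := √(∫ x, f x ^ 2)

/-- Membership in `H^s(𝕋)`, for `s ≥ 0`. -/
def MemHs (s : ℝ) (f : Torus → ℝ) : Prop :=
  MemLp f 2 volume ∧ Summable fun k : ℤ => (|(k : ℝ)| ^ s * ‖coeff f k‖) ^ 2

/-- `‖f‖_{H^s} = 2^{-1/2} (‖f‖² + ‖D^s f‖²)^{1/2}`, for `s ≥ 0` and `f ∈ H^s`. -/
def hsNorm (s : ℝ) (f : Torus → ℝ) : ℝ := (√2)⁻¹ * √(l2norm f ^ 2 + l2norm (absD s f) ^ 2)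

/-- `‖f‖_{H^{-1}} = ‖⟨D⟩⁻¹ f‖`, for `f ∈ L²`. -/
def hNegOneNorm (f : Torus → ℝ) : ℝ := l2norm (invJap f)

/-- `u ∈ C(S; H^s(𝕋))`. -/
def ContInHs (s : ℝ) (S : Set ℝ) (u : ℝ → Torus → ℝ) : Prop :=
  ∀ t ∈ S, MemHs s (u t) ∧ Tendsto (fun τ => hsNorm s (u τ - u t)) (𝓝[S] t) (𝓝 0)

/-- The real coefficients of the equation. -/
structure Coeffs where
  c₁ : ℝ
  c₂ : ℝ
  c₃ : ℝ
  c₄ : ℝ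
  c₅ : ℝ
  c₆ : ℝ
  c₇ : ℝ

/-- The nonlinear operator `K`. -/
def opK (c : Coeffs) (u : Torus → ℝ) : Torus → ℝ :=
  hilb (dx 3 u)
    + c.c₁ • (u * dx 2 u) + c.c₂ • (dx 1 u) ^ 2 + c.c₃ • (hilb (dx 1 u)) ^ 2
    + c.c₄ • hilb (u * hilb (dx 2 u))
    + c.c₅ • hilb (u ^ 2 * dx 1 u) + c.c₆ • (u * hilb (u * dx 1 u))
    + c.c₇ • (u ^ 2 * hilb (dx 1 u)) - u ^ 4

/-- `u` satisfies `∂ₜu = ∂ₓK(u) - ε ∂ₓ⁴u` on `[0,T]`, in the sense of distributions in `x`: the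
equation is tested against each character `e^{-ikx}`, with one-sided time derivatives at the two
end points. (For `u ∈ C([0,T]; H^s)` with `s > 7/2` the right-hand side is continuous in time with
values in `H^{s-4}`, so this is the same as the equation in `C([0,T]; H^{s-4})`.) -/
def SolvesReg (c : Coeffs) (ε T : ℝ) (u : ℝ → Torus → ℝ) : Prop :=
  ∀ t ∈ Icc 0 T, ∀ k : ℤ,
    HasDerivWithinAt (fun τ => coeff (u τ) k)
      (Complex.I * (k : ℂ) * coeff (opK c (u t)) k
        - (ε : ℂ) * ((Complex.I * (k : ℂ)) ^ 4 * coeff (u t) k))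
      (Icc 0 T) t

def lam₁ (c : Coeffs) (s : ℝ) : ℝ := (c.c₁ - c.c₄) * s - c.c₁ / 2 + 2 * c.c₂ + c.c₄ / 2
def lam₂ (c : Coeffs) (s : ℝ) : ℝ := -2 * c.c₃ * s - c.c₄
def lam₃ (c : Coeffs) (s : ℝ) : ℝ := -2 * (c.c₅ + c.c₆ + c.c₇) * s - 2 * c.c₅ - c.c₆
def lam₄ (c : Coeffs) (s : ℝ) : ℝ := 2 * (c.c₁ - c.c₄) * s - 5 * c.c₁ + 4 * c.c₂ + 5 * c.c₄

/-- First correction term. -/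
def corr₁ (c : Coeffs) (ψ : ℝ → ℝ) (f g : Torus → ℝ) : ℝ :=
  lam₁ c 0 / 4 * ∫ x, f x * hilb (f - g) x * hilb (opJ ψ (f - g)) x

/-- Second correction term. -/
def corr₂ (c : Coeffs) (ψ : ℝ → ℝ) (f g : Torus → ℝ) : ℝ :=
  lam₂ c 0 / 4 * ∫ x, hilb (dx 1 f) x * opJ ψ (f - g) x ^ 2

/-- Third correction term. -/
def corr₃ (c : Coeffs) (ψ : ℝ → ℝ) (f g : Torus → ℝ) : ℝ :=
  (lam₁ c 0 * lam₄ c 0 + 4 * lam₃ c 0) / 32 * ∫ x, f x ^ 2 * opJ ψ (f - g) x ^ 2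

/-- The modified energy `E(f,g)`; `κ` is the large constant in its weight. -/
def energy (c : Coeffs) (ψ : ℝ → ℝ) (κ : ℝ) (f g : Torus → ℝ) : ℝ :=
  1 / 2 * l2norm (f - g) ^ 2
    + 1 / 2 * hNegOneNorm (f - g) ^ 2 * (1 + κ * l2norm f ^ 2 + κ * l2norm f ^ 4)
    + (corr₁ c ψ f g + corr₂ c ψ f g + corr₃ c ψ f g)

/-- The constant `κ` is admissible in the energy: `E(f,g)` is comparable to
`‖f-g‖²_{H^{-1}} (1 + κ‖f‖² + κ‖f‖⁴) + ‖f-g‖²` for all `f, g ∈ H¹`. -/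
def Admissible (c : Coeffs) (ψ : ℝ → ℝ) (κ : ℝ) : Prop :=
  ∀ f g : Torus → ℝ, MemHs 1 f → MemHs 1 g →
    energy c ψ κ f g ≤
        hNegOneNorm (f - g) ^ 2 * (1 + κ * l2norm f ^ 2 + κ * l2norm f ^ 4) + l2norm (f - g) ^ 2 ∧
      hNegOneNorm (f - g) ^ 2 * (1 + κ * l2norm f ^ 2 + κ * l2norm f ^ 4) + l2norm (f - g) ^ 2 ≤
        4 * energy c ψ κ f g

/-- `I_s(f,g) = 1 + ‖f‖_{H^s} + ‖g‖_{H^s}`. -/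
def sizeI (s : ℝ) (f g : Torus → ℝ) : ℝ := 1 + hsNorm s f + hsNorm s g

end BO4

end

/-! The proof runs on Fourier coefficients. Let `a`, `g` be those of `u₁`, `u₂` and `w = a - g`. The
equation reads `∂ₜ a_k = -i φ(k) a_k + i k N(a)_k - ε k⁴ a_k` with `φ(k) = k|k|³`, and the energy is
a sum of diagonal forms in `w` and of forms `∑ a_{k-l} θ(k,l) w_l conj(w_k)` with real symbols, the
last of them with `a * a` in place of `a`.

The obstruction is the part of the linearized equation that is linear in `a`, with symbol `pq`. In
the real part of `i` times a form only the antisymmetric part of the symbol counts, but for `pq`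
this part still has size `|k-l||k||l|`, a loss of one derivative on each copy of `w`. The
corrections are a normal form. Along the linear flow a form with symbol `θ` becomes `i` times the
form with symbol `θ Φ`, where `Φ = φ(k) - φ(l) - φ(k-l)`; for large frequencies of equal sign, up to
errors controlled by `k-l`, the symbols of the first two corrections give multiples of `(k-l)kl` and
`|k-l||k|(k-l)`. The values of `λ₁`, `λ₂` are those for which the sum is bounded by `(1+|k-l|)³`
(`abs_symLin_le`). Through the quadratic part of the nonlinearity, the first correction then creates
terms quadratic in `a`, of size `|k|(k-l)`; together with those of the cubic nonlinearity they are
removed by the third correction (`abs_symQuad_le`). One piece, carried by `c₃`, cancels only after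
the two copies of `a` are exchanged (`RQ_left_abs_sub`). Every other form has a symbol within a
bounded error of `α k`, and `k` antisymmetrizes to `k - l`. Forms with symbols bounded by background
weights are estimated by Schur's test (`abs_RI_le`, `abs_RQ_le`); the cost is at most the norm of
`a` in the Wiener algebra with weight `(1+|k|)³`, which `H^{s₀}` controls for `s₀ > 7/2`. This is
collected in `abs_main_le`.

Terms at least quadratic in `w` need no cancellation: they carry at most three derivatives, which
can be put on one copy of `w`, bounded in that algebra, while another copy stays in `ℓ²`
(`dm_remD`). The operator `a|D|(a ·)` from the `c₆` term is replaced by its symmetric version, the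
error being a double commutator of order `-1` (`dm_comm`).

The viscous terms are written as `-ε₁∂ₓ⁴w + (ε₂-ε₁)∂ₓ⁴g`. The dissipation of the first absorbs, by
interpolation, what it produces in the corrections (`neg_dissipation_le`). The second is a square
integrable forcing handled by Young's inequality (`abs_Gx_young`).

Differentiability of the energy holds because solutions are continuous with weight `3` and
differentiable with weight `-1`, and forms with bounded symbols tolerate one argument of weight `-1`
if the others have weight `1` (`HD.tri`). Admissibility of large `κ` holds because the corrections
are controlled by the `ℓ¹` norm of `J w`, which interpolates between `H⁻¹` and `L²` (`nJ_sq_le`);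
the price on the `H⁻¹` side is linear and quadratic in `‖f‖²`, exactly the weight in the energy. -/

noncomputable section
namespace BO4

/-! ### Fourier symbols -/

/-- The weight `1 + |k|`. -/
def jb (k : ℤ) : ℝ := 1 + |(k : ℝ)|

/-- The symbol `k |k|³`. -/
def phi (k : ℤ) : ℝ := k * |(k : ℝ)| ^ 3

/-- The symbol of `J` at an integer. -/
def Jc (k : ℤ) : ℝ := if 2 ≤ |k| then |(k : ℝ)|⁻¹ else 0

/-- The real sign of an integer. -/
def sg (k : ℤ) : ℝ := (Int.sign k : ℝ)

/-- The resonance function of `ℋ∂ₓ⁴`. -/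
def Phi (k l : ℤ) : ℝ := phi k - phi l - phi (k - l)

/-- The symmetrized symbol of the form `∫ f (ℋw) (ℋJw)`. -/
def th₁ (k l : ℤ) : ℝ := sg k * sg l * (Jc k + Jc l) / 2

lemma one_le_jb (k : ℤ) : 1 ≤ jb k := by unfold jb; linarith [abs_nonneg (k : ℝ)]
lemma jb_pos (k : ℤ) : 0 < jb k := by linarith [one_le_jb k]
lemma abs_le_jb (k : ℤ) : |(k : ℝ)| ≤ jb k := by unfold jb; linarith
lemma jb_neg (k : ℤ) : jb (-k) = jb k := by simp [jb]
-- This submultiplicativity makes the weighted `ℓ¹` spaces convolution algebras and lets weights be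
-- moved between output, background and argument of a form.
lemma jb_add_le (k l : ℤ) : jb (k + l) ≤ jb k * jb l := by
  unfold jb; push_cast
  nlinarith [abs_add_le (k : ℝ) l, abs_nonneg (k : ℝ), abs_nonneg (l : ℝ),
    mul_nonneg (abs_nonneg (k : ℝ)) (abs_nonneg (l : ℝ))]
lemma phi_neg (k : ℤ) : phi (-k) = -phi k := by simp [phi]
lemma Jc_neg (k : ℤ) : Jc (-k) = Jc k := by simp [Jc]
lemma sg_neg (k : ℤ) : sg (-k) = -sg k := by simp [sg]
lemma th₁_neg (k l : ℤ) : th₁ (-k) (-l) = th₁ k l := by simp [th₁, sg_neg, Jc_neg]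
lemma th₁_comm (k l : ℤ) : th₁ k l = th₁ l k := by unfold th₁; ring
lemma Phi_neg (k l : ℤ) : Phi (-k) (-l) = -Phi k l := by
  have : -k - -l = -(k - l) := by ring
  rw [Phi, Phi, this, phi_neg, phi_neg, phi_neg]; ring
lemma Jc_nonneg (k : ℤ) : 0 ≤ Jc k := by unfold Jc; split_ifs <;> positivity
lemma Jc_mul_abs_le (k : ℤ) : Jc k * |(k : ℝ)| ≤ 1 := by
  unfold Jc; split_ifs with h
  · exact (inv_mul_le_one)
  · simp
lemma Jc_le_one (k : ℤ) : Jc k ≤ 1 := by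
  unfold Jc; split_ifs with h
  · have : (2 : ℝ) ≤ |(k : ℝ)| := by exact_mod_cast h
    exact inv_le_one_of_one_le₀ (by linarith)
  · norm_num
lemma Jc_of_two_le {k : ℤ} (h : 2 ≤ k) : Jc k = (k : ℝ)⁻¹ := by
  have h' : (2 : ℝ) ≤ k := by exact_mod_cast h
  rw [Jc, if_pos (by rw [abs_of_nonneg (by omega)]; exact h), abs_of_nonneg (by linarith)]
lemma sg_of_two_le {k : ℤ} (h : 2 ≤ k) : sg k = 1 := by
  simp [sg, Int.sign_eq_one_of_pos (show 0 < k by omega)]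
lemma abs_sg_le (k : ℤ) : |sg k| ≤ 1 := by
  rcases lt_trichotomy k 0 with h | h | h
  · simp [sg, Int.sign_eq_neg_one_of_neg h]
  · simp [sg, h]
  · simp [sg, Int.sign_eq_one_of_pos h]
lemma th₁_of_two_le {k l : ℤ} (hk : 2 ≤ k) (hl : 2 ≤ l) :
    th₁ k l = ((k : ℝ)⁻¹ + (l : ℝ)⁻¹) / 2 := by
  simp [th₁, sg_of_two_le, Jc_of_two_le, hk, hl]
lemma abs_th₁_le (k l : ℤ) : |th₁ k l| ≤ (Jc k + Jc l) / 2 := by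
  have h1 := abs_sg_le k
  have h2 := abs_sg_le l
  have h3 : 0 ≤ (Jc k + Jc l) / 2 := by linarith [Jc_nonneg k, Jc_nonneg l]
  rw [th₁, mul_div_assoc, abs_mul, abs_mul, abs_of_nonneg h3]
  have : |sg k| * |sg l| ≤ 1 := mul_le_one₀ h1 (abs_nonneg _) h2
  nlinarith

/-- Two integers are both large and positive, or both large and negative, or controlled by their
difference. -/
lemma pair_cases (k l : ℤ) : (2 ≤ k ∧ 2 ≤ l) ∨ (2 ≤ -k ∧ 2 ≤ -l) ∨
    (|(k : ℝ)| ≤ jb (k - l) ∧ |(l : ℝ)| ≤ jb (k - l)) := by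
  have : (2 ≤ k ∧ 2 ≤ l) ∨ (2 ≤ -k ∧ 2 ≤ -l) ∨ (|k| ≤ 1 + |k - l| ∧ |l| ≤ 1 + |k - l|) := by
    rcases abs_cases k with h | h <;> rcases abs_cases l with h' | h' <;>
      rcases abs_cases (k - l) with h'' | h'' <;> omega
  refine this.imp_right (Or.imp_right fun h => ?_)
  unfold jb
  exact_mod_cast h

/-- The trichotomy for two frequencies, with an intermediate one. When all are at least `2` with a
common sign, `J` is exactly `1/|k|` and leading terms are computed algebraically. Otherwise the path
from `k` over `j` to `l` comes close to zero or crosses it, so the steps control all three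
frequencies and no cancellation is needed. -/
lemma triple_cases (k j l : ℤ) : (2 ≤ k ∧ 2 ≤ j ∧ 2 ≤ l) ∨ (2 ≤ -k ∧ 2 ≤ -j ∧ 2 ≤ -l) ∨
    (|(k : ℝ)| ≤ jb (k - j) * jb (j - l) ∧ |(j : ℝ)| ≤ jb (k - j) * jb (j - l) ∧
      |(l : ℝ)| ≤ jb (k - j) * jb (j - l)) := by
  have : (2 ≤ k ∧ 2 ≤ j ∧ 2 ≤ l) ∨ (2 ≤ -k ∧ 2 ≤ -j ∧ 2 ≤ -l) ∨
      (|k| ≤ 1 + |k - j| + |j - l| ∧ |j| ≤ 1 + |k - j| + |j - l| ∧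
        |l| ≤ 1 + |k - j| + |j - l|) := by
    rcases abs_cases k with h | h <;> rcases abs_cases l with h' | h' <;>
      rcases abs_cases j with h1 | h1 <;> rcases abs_cases (k - j) with h'' | h'' <;>
      rcases abs_cases (j - l) with h2 | h2 <;> omega
  refine this.imp_right (Or.imp_right fun h => ?_)
  have e : (1 : ℝ) + |((k - j : ℤ) : ℝ)| + |((j - l : ℤ) : ℝ)| ≤ jb (k - j) * jb (j - l) := by
    unfold jb
    nlinarith [abs_nonneg ((k - j : ℤ) : ℝ), abs_nonneg ((j - l : ℤ) : ℝ)]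
  refine ⟨le_trans ?_ e, le_trans ?_ e, le_trans ?_ e⟩
  · exact_mod_cast h.1
  · exact_mod_cast h.2.1
  · exact_mod_cast h.2.2

/-- For equal signs the difference is `4a³b + 6a²b² + 4ab³`. For opposite signs the larger absolute
value is itself the sum of the two others, and the same expansion applies. -/
lemma abs_quartic_add_sub_le (x y : ℝ) :
    |(x + y) * |x + y| ^ 3 - x * |x| ^ 3 - y * |y| ^ 3| ≤ 6 * |x| * |y| * (|x| + |y|) ^ 2 := by
  have key : ∀ a b : ℝ, 0 ≤ a → 0 ≤ b →
      |(a + b) ^ 4 - a ^ 4 - b ^ 4| ≤ 6 * a * b * (a + b) ^ 2 := by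
    intro a b ha hb
    have h1 : 0 ≤ a * b := mul_nonneg ha hb
    have h2 : 0 ≤ a * b * (a * b) := mul_nonneg h1 h1
    have h3 : 0 ≤ a * b * a ^ 2 := by positivity
    have h4 : 0 ≤ a * b * b ^ 2 := by positivity
    rw [abs_le]; constructor <;> nlinarith
  have key2 : ∀ a b : ℝ, 0 ≤ a → 0 ≤ b →
      |(a - b) * |a - b| ^ 3 - a ^ 4 + b ^ 4| ≤ 6 * a * b * (a + b) ^ 2 := by
    intro a b ha hb
    have h1 : 0 ≤ a * b := mul_nonneg ha hb
    rcases le_total b a with h | h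
    · have := key (a - b) b (by linarith) hb
      rw [abs_of_nonneg (show 0 ≤ a - b by linarith)]
      rw [show (a - b) * (a - b) ^ 3 - a ^ 4 + b ^ 4 = -((a - b + b) ^ 4 - (a - b) ^ 4 - b ^ 4) by
        ring, abs_neg]
      refine this.trans ?_
      have : 6 * (a - b) * b * (a - b + b) ^ 2 ≤ 6 * a * b * (a - b + b) ^ 2 := by
        gcongr; linarith
      refine this.trans ?_
      gcongr; linarith
    · have := key (b - a) a (by linarith) ha
      rw [abs_of_nonpos (show a - b ≤ 0 by linarith)]
      rw [show (a - b) * (-(a - b)) ^ 3 - a ^ 4 + b ^ 4 = (b - a + a) ^ 4 - (b - a) ^ 4 - a ^ 4 by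
        ring]
      refine this.trans ?_
      have : 6 * (b - a) * a * (b - a + a) ^ 2 ≤ 6 * b * a * (b - a + a) ^ 2 := by
        gcongr; linarith
      refine this.trans ?_
      rw [mul_right_comm 6 b a, sub_add_cancel]
      gcongr; linarith
  rcases le_total 0 x with hx | hx <;> rcases le_total 0 y with hy | hy
  · rw [abs_of_nonneg hx, abs_of_nonneg hy, abs_of_nonneg (add_nonneg hx hy)]
    convert key x y hx hy using 2; ring
  · have := key2 x (-y) hx (by linarith)
    rw [abs_of_nonneg hx, abs_of_nonpos hy]
    convert this using 2
    rw [sub_neg_eq_add]; ring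
  · have := key2 y (-x) hy (by linarith)
    rw [abs_of_nonpos hx, abs_of_nonneg hy]
    convert this using 1
    · rw [sub_neg_eq_add, add_comm y x]; congr 1; ring
    · ring
  · have := key (-x) (-y) (by linarith) (by linarith)
    rw [abs_of_nonpos hx, abs_of_nonpos hy, abs_of_nonpos (add_nonpos hx hy), ← abs_neg]
    convert this using 2; ring

lemma abs_Phi_le (k l : ℤ) :
    |Phi k l| ≤ 6 * |(l : ℝ)| * |((k - l : ℤ) : ℝ)| * (|(l : ℝ)| + |((k - l : ℤ) : ℝ)|) ^ 2 := by
  have := abs_quartic_add_sub_le l (k - l)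
  simp only [add_sub_cancel] at this
  unfold Phi phi; push_cast; exact this

lemma Phi_swap (k l : ℤ) : Phi l k = -Phi k l := by
  have : l - k = -(k - l) := by ring
  rw [Phi, Phi, this, phi_neg]; ring

/-- `Φ` is the sum of the odd function `φ` over `k`, `-l`, `l - k`, which add up to zero; hence any
two of the three frequencies can be factored out, here `k` and `l`. -/
lemma abs_Phi_le' (k l : ℤ) :
    |Phi k l| ≤ 6 * |(k : ℝ)| * |(l : ℝ)| * (|(k : ℝ)| + |(l : ℝ)|) ^ 2 := by
  have := abs_quartic_add_sub_le k (-l)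
  simp only [abs_neg, ← sub_eq_add_neg] at this
  rw [Phi, ← abs_neg]; unfold phi; push_cast
  convert this using 2; ring

/-- The resonance vanishes linearly in `l`, and this factor absorbs the `1/|l|` of `J`. -/
lemma Jc_mul_Phi_le (k l : ℤ) (m : ℝ) (hk : |(k : ℝ)| ≤ m) (hl : |(l : ℝ)| ≤ m)
    (ha : |((k - l : ℤ) : ℝ)| ≤ m) : Jc l * |Phi k l| ≤ 24 * m ^ 3 := by
  have hm : 0 ≤ m := (abs_nonneg _).trans hk
  calc Jc l * |Phi k l| ≤ Jc l * (6 * |(l : ℝ)| * |((k - l : ℤ) : ℝ)| *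
        (|(l : ℝ)| + |((k - l : ℤ) : ℝ)|) ^ 2) :=
        mul_le_mul_of_nonneg_left (abs_Phi_le k l) (Jc_nonneg l)
    _ = (Jc l * |(l : ℝ)|) * (6 * |((k - l : ℤ) : ℝ)| *
        (|(l : ℝ)| + |((k - l : ℤ) : ℝ)|) ^ 2) := by ring
    _ ≤ 1 * (6 * m * (m + m) ^ 2) := by
        gcongr
        exact Jc_mul_abs_le l
    _ = 24 * m ^ 3 := by ring

lemma abs_th₁_mul_Phi_le (k l : ℤ) (m : ℝ) (hk : |(k : ℝ)| ≤ m) (hl : |(l : ℝ)| ≤ m)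
    (ha : |((k - l : ℤ) : ℝ)| ≤ m) : |th₁ k l * Phi k l| ≤ 24 * m ^ 3 := by
  have h1 := Jc_mul_Phi_le k l m hk hl ha
  have h2 := Jc_mul_Phi_le l k m hl hk (by
    rw [show l - k = -(k - l) by ring]; push_cast; rw [abs_neg]; push_cast at ha; exact ha)
  rw [Phi_swap, abs_neg] at h2
  rw [abs_mul]
  have := mul_le_mul_of_nonneg_right (abs_th₁_le k l) (abs_nonneg (Phi k l))
  linarith

lemma abs_JJ_mul_Phi_le (k l : ℤ) (m : ℝ) (hk : |(k : ℝ)| ≤ m) (hl : |(l : ℝ)| ≤ m) :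
    |Jc k * Jc l * Phi k l| ≤ 24 * m ^ 2 := by
  have hm : 0 ≤ m := (abs_nonneg _).trans hk
  rw [abs_mul, abs_of_nonneg (mul_nonneg (Jc_nonneg k) (Jc_nonneg l))]
  calc Jc k * Jc l * |Phi k l| ≤ Jc k * Jc l * (6 * |(k : ℝ)| * |(l : ℝ)| *
        (|(k : ℝ)| + |(l : ℝ)|) ^ 2) :=
        mul_le_mul_of_nonneg_left (abs_Phi_le' k l) (mul_nonneg (Jc_nonneg k) (Jc_nonneg l))
    _ = (Jc k * |(k : ℝ)|) * (Jc l * |(l : ℝ)|) * (6 * (|(k : ℝ)| + |(l : ℝ)|) ^ 2) := by ring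
    _ ≤ 1 * 1 * (6 * (m + m) ^ 2) := by
        gcongr
        · exact mul_nonneg (Jc_nonneg l) (abs_nonneg _)
        · exact Jc_mul_abs_le k
        · exact Jc_mul_abs_le l
    _ = 24 * m ^ 2 := by ring

/-- The leading part of `th₁ * Phi`. -/
lemma abs_th₁_Phi_sub_le {k l : ℤ} (hk : 2 ≤ k) (hl : 2 ≤ l) :
    |th₁ k l * Phi k l - 4 * ((k : ℝ) - l) * k * l| ≤ 3 * |(k : ℝ) - l| ^ 3 := by
  have key : ∀ d l : ℝ, 0 ≤ d → 0 < l → |((l + d)⁻¹ + l⁻¹) / 2 * ((l + d) ^ 4 - l ^ 4 - d ^ 4)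
      - 4 * d * (l + d) * l| ≤ 3 * d ^ 3 := by
    intro d l hd hl
    have : ((l + d)⁻¹ + l⁻¹) / 2 * ((l + d) ^ 4 - l ^ 4 - d ^ 4) - 4 * d * (l + d) * l
        = d ^ 3 * (2 * d + 3 * l) / (l + d) := by field_simp; ring
    rw [this, abs_of_nonneg (by positivity), div_le_iff₀ (by positivity)]
    have := pow_nonneg hd 3
    nlinarith [mul_nonneg this hd]
  have hk' : (2 : ℝ) ≤ k := by exact_mod_cast hk
  have hl' : (2 : ℝ) ≤ l := by exact_mod_cast hl
  rw [th₁_of_two_le hk hl, Phi, phi, phi, phi, abs_of_nonneg (show (0 : ℝ) ≤ k by linarith),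
    abs_of_nonneg (show (0 : ℝ) ≤ l by linarith)]
  push_cast
  rcases le_total l k with h | h
  · have h' : (l : ℝ) ≤ k := by exact_mod_cast h
    have := key (k - l) l (by linarith) (by linarith)
    rw [abs_of_nonneg (show (0 : ℝ) ≤ k - l by linarith)]
    rw [add_sub_cancel] at this
    convert this using 2; ring
  · have h' : (k : ℝ) ≤ l := by exact_mod_cast h
    have := key (l - k) k (by linarith) (by linarith)
    rw [abs_of_nonpos (show (k : ℝ) - l ≤ 0 by linarith)]
    rw [add_sub_cancel] at this
    rw [← abs_neg]
    convert this using 2 <;> ring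

/-- The leading part of `J J Phi`. -/
lemma abs_JJ_Phi_sub_le_of_two_le {k l : ℤ} (hk : 2 ≤ k) (hl : 2 ≤ l) :
    |Jc k * Jc l * Phi k l - 4 * |(k : ℝ)| * (k - l)| ≤ 4 * |(k : ℝ) - l| ^ 2 := by
  have hk' : (2 : ℝ) ≤ k := by exact_mod_cast hk
  have hl' : (2 : ℝ) ≤ l := by exact_mod_cast hl
  rw [Jc_of_two_le hk, Jc_of_two_le hl, Phi, phi, phi, phi,
    abs_of_nonneg (show (0 : ℝ) ≤ k by linarith), abs_of_nonneg (show (0 : ℝ) ≤ l by linarith)]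
  push_cast
  rcases le_total l k with h | h
  · have h' : (l : ℝ) ≤ k := by exact_mod_cast h
    rw [abs_of_nonneg (show (0 : ℝ) ≤ k - l by linarith)]
    obtain ⟨d, hd, e⟩ : ∃ d : ℝ, 0 ≤ d ∧ (k : ℝ) = l + d := ⟨k - l, by linarith, by ring⟩
    rw [e]
    have : (l + d)⁻¹ * (l : ℝ)⁻¹ * ((l + d) * (l + d) ^ 3 - l * l ^ 3
        - (l + d - l) * (l + d - l) ^ 3) - 4 * (l + d) * (l + d - l)
        = -(2 * l * d ^ 2 / (l + d)) := by field_simp; ring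
    rw [this, abs_neg, abs_of_nonneg (by positivity), div_le_iff₀ (by positivity)]
    nlinarith [mul_nonneg (sq_nonneg d) hd, sq_nonneg d, mul_nonneg (sq_nonneg d) (show (0 : ℝ) ≤ l by linarith)]
  · have h' : (k : ℝ) ≤ l := by exact_mod_cast h
    rw [abs_of_nonpos (show (k : ℝ) - l ≤ 0 by linarith)]
    obtain ⟨d, hd, e⟩ : ∃ d : ℝ, 0 ≤ d ∧ (l : ℝ) = k + d := ⟨l - k, by linarith, by ring⟩
    rw [e]
    have : (k : ℝ)⁻¹ * (k + d)⁻¹ * (k * k ^ 3 - (k + d) * (k + d) ^ 3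
        - (k - (k + d)) * (-(k - (k + d))) ^ 3) - 4 * k * (k - (k + d))
        = -((2 * k * d ^ 2 + 4 * d ^ 3) / (k + d)) := by field_simp; ring
    rw [this, abs_neg, abs_of_nonneg (by positivity), div_le_iff₀ (by positivity)]
    nlinarith [mul_nonneg (sq_nonneg d) hd, sq_nonneg d, mul_nonneg (sq_nonneg d) (show (0 : ℝ) ≤ k by linarith)]

/-- Large frequencies of equal sign are covered by the exact expansion, extended to negative ones by
oddness; in the remaining case both terms are separately bounded. -/
lemma abs_JJ_Phi_sub_le (k l : ℤ) :
    |Jc k * Jc l * Phi k l - 4 * |(k : ℝ)| * (k - l)| ≤ 28 * jb (k - l) ^ 2 := by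
  have hb : |(k : ℝ) - l| ≤ jb (k - l) := by simpa using abs_le_jb (k - l)
  have hs : |(k : ℝ) - l| ^ 2 ≤ jb (k - l) ^ 2 := by gcongr
  have h0 : 0 ≤ jb (k - l) ^ 2 := sq_nonneg _
  rcases pair_cases k l with ⟨hk, hl⟩ | ⟨hk, hl⟩ | ⟨hk, hl⟩
  · linarith [abs_JJ_Phi_sub_le_of_two_le hk hl]
  · have := abs_JJ_Phi_sub_le_of_two_le hk hl
    rw [Jc_neg, Jc_neg, Phi_neg] at this
    push_cast at this
    rw [abs_neg, ← abs_neg, ← abs_neg (-(k : ℝ) - -l)] at this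
    have e1 : -(Jc k * Jc l * -Phi k l - 4 * |(k : ℝ)| * (-k - -l))
      = Jc k * Jc l * Phi k l - 4 * |(k : ℝ)| * (k - l) := by ring
    have e2 : -(-(k : ℝ) - -l) = k - l := by ring
    rw [e1, e2] at this
    linarith
  · have h1 := abs_JJ_mul_Phi_le k l _ hk hl
    have h2 : |4 * |(k : ℝ)| * (k - l)| ≤ 4 * jb (k - l) ^ 2 := by
      rw [abs_mul, abs_mul, abs_abs, abs_of_pos (show (0 : ℝ) < 4 by norm_num), sq, ← mul_assoc]
      have := jb_pos (k - l)
      gcongr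
    linarith [abs_sub (Jc k * Jc l * Phi k l) (4 * |(k : ℝ)| * (k - l))]
end BO4
end

/-! ### Symbols of the linearized equation; cancellation of the terms linear in the background -/

noncomputable section
namespace BO4

/-- The symbol of the part of the linearized equation that is linear in the background. -/
def pq (c : Coeffs) (k l : ℤ) : ℝ :=
  k * (-c.c₁ * (l ^ 2 + (k - l) ^ 2) - 2 * c.c₂ * ((k - l) * l)
      + 2 * c.c₃ * (|(k : ℝ) - l| * |(l : ℝ)|))
    + c.c₄ * (|(k : ℝ)| * (l * |(l : ℝ)| + (k - l) * |(k : ℝ) - l|))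

/-- The symbol of the part of the linearized equation carried by the square of the background. -/
def pe (c : Coeffs) (k l : ℤ) : ℝ :=
  c.c₅ * (k * |(k : ℝ)|) + c.c₇ * (k * |(l : ℝ)|) + c.c₆ * (k * (|(k : ℝ)| + |(l : ℝ)|)) / 2

/-- The total size of the coefficients. -/
def Coeffs.size (c : Coeffs) : ℝ :=
  1 + |c.c₁| + |c.c₂| + |c.c₃| + |c.c₄| + |c.c₅| + |c.c₆| + |c.c₇|

lemma Coeffs.one_le_size (c : Coeffs) : 1 ≤ c.size := by
  unfold Coeffs.size
  linarith [abs_nonneg c.c₁, abs_nonneg c.c₂, abs_nonneg c.c₃, abs_nonneg c.c₄, abs_nonneg c.c₅,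
    abs_nonneg c.c₆, abs_nonneg c.c₇]

lemma Coeffs.size_nonneg (c : Coeffs) : 0 ≤ c.size := by linarith [c.one_le_size]

/-- Every symbol is a linear combination of the `cᵢ` with universal symbols; with this it suffices
to bound each universal symbol by the same `B`. -/
lemma abs_comb₄_le (c : Coeffs) {q₁ q₂ q₃ q₄ B : ℝ} (h₁ : |q₁| ≤ B) (h₂ : |q₂| ≤ B)
    (h₃ : |q₃| ≤ B) (h₄ : |q₄| ≤ B) :
    |c.c₁ * q₁ + c.c₂ * q₂ + c.c₃ * q₃ + c.c₄ * q₄| ≤ c.size * B := by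
  have hB : 0 ≤ B := (abs_nonneg _).trans h₁
  have e : ∀ a q : ℝ, |q| ≤ B → |a * q| ≤ |a| * B := fun a q h => by
    rw [abs_mul]; exact mul_le_mul_of_nonneg_left h (abs_nonneg a)
  have := e c.c₁ _ h₁
  have := e c.c₂ _ h₂
  have := e c.c₃ _ h₃
  have := e c.c₄ _ h₄
  have h5 := mul_nonneg (abs_nonneg c.c₅) hB
  have h6 := mul_nonneg (abs_nonneg c.c₆) hB
  have h7 := mul_nonneg (abs_nonneg c.c₇) hB
  have : c.size * B = B + |c.c₁| * B + |c.c₂| * B + |c.c₃| * B + |c.c₄| * B + |c.c₅| * B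
    + |c.c₆| * B + |c.c₇| * B := by unfold Coeffs.size; ring
  rw [this]
  linarith [abs_add_le (c.c₁ * q₁ + c.c₂ * q₂ + c.c₃ * q₃) (c.c₄ * q₄),
    abs_add_le (c.c₁ * q₁ + c.c₂ * q₂) (c.c₃ * q₃), abs_add_le (c.c₁ * q₁) (c.c₂ * q₂)]

lemma abs_comb₃_le (c : Coeffs) {q₁ q₂ q₃ B : ℝ} (h₁ : |q₁| ≤ B) (h₂ : |q₂| ≤ B)
    (h₃ : |q₃| ≤ B) : |c.c₅ * q₁ + c.c₆ * q₂ + c.c₇ * q₃| ≤ c.size * B := by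
  have hB : 0 ≤ B := (abs_nonneg _).trans h₁
  have e : ∀ a q : ℝ, |q| ≤ B → |a * q| ≤ |a| * B := fun a q h => by
    rw [abs_mul]; exact mul_le_mul_of_nonneg_left h (abs_nonneg a)
  have := e c.c₅ _ h₁
  have := e c.c₆ _ h₂
  have := e c.c₇ _ h₃
  have h1 := mul_nonneg (abs_nonneg c.c₁) hB
  have h2 := mul_nonneg (abs_nonneg c.c₂) hB
  have h3 := mul_nonneg (abs_nonneg c.c₃) hB
  have h4 := mul_nonneg (abs_nonneg c.c₄) hB
  have : c.size * B = B + |c.c₁| * B + |c.c₂| * B + |c.c₃| * B + |c.c₄| * B + |c.c₅| * B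
    + |c.c₆| * B + |c.c₇| * B := by unfold Coeffs.size; ring
  rw [this]
  linarith [abs_add_le (c.c₅ * q₁ + c.c₆ * q₂) (c.c₇ * q₃), abs_add_le (c.c₅ * q₁) (c.c₆ * q₂)]

lemma pq_neg (c : Coeffs) (k l : ℤ) : pq c (-k) (-l) = -pq c k l := by
  have e : -(k : ℝ) - -l = -(k - l) := by ring
  simp only [pq, Int.cast_neg, e, abs_neg]; ring

lemma pe_neg (c : Coeffs) (k l : ℤ) : pe c (-k) (-l) = -pe c k l := by
  simp only [pe, Int.cast_neg, abs_neg]; ring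

/-- Products of two and three bounded factors. -/
lemma abs_mul_le_of_le {x y a b : ℝ} (hx : |x| ≤ a) (hy : |y| ≤ b) : |x * y| ≤ a * b := by
  rw [abs_mul]; exact mul_le_mul hx hy (abs_nonneg _) ((abs_nonneg _).trans hx)

lemma abs_pq_le (c : Coeffs) (k l : ℤ) {m : ℝ} (hl : |(l : ℝ)| ≤ m)
    (ha : |(k : ℝ) - l| ≤ m) : |pq c k l| ≤ c.size * (|(k : ℝ)| * (2 * m ^ 2)) := by
  have e : pq c k l = c.c₁ * (k * -(l ^ 2 + (k - l) ^ 2)) + c.c₂ * (k * (-2 * ((k - l) * l)))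
      + c.c₃ * (k * (2 * (|(k : ℝ) - l| * |(l : ℝ)|)))
      + c.c₄ * (|(k : ℝ)| * (l * |(l : ℝ)| + (k - l) * |(k : ℝ) - l|)) := by unfold pq; ring
  have h1 : |(l : ℝ) * l| ≤ m * m := abs_mul_le_of_le hl hl
  have h2 : |((k : ℝ) - l) * (k - l)| ≤ m * m := abs_mul_le_of_le ha ha
  have h3 : |((k : ℝ) - l) * l| ≤ m * m := abs_mul_le_of_le ha hl
  have h4 : |(l : ℝ) * (|(l : ℝ)|)| ≤ m * m := abs_mul_le_of_le hl (by rwa [abs_abs])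
  have h5 : |((k : ℝ) - l) * (|(k : ℝ) - l|)| ≤ m * m := abs_mul_le_of_le ha (by rwa [abs_abs])
  have h6 : |(|(k : ℝ) - l| * |(l : ℝ)|)| ≤ m * m :=
    abs_mul_le_of_le (by rwa [abs_abs]) (by rwa [abs_abs])
  rw [abs_le] at h1 h2 h3 h4 h5 h6
  rw [e]
  apply abs_comb₄_le
  · apply abs_mul_le_of_le le_rfl
    rw [abs_le]; constructor <;> nlinarith
  · apply abs_mul_le_of_le le_rfl
    rw [abs_le]; constructor <;> nlinarith
  · apply abs_mul_le_of_le le_rfl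
    rw [abs_le]; constructor <;> nlinarith
  · apply abs_mul_le_of_le (abs_abs _).le
    rw [abs_le]; constructor <;> nlinarith

lemma abs_pe_le (c : Coeffs) (k l : ℤ) {m : ℝ} (hk : |(k : ℝ)| ≤ m) (hl : |(l : ℝ)| ≤ m) :
    |pe c k l| ≤ c.size * (|(k : ℝ)| * m) := by
  have e : pe c k l = c.c₅ * (k * |(k : ℝ)|) + c.c₆ * (k * ((|(k : ℝ)| + |(l : ℝ)|) / 2))
      + c.c₇ * (k * |(l : ℝ)|) := by unfold pe; ring
  have h1 := abs_nonneg (k : ℝ)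
  have h2 := abs_nonneg (l : ℝ)
  rw [e]
  apply abs_comb₃_le
  · exact abs_mul_le_of_le le_rfl (by rwa [abs_abs])
  · exact abs_mul_le_of_le le_rfl (by rw [abs_of_nonneg (by positivity)]; linarith)
  · exact abs_mul_le_of_le le_rfl (by rwa [abs_abs])

/-- The symbol of all terms in the derivative of the energy that are linear in the background. -/
def symLin (c : Coeffs) (k l : ℤ) : ℝ :=
  pq c k l - pq c l k + lam₁ c 0 / 2 * (th₁ k l * Phi k l)
    + lam₂ c 0 / 2 * (|(k : ℝ) - l| * (Jc k * Jc l * Phi k l))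

lemma symLin_neg (c : Coeffs) (k l : ℤ) : symLin c (-k) (-l) = -symLin c k l := by
  have e : -(k : ℝ) - -l = -(k - l) := by ring
  simp only [symLin, pq_neg, th₁_neg, Phi_neg, Jc_neg, Int.cast_neg, e, abs_neg]; ring

/-- With `x = k - l`, the top terms of `pq(k,l) - pq(l,k)` are `(c₁ - 4c₂ - c₄) k l x` and `c₄ (k +
l) x|x|`; the `c₃` part is symmetric and drops out. Since `θ₁Φ ≈ 4klx` and `JJΦ ≈ 4kx`, the
coefficient `λ₁/2` removes the first and `λ₂/2` the second, where `k + l` and `2k` differ only by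
`x`. What remains is cubic in `x`. -/
lemma abs_symLin_near (c : Coeffs) {k l : ℤ} (hk : 2 ≤ k) (hl : 2 ≤ l) :
    |symLin c k l| ≤ c.size * (8 * |(k : ℝ) - l| ^ 3) := by
  have hT := abs_th₁_Phi_sub_le hk hl
  have hU := abs_JJ_Phi_sub_le_of_two_le hk hl
  have hk' : (0 : ℝ) < k := by exact_mod_cast (by omega : 0 < k)
  have hl' : (0 : ℝ) < l := by exact_mod_cast (by omega : 0 < l)
  rw [symLin]
  generalize th₁ k l * Phi k l = T at *
  generalize Jc k * Jc l * Phi k l = U at *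
  rw [abs_of_pos hk'] at hU
  unfold pq lam₁ lam₂
  rw [abs_sub_comm (l : ℝ) k, abs_of_pos hk', abs_of_pos hl']
  generalize (k : ℝ) = K at *
  generalize (l : ℝ) = L at *
  have hV : |(|K - L| * (U - 4 * K * (K - L)))| ≤ |K - L| * (4 * |K - L| ^ 2) :=
    abs_mul_le_of_le (abs_abs _).le hU
  have h0 : 0 ≤ |K - L| ^ 3 := by positivity
  have h3 : |(K - L) ^ 3| ≤ |K - L| ^ 3 := (abs_pow _ _).le
  have h4 : |(K - L) ^ 2 * (|K - L|)| ≤ |K - L| ^ 3 := by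
    rw [abs_mul, abs_pow, abs_abs, ← pow_succ]
  have e : K * (-c.c₁ * (L ^ 2 + (K - L) ^ 2) - 2 * c.c₂ * ((K - L) * L)
        + 2 * c.c₃ * (|K - L| * L)) + c.c₄ * (K * (L * L + (K - L) * |K - L|))
      - (L * (-c.c₁ * (K ^ 2 + (L - K) ^ 2) - 2 * c.c₂ * ((L - K) * K)
        + 2 * c.c₃ * (|K - L| * K)) + c.c₄ * (L * (K * K + (L - K) * |K - L|)))
      + ((c.c₁ - c.c₄) * 0 - c.c₁ / 2 + 2 * c.c₂ + c.c₄ / 2) / 2 * T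
      + (-2 * c.c₃ * 0 - c.c₄) / 2 * (|K - L| * U)
      = c.c₁ * (-(T - 4 * (K - L) * K * L) / 4 - (K - L) ^ 3)
        + c.c₂ * (T - 4 * (K - L) * K * L) + c.c₃ * 0
        + c.c₄ * ((T - 4 * (K - L) * K * L) / 4 - |K - L| * (U - 4 * K * (K - L)) / 2
          - (K - L) ^ 2 * |K - L|) := by ring
  rw [e]
  rw [abs_le] at hT hV h3 h4
  apply abs_comb₄_le
  · rw [abs_le]; constructor <;> linarith
  · rw [abs_le]; constructor <;> linarith
  · rw [abs_zero]; linarith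
  · rw [abs_le]; constructor <;> nlinarith

lemma abs_lam₁_le (c : Coeffs) : |lam₁ c 0| ≤ 2 * c.size := by
  have := abs_comb₄_le c (q₁ := -1 / 2) (q₂ := 2) (q₃ := 0) (q₄ := 1 / 2) (B := 2)
    (by rw [abs_le]; norm_num) (by rw [abs_le]; norm_num) (by simp) (by rw [abs_le]; norm_num)
  rw [mul_comm c.size] at this
  convert this using 2; unfold lam₁; ring

lemma abs_lam₂_le (c : Coeffs) : |lam₂ c 0| ≤ c.size := by
  have := abs_comb₄_le c (q₁ := 0) (q₂ := 0) (q₃ := 0) (q₄ := -1) (B := 1)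
    (by simp) (by simp) (by simp) (by simp)
  rw [mul_one] at this
  convert this using 2; unfold lam₂; ring

lemma abs_symLin_le (c : Coeffs) (k l : ℤ) : |symLin c k l| ≤ c.size * (40 * jb (k - l) ^ 3) := by
  have hb : |(k : ℝ) - l| ≤ jb (k - l) := by simpa using abs_le_jb (k - l)
  have hs : |(k : ℝ) - l| ^ 3 ≤ jb (k - l) ^ 3 := by gcongr
  have h0 : 0 ≤ jb (k - l) ^ 3 := by have := jb_pos (k - l); positivity
  have hc := c.size_nonneg
  rcases pair_cases k l with ⟨hk, hl⟩ | ⟨hk, hl⟩ | ⟨hk, hl⟩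
  · exact (abs_symLin_near c hk hl).trans (by gcongr; linarith)
  · have := abs_symLin_near c hk hl
    rw [symLin_neg, abs_neg] at this
    push_cast at this
    rw [show -(k : ℝ) - -l = -(k - l) by ring, abs_neg] at this
    exact this.trans (by gcongr; linarith)
  -- Both frequencies are now bounded by the background weight, so each of the four terms is
  -- separately cubic in it.
  · have hm := jb_pos (k - l)
    have h1 := abs_pq_le c k l hl hb
    have h2 := abs_pq_le c l k hk (by rwa [abs_sub_comm])
    have h3 := abs_mul_le_of_le (abs_lam₁_le c) (abs_th₁_mul_Phi_le k l _ hk hl (by exact_mod_cast hb))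
    have h4 := abs_mul_le_of_le (abs_lam₂_le c) (abs_mul_le_of_le (x := |(k : ℝ) - l|) (a := jb (k - l))
      (by rwa [abs_abs]) (abs_JJ_mul_Phi_le k l _ hk hl))
    have h5 : c.size * (|(k : ℝ)| * (2 * jb (k - l) ^ 2)) ≤ c.size * (2 * jb (k - l) ^ 3) := by
      rw [pow_succ' _ 2, mul_left_comm (2 : ℝ)]; gcongr
    have h6 : c.size * (|(l : ℝ)| * (2 * jb (k - l) ^ 2)) ≤ c.size * (2 * jb (k - l) ^ 3) := by
      rw [pow_succ' _ 2, mul_left_comm (2 : ℝ)]; gcongr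
    rw [abs_le] at h1 h2 h3 h4
    rw [symLin, abs_le]
    constructor <;> nlinarith
end BO4
end

/-! ### Leading parts of the symbols in the terms quadratic in the background -/

noncomputable section
namespace BO4

/-- The coefficient of the third correction term. -/
def mu₃ (c : Coeffs) : ℝ := (lam₁ c 0 * lam₄ c 0 + 4 * lam₃ c 0) / 32

/-- Leading part of `th₁ k j * pq j l`, with `x = k - j` and `y = j - l`. -/
def ldTh (c : Coeffs) (k j l : ℤ) : ℝ :=
  -(c.c₁ - c.c₄) * (k * |(k : ℝ)|)
    + |(k : ℝ)| * (5 / 2 * (c.c₁ - c.c₄) * (k - j) + (2 * (c.c₁ - c.c₄) - 2 * c.c₂) * (j - l))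
    + 2 * c.c₃ * (k * |(j : ℝ) - l|)

lemma ldTh_neg (c : Coeffs) (k j l : ℤ) : ldTh c (-k) (-j) (-l) = -ldTh c k j l := by
  have e : -(j : ℝ) - -l = -(j - l) := by ring
  simp only [ldTh, Int.cast_neg, abs_neg, e]; ring

lemma one_le_jb_mul (x y : ℤ) : 1 ≤ jb x * jb y := one_le_mul_of_one_le_of_one_le
  (one_le_jb x) (one_le_jb y)

lemma jb_le_mul_left (x y : ℤ) : jb x ≤ jb x * jb y :=
  le_mul_of_one_le_right (jb_pos x).le (one_le_jb y)

lemma jb_le_mul_right (x y : ℤ) : jb y ≤ jb x * jb y :=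
  le_mul_of_one_le_left (jb_pos y).le (one_le_jb x)

lemma abs_sub_le_jb (k j : ℤ) : |(k : ℝ) - j| ≤ jb (k - j) := by simpa using abs_le_jb (k - j)

lemma jb_mul_neg_swap (k j l : ℤ) : jb (l - j) * jb (j - k) = jb (k - j) * jb (j - l) := by
  rw [← jb_neg (l - j), ← jb_neg (j - k), mul_comm]; congr 2 <;> ring

lemma near_data {k j l : ℤ} (hk : 2 ≤ k) : (0 : ℝ) < (k : ℝ)⁻¹ ∧ (k : ℝ)⁻¹ ≤ 1 ∧
    |(k : ℝ) - j| ≤ jb (k - j) * jb (j - l) ∧ |(j : ℝ) - l| ≤ jb (k - j) * jb (j - l) ∧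
    |(k : ℝ) - l| ≤ jb (k - j) * jb (j - l) := by
  have hk' : (2 : ℝ) ≤ k := by exact_mod_cast hk
  refine ⟨by positivity, inv_le_one_of_one_le₀ (by linarith), ?_, ?_, ?_⟩
  · exact (abs_sub_le_jb k j).trans (jb_le_mul_left _ _)
  · exact (abs_sub_le_jb j l).trans (jb_le_mul_right _ _)
  · have h := jb_add_le (k - j) (j - l)
    rw [sub_add_sub_cancel] at h
    exact (abs_sub_le_jb k l).trans h

lemma mul₃_abs_le {x y z m : ℝ} (hx : |x| ≤ m) (hy : |y| ≤ m) (hz : |z| ≤ m) :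
    |x * y * z| ≤ m ^ 3 := by
  rw [pow_succ, sq]; exact abs_mul_le_of_le (abs_mul_le_of_le hx hy) hz

/-- Expansion in `x = k - j`, `y = j - l`, `s = x + y`. Exactly, `θ₁ = (1 - x/(2k))/j`, and for
positive frequencies `j` divides `pq(j,l)`; the quotient is a quadratic polynomial in `k`. The terms
of degree two and one in `k` form `ldTh`, and the error is polynomial in `x`, `y`, `|y|`, `s` and
`x/k`. -/
lemma abs_th₁_pq_sub_near (c : Coeffs) {k j l : ℤ} (hk : 2 ≤ k) (hj : 2 ≤ j) (hl : 2 ≤ l) :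
    |th₁ k j * pq c j l - ldTh c k j l| ≤ c.size * (6 * (jb (k - j) * jb (j - l)) ^ 3) := by
  obtain ⟨r0, r1, hx, hy, hs⟩ := near_data (j := j) (l := l) hk
  have hm := one_le_jb_mul (k - j) (j - l)
  have hk' : (0 : ℝ) < k := by exact_mod_cast (by omega : 0 < k)
  have hj' : (0 : ℝ) < j := by exact_mod_cast (by omega : 0 < j)
  have hl' : (0 : ℝ) < l := by exact_mod_cast (by omega : 0 < l)
  rw [th₁_of_two_le hk hj, pq, ldTh, abs_of_pos hk', abs_of_pos hj', abs_of_pos hl']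
  generalize jb (k - j) * jb (j - l) = m at *
  have hm0 : 0 < m := by linarith
  have hm23 : m ^ 2 ≤ m ^ 3 := pow_le_pow_right₀ hm (by norm_num)
  obtain ⟨x, ex⟩ : ∃ x : ℝ, x = k - j := ⟨_, rfl⟩
  obtain ⟨y, ey⟩ : ∃ y : ℝ, y = j - l := ⟨_, rfl⟩
  have ej : (j : ℝ) = k - x := by rw [ex]; ring
  have el : (l : ℝ) = k - (x + y) := by rw [ex, ey]; ring
  rw [← ex] at hx
  rw [← ey] at hy
  have hs' : |x + y| ≤ m := by rwa [show x + y = (k : ℝ) - l by rw [ex, ey]; ring]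
  obtain ⟨s, es⟩ : ∃ s : ℝ, s = x + y := ⟨_, rfl⟩
  have hy' : |(|y|)| ≤ m := by rwa [abs_abs]
  have hxr : |x * (k : ℝ)⁻¹| ≤ m := by
    have := abs_mul_le_of_le hx (show |(k : ℝ)⁻¹| ≤ 1 by rwa [abs_of_pos r0])
    rwa [mul_one] at this
  have e : ((k : ℝ)⁻¹ + (j : ℝ)⁻¹) / 2 * (j * (-c.c₁ * (l ^ 2 + (j - l) ^ 2)
        - 2 * c.c₂ * ((j - l) * l) + 2 * c.c₃ * (|(j : ℝ) - l| * l))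
        + c.c₄ * (j * (l * l + (j - l) * |(j : ℝ) - l|)))
      - (-(c.c₁ - c.c₄) * (k * k) + k * (5 / 2 * (c.c₁ - c.c₄) * (k - j)
        + (2 * (c.c₁ - c.c₄) - 2 * c.c₂) * (j - l)) + 2 * c.c₃ * (k * |(j : ℝ) - l|))
      = c.c₁ * (-(s * s) - y * y - x * s + (x * (k : ℝ)⁻¹ * s * s + x * (k : ℝ)⁻¹ * y * y) / 2)
        + c.c₂ * (2 * (y * s) + (x * y - x * (k : ℝ)⁻¹ * y * s))
        + c.c₃ * (-2 * (|y| * s) - (x * |y| - x * (k : ℝ)⁻¹ * |y| * s))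
        + c.c₄ * (s * s + y * |y| + x * s - (x * (k : ℝ)⁻¹ * s * s
          + x * (k : ℝ)⁻¹ * y * |y|) / 2) := by
    have hA : ((k : ℝ)⁻¹ + (j : ℝ)⁻¹) / 2 = (1 - x * (k : ℝ)⁻¹ / 2) * (j : ℝ)⁻¹ := by
      field_simp; rw [ej]; ring
    rw [hA, ← ey, ← ex, el, ← es]
    have h1 : (j : ℝ)⁻¹ * j = 1 := inv_mul_cancel₀ hj'.ne'
    have h2 : (k : ℝ)⁻¹ * k = 1 := inv_mul_cancel₀ hk'.ne'
    have hB : (1 - x * (k : ℝ)⁻¹ / 2) * (j : ℝ)⁻¹ * (j * (-c.c₁ * ((k - s) ^ 2 + y ^ 2)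
        - 2 * c.c₂ * (y * (k - s)) + 2 * c.c₃ * (|y| * (k - s)))
        + c.c₄ * (j * ((k - s) * (k - s) + y * |y|)))
        = (1 - x * (k : ℝ)⁻¹ / 2) * (-c.c₁ * ((k - s) ^ 2 + y ^ 2)
        - 2 * c.c₂ * (y * (k - s)) + 2 * c.c₃ * (|y| * (k - s))
        + c.c₄ * ((k - s) * (k - s) + y * |y|)) := by
      linear_combination (1 - x * (k : ℝ)⁻¹ / 2) * (-c.c₁ * ((k - s) ^ 2 + y ^ 2)
        - 2 * c.c₂ * (y * (k - s)) + 2 * c.c₃ * (|y| * (k - s))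
        + c.c₄ * ((k - s) * (k - s) + y * |y|)) * h1
    rw [hB]
    have hy2 : y = s - x := by rw [es]; ring
    have hz : ∀ z : ℝ, (1 - x * (k : ℝ)⁻¹ / 2) * (-c.c₁ * ((k - s) ^ 2 + y ^ 2)
        - 2 * c.c₂ * (y * (k - s)) + 2 * c.c₃ * (z * (k - s))
        + c.c₄ * ((k - s) * (k - s) + y * z)) - (-(c.c₁ - c.c₄) * (k * k)
        + k * (5 / 2 * (c.c₁ - c.c₄) * x + (2 * (c.c₁ - c.c₄) - 2 * c.c₂) * y)
        + 2 * c.c₃ * (k * z)) =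
        c.c₁ * (-(s * s) - y * y - x * s + (x * (k : ℝ)⁻¹ * s * s + x * (k : ℝ)⁻¹ * y * y) / 2)
        + c.c₂ * (2 * (y * s) + (x * y - x * (k : ℝ)⁻¹ * y * s))
        + c.c₃ * (-2 * (z * s) - (x * z - x * (k : ℝ)⁻¹ * z * s))
        + c.c₄ * (s * s + y * z + x * s - (x * (k : ℝ)⁻¹ * s * s
          + x * (k : ℝ)⁻¹ * y * z) / 2) := by
      intro z
      rw [hy2]
      linear_combination (x * (c.c₁ - c.c₄) / 2 * (k - 2 * s) + x * c.c₂ * (s - x)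
        - x * c.c₃ * z) * h2
    exact hz _
  rw [e]
  rw [← es] at hs'
  have h2 : ∀ {a b : ℝ}, |a| ≤ m → |b| ≤ m → |a * b| ≤ m ^ 3 := fun ha hb =>
    (abs_mul_le_of_le ha hb).trans (by rw [← sq]; exact hm23)
  have t1 := h2 hs' hs'
  have t2 := h2 hy hy
  have t3 := h2 hx hs'
  have t4 := h2 hy hs'
  have t5 := h2 hx hy
  have t6 := h2 hy' hs'
  have t7 := h2 hx hy'
  have t8 := h2 hy hy'
  have u1 := mul₃_abs_le hxr hs' hs'
  have u2 := mul₃_abs_le hxr hy hy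
  have u3 := mul₃_abs_le hxr hy hs'
  have u4 := mul₃_abs_le hxr hy' hs'
  have u5 := mul₃_abs_le hxr hy hy'
  rw [abs_le] at t1 t2 t3 t4 t5 t6 t7 t8 u1 u2 u3 u4 u5
  apply abs_comb₄_le <;> (rw [abs_le]; constructor <;> linarith)

lemma abs_ldTh_le (c : Coeffs) (k j l : ℤ) (m : ℝ) (hk : |(k : ℝ)| ≤ m)
    (hx : |(k : ℝ) - j| ≤ m) (hy : |(j : ℝ) - l| ≤ m) :
    |ldTh c k j l| ≤ c.size * (6 * m ^ 2) := by
  have hk' : |(|(k : ℝ)|)| ≤ m := by rwa [abs_abs]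
  have hy' : |(|(j : ℝ) - l|)| ≤ m := by rwa [abs_abs]
  have h1 := abs_mul_le_of_le hk hk'
  have h2 := abs_mul_le_of_le hk' hx
  have h3 := abs_mul_le_of_le hk' hy
  have h4 := abs_mul_le_of_le hk hy'
  have e : ldTh c k j l = c.c₁ * (-(k * |(k : ℝ)|) + 5 / 2 * (|(k : ℝ)| * (k - j))
      + 2 * (|(k : ℝ)| * (j - l))) + c.c₂ * (-2 * (|(k : ℝ)| * (j - l)))
      + c.c₃ * (2 * (k * |(j : ℝ) - l|)) + c.c₄ * (k * |(k : ℝ)|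
      - 5 / 2 * (|(k : ℝ)| * (k - j)) - 2 * (|(k : ℝ)| * (j - l))) := by unfold ldTh; ring
  rw [abs_le] at h1 h2 h3 h4
  rw [e]
  apply abs_comb₄_le <;> (rw [abs_le]; constructor <;> nlinarith)

lemma abs_th₁_le_one (k l : ℤ) : |th₁ k l| ≤ 1 := by
  have := abs_th₁_le k l
  linarith [Jc_le_one k, Jc_le_one l]

lemma abs_th₁_pq_sub_le (c : Coeffs) (k j l : ℤ) :
    |th₁ k j * pq c j l - ldTh c k j l| ≤ c.size * (8 * (jb (k - j) * jb (j - l)) ^ 3) := by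
  have hm := one_le_jb_mul (k - j) (j - l)
  have hc := c.size_nonneg
  have hm23 : (jb (k - j) * jb (j - l)) ^ 2 ≤ (jb (k - j) * jb (j - l)) ^ 3 :=
    pow_le_pow_right₀ hm (by norm_num)
  rcases triple_cases k j l with ⟨hk, hj, hl⟩ | ⟨hk, hj, hl⟩ | ⟨hk, hj, hl⟩
  · refine (abs_th₁_pq_sub_near c hk hj hl).trans ?_
    gcongr; norm_num
  · have := abs_th₁_pq_sub_near c hk hj hl
    rw [th₁_neg, pq_neg, ldTh_neg, show -k - -j = -(k - j) by ring,
      show -j - -l = -(j - l) by ring, jb_neg, jb_neg, ← abs_neg] at this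
    rw [show th₁ k j * pq c j l - ldTh c k j l = -(th₁ k j * -pq c j l - -ldTh c k j l) by ring]
    refine this.trans ?_
    gcongr; norm_num
  · have hx := (abs_sub_le_jb k j).trans (jb_le_mul_left _ (j - l))
    have hy := (abs_sub_le_jb j l).trans (jb_le_mul_right (k - j) _)
    have h1 := abs_mul_le_of_le (abs_th₁_le_one k j) (abs_pq_le c j l hl hy)
    have h2 := abs_ldTh_le c k j l _ hk hx hy
    generalize jb (k - j) * jb (j - l) = m at *
    have h3 : c.size * (|(j : ℝ)| * (2 * m ^ 2)) ≤ c.size * (2 * m ^ 3) := by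
      rw [pow_succ' _ 2, mul_left_comm (2 : ℝ)]; gcongr
    have h4 : c.size * (6 * m ^ 2) ≤ c.size * (6 * m ^ 3) := by gcongr
    have := abs_sub (th₁ k j * pq c j l) (ldTh c k j l)
    linarith

/-- Here `J_j` removes the factor `j` of `pq(j,l)` and `J_k` divides the remaining quadratic in `k`
by `k`: the result is a multiple of `k` up to a bounded error. Only `c₁ - c₄` survives because the
`c₂` and `c₃` parts carry a factor `j - l`. -/
lemma abs_JJ_pq_add_near (c : Coeffs) {k j l : ℤ} (hk : 2 ≤ k) (hj : 2 ≤ j) (hl : 2 ≤ l) :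
    |Jc k * Jc j * pq c j l + (c.c₁ - c.c₄) * k| ≤
      c.size * (5 * (jb (k - j) * jb (j - l)) ^ 2) := by
  obtain ⟨r0, r1, hx, hy, hs⟩ := near_data (j := j) (l := l) hk
  have hm := one_le_jb_mul (k - j) (j - l)
  have hk' : (0 : ℝ) < k := by exact_mod_cast (by omega : 0 < k)
  have hj' : (0 : ℝ) < j := by exact_mod_cast (by omega : 0 < j)
  have hl' : (0 : ℝ) < l := by exact_mod_cast (by omega : 0 < l)
  rw [Jc_of_two_le hk, Jc_of_two_le hj, pq, abs_of_pos hj', abs_of_pos hl']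
  generalize jb (k - j) * jb (j - l) = m at *
  have hm0 : 0 < m := by linarith
  obtain ⟨s, es⟩ : ∃ s : ℝ, s = k - l := ⟨_, rfl⟩
  obtain ⟨y, ey⟩ : ∃ y : ℝ, y = j - l := ⟨_, rfl⟩
  have el : (l : ℝ) = k - s := by rw [es]; ring
  rw [← es] at hs
  rw [← ey] at hy ⊢
  rw [el]
  have hy' : |(|y|)| ≤ m := by rwa [abs_abs]
  have h1 : (j : ℝ)⁻¹ * j = 1 := inv_mul_cancel₀ hj'.ne'
  have h2 : (k : ℝ)⁻¹ * k = 1 := inv_mul_cancel₀ hk'.ne'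
  have e : (k : ℝ)⁻¹ * (j : ℝ)⁻¹ * (j * (-c.c₁ * ((k - s) ^ 2 + y ^ 2)
        - 2 * c.c₂ * (y * (k - s)) + 2 * c.c₃ * (|y| * (k - s)))
        + c.c₄ * (j * ((k - s) * (k - s) + y * |y|))) + (c.c₁ - c.c₄) * k
      = c.c₁ * (2 * s - (k : ℝ)⁻¹ * (s * s) - (k : ℝ)⁻¹ * (y * y))
        + c.c₂ * (-2 * y + 2 * ((k : ℝ)⁻¹ * (y * s)))
        + c.c₃ * (2 * |y| - 2 * ((k : ℝ)⁻¹ * (|y| * s)))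
        + c.c₄ * (-2 * s + (k : ℝ)⁻¹ * (s * s) + (k : ℝ)⁻¹ * (y * |y|)) := by
    linear_combination (k : ℝ)⁻¹ * (-c.c₁ * ((k - s) ^ 2 + y ^ 2)
        - 2 * c.c₂ * (y * (k - s)) + 2 * c.c₃ * (|y| * (k - s))
        + c.c₄ * ((k - s) * (k - s) + y * |y|)) * h1 + (-(c.c₁ - c.c₄) * (k - 2 * s)
        - 2 * c.c₂ * y + 2 * c.c₃ * |y|) * h2
  have hr : ∀ {a b : ℝ}, |a| ≤ m → |b| ≤ m → |(k : ℝ)⁻¹ * (a * b)| ≤ m ^ 2 := fun ha hb => by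
    have := abs_mul_le_of_le (show |(k : ℝ)⁻¹| ≤ 1 by rwa [abs_of_pos r0]) (abs_mul_le_of_le ha hb)
    rwa [one_mul, ← sq] at this
  have hm2 : m ≤ m ^ 2 := by nlinarith
  have t1 := hr hs hs
  have t2 := hr hy hy
  have t3 := hr hy hs
  have t4 := hr hy' hs
  have t5 := hr hy hy'
  rw [abs_le] at t1 t2 t3 t4 t5 hs hy hy'
  rw [e]
  apply abs_comb₄_le <;> (rw [abs_le]; constructor <;> linarith)

lemma abs_JJ_pq_add_le (c : Coeffs) (k j l : ℤ) :
    |Jc k * Jc j * pq c j l + (c.c₁ - c.c₄) * k| ≤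
      c.size * (5 * (jb (k - j) * jb (j - l)) ^ 2) := by
  have hm := one_le_jb_mul (k - j) (j - l)
  have hc := c.size_nonneg
  rcases triple_cases k j l with ⟨hk, hj, hl⟩ | ⟨hk, hj, hl⟩ | ⟨hk, hj, hl⟩
  · exact abs_JJ_pq_add_near c hk hj hl
  · have := abs_JJ_pq_add_near c hk hj hl
    rw [Jc_neg, Jc_neg, pq_neg, show -k - -j = -(k - j) by ring,
      show -j - -l = -(j - l) by ring, jb_neg, jb_neg, ← abs_neg] at this
    convert this using 2; push_cast; ring
  · have hy := (abs_sub_le_jb j l).trans (jb_le_mul_right (k - j) _)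
    have h1 := abs_pq_le c j l hl hy
    have h5 := abs_comb₄_le c (q₁ := k) (q₂ := 0) (q₃ := 0) (q₄ := -k)
      (B := jb (k - j) * jb (j - l)) hk (by simp; linarith) (by simp; linarith) (by simpa using hk)
    have e5 : c.c₁ * (k : ℝ) + c.c₂ * 0 + c.c₃ * 0 + c.c₄ * -k = (c.c₁ - c.c₄) * k := by ring
    rw [e5] at h5
    generalize jb (k - j) * jb (j - l) = m at *
    have h2 : |Jc k * Jc j * pq c j l| ≤ c.size * (2 * m ^ 2) := by
      rw [abs_mul, abs_of_nonneg (mul_nonneg (Jc_nonneg k) (Jc_nonneg j))]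
      calc Jc k * Jc j * |pq c j l| ≤ Jc k * Jc j * (c.size * (|(j : ℝ)| * (2 * m ^ 2))) :=
            mul_le_mul_of_nonneg_left h1 (mul_nonneg (Jc_nonneg k) (Jc_nonneg j))
        _ = Jc k * (Jc j * |(j : ℝ)|) * (c.size * (2 * m ^ 2)) := by ring
        _ ≤ 1 * 1 * (c.size * (2 * m ^ 2)) := by
            have := Jc_nonneg j
            gcongr
            · exact Jc_le_one k
            · exact Jc_mul_abs_le j
        _ = _ := by ring
    have h3 : c.size * m ≤ c.size * (m ^ 2) := by gcongr; nlinarith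
    have h4 : 0 ≤ c.size * m ^ 2 := by positivity
    have := abs_add_le (Jc k * Jc j * pq c j l) ((c.c₁ - c.c₄) * k)
    linarith

/-- At top order `pe(j,l)` is `(c₅ + c₆ + c₇) j|j|` and `θ₁` divides by `|j|`. Only the multiple of
`k` matters, because it disappears on antisymmetrization. -/
lemma abs_th₁_pe_sub_le (c : Coeffs) (k j l : ℤ) :
    |th₁ k j * pe c j l - (c.c₅ + c.c₆ + c.c₇) * k| ≤
      c.size * (3 * (jb (k - j) * jb (j - l)) ^ 2) := by
  have hm := one_le_jb_mul (k - j) (j - l)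
  have hc := c.size_nonneg
  have near : ∀ {k j l : ℤ}, 2 ≤ k → 2 ≤ j → 2 ≤ l →
      |th₁ k j * pe c j l - (c.c₅ + c.c₆ + c.c₇) * k| ≤
      c.size * (3 * (jb (k - j) * jb (j - l)) ^ 2) := by
    intro k j l hk hj hl
    obtain ⟨r0, r1, hx, hy, hs⟩ := near_data (j := j) (l := l) hk
    have hm := one_le_jb_mul (k - j) (j - l)
    have hk' : (0 : ℝ) < k := by exact_mod_cast (by omega : 0 < k)
    have hj' : (0 : ℝ) < j := by exact_mod_cast (by omega : 0 < j)
    have hl' : (0 : ℝ) < l := by exact_mod_cast (by omega : 0 < l)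
    rw [th₁_of_two_le hk hj, pe, abs_of_pos hj', abs_of_pos hl']
    generalize jb (k - j) * jb (j - l) = m at *
    have hm0 : 0 < m := by linarith
    have hm2 : m ≤ m ^ 2 := by nlinarith
    obtain ⟨x, ex⟩ : ∃ x : ℝ, x = k - j := ⟨_, rfl⟩
    obtain ⟨s, es⟩ : ∃ s : ℝ, s = k - l := ⟨_, rfl⟩
    have ej : (j : ℝ) = k - x := by rw [ex]; ring
    have el : (l : ℝ) = k - s := by rw [es]; ring
    rw [← ex] at hx
    rw [← es] at hs
    have hA : ((k : ℝ)⁻¹ + (j : ℝ)⁻¹) / 2 = (1 - x * (k : ℝ)⁻¹ / 2) * (j : ℝ)⁻¹ := by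
      field_simp; rw [ej]; ring
    have h1 : (j : ℝ)⁻¹ * j = 1 := inv_mul_cancel₀ hj'.ne'
    have h2 : (k : ℝ)⁻¹ * k = 1 := inv_mul_cancel₀ hk'.ne'
    have e : ((k : ℝ)⁻¹ + (j : ℝ)⁻¹) / 2 * (c.c₅ * (j * j) + c.c₇ * (j * l)
          + c.c₆ * (j * (j + l)) / 2) - (c.c₅ + c.c₆ + c.c₇) * k
        = c.c₅ * (-3 / 2 * x + (k : ℝ)⁻¹ * (x * x) / 2)
          + c.c₆ * (-x - s / 2 + (k : ℝ)⁻¹ * (x * x) / 4 + (k : ℝ)⁻¹ * (x * s) / 4)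
          + c.c₇ * (-s - x / 2 + (k : ℝ)⁻¹ * (x * s) / 2) := by
      have hB : ((k : ℝ)⁻¹ + (j : ℝ)⁻¹) / 2 * (c.c₅ * (j * j) + c.c₇ * (j * l)
          + c.c₆ * (j * (j + l)) / 2) = (1 - x * (k : ℝ)⁻¹ / 2) * (c.c₅ * j + c.c₇ * l
          + c.c₆ * (j + l) / 2) := by
        rw [hA]
        linear_combination (1 - x * (k : ℝ)⁻¹ / 2) * (c.c₅ * j + c.c₇ * l
          + c.c₆ * (j + l) / 2) * h1
      rw [hB, ej, el]
      linear_combination (-x / 2) * (c.c₅ + c.c₆ + c.c₇) * h2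
    have hr : ∀ {a b : ℝ}, |a| ≤ m → |b| ≤ m → |(k : ℝ)⁻¹ * (a * b)| ≤ m ^ 2 := fun ha hb => by
      have := abs_mul_le_of_le (show |(k : ℝ)⁻¹| ≤ 1 by rwa [abs_of_pos r0])
        (abs_mul_le_of_le ha hb)
      rwa [one_mul, ← sq] at this
    have t1 := hr hx hx
    have t2 := hr hx hs
    rw [abs_le] at t1 t2 hs hx
    rw [e]
    apply abs_comb₃_le <;> (rw [abs_le]; constructor <;> linarith)
  rcases triple_cases k j l with ⟨hk, hj, hl⟩ | ⟨hk, hj, hl⟩ | ⟨hk, hj, hl⟩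
  · exact near hk hj hl
  · have := near hk hj hl
    rw [th₁_neg, pe_neg, show -k - -j = -(k - j) by ring,
      show -j - -l = -(j - l) by ring, jb_neg, jb_neg, ← abs_neg] at this
    convert this using 2; push_cast; ring
  · have h1 := abs_mul_le_of_le (abs_th₁_le_one k j) (abs_pe_le c j l hj hl)
    have h5 := abs_comb₃_le c (q₁ := k) (q₂ := k) (q₃ := k)
      (B := jb (k - j) * jb (j - l)) hk hk hk
    have e5 : c.c₅ * (k : ℝ) + c.c₆ * k + c.c₇ * k = (c.c₅ + c.c₆ + c.c₇) * k := by ring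
    rw [e5] at h5
    generalize jb (k - j) * jb (j - l) = m at *
    have h2 : c.size * (|(j : ℝ)| * m) ≤ c.size * m ^ 2 := by rw [sq]; gcongr
    have h3 : c.size * m ≤ c.size * (m ^ 2) := by gcongr; nlinarith
    have h4 : 0 ≤ c.size * m ^ 2 := by positivity
    have := abs_sub (th₁ k j * pe c j l) ((c.c₅ + c.c₆ + c.c₇) * k)
    linarith

lemma abs_mul_abs_sub_sub_le (k l : ℤ) :
    |(k : ℝ) * |(k : ℝ)| - l * |(l : ℝ)| - 2 * |(k : ℝ)| * (k - l)| ≤ 4 * jb (k - l) ^ 2 := by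
  have hb := abs_sub_le_jb k l
  have h2 : ((k : ℝ) - l) ^ 2 ≤ jb (k - l) ^ 2 := by rw [← sq_abs]; gcongr
  have h0 := sq_nonneg (jb (k - l))
  rcases pair_cases k l with ⟨hk, hl⟩ | ⟨hk, hl⟩ | ⟨hk, hl⟩
  · have hk' : (0 : ℝ) < k := by exact_mod_cast (by omega : 0 < k)
    have hl' : (0 : ℝ) < l := by exact_mod_cast (by omega : 0 < l)
    rw [abs_of_pos hk', abs_of_pos hl', abs_le]; constructor <;> nlinarith
  · have hk' : (k : ℝ) < 0 := by exact_mod_cast (by omega : k < 0)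
    have hl' : (l : ℝ) < 0 := by exact_mod_cast (by omega : l < 0)
    rw [abs_of_neg hk', abs_of_neg hl', abs_le]; constructor <;> nlinarith
  · have t1 := abs_mul_le_of_le hk (y := |(k : ℝ)|) (b := jb (k - l)) (by rwa [abs_abs])
    have t2 := abs_mul_le_of_le hl (y := |(l : ℝ)|) (b := jb (k - l)) (by rwa [abs_abs])
    have t3 := abs_mul_le_of_le (x := |(k : ℝ)|) (a := jb (k - l)) (by rwa [abs_abs]) hb
    rw [abs_le] at t1 t2 t3 ⊢
    constructor <;> nlinarith

/-- The products `k|l|` and `l|k|` agree for equal signs, so `c₇` drops out and `c₆` contributes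
through half of `k|k|` only; the derivative `2|k|` of `k|k|` gives the leading term. -/
lemma abs_pe_sub_le (c : Coeffs) (k l : ℤ) :
    |pe c k l - pe c l k - (2 * c.c₅ + c.c₆) * (|(k : ℝ)| * (k - l))| ≤
      c.size * (4 * jb (k - l) ^ 2) := by
  have h1 := abs_mul_abs_sub_sub_le k l
  have h0 := sq_nonneg (jb (k - l))
  have h2 : |(k : ℝ) * |(l : ℝ)| - l * (|(k : ℝ)|)| ≤ 2 * jb (k - l) ^ 2 := by
    rcases pair_cases k l with ⟨hk, hl⟩ | ⟨hk, hl⟩ | ⟨hk, hl⟩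
    · have hk' : (0 : ℝ) < k := by exact_mod_cast (by omega : 0 < k)
      have hl' : (0 : ℝ) < l := by exact_mod_cast (by omega : 0 < l)
      rw [abs_of_pos hk', abs_of_pos hl', abs_le]; constructor <;> nlinarith
    · have hk' : (k : ℝ) < 0 := by exact_mod_cast (by omega : k < 0)
      have hl' : (l : ℝ) < 0 := by exact_mod_cast (by omega : l < 0)
      rw [abs_of_neg hk', abs_of_neg hl', abs_le]; constructor <;> nlinarith
    · have t1 := abs_mul_le_of_le hk (y := |(l : ℝ)|) (b := jb (k - l)) (by rwa [abs_abs])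
      have t2 := abs_mul_le_of_le hl (y := |(k : ℝ)|) (b := jb (k - l)) (by rwa [abs_abs])
      rw [abs_le] at t1 t2 ⊢
      constructor <;> nlinarith
  have e : pe c k l - pe c l k - (2 * c.c₅ + c.c₆) * (|(k : ℝ)| * (k - l))
      = c.c₅ * ((k : ℝ) * |(k : ℝ)| - l * |(l : ℝ)| - 2 * |(k : ℝ)| * (k - l))
        + c.c₆ * (((k : ℝ) * |(k : ℝ)| - l * |(l : ℝ)| - 2 * |(k : ℝ)| * (k - l)) / 2
          + ((k : ℝ) * |(l : ℝ)| - l * |(k : ℝ)|) / 2)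
        + c.c₇ * ((k : ℝ) * |(l : ℝ)| - l * |(k : ℝ)|) := by unfold pe; ring
  rw [e]
  rw [abs_le] at h1 h2
  apply abs_comb₃_le <;> (rw [abs_le]; constructor <;> linarith)
end BO4
end

/-! ### Cancellation of the terms quadratic in the background -/

noncomputable section
namespace BO4

lemma abs_mul_abs_le {x y a b : ℝ} (hx : |x| ≤ a) (hy : |y| ≤ b) : |x * (|y|)| ≤ a * b :=
  abs_mul_le_of_le hx (by rwa [abs_abs])

lemma abs_lam₄_le (c : Coeffs) : |lam₄ c 0| ≤ 5 * c.size := by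
  have := abs_comb₄_le c (q₁ := -5) (q₂ := 4) (q₃ := 0) (q₄ := 5) (B := 5)
    (by rw [abs_le]; norm_num) (by rw [abs_le]; norm_num) (by simp) (by rw [abs_le]; norm_num)
  rw [mul_comm c.size] at this
  convert this using 2; unfold lam₄; ring

lemma abs_lam₃_le (c : Coeffs) : |lam₃ c 0| ≤ 2 * c.size := by
  have := abs_comb₃_le c (q₁ := -2) (q₂ := -1) (q₃ := 0) (B := 2)
    (by rw [abs_le]; norm_num) (by rw [abs_le]; norm_num) (by simp)
  rw [mul_comm c.size] at this
  convert this using 2; unfold lam₃; ring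

lemma size_le_sq (c : Coeffs) : c.size ≤ c.size ^ 2 := by nlinarith [c.one_le_size]

lemma abs_mu₃_le (c : Coeffs) : |mu₃ c| ≤ c.size ^ 2 := by
  have h1 := abs_mul_le_of_le (abs_lam₁_le c) (abs_lam₄_le c)
  have h2 := abs_lam₃_le c
  have h3 := size_le_sq c
  have h4 := c.size_nonneg
  unfold mu₃
  rw [abs_le] at *
  constructor <;> nlinarith

/-- The symbol of all terms in the derivative of the energy that are quadratic in the background
and of critical order. -/
def symQuad (c : Coeffs) (k j l : ℤ) : ℝ :=
  pe c k l - pe c l k + 2 * mu₃ c * (Jc k * Jc l * (phi k - phi l - phi (k - j) - phi (j - l)))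
    + lam₁ c 0 / 2 * (th₁ k j * pq c j l - th₁ l j * pq c j k)
    - lam₁ c 0 * c.c₃ * (k * (|(j : ℝ) - l| - |(k : ℝ) - j|))

lemma jb_sub_le (k j l : ℤ) : jb (k - l) ≤ jb (k - j) * jb (j - l) := by
  have h := jb_add_le (k - j) (j - l)
  rwa [sub_add_sub_cancel] at h

/-- The quartic resonance differs from `Φ(k,l)` by `φ(k-l) - φ(k-j) - φ(j-l)`, which involves
background frequencies only. The leading part is therefore the same as for the trilinear resonance.
-/
lemma abs_JJ_phi_le (k j l : ℤ) :
    |Jc k * Jc l * (phi k - phi l - phi (k - j) - phi (j - l)) - 4 * |(k : ℝ)| * (k - l)| ≤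
      52 * (jb (k - j) * jb (j - l)) ^ 3 := by
  have h1 := abs_JJ_Phi_sub_le k l
  have hs := jb_sub_le k j l
  have hm := one_le_jb_mul (k - j) (j - l)
  have h2 := abs_quartic_add_sub_le (k - j) (j - l)
  have hx := abs_sub_le_jb k j
  have hy := abs_sub_le_jb j l
  have h3 : |phi (k - l) - phi (k - j) - phi (j - l)| ≤ 24 * (jb (k - j) * jb (j - l)) ^ 3 := by
    rw [sub_add_sub_cancel] at h2
    unfold phi; push_cast
    refine h2.trans ?_
    have e1 : |(k : ℝ) - j| + |(j : ℝ) - l| ≤ 2 * (jb (k - j) * jb (j - l)) := by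
      linarith [jb_le_mul_left (k - j) (j - l), jb_le_mul_right (k - j) (j - l)]
    have p1 := jb_pos (k - j)
    have p2 := jb_pos (j - l)
    calc 6 * |(k : ℝ) - j| * |(j : ℝ) - l| * (|(k : ℝ) - j| + |(j : ℝ) - l|) ^ 2
        ≤ 6 * jb (k - j) * jb (j - l) * (2 * (jb (k - j) * jb (j - l))) ^ 2 := by
          gcongr
      _ = _ := by ring
  have h4 : |Jc k * Jc l * (phi (k - l) - phi (k - j) - phi (j - l))| ≤
      1 * (24 * (jb (k - j) * jb (j - l)) ^ 3) := by
    refine abs_mul_le_of_le ?_ h3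
    rw [abs_of_nonneg (mul_nonneg (Jc_nonneg k) (Jc_nonneg l))]
    exact mul_le_one₀ (Jc_le_one k) (Jc_nonneg l) (Jc_le_one l)
  have h5 : 28 * jb (k - l) ^ 2 ≤ 28 * (jb (k - j) * jb (j - l)) ^ 3 := by
    have := jb_pos (k - l)
    have : jb (k - l) ^ 2 ≤ (jb (k - j) * jb (j - l)) ^ 2 := by gcongr
    have := pow_le_pow_right₀ hm (show 2 ≤ 3 by norm_num)
    linarith
  have e : Jc k * Jc l * (phi k - phi l - phi (k - j) - phi (j - l)) - 4 * |(k : ℝ)| * (k - l)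
      = (Jc k * Jc l * Phi k l - 4 * |(k : ℝ)| * (k - l))
        + Jc k * Jc l * (phi (k - l) - phi (k - j) - phi (j - l)) := by unfold Phi; ring
  rw [e]
  linarith [abs_add_le (Jc k * Jc l * Phi k l - 4 * |(k : ℝ)| * (k - l))
    (Jc k * Jc l * (phi (k - l) - phi (k - j) - phi (j - l)))]

/-- The leading parts cancel. -/
lemma ldTh_sub_swap (c : Coeffs) (k j l : ℤ) :
    |ldTh c k j l - ldTh c l j k - 2 * c.c₃ * (k * (|(j : ℝ) - l| - |(k : ℝ) - j|))
      + lam₄ c 0 / 2 * (|(k : ℝ)| * (k - l))| ≤ c.size * (12 * (jb (k - j) * jb (j - l)) ^ 2) := by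
  have h1 := abs_mul_abs_sub_sub_le k l
  have hs := jb_sub_le k j l
  have hm := one_le_jb_mul (k - j) (j - l)
  have hx := (abs_sub_le_jb k j).trans (jb_le_mul_left _ (j - l))
  have hy := (abs_sub_le_jb j l).trans (jb_le_mul_right (k - j) _)
  have ha := (abs_sub_le_jb k l).trans hs
  have hj0 := jb_pos (k - l)
  have h2 : jb (k - l) ^ 2 ≤ (jb (k - j) * jb (j - l)) ^ 2 := by gcongr
  have h3 : |(|(k : ℝ)| - |(l : ℝ)|)| ≤ jb (k - j) * jb (j - l) :=
    (abs_abs_sub_abs_le _ _).trans ha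
  have e : ldTh c k j l - ldTh c l j k - 2 * c.c₃ * (k * (|(j : ℝ) - l| - |(k : ℝ) - j|))
      + lam₄ c 0 / 2 * (|(k : ℝ)| * (k - l))
      = c.c₁ * (-(k * |(k : ℝ)| - l * |(l : ℝ)| - 2 * |(k : ℝ)| * (k - l))
          - (|(k : ℝ)| - |(l : ℝ)|) * (5 / 2 * (j - l) + 2 * (k - j)))
        + c.c₂ * (2 * ((|(k : ℝ)| - |(l : ℝ)|) * (k - j)))
        + c.c₃ * (2 * ((k - l) * |(k : ℝ) - j|))
        + c.c₄ * (k * |(k : ℝ)| - l * |(l : ℝ)| - 2 * |(k : ℝ)| * (k - l)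
          + (|(k : ℝ)| - |(l : ℝ)|) * (5 / 2 * (j - l) + 2 * (k - j))) := by
    unfold ldTh lam₄
    rw [abs_sub_comm (j : ℝ) k]; ring
  rw [e]
  have t1 := abs_mul_le_of_le h3 hx
  have t2 := abs_mul_le_of_le h3 hy
  have t3 := abs_mul_abs_le ha hx
  rw [← sq] at t1 t2 t3
  have h1' := h1.trans (mul_le_mul_of_nonneg_left h2 (by norm_num))
  generalize (jb (k - j) * jb (j - l)) ^ 2 = M at *
  have hM : 0 ≤ M := (abs_nonneg _).trans t1
  rw [abs_le] at h1' t1 t2 t3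
  apply abs_comb₄_le <;> (rw [abs_le]; constructor <;> linarith)

/-- All leading terms are multiples of `|k|(k-l)`: `pe` contributes `2c₅ + c₆ = -λ₃`, the third
correction `8μ₃ = λ₁λ₄/4 + λ₃`, and the antisymmetrized `θ₁ pq` contributes `-λ₁λ₄/4`. Their sum is
zero, which is what fixes `μ₃`. The `c₃` part of `θ₁ pq` does not cancel pointwise and is subtracted
in the definition of `symQuad`. -/
lemma abs_symQuad_le (c : Coeffs) (k j l : ℤ) :
    |symQuad c k j l| ≤ c.size ^ 2 * (200 * (jb (k - j) * jb (j - l)) ^ 3) := by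
  have h1 := abs_pe_sub_le c k l
  have h2 := abs_mul_le_of_le (abs_mu₃_le c) (abs_JJ_phi_le k j l)
  have h3 := abs_th₁_pq_sub_le c k j l
  have h4 := abs_th₁_pq_sub_le c l j k
  rw [jb_mul_neg_swap] at h4
  have h34 := abs_sub (th₁ k j * pq c j l - ldTh c k j l) (th₁ l j * pq c j k - ldTh c l j k)
  have h5 := ldTh_sub_swap c k j l
  have h6 := abs_add_le (th₁ k j * pq c j l - ldTh c k j l - (th₁ l j * pq c j k - ldTh c l j k))
    (ldTh c k j l - ldTh c l j k - 2 * c.c₃ * (k * (|(j : ℝ) - l| - |(k : ℝ) - j|))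
      + lam₄ c 0 / 2 * (|(k : ℝ)| * (k - l)))
  have hm := one_le_jb_mul (k - j) (j - l)
  have hm3 := pow_le_pow_right₀ hm (show 2 ≤ 3 by norm_num)
  have hj : jb (k - l) ^ 2 ≤ (jb (k - j) * jb (j - l)) ^ 2 := by
    have := jb_pos (k - l)
    have := jb_sub_le k j l
    gcongr
  have e : symQuad c k j l = (pe c k l - pe c l k - (2 * c.c₅ + c.c₆) * (|(k : ℝ)| * (k - l)))
      + 2 * (mu₃ c * (Jc k * Jc l * (phi k - phi l - phi (k - j) - phi (j - l))
        - 4 * |(k : ℝ)| * (k - l)))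
      + lam₁ c 0 * ((th₁ k j * pq c j l - ldTh c k j l - (th₁ l j * pq c j k - ldTh c l j k)
        + (ldTh c k j l - ldTh c l j k - 2 * c.c₃ * (k * (|(j : ℝ) - l| - |(k : ℝ) - j|))
        + lam₄ c 0 / 2 * (|(k : ℝ)| * (k - l))))) / 2 := by
    unfold symQuad mu₃ lam₃; ring
  rw [e]
  generalize jb (k - j) * jb (j - l) = m at *
  have hc := c.one_le_size
  have hc2 := size_le_sq c
  have hm0 : 0 ≤ m ^ 2 := sq_nonneg m
  have h7 : |th₁ k j * pq c j l - ldTh c k j l - (th₁ l j * pq c j k - ldTh c l j k)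
      + (ldTh c k j l - ldTh c l j k - 2 * c.c₃ * (k * (|(j : ℝ) - l| - |(k : ℝ) - j|))
        + lam₄ c 0 / 2 * (|(k : ℝ)| * (k - l)))| ≤ c.size * (28 * m ^ 3) := by
    have : c.size * (12 * m ^ 2) ≤ c.size * (12 * m ^ 3) := by gcongr
    linarith
  have h8 := abs_mul_le_of_le (abs_lam₁_le c) h7
  have h9 : c.size * (4 * jb (k - l) ^ 2) ≤ c.size ^ 2 * (4 * m ^ 3) := by
    have := hj.trans hm3
    gcongr
  rw [abs_le] at h1 h2 h8 ⊢
  constructor <;> nlinarith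

/-! ### Symbols of the lower order terms, including those of the `H⁻¹` pairing -/

/-- The symbol of `(1 - ∂ₓ²)⁻¹`. -/
def om (k : ℤ) : ℝ := (1 + (k : ℝ) ^ 2)⁻¹

lemma om_nonneg (k : ℤ) : 0 ≤ om k := by unfold om; positivity
lemma om_le_one (k : ℤ) : om k ≤ 1 := inv_le_one_of_one_le₀ (by nlinarith [sq_nonneg (k : ℝ)])
lemma om_mul (k : ℤ) : om k * (1 + (k : ℝ) ^ 2) = 1 := inv_mul_cancel₀ (by positivity)

lemma om_mul_le {k : ℤ} {A B : ℝ} (h : A ≤ B * (1 + (k : ℝ) ^ 2)) : om k * A ≤ B := by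
  calc om k * A ≤ om k * (B * (1 + (k : ℝ) ^ 2)) := mul_le_mul_of_nonneg_left h (om_nonneg k)
    _ = B * (om k * (1 + (k : ℝ) ^ 2)) := by ring
    _ = B := by rw [om_mul, mul_one]

lemma abs_om_mul_le {k : ℤ} {A B : ℝ} (h : |A| ≤ B * (1 + (k : ℝ) ^ 2)) : |om k * A| ≤ B := by
  rw [abs_mul, abs_of_nonneg (om_nonneg k)]; exact om_mul_le h

/-- At top order `pq(k,l)` is `-(c₁ - c₄)k³`, and `(1 + k²)⁻¹` turns it into a multiple of `k`,
harmless after antisymmetrization. The other terms have at least one factor `k - l` and at most two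
of `k`, which `(1 + k²)⁻¹` compensates. -/
lemma abs_om_pq_add_le (c : Coeffs) (k l : ℤ) :
    |om k * pq c k l + (c.c₁ - c.c₄) * k| ≤ c.size * (14 * jb (k - l) ^ 3) := by
  have hb := abs_sub_le_jb k l
  have h1 := one_le_jb (k - l)
  have hc := c.size_nonneg
  have e : om k * pq c k l + (c.c₁ - c.c₄) * k
      = om k * (pq c k l + (c.c₁ - c.c₄) * k * (1 + (k : ℝ) ^ 2)) := by
    linear_combination -(c.c₁ - c.c₄) * k * om_mul k
  rw [e]
  apply abs_om_mul_le
  -- The bracket is zero for equal signs; for opposite signs both frequencies are at most `|k - l|`.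
  have hsgn : |(|(k : ℝ)| * |(l : ℝ)| - k * l) * l| ≤ 2 * |(k : ℝ) - l| ^ 3 := by
    rcases le_total 0 (k : ℝ) with hk | hk <;> rcases le_total 0 (l : ℝ) with hl | hl
    · rw [abs_of_nonneg hk, abs_of_nonneg hl]; simp
    · rw [abs_of_nonneg hk, abs_of_nonpos hl, abs_of_nonneg (by linarith : (0:ℝ) ≤ k - l)]
      have h0 := mul_nonneg hk (neg_nonneg.2 hl)
      rw [abs_le]; constructor <;> nlinarith [mul_nonneg h0 (neg_nonneg.2 hl), mul_nonneg h0 hk, pow_nonneg hk 3, pow_nonneg (neg_nonneg.2 hl) 3]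
    · rw [abs_of_nonpos hk, abs_of_nonneg hl, abs_of_nonpos (by linarith : (k:ℝ) - l ≤ 0)]
      have h0 := mul_nonneg (neg_nonneg.2 hk) hl
      rw [abs_le]; constructor <;> nlinarith [mul_nonneg h0 (neg_nonneg.2 hk), mul_nonneg h0 hl, pow_nonneg (neg_nonneg.2 hk) 3, pow_nonneg hl 3]
    · rw [abs_of_nonpos hk, abs_of_nonpos hl]; simp
  have hb3 : |(k : ℝ) - l| ^ 3 ≤ jb (k - l) ^ 3 := by gcongr
  have e2 : pq c k l + (c.c₁ - c.c₄) * k * (1 + (k : ℝ) ^ 2)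
      = c.c₁ * (k - k * (2 * ((k - l) * (k - l))) + 2 * (k * k * (k - l)))
        + c.c₂ * (-2 * (k * k * (k - l)) + 2 * (k * ((k - l) * (k - l))))
        + c.c₃ * (2 * (k * (|(k : ℝ) - l| * |(l : ℝ)|)))
        + c.c₄ * (-k - 2 * (k * k * (k - l)) + k * ((k - l) * (k - l))
          + |(k : ℝ)| * ((k - l) * |(k : ℝ) - l|) + (|(k : ℝ)| * |(l : ℝ)| - k * l) * l) := by
    unfold pq; ring
  rw [e2, mul_assoc c.size]
  have hB : |(k : ℝ)| ≤ 1 + (k : ℝ) ^ 2 := by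
    rw [abs_le]; constructor <;> nlinarith [sq_nonneg ((k : ℝ) + 1), sq_nonneg ((k : ℝ) - 1)]
  have hB2 : |(k : ℝ) * k| ≤ 1 + (k : ℝ) ^ 2 := by
    rw [abs_of_nonneg (mul_self_nonneg _)]; nlinarith
  have hB0 : 1 ≤ 1 + (k : ℝ) ^ 2 := by nlinarith [sq_nonneg (k : ℝ)]
  have hkl : |(k : ℝ) * l| ≤ 2 * ((1 + (k : ℝ) ^ 2) * jb (k - l)) := by
    have e3 : (k : ℝ) * l = k * k - k * (k - l) := by ring
    have := abs_sub ((k : ℝ) * k) (k * (k - l))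
    have h4 := abs_mul_le_of_le hB hb
    rw [e3]
    nlinarith
  have t1 := abs_mul_le_of_le hB (abs_mul_le_of_le hb hb)
  have t2 := abs_mul_le_of_le hB2 hb
  have t3' : |(k : ℝ) * (|(k : ℝ) - l| * |(l : ℝ)|)| ≤
      2 * ((1 + (k : ℝ) ^ 2) * jb (k - l)) * jb (k - l) := by
    rw [show |(k : ℝ) * (|(k : ℝ) - l| * |(l : ℝ)|)| = |(k : ℝ) * l * (|(k : ℝ) - l|)| by
      simp only [abs_mul, abs_abs]; ring]
    exact abs_mul_abs_le hkl hb
  have t4 := abs_mul_le_of_le (x := |(k : ℝ)|) (a := 1 + (k : ℝ) ^ 2) (by rwa [abs_abs])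
    (abs_mul_abs_le hb hb)
  have hs : |(|(k : ℝ)| * |(l : ℝ)| - k * l) * l| ≤ 2 * ((1 + (k : ℝ) ^ 2) * jb (k - l) ^ 3) := by
    refine hsgn.trans ?_
    have : jb (k - l) ^ 3 ≤ (1 + (k : ℝ) ^ 2) * jb (k - l) ^ 3 :=
      le_mul_of_one_le_left (by positivity) hB0
    linarith
  generalize hM : (1 + (k : ℝ) ^ 2) = M at *
  generalize jb (k - l) = b at *
  have hM0 : 0 ≤ M := by linarith
  have u0 : M ≤ M * b ^ 3 := le_mul_of_one_le_right hM0 (one_le_pow₀ h1)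
  have u1 : M * b ≤ M * b ^ 3 := by gcongr; exact le_self_pow₀ h1 (by norm_num)
  have u2 : M * (b * b) ≤ M * b ^ 3 := by
    rw [← sq]; gcongr; norm_num
  rw [show 14 * b ^ 3 * M = 14 * (M * b ^ 3) by ring]
  rw [abs_le] at hB t1 t2 t3' t4 hs
  apply abs_comb₄_le <;> (rw [abs_le]; constructor <;> linarith)

lemma abs_om_pe_le (c : Coeffs) (k l : ℤ) : |om k * pe c k l| ≤ c.size * (2 * jb (k - l)) := by
  have hb := abs_sub_le_jb k l
  have h1 := one_le_jb (k - l)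
  have hc := c.size_nonneg
  have hl : |(l : ℝ)| ≤ |(k : ℝ)| + jb (k - l) := by
    have := abs_sub_abs_le_abs_sub (l : ℝ) k
    rw [abs_sub_comm] at this
    linarith
  have h2 := abs_pe_le c k l (m := |(k : ℝ)| + jb (k - l)) (by linarith) hl
  apply abs_om_mul_le
  refine h2.trans ?_
  rw [mul_assoc]
  refine mul_le_mul_of_nonneg_left ?_ hc
  have hB : |(k : ℝ)| ≤ 1 + (k : ℝ) ^ 2 := by
    rw [abs_le]; constructor <;> nlinarith [sq_nonneg ((k : ℝ) + 1), sq_nonneg ((k : ℝ) - 1)]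
  have h3 : |(k : ℝ)| * |(k : ℝ)| ≤ 1 + (k : ℝ) ^ 2 := by rw [abs_mul_abs_self]; nlinarith
  nlinarith [mul_le_mul_of_nonneg_right hB (by linarith : 0 ≤ jb (k - l)), sq_nonneg (k : ℝ)]

lemma abs_om_mul_self_le (k : ℤ) : |om k * k| ≤ 1 := by
  apply abs_om_mul_le
  rw [abs_le]; constructor <;> nlinarith [sq_nonneg ((k : ℝ) + 1), sq_nonneg ((k : ℝ) - 1)]

lemma Jc_mul_abs_le_jb (k j : ℤ) : Jc k * |(j : ℝ)| ≤ jb (k - j) := by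
  have h : |(j : ℝ)| ≤ |(k : ℝ)| + |(k : ℝ) - j| := by
    have := abs_sub_abs_le_abs_sub (j : ℝ) k
    rw [abs_sub_comm] at this
    linarith
  have h2 := Jc_mul_abs_le k
  have h3 : Jc k * |(k : ℝ) - j| ≤ 1 * |(k : ℝ) - j| :=
    mul_le_mul_of_nonneg_right (Jc_le_one k) (abs_nonneg _)
  calc Jc k * |(j : ℝ)| ≤ Jc k * (|(k : ℝ)| + |(k : ℝ) - j|) :=
        mul_le_mul_of_nonneg_left h (Jc_nonneg k)
    _ ≤ jb (k - j) := by unfold jb; push_cast; linarith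

lemma abs_th₁_mul_le (k j : ℤ) : |th₁ k j * j| ≤ jb (k - j) := by
  have h1 := Jc_mul_abs_le_jb k j
  have h2 := Jc_mul_abs_le j
  have h3 := one_le_jb (k - j)
  rw [abs_mul]
  have := mul_le_mul_of_nonneg_right (abs_th₁_le k j) (abs_nonneg (j : ℝ))
  linarith

lemma abs_JJ_mul_le (k j : ℤ) : |Jc k * Jc j * j| ≤ 1 := by
  rw [abs_mul, abs_of_nonneg (mul_nonneg (Jc_nonneg k) (Jc_nonneg j)), mul_assoc]
  exact mul_le_one₀ (Jc_le_one k) (mul_nonneg (Jc_nonneg j) (abs_nonneg _)) (Jc_mul_abs_le j)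

lemma abs_JJ_pe_le (c : Coeffs) (k j l : ℤ) :
    |Jc k * Jc j * pe c j l| ≤ c.size * (2 * (jb (k - j) * jb (j - l))) := by
  have hl : |(l : ℝ)| ≤ |(j : ℝ)| + |(j : ℝ) - l| := by
    have := abs_sub_abs_le_abs_sub (l : ℝ) j
    rw [abs_sub_comm] at this
    linarith
  have h2 := abs_pe_le c j l (m := |(j : ℝ)| + |(j : ℝ) - l|)
    (by linarith [abs_nonneg ((j : ℝ) - l)]) hl
  have h3 := Jc_mul_abs_le_jb k j
  have h4 : Jc k * |(j : ℝ) - l| ≤ 1 * jb (j - l) :=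
    mul_le_mul (Jc_le_one k) (abs_sub_le_jb j l) (abs_nonneg _) zero_le_one
  have h5 := jb_le_mul_left (k - j) (j - l)
  have h6 := jb_le_mul_right (k - j) (j - l)
  have hc := c.size_nonneg
  rw [abs_mul, abs_of_nonneg (mul_nonneg (Jc_nonneg k) (Jc_nonneg j))]
  calc Jc k * Jc j * |pe c j l| ≤ Jc k * Jc j * (c.size * (|(j : ℝ)| *
        (|(j : ℝ)| + |(j : ℝ) - l|))) :=
        mul_le_mul_of_nonneg_left h2 (mul_nonneg (Jc_nonneg k) (Jc_nonneg j))
    _ = c.size * ((Jc j * |(j : ℝ)|) * (Jc k * |(j : ℝ)| + Jc k * |(j : ℝ) - l|)) := by ring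
    _ ≤ c.size * (1 * (jb (k - j) + 1 * jb (j - l))) := by
        have := Jc_nonneg k
        have := jb_pos (k - j)
        have := jb_pos (j - l)
        gcongr
        exact Jc_mul_abs_le j
    _ ≤ _ := mul_le_mul_of_nonneg_left (by linarith) hc

/-- The symbol of the second correction term. -/
def th₂ (k l : ℤ) : ℝ := |(k : ℝ) - l| * (Jc k * Jc l)

lemma th₂_comm (k l : ℤ) : th₂ k l = th₂ l k := by
  unfold th₂; rw [abs_sub_comm, mul_comm (Jc k)]

lemma th₂_nonneg (k l : ℤ) : 0 ≤ th₂ k l :=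
  mul_nonneg (abs_nonneg _) (mul_nonneg (Jc_nonneg k) (Jc_nonneg l))

/-- The factor `|k - l| ≤ |k| + |l|` uses up one of the two copies of `J`. So the second correction,
in spite of the derivative on `f`, has the same order as the first and obeys the same bounds. -/
lemma th₂_le (k l : ℤ) : th₂ k l ≤ Jc k + Jc l := by
  have h : |(k : ℝ) - l| ≤ |(k : ℝ)| + |(l : ℝ)| := abs_sub _ _
  calc th₂ k l ≤ (|(k : ℝ)| + |(l : ℝ)|) * (Jc k * Jc l) :=
        mul_le_mul_of_nonneg_right h (mul_nonneg (Jc_nonneg k) (Jc_nonneg l))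
    _ = (Jc k * |(k : ℝ)|) * Jc l + (Jc l * |(l : ℝ)|) * Jc k := by ring
    _ ≤ 1 * Jc l + 1 * Jc k := add_le_add
        (mul_le_mul_of_nonneg_right (Jc_mul_abs_le k) (Jc_nonneg l))
        (mul_le_mul_of_nonneg_right (Jc_mul_abs_le l) (Jc_nonneg k))
    _ = _ := by ring

lemma abs_th₂_le (k l : ℤ) : |th₂ k l| ≤ 2 := by
  rw [abs_of_nonneg (th₂_nonneg k l)]
  linarith [th₂_le k l, Jc_le_one k, Jc_le_one l]
end BO4
end

noncomputable section
namespace BO4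
open scoped ENNReal ComplexConjugate

/-! ### Weighted summable sequences -/

lemma summable_of_tsum_enorm {ι E : Type*} [NormedAddCommGroup E] [CompleteSpace E] {f : ι → E}
    (h : ∑' i, ‖f i‖ₑ ≠ ⊤) : Summable f := by
  have : Summable fun i => ‖f i‖₊ := ENNReal.tsum_coe_ne_top_iff_summable.1 h
  exact this.of_nnnorm

lemma tsum_enorm_ne_top {ι E : Type*} [NormedAddCommGroup E] {f : ι → E}
    (h : Summable fun i => ‖f i‖) : ∑' i, ‖f i‖ₑ ≠ ⊤ := by
  exact ENNReal.tsum_coe_ne_top_iff_summable.2 (NNReal.summable_coe.1 h)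

lemma enorm_tsum_le {ι E : Type*} [NormedAddCommGroup E] [CompleteSpace E] (f : ι → E) :
    ‖∑' i, f i‖ₑ ≤ ∑' i, ‖f i‖ₑ := by
  by_cases h : ∑' i, ‖f i‖ₑ = ⊤
  · rw [h]; exact le_top
  · have hs : Summable fun i => ‖f i‖₊ := ENNReal.tsum_coe_ne_top_iff_summable.1 h
    have := nnnorm_tsum_le hs
    simp only [enorm_eq_nnnorm]
    rw [← ENNReal.coe_tsum hs]
    exact_mod_cast this

/-- The weight `1 + |k|` with values in `[0,∞]`. -/
def jw (k : ℤ) : ℝ≥0∞ := ENNReal.ofReal (jb k)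

lemma one_le_jw (k : ℤ) : 1 ≤ jw k := by
  rw [jw, ← ENNReal.ofReal_one]; exact ENNReal.ofReal_le_ofReal (one_le_jb k)
lemma jw_ne_top (k : ℤ) : jw k ≠ ⊤ := ENNReal.ofReal_ne_top
lemma jw_ne_zero (k : ℤ) : jw k ≠ 0 := (zero_lt_one.trans_le (one_le_jw k)).ne'
lemma jw_neg (k : ℤ) : jw (-k) = jw k := by rw [jw, jw, jb_neg]
lemma jw_add_le (k l : ℤ) : jw (k + l) ≤ jw k * jw l := by
  rw [jw, jw, jw, ← ENNReal.ofReal_mul (jb_pos k).le]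
  exact ENNReal.ofReal_le_ofReal (jb_add_le k l)
lemma jw_le_sub_mul (k j : ℤ) : jw k ≤ jw (k - j) * jw j := by
  have := jw_add_le (k - j) j; rwa [sub_add_cancel] at this
lemma jw_sub_le (k j : ℤ) : jw (k - j) ≤ jw k * jw j := by
  have := jw_add_le k (-j); rwa [jw_neg, ← sub_eq_add_neg] at this
-- The same submultiplicativity for the weight of order `-1`, in which time derivatives of solutions
-- live.
lemma inv_jw_le (k j : ℤ) : (jw k)⁻¹ ≤ (jw (k - j))⁻¹ * jw j := by
  rw [ENNReal.inv_le_iff_inv_le, ENNReal.mul_inv (Or.inr (jw_ne_top _)) (Or.inr (jw_ne_zero _)),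
    inv_inv, ← div_eq_mul_inv]
  exact ENNReal.div_le_of_le_mul (jw_sub_le k j)
lemma one_le_jw_pow (k : ℤ) (n : ℕ) : 1 ≤ jw k ^ n := one_le_pow₀ (one_le_jw k)
lemma jw_pow_mono (k : ℤ) {m n : ℕ} (h : m ≤ n) : jw k ^ m ≤ jw k ^ n :=
  pow_le_pow_right₀ (one_le_jw k) h
lemma ofReal_jb_pow (k : ℤ) (n : ℕ) : ENNReal.ofReal (jb k ^ n) = jw k ^ n :=
  ENNReal.ofReal_pow (jb_pos k).le n

/-- The weighted absolute values of a sequence. -/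
def wt (n : ℕ) (a : ℤ → ℂ) (k : ℤ) : ℝ≥0∞ := jw k ^ n * ‖a k‖ₑ

/-- The norm in the weighted Wiener algebra. -/
def nr (n : ℕ) (a : ℤ → ℂ) : ℝ≥0∞ := ∑' k, wt n a k

lemma wt_mono {m n : ℕ} (h : m ≤ n) (a : ℤ → ℂ) (k : ℤ) : wt m a k ≤ wt n a k :=
  mul_le_mul_left (jw_pow_mono k h) _

lemma nr_mono {m n : ℕ} (h : m ≤ n) (a : ℤ → ℂ) : nr m a ≤ nr n a :=
  ENNReal.tsum_le_tsum fun k => wt_mono h a k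

lemma nr_ne_top_mono {m n : ℕ} (h : m ≤ n) {a : ℤ → ℂ} (ha : nr n a ≠ ⊤) : nr m a ≠ ⊤ :=
  ne_top_of_le_ne_top ha (nr_mono h a)

lemma nr_zero_eq (a : ℤ → ℂ) : nr 0 a = ∑' k, ‖a k‖ₑ := by simp [nr, wt]

lemma tsum_sub_right (A : ℤ → ℝ≥0∞) (j : ℤ) : ∑' k, A (k - j) = ∑' k, A k :=
  (Equiv.subRight j).tsum_eq A

lemma tsum_sub_left (A : ℤ → ℝ≥0∞) (k : ℤ) : ∑' j, A (k - j) = ∑' j, A j :=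
  (Equiv.subLeft k).tsum_eq A

/-- Convolution of nonnegative sequences. -/
def econv (A B : ℤ → ℝ≥0∞) (k : ℤ) : ℝ≥0∞ := ∑' j, A (k - j) * B j

lemma tsum_econv (A B : ℤ → ℝ≥0∞) : ∑' k, econv A B k = (∑' k, A k) * ∑' k, B k := by
  unfold econv
  rw [ENNReal.tsum_comm]
  simp_rw [ENNReal.tsum_mul_right, tsum_sub_right, ENNReal.tsum_mul_left]

lemma econv_comm (A B : ℤ → ℝ≥0∞) : econv A B = econv B A := by
  funext k
  unfold econv
  rw [← (Equiv.subLeft k).tsum_eq fun j => A (k - j) * B j]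
  simp [mul_comm]

lemma econv_assoc (A B C : ℤ → ℝ≥0∞) : econv (econv A B) C = econv A (econv B C) := by
  funext k
  unfold econv
  simp_rw [← ENNReal.tsum_mul_left, ← ENNReal.tsum_mul_right]
  rw [ENNReal.tsum_comm (f := fun j i => A (k - j) * (B (j - i) * C i))]
  refine tsum_congr fun l => ?_
  rw [← (Equiv.addRight l).tsum_eq fun m => A (k - m) * (B (m - l) * C l)]
  refine tsum_congr fun j => ?_
  simp only [Equiv.coe_addRight, add_sub_cancel_right]
  rw [show k - l - j = k - (j + l) by ring, mul_assoc]

lemma econv_mono {A A' B B' : ℤ → ℝ≥0∞} (hA : ∀ k, A k ≤ A' k) (hB : ∀ k, B k ≤ B' k) (k : ℤ) :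
    econv A B k ≤ econv A' B' k :=
  ENNReal.tsum_le_tsum fun _ => mul_le_mul' (hA _) (hB _)

lemma jw_pow_mul_econv_le (n : ℕ) (A B : ℤ → ℝ≥0∞) (k : ℤ) :
    jw k ^ n * econv A B k ≤ econv (fun k => jw k ^ n * A k) (fun k => jw k ^ n * B k) k := by
  unfold econv
  rw [← ENNReal.tsum_mul_left]
  refine ENNReal.tsum_le_tsum fun j => ?_
  calc jw k ^ n * (A (k - j) * B j) ≤ (jw (k - j) * jw j) ^ n * (A (k - j) * B j) :=
        mul_le_mul_left (pow_le_pow_left₀ (zero_le) (jw_le_sub_mul k j) n) _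
    _ = _ := by ring

/-- Convolution of sequences. -/
def conv (a b : ℤ → ℂ) (k : ℤ) : ℂ := ∑' j, a (k - j) * b j

lemma enorm_conv_le (a b : ℤ → ℂ) (k : ℤ) : ‖conv a b k‖ₑ ≤ econv (wt 0 a) (wt 0 b) k := by
  refine (enorm_tsum_le _).trans (le_of_eq ?_)
  simp [econv, wt, enorm_mul]

lemma wt_conv_le (n : ℕ) (a b : ℤ → ℂ) (k : ℤ) :
    wt n (conv a b) k ≤ econv (wt n a) (wt n b) k := by
  refine (mul_le_mul_right (enorm_conv_le a b k) _).trans ?_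
  refine (jw_pow_mul_econv_le n _ _ k).trans (le_of_eq ?_)
  simp [wt]; rfl

lemma nr_conv_le (n : ℕ) (a b : ℤ → ℂ) : nr n (conv a b) ≤ nr n a * nr n b :=
  (ENNReal.tsum_le_tsum fun k => wt_conv_le n a b k).trans (tsum_econv _ _).le

lemma nr_conv_ne_top {n : ℕ} {a b : ℤ → ℂ} (ha : nr n a ≠ ⊤) (hb : nr n b ≠ ⊤) :
    nr n (conv a b) ≠ ⊤ := ne_top_of_le_ne_top (ENNReal.mul_ne_top ha hb) (nr_conv_le n a b)

lemma nr_add_le (n : ℕ) (a b : ℤ → ℂ) : nr n (a + b) ≤ nr n a + nr n b := by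
  unfold nr
  rw [← ENNReal.tsum_add]
  refine ENNReal.tsum_le_tsum fun k => ?_
  rw [wt, wt, wt, ← mul_add]
  exact mul_le_mul_right (enorm_add_le _ _) _

lemma nr_neg (n : ℕ) (a : ℤ → ℂ) : nr n (-a) = nr n a := by simp [nr, wt]

lemma nr_sub_le (n : ℕ) (a b : ℤ → ℂ) : nr n (a - b) ≤ nr n a + nr n b := by
  rw [sub_eq_add_neg, ← nr_neg n b]; exact nr_add_le n a (-b)

lemma nr_smul (n : ℕ) (r : ℂ) (a : ℤ → ℂ) : nr n (r • a) = ‖r‖ₑ * nr n a := by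
  unfold nr
  rw [← ENNReal.tsum_mul_left]
  refine tsum_congr fun k => ?_
  simp [wt, enorm_mul]; ring

lemma nr_zero_fun (n : ℕ) : nr n 0 = 0 := by simp [nr, wt]

/-- A multiplier of order `s` maps the weighted algebra of order `n + s` to that of order `n`. -/
lemma nr_mul_le {n s : ℕ} {C : ℝ≥0∞} {m : ℤ → ℂ} (hm : ∀ k, ‖m k‖ₑ ≤ C * jw k ^ s) (a : ℤ → ℂ) :
    nr n (fun k => m k * a k) ≤ C * nr (n + s) a := by
  unfold nr
  rw [← ENNReal.tsum_mul_left]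
  refine ENNReal.tsum_le_tsum fun k => ?_
  simp only [wt, enorm_mul]
  calc jw k ^ n * (‖m k‖ₑ * ‖a k‖ₑ) ≤ jw k ^ n * (C * jw k ^ s * ‖a k‖ₑ) := by gcongr; exact hm k
    _ = _ := by rw [pow_add]; ring

lemma summable_conv {a b : ℤ → ℂ} (ha : nr 0 a ≠ ⊤) (hb : nr 0 b ≠ ⊤) (k : ℤ) :
    Summable fun j => a (k - j) * b j := by
  apply summable_of_tsum_enorm
  have h : ∑' j, ‖a (k - j) * b j‖ₑ = econv (wt 0 a) (wt 0 b) k := by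
    simp [econv, wt, enorm_mul]
  rw [h]
  have h2 := ENNReal.le_tsum (f := econv (wt 0 a) (wt 0 b)) k
  rw [tsum_econv] at h2
  exact ne_top_of_le_ne_top (ENNReal.mul_ne_top ha hb) h2

lemma conv_comm (a b : ℤ → ℂ) : conv a b = conv b a := by
  funext k
  unfold conv
  rw [← (Equiv.subLeft k).tsum_eq fun j => a (k - j) * b j]
  simp [mul_comm]

lemma conv_add_right {a b b' : ℤ → ℂ} (ha : nr 0 a ≠ ⊤) (hb : nr 0 b ≠ ⊤) (hb' : nr 0 b' ≠ ⊤) :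
    conv a (b + b') = conv a b + conv a b' := by
  funext k
  simp only [conv, Pi.add_apply, mul_add]
  exact (summable_conv ha hb k).tsum_add (summable_conv ha hb' k)

lemma conv_assoc {a b c : ℤ → ℂ} (ha : nr 0 a ≠ ⊤) (hb : nr 0 b ≠ ⊤) (hc : nr 0 c ≠ ⊤) :
    conv (conv a b) c = conv a (conv b c) := by
  funext k
  unfold conv
  simp_rw [← tsum_mul_left, ← tsum_mul_right]
  rw [← Summable.tsum_comm (f := fun j i => a (k - j) * (b (j - i) * c i))]
  · refine tsum_congr fun l => ?_
    rw [← (Equiv.addRight l).tsum_eq fun m => a (k - m) * (b (m - l) * c l)]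
    refine tsum_congr fun j => ?_
    simp only [Equiv.coe_addRight, add_sub_cancel_right]
    rw [show k - l - j = k - (j + l) by ring, mul_assoc]
  · apply summable_of_tsum_enorm
    rw [ENNReal.tsum_prod']
    have h : ∀ j, ∑' i, ‖Function.uncurry (fun j i => a (k - j) * (b (j - i) * c i)) (j, i)‖ₑ
        = wt 0 a (k - j) * econv (wt 0 b) (wt 0 c) j := by
      intro j
      simp only [Function.uncurry_apply_pair, enorm_mul, ENNReal.tsum_mul_left, econv, wt,
        pow_zero, one_mul]
    simp_rw [h]
    change econv (wt 0 a) (econv (wt 0 b) (wt 0 c)) k ≠ ⊤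
    have h2 := ENNReal.le_tsum (f := econv (wt 0 a) (econv (wt 0 b) (wt 0 c))) k
    rw [tsum_econv, tsum_econv] at h2
    exact ne_top_of_le_ne_top (ENNReal.mul_ne_top ha (ENNReal.mul_ne_top hb hc)) h2

lemma conv_single_left (a : ℤ → ℂ) : conv (Pi.single 0 1) a = a := by
  funext k
  unfold conv
  rw [tsum_eq_single k]
  · simp
  · intro j hj
    rw [Pi.single_eq_of_ne (sub_ne_zero.2 hj.symm), zero_mul]

/-- The Wiener algebra of summable sequences, with convolution. -/
structure WA where
  /-- The underlying sequence. -/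
  val : ℤ → ℂ
  fin : nr 0 val ≠ ⊤

namespace WA

@[ext] lemma ext' {a b : WA} (h : a.val = b.val) : a = b := by
  cases a; cases b; simp_all

instance : Zero WA := ⟨⟨0, by simp [nr_zero_fun]⟩⟩
instance : One WA := ⟨⟨Pi.single 0 1, by
  rw [nr_zero_eq, tsum_eq_single 0]
  · simp
  · intro k hk; simp [Pi.single_eq_of_ne hk]⟩⟩
instance : Add WA := ⟨fun a b => ⟨a.val + b.val,
  ne_top_of_le_ne_top (ENNReal.add_ne_top.2 ⟨a.fin, b.fin⟩) (nr_add_le 0 _ _)⟩⟩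
instance : Neg WA := ⟨fun a => ⟨-a.val, by rw [nr_neg]; exact a.fin⟩⟩
instance : Mul WA := ⟨fun a b => ⟨conv a.val b.val, nr_conv_ne_top a.fin b.fin⟩⟩

/-- The ring structure turns every algebraic identity between iterated convolutions of summable
sequences into an application of `ring`. -/
instance : CommRing WA where
  add_assoc a b c := ext' (add_assoc a.val b.val c.val)
  zero_add a := ext' (zero_add a.val)
  add_zero a := ext' (add_zero a.val)
  add_comm a b := ext' (add_comm a.val b.val)
  neg_add_cancel a := ext' (neg_add_cancel a.val)
  nsmul := nsmulRec
  zsmul := zsmulRec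
  mul_assoc a b c := ext' (conv_assoc a.fin b.fin c.fin)
  mul_comm a b := ext' (conv_comm a.val b.val)
  one_mul a := ext' (conv_single_left a.val)
  mul_one a := ext' ((conv_comm _ _).trans (conv_single_left a.val))
  left_distrib a b c := ext' (conv_add_right a.fin b.fin c.fin)
  right_distrib a b c := ext' (by
    change conv (a.val + b.val) c.val = conv a.val c.val + conv b.val c.val
    rw [conv_comm, conv_add_right c.fin a.fin b.fin, conv_comm c.val, conv_comm c.val])
  zero_mul a := ext' (by funext k; change conv 0 a.val k = 0; simp [conv])
  mul_zero a := ext' (by funext k; change conv a.val 0 k = 0; simp [conv])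

lemma val_add (a b : WA) : (a + b).val = a.val + b.val := rfl
lemma val_mul (a b : WA) : (a * b).val = conv a.val b.val := rfl
lemma val_neg (a : WA) : (-a).val = -a.val := rfl
lemma val_sub (a b : WA) : (a - b).val = a.val - b.val := by
  rw [sub_eq_add_neg, val_add, val_neg, sub_eq_add_neg]

end WA
end BO4
end

noncomputable section
namespace BO4
open scoped ENNReal ComplexConjugate

/-! ### Functions and their Fourier coefficients -/

lemma memLp_ofReal {f : Torus → ℝ} (hf : MemLp f 2 volume) :
    MemLp (fun x => (f x : ℂ)) 2 (AddCircle.haarAddCircle : Measure Torus) :=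
  MeasureTheory.memLp_haarAddCircle_iff.2 hf.ofReal

lemma integrable_ofReal {f : Torus → ℝ} (hf : MemLp f 2 volume) :
    Integrable (fun x => (f x : ℂ)) (AddCircle.haarAddCircle : Measure Torus) :=
  (memLp_ofReal hf).integrable (by norm_num)

lemma coeff_neg (f : Torus → ℝ) (k : ℤ) : coeff f (-k) = conj (coeff f k) := by
  unfold coeff fourierCoeff
  rw [← integral_conj]
  congr 1
  funext x
  simp

lemma coeff_add {f g : Torus → ℝ} (hf : MemLp f 2 volume) (hg : MemLp g 2 volume) :
    coeff (f + g) = coeff f + coeff g := by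
  have := fourierCoeff.add (integrable_ofReal hf) (integrable_ofReal hg)
  funext k
  rw [Pi.add_apply, coeff, coeff, coeff, ← Pi.add_apply, ← this]
  congr 1
  funext x
  simp

lemma coeff_smul (r : ℝ) (f : Torus → ℝ) : coeff (r • f) = (r : ℂ) • coeff f := by
  funext k
  rw [Pi.smul_apply, coeff, coeff, smul_eq_mul, ← fourierCoeff.const_mul]
  congr 1
  funext x
  simp

lemma coeff_neg_fun (f : Torus → ℝ) : coeff (-f) = -coeff f := by
  have := coeff_smul (-1) f
  simpa using this

lemma coeff_sub {f g : Torus → ℝ} (hf : MemLp f 2 volume) (hg : MemLp g 2 volume) :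
    coeff (f - g) = coeff f - coeff g := by
  rw [sub_eq_add_neg, coeff_add hf hg.neg, coeff_neg_fun, sub_eq_add_neg]

lemma ae_haar_iff {p : Torus → Prop} :
    (∀ᵐ x ∂(AddCircle.haarAddCircle : Measure Torus), p x) ↔ ∀ᵐ x, p x := by
  rw [AddCircle.volume_eq_smul_haarAddCircle, Measure.ae_ennreal_smul_measure_iff]
  simp [Real.pi_pos]

lemma integral_eq_haar (f : Torus → ℝ) :
    ∫ x, f x = 2 * Real.pi * ∫ x, f x ∂(AddCircle.haarAddCircle : Measure Torus) := by
  rw [AddCircle.integral_haarAddCircle, smul_eq_mul, mul_inv_cancel_left₀ Real.two_pi_pos.ne']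

lemma integral_eq_coeff (f : Torus → ℝ) : ((∫ x, f x : ℝ) : ℂ) = 2 * Real.pi * coeff f 0 := by
  rw [integral_eq_haar, coeff, fourierCoeff, Complex.ofReal_mul, Complex.ofReal_mul]
  congr 1
  refine integral_ofReal.symm.trans ?_
  simp

lemma hasSum_sq_coeff {f : Torus → ℝ} (hf : MemLp f 2 volume) :
    HasSum (fun k => ‖coeff f k‖ ^ 2) ((2 * Real.pi)⁻¹ * l2norm f ^ 2) := by
  have h := hasSum_sq_fourierCoeff (memLp_ofReal hf).toLp
  have e : ∀ k, fourierCoeff ((memLp_ofReal hf).toLp : Torus → ℂ) k = coeff f k := fun k => by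
    rw [fourierCoeff_congr_ae (MemLp.coeFn_toLp (memLp_ofReal hf)), coeff]
  simp_rw [e] at h
  convert h using 1
  have h1 : ∫ t, ‖((memLp_ofReal hf).toLp : Torus → ℂ) t‖ ^ 2 ∂AddCircle.haarAddCircle
      = ∫ t, f t ^ 2 ∂AddCircle.haarAddCircle := by
    refine integral_congr_ae ?_
    filter_upwards [MemLp.coeFn_toLp (memLp_ofReal hf)] with x hx
    rw [hx]; simp
  rw [h1, l2norm, Real.sq_sqrt (integral_nonneg fun x => sq_nonneg _), integral_eq_haar,
    inv_mul_cancel_left₀ Real.two_pi_pos.ne']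

lemma l2norm_sq {f : Torus → ℝ} (hf : MemLp f 2 volume) :
    l2norm f ^ 2 = 2 * Real.pi * ∑' k, ‖coeff f k‖ ^ 2 := by
  rw [(hasSum_sq_coeff hf).tsum_eq, mul_inv_cancel_left₀ Real.two_pi_pos.ne']

lemma memℓp_two_iff {a : ℤ → ℂ} : Memℓp a 2 ↔ Summable fun k => ‖a k‖ ^ 2 := by
  rw [memℓp_gen_iff (by norm_num)]
  simp

/-- A multiplier with real kernel acts on coefficients as expected. -/
lemma mult_spec {m : ℤ → ℂ} (hm : ∀ k, m (-k) = conj (m k)) {f : Torus → ℝ}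
    (h : Summable fun k => ‖m k * coeff f k‖ ^ 2) :
    MemLp (mult m f) 2 volume ∧ coeff (mult m f) = fun k => m k * coeff f k := by
  have h' : Memℓp (fun k : ℤ => m k * coeff f k) 2 := memℓp_two_iff.2 h
  set F : Lp ℂ 2 (AddCircle.haarAddCircle : Measure Torus) :=
    (fourierBasis (T := 2 * Real.pi)).repr.symm ⟨fun k => m k * coeff f k, h'⟩ with hF
  have e : mult m f = fun x => (F x).re := by
    unfold mult
    rw [dif_pos h']
  have hFc : ∀ k, fourierCoeff F k = m k * coeff f k := fun k => by
    rw [← fourierBasis_repr, hF, LinearIsometryEquiv.apply_symm_apply]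
  have hFm : MemLp F 2 (AddCircle.haarAddCircle : Measure Torus) := Lp.memLp F
  have hFi : Integrable F (AddCircle.haarAddCircle : Measure Torus) :=
    hFm.integrable (by norm_num)
  refine ⟨?_, ?_⟩
  · rw [e]
    exact (MeasureTheory.memLp_haarAddCircle_iff.1 hFm).re
  · funext k
    rw [e, coeff]
    have hc : Integrable (fun x => conj (F x)) (AddCircle.haarAddCircle : Measure Torus) :=
      Complex.conjCLE.toContinuousLinearMap.integrable_comp hFi
    -- The real part is the average of `F` and its conjugate; the symmetry of `m` and the reality of
    -- `f` make the coefficients of the two halves equal.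
    have e1 : (fun x => (((F x).re : ℝ) : ℂ)) = fun x => (2 : ℂ)⁻¹ * (F x + conj (F x)) := by
      funext x
      rw [Complex.add_conj]; push_cast; ring
    have e2 : fourierCoeff (fun x => conj (F x)) k = conj (fourierCoeff F (-k)) := by
      unfold fourierCoeff
      rw [← integral_conj]
      congr 1
      funext x
      simp
    have e3 := congrFun (fourierCoeff.add hFi hc) k
    rw [e1, fourierCoeff.const_mul]
    change (2 : ℂ)⁻¹ * fourierCoeff (⇑F + fun x => conj (F x)) k = _
    rw [e3, Pi.add_apply, e2, hFc, hFc, hm, coeff_neg]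
    simp only [map_mul, Complex.conj_conj]
    ring

/-- Real functions in the Wiener algebra. -/
def Wiener (f : Torus → ℝ) : Prop := MemLp f 2 volume ∧ nr 0 (coeff f) ≠ ⊤

lemma nr_zero_ne_top_iff {a : ℤ → ℂ} : nr 0 a ≠ ⊤ ↔ Summable fun k => ‖a k‖ := by
  rw [nr_zero_eq]
  refine ⟨fun h => ?_, tsum_enorm_ne_top⟩
  exact NNReal.summable_coe.2 (ENNReal.tsum_coe_ne_top_iff_summable.1 h)

/-- The continuous function with given summable Fourier coefficients. -/
def synth (a : ℤ → ℂ) : C(Torus, ℂ) := ∑' k, a k • fourier k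

lemma hasSum_synth {a : ℤ → ℂ} (ha : nr 0 a ≠ ⊤) :
    HasSum (fun k => a k • (fourier k : C(Torus, ℂ))) (synth a) := by
  refine (Summable.of_norm ?_).hasSum
  simp_rw [norm_smul, fourier_norm, mul_one]
  exact nr_zero_ne_top_iff.1 ha

/-- The Fourier series converges both in `L²` and uniformly, and the two limits agree in `L²`. -/
lemma Wiener.ae_eq_synth {f : Torus → ℝ} (hf : Wiener f) :
    ∀ᵐ x ∂(AddCircle.haarAddCircle : Measure Torus), (f x : ℂ) = synth (coeff f) x := by
  have h1 := hasSum_fourier_series_L2 (memLp_ofReal hf.1).toLp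
  have e : ∀ k, fourierCoeff ((memLp_ofReal hf.1).toLp : Torus → ℂ) k = coeff f k := fun k => by
    rw [fourierCoeff_congr_ae (MemLp.coeFn_toLp (memLp_ofReal hf.1)), coeff]
  simp_rw [e] at h1
  have h2 := (hasSum_synth hf.2).mapL
    (ContinuousMap.toLp (E := ℂ) 2 (AddCircle.haarAddCircle : Measure Torus) ℂ)
  have h3 := h1.unique (by simpa only [map_smul] using h2)
  filter_upwards [MemLp.coeFn_toLp (memLp_ofReal hf.1),
    ContinuousMap.coeFn_toLp (p := 2) (𝕜 := ℂ) (AddCircle.haarAddCircle : Measure Torus)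
      (synth (coeff f))] with x hx1 hx2
  rw [← hx1, h3, hx2]

/-- Only one factor needs summable coefficients: its series is inserted and integrated term by term,
the sum of the `L¹` norms being finite. The other factor may be merely square integrable, as `ℋ∂ₓf`
is for `f ∈ H¹`. -/
lemma coeff_mul {h g : Torus → ℝ} (hh : MemLp h 2 volume) (hg : Wiener g) :
    coeff (h * g) = conv (coeff h) (coeff g) := by
  funext k
  have hi := integrable_ofReal hh
  have e1 : coeff (h * g) k = ∫ x, ∑' j, coeff g j * (fourier (-(k - j)) x * (h x : ℂ))
      ∂(AddCircle.haarAddCircle : Measure Torus) := by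
    rw [coeff, fourierCoeff]
    refine integral_congr_ae ?_
    filter_upwards [hg.ae_eq_synth] with x hx
    have hs : HasSum (fun j => coeff g j * (fourier j x : ℂ)) (synth (coeff g) x) := by
      have := (hasSum_synth hg.2).map (ContinuousMap.evalCLM ℂ x) (ContinuousMap.evalCLM ℂ x).continuous
      simpa [Function.comp_def] using this
    have hs2 := hs.mul_left (fourier (-k) x * (h x : ℂ))
    rw [Pi.mul_apply, Complex.ofReal_mul, hx, smul_eq_mul, ← mul_assoc, ← hs2.tsum_eq]
    refine tsum_congr fun j => ?_
    rw [show -(k - j) = -k + j by ring, fourier_add]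
    ring
  have hint : ∀ j : ℤ, Integrable (fun x => coeff g j * (fourier (-(k - j)) x * (h x : ℂ)))
      (AddCircle.haarAddCircle : Measure Torus) := fun j =>
    (hi.fourier_smul (-(k - j))).const_mul _
  have hnorm : ∀ j : ℤ, ∫ x, ‖coeff g j * (fourier (-(k - j)) x * (h x : ℂ))‖
      ∂(AddCircle.haarAddCircle : Measure Torus)
      = ‖coeff g j‖ * ∫ x, ‖(h x : ℂ)‖ ∂(AddCircle.haarAddCircle : Measure Torus) := by
    intro j
    rw [← integral_const_mul]
    congr 1
    funext x
    have : ‖(fourier (-(k - j)) x : ℂ)‖ = 1 := by rw [fourier_apply]; exact Circle.norm_coe _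
    rw [norm_mul, norm_mul, this, one_mul]
  have hs := hasSum_integral_of_summable_integral_norm hint (by
    simp_rw [hnorm]
    exact (nr_zero_ne_top_iff.1 hg.2).mul_right _)
  rw [e1, ← hs.tsum_eq]
  unfold conv
  refine tsum_congr fun j => ?_
  rw [integral_const_mul, mul_comm]
  rfl

lemma memLp_mul {h g : Torus → ℝ} (hh : MemLp h 2 volume) (hg : Wiener g) :
    MemLp (h * g) 2 volume := by
  refine MemLp.of_le_mul (c := ‖synth (coeff g)‖) hh (hh.1.mul hg.1.1) ?_
  filter_upwards [ae_haar_iff.1 hg.ae_eq_synth] with x hx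
  have : ‖g x‖ ≤ ‖synth (coeff g)‖ := by
    rw [← Complex.norm_real, hx]; exact ContinuousMap.norm_coe_le_norm _ _
  rw [Pi.mul_apply, norm_mul, mul_comm]
  gcongr

lemma Wiener.mul {f g : Torus → ℝ} (hf : Wiener f) (hg : Wiener g) : Wiener (f * g) :=
  ⟨memLp_mul hf.1 hg, by rw [coeff_mul hf.1 hg]; exact nr_conv_ne_top hf.2 hg.2⟩

lemma Wiener.add {f g : Torus → ℝ} (hf : Wiener f) (hg : Wiener g) : Wiener (f + g) :=
  ⟨hf.1.add hg.1, by
    rw [coeff_add hf.1 hg.1]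
    exact ne_top_of_le_ne_top (ENNReal.add_ne_top.2 ⟨hf.2, hg.2⟩) (nr_add_le 0 _ _)⟩

lemma Wiener.smul {f : Torus → ℝ} (r : ℝ) (hf : Wiener f) : Wiener (r • f) :=
  ⟨hf.1.const_smul r, by
    rw [coeff_smul, nr_smul]; exact ENNReal.mul_ne_top enorm_ne_top hf.2⟩

lemma Wiener.sub {f g : Torus → ℝ} (hf : Wiener f) (hg : Wiener g) : Wiener (f - g) := by
  have := hf.add (hg.smul (-1))
  simpa [sub_eq_add_neg] using this

/-- Summability is stronger than square summability. -/
lemma summable_sq_of_nr {a : ℤ → ℂ} (ha : nr 0 a ≠ ⊤) : Summable fun k => ‖a k‖ ^ 2 := by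
  have h := nr_zero_ne_top_iff.1 ha
  refine Summable.of_norm_bounded_eventually h ?_
  have := h.tendsto_cofinite_zero.eventually (gt_mem_nhds zero_lt_one)
  filter_upwards [this] with k hk
  rw [Real.norm_of_nonneg (by positivity), sq]
  exact mul_le_of_le_one_left (norm_nonneg _) hk.le

lemma Wiener.mult {m : ℤ → ℂ} (hm : ∀ k, m (-k) = conj (m k)) {f : Torus → ℝ}
    (h : nr 0 (fun k => m k * coeff f k) ≠ ⊤) :
    Wiener (mult m f) ∧ coeff (mult m f) = fun k => m k * coeff f k := by
  have := mult_spec hm (summable_sq_of_nr h)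
  exact ⟨⟨this.1, by rw [this.2]; exact h⟩, this.2⟩
end BO4
end

noncomputable section
namespace BO4
open scoped ENNReal ComplexConjugate

/-! ### Trilinear forms -/

/-- A weighted `ℓ¹` norm. -/
def wn (ω : ℤ → ℝ≥0∞) (a : ℤ → ℂ) : ℝ≥0∞ := ∑' k, ω k * ‖a k‖ₑ

lemma nr_eq_wn (n : ℕ) (a : ℤ → ℂ) : nr n a = wn (fun k => jw k ^ n) a := rfl

/-- The trilinear form with symbol `θ`. -/
def tri (θ : ℤ → ℤ → ℝ) (a x v : ℤ → ℂ) : ℂ :=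
  ∑' p : ℤ × ℤ, a (p.1 - p.2) * (θ p.1 p.2 : ℂ) * x p.2 * conj (v p.1)

lemma tsum_triple_le (A B V : ℤ → ℝ≥0∞) :
    ∑' p : ℤ × ℤ, A (p.1 - p.2) * B p.2 * V p.1 ≤ (∑' k, A k) * (∑' k, B k) * ∑' k, V k := by
  rw [ENNReal.tsum_prod']
  calc ∑' k, ∑' l, A (k - l) * B l * V k ≤ ∑' k, ∑' l, (∑' i, A i) * B l * V k := by
        gcongr with k l; exact ENNReal.le_tsum _
    _ = _ := by simp_rw [ENNReal.tsum_mul_right, ENNReal.tsum_mul_left]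

lemma enorm_ofReal_eq (r : ℝ) : ‖(r : ℂ)‖ₑ = ‖r‖ₑ := by
  rw [← ofReal_norm, Complex.norm_real, ofReal_norm]

lemma enorm_real_le {r C : ℝ} (h : |r| ≤ C) : ‖(r : ℂ)‖ₑ ≤ ENNReal.ofReal C := by
  rw [enorm_ofReal_eq, ← ofReal_norm]; exact ENNReal.ofReal_le_ofReal h

lemma enorm_conj (z : ℂ) : ‖conj z‖ₑ = ‖z‖ₑ := by
  rw [← ofReal_norm, ← ofReal_norm, RCLike.norm_conj]

lemma tsum_enorm_tri_le {θ : ℤ → ℤ → ℝ} {C : ℝ≥0∞} {ω₁ ω₂ ω₃ : ℤ → ℝ≥0∞}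
    (h : ∀ k l, ‖(θ k l : ℂ)‖ₑ ≤ C * (ω₁ (k - l) * ω₂ l * ω₃ k)) (a x v : ℤ → ℂ) :
    ∑' p : ℤ × ℤ, ‖a (p.1 - p.2) * (θ p.1 p.2 : ℂ) * x p.2 * conj (v p.1)‖ₑ ≤
      C * (wn ω₁ a * wn ω₂ x * wn ω₃ v) := by
  refine le_trans ?_ (mul_le_mul_right (tsum_triple_le (fun k => ω₁ k * ‖a k‖ₑ)
    (fun k => ω₂ k * ‖x k‖ₑ) (fun k => ω₃ k * ‖v k‖ₑ)) C)
  rw [← ENNReal.tsum_mul_left]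
  refine ENNReal.tsum_le_tsum fun p => ?_
  simp only [enorm_mul, enorm_conj]
  calc ‖a (p.1 - p.2)‖ₑ * ‖(θ p.1 p.2 : ℂ)‖ₑ * ‖x p.2‖ₑ * ‖v p.1‖ₑ
      ≤ ‖a (p.1 - p.2)‖ₑ * (C * (ω₁ (p.1 - p.2) * ω₂ p.2 * ω₃ p.1)) * ‖x p.2‖ₑ * ‖v p.1‖ₑ := by
        gcongr; exact h _ _
    _ = _ := by ring

lemma enorm_tri_le {θ : ℤ → ℤ → ℝ} {C : ℝ≥0∞} {ω₁ ω₂ ω₃ : ℤ → ℝ≥0∞}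
    (h : ∀ k l, ‖(θ k l : ℂ)‖ₑ ≤ C * (ω₁ (k - l) * ω₂ l * ω₃ k)) (a x v : ℤ → ℂ) :
    ‖tri θ a x v‖ₑ ≤ C * (wn ω₁ a * wn ω₂ x * wn ω₃ v) :=
  (enorm_tsum_le _).trans (tsum_enorm_tri_le h a x v)

lemma summable_tri {θ : ℤ → ℤ → ℝ} {C : ℝ≥0∞} {ω₁ ω₂ ω₃ : ℤ → ℝ≥0∞}
    (h : ∀ k l, ‖(θ k l : ℂ)‖ₑ ≤ C * (ω₁ (k - l) * ω₂ l * ω₃ k)) {a x v : ℤ → ℂ} (hC : C ≠ ⊤)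
    (ha : wn ω₁ a ≠ ⊤) (hx : wn ω₂ x ≠ ⊤) (hv : wn ω₃ v ≠ ⊤) :
    Summable fun p : ℤ × ℤ => a (p.1 - p.2) * (θ p.1 p.2 : ℂ) * x p.2 * conj (v p.1) :=
  summable_of_tsum_enorm (ne_top_of_le_ne_top
    (ENNReal.mul_ne_top hC (ENNReal.mul_ne_top (ENNReal.mul_ne_top ha hx) hv))
    (tsum_enorm_tri_le h a x v))

/-- Sequences of Fourier coefficients of real functions. -/
def RealSeq (a : ℤ → ℂ) : Prop := ∀ k, a (-k) = conj (a k)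

lemma realSeq_coeff (f : Torus → ℝ) : RealSeq (coeff f) := coeff_neg f

lemma conj_tri {θ : ℤ → ℤ → ℝ} {a : ℤ → ℂ} (ha : RealSeq a) (x v : ℤ → ℂ) :
    conj (tri θ a x v) = tri (fun k l => θ l k) a v x := by
  unfold tri
  rw [Complex.conj_tsum, ← (Equiv.prodComm ℤ ℤ).tsum_eq]
  refine tsum_congr fun p => ?_
  simp only [Equiv.prodComm_apply, Prod.fst_swap, Prod.snd_swap, map_mul, Complex.conj_conj,
    Complex.conj_ofReal]
  rw [← ha, neg_sub]; ring

lemma norm_coeff_le (h : Torus → ℝ) (k : ℤ) :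
    ‖coeff h k‖ ≤ ∫ x, ‖(h x : ℂ)‖ ∂(AddCircle.haarAddCircle : Measure Torus) := by
  rw [coeff, fourierCoeff]
  refine (norm_integral_le_integral_norm _).trans (le_of_eq ?_)
  congr 1
  funext x
  have : ‖(fourier (-k) x : ℂ)‖ = 1 := by rw [fourier_apply]; exact Circle.norm_coe _
  rw [norm_smul, this, one_mul]

lemma integral_mul_mul {h y z : Torus → ℝ} (hh : MemLp h 2 volume) (hy : Wiener y)
    (hz : Wiener z) : ((∫ x, h x * y x * z x : ℝ) : ℂ)
      = 2 * Real.pi * tri (fun _ _ => 1) (coeff h) (coeff y) (coeff z) := by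
  have e := integral_eq_coeff (h * y * z)
  simp only [Pi.mul_apply] at e
  rw [e, coeff_mul (memLp_mul hh hy) hz, coeff_mul hh hy]
  congr 1
  have hs : Summable fun p : ℤ × ℤ => coeff h (p.1 - p.2) * ((1 : ℝ) : ℂ) * coeff y p.2
      * conj (coeff z p.1) := by
    have h1 := (nr_zero_ne_top_iff.1 hz.2).mul_of_nonneg (nr_zero_ne_top_iff.1 hy.2)
      (fun _ => norm_nonneg _) (fun _ => norm_nonneg _)
    refine Summable.of_norm_bounded (h1.mul_left
      (∫ x, ‖(h x : ℂ)‖ ∂(AddCircle.haarAddCircle : Measure Torus))) fun p => ?_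
    simp only [Complex.ofReal_one, mul_one, norm_mul, RCLike.norm_conj]
    rw [mul_comm ‖coeff z p.1‖, ← mul_assoc]
    gcongr
    exact norm_coeff_le h _
  unfold tri conv
  -- The zeroth coefficient of the product pairs frequency `k` with `-k`; reality of `z` turns the
  -- latter into a conjugate.
  rw [hs.tsum_prod, ← (Equiv.neg ℤ).tsum_eq]
  refine tsum_congr fun k => ?_
  rw [← tsum_mul_right]
  refine tsum_congr fun l => ?_
  simp [coeff_neg]

/-! ### The energy on the Fourier side -/

lemma nr_finite_of_bounded_mul {m : ℤ → ℂ} (hm : ∀ k, ‖m k‖ₑ ≤ 1) {a : ℤ → ℂ} {n : ℕ}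
    (ha : nr n a ≠ ⊤) : nr n (fun k => m k * a k) ≠ ⊤ := by
  have := nr_mul_le (n := n) (s := 0) (C := 1) (m := m) (by simpa using hm) a
  rw [one_mul, add_zero] at this
  exact ne_top_of_le_ne_top ha this

lemma enorm_hilb_symbol_le (k : ℤ) : ‖-Complex.I * (Int.sign k : ℂ)‖ₑ ≤ 1 := by
  have := abs_sg_le k
  rw [← ofReal_norm, ← ENNReal.ofReal_one]
  apply ENNReal.ofReal_le_ofReal
  rw [norm_mul, norm_neg, Complex.norm_I, one_mul]
  rw [sg, ← Real.norm_eq_abs] at this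
  rwa [Complex.norm_intCast, ← Real.norm_eq_abs]

lemma hilb_symbol_neg (k : ℤ) : -Complex.I * (Int.sign (-k) : ℂ)
    = conj (-Complex.I * (Int.sign k : ℂ)) := by simp

lemma Wiener.hilb {f : Torus → ℝ} (hf : Wiener f) :
    Wiener (hilb f) ∧ coeff (hilb f) = fun k => -Complex.I * (Int.sign k : ℂ) * coeff f k :=
  Wiener.mult hilb_symbol_neg (nr_finite_of_bounded_mul enorm_hilb_symbol_le hf.2)

lemma psi_div_eq {ψ : ℝ → ℝ} (hψ : IsLowCut ψ) (k : ℤ) : ψ k / |(k : ℝ)| = Jc k := by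
  unfold Jc
  split_ifs with h
  · rw [hψ.eq_one k (by exact_mod_cast h), one_div]
  · have : |k| ≤ 1 := by omega
    rw [hψ.eq_zero k (by exact_mod_cast this), zero_div]

lemma enorm_Jc_le (k : ℤ) : ‖((Jc k : ℝ) : ℂ)‖ₑ ≤ 1 := by
  rw [← ENNReal.ofReal_one]
  exact enorm_real_le (by rw [abs_of_nonneg (Jc_nonneg k)]; exact Jc_le_one k)

lemma Wiener.opJ {ψ : ℝ → ℝ} (hψ : IsLowCut ψ) {f : Torus → ℝ} (hf : Wiener f) :
    Wiener (opJ ψ f) ∧ coeff (opJ ψ f) = fun k => ((Jc k : ℝ) : ℂ) * coeff f k := by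
  unfold BO4.opJ
  simp_rw [psi_div_eq hψ]
  exact Wiener.mult (fun k => by rw [Jc_neg, Complex.conj_ofReal])
    (nr_finite_of_bounded_mul enorm_Jc_le hf.2)

/-- The square of the `L²` norm of a sequence. -/
def sqn (a : ℤ → ℂ) : ℝ := ∑' k, ‖a k‖ ^ 2

/-- The weight in the energy. -/
def wgt (κ : ℝ) (a : ℤ → ℂ) : ℝ := 1 + κ * (2 * Real.pi * sqn a) + κ * (2 * Real.pi * sqn a) ^ 2

/-- The square of the `H⁻¹` norm of a sequence. -/
def omn (a : ℤ → ℂ) : ℝ := ∑' k, om k * ‖a k‖ ^ 2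

/-- The correction terms on the Fourier side. -/
def corrSeq (c : Coeffs) (a w : ℤ → ℂ) : ℝ :=
  (lam₁ c 0 / 4 * tri th₁ a w w + lam₂ c 0 / 4 * tri th₂ a w w
    + mu₃ c * tri (fun k l => Jc k * Jc l) (conv a a) w w : ℂ).re

/-- The energy on the Fourier side. -/
def eSeq (c : Coeffs) (κ : ℝ) (a w : ℤ → ℂ) : ℝ :=
  1 / 2 * sqn w + 1 / 2 * omn w * wgt κ a + corrSeq c a w

lemma summable_sq {f : Torus → ℝ} (hf : MemLp f 2 volume) : Summable fun k => ‖coeff f k‖ ^ 2 :=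
  (hasSum_sq_coeff hf).summable

lemma hNegOneNorm_sq {f : Torus → ℝ} (hf : MemLp f 2 volume) :
    hNegOneNorm f ^ 2 = 2 * Real.pi * omn (coeff f) := by
  have hs : ∀ k : ℤ, ‖(((√(1 + (k : ℝ) ^ 2))⁻¹ : ℝ) : ℂ) * coeff f k‖ ^ 2
      = om k * ‖coeff f k‖ ^ 2 := fun k => by
    rw [norm_mul, mul_pow, Complex.norm_real, Real.norm_of_nonneg (by positivity), inv_pow,
      Real.sq_sqrt (by positivity), om]
  have := mult_spec (m := fun k : ℤ => (((√(1 + (k : ℝ) ^ 2))⁻¹ : ℝ) : ℂ)) (f := f)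
    (fun k => by simp) (by
      simp_rw [hs]
      refine Summable.of_nonneg_of_le (fun k => mul_nonneg (om_nonneg k) (sq_nonneg _))
        (fun k => mul_le_of_le_one_left (sq_nonneg _) (om_le_one k)) (summable_sq hf))
  unfold hNegOneNorm invJap
  rw [l2norm_sq this.1, this.2, omn]
  simp_rw [hs]

/-- Conjugating a form with real background exchanges the two arguments of its symbol, so the real
part sees only the symmetrization. `θ₁` is the symmetric version of the symbol that arises from the
integral. -/
lemma re_tri_th₁ {a x : ℤ → ℂ} (ha : RealSeq a) (hf : nr 0 a ≠ ⊤) (hx : nr 0 x ≠ ⊤) :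
    (tri th₁ a x x).re = (tri (fun k l => sg l * sg k * Jc k) a x x).re := by
  have hb : ∀ k l : ℤ, ‖((sg l * sg k * Jc k : ℝ) : ℂ)‖ₑ
      ≤ 1 * (jw (k - l) ^ 0 * jw l ^ 0 * jw k ^ 0) := fun k l => by
    simp only [pow_zero, mul_one]
    rw [← ENNReal.ofReal_one]
    refine enorm_real_le ?_
    rw [abs_mul, abs_mul, abs_of_nonneg (Jc_nonneg k)]
    exact mul_le_one₀ (mul_le_one₀ (abs_sg_le l) (abs_nonneg _) (abs_sg_le k)) (Jc_nonneg k)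
      (Jc_le_one k)
  have s1 := summable_tri hb (a := a) (x := x) (v := x) ENNReal.one_ne_top hf hx hx
  have s2 := summable_tri (θ := fun k l => sg k * sg l * Jc l) (C := 1)
    (ω₁ := fun k => jw k ^ 0) (ω₂ := fun k => jw k ^ 0) (ω₃ := fun k => jw k ^ 0)
    (fun k l => (hb l k).trans (by simp)) (a := a) (x := x) (v := x) ENNReal.one_ne_top hf hx hx
  have e : tri th₁ a x x = 2⁻¹ * (tri (fun k l => sg l * sg k * Jc k) a x x
      + tri (fun k l => sg k * sg l * Jc l) a x x) := by
    unfold tri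
    rw [← s1.tsum_add s2, ← tsum_mul_left]
    refine tsum_congr fun p => ?_
    unfold th₁; push_cast; ring
  have e2 := conj_tri (θ := fun k l => sg l * sg k * Jc k) ha x x
  rw [e, ← e2, Complex.add_conj]
  simp

/-- The last hypothesis says that `∂ₓf` is square integrable, so that the multipliers in the second
correction are the genuine operators and not the default value `0`. -/
lemma energy_eq (c : Coeffs) {ψ : ℝ → ℝ} (hψ : IsLowCut ψ) (κ : ℝ) {f g : Torus → ℝ}
    (hf : Wiener f) (hg : Wiener g) (hf1 : Summable fun k : ℤ => (|(k : ℝ)| * ‖coeff f k‖) ^ 2) :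
    energy c ψ κ f g = 2 * Real.pi * eSeq c κ (coeff f) (coeff f - coeff g) := by
  have hw := hf.sub hg
  have hwc := coeff_sub hf.1 hg.1
  have hH := hw.hilb
  have hJ := hw.opJ hψ
  have hHJ := hJ.1.hilb
  have hff := hf.mul hf
  have hwn : nr 0 (coeff (f - g)) ≠ ⊤ := hw.2
  -- the first correction
  have h1 : (∫ x, f x * hilb (f - g) x * hilb (opJ ψ (f - g)) x)
      = 2 * Real.pi * (tri th₁ (coeff f) (coeff (f - g)) (coeff (f - g))).re := by
    have e := integral_mul_mul hf.1 hH.1 hHJ.1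
    rw [re_tri_th₁ (realSeq_coeff f) hf.2 hw.2, ← Complex.ofReal_re (∫ x, _), e]
    have : tri (fun _ _ => 1) (coeff f) (coeff (hilb (f - g))) (coeff (hilb (opJ ψ (f - g))))
        = tri (fun k l => sg l * sg k * Jc k) (coeff f) (coeff (f - g)) (coeff (f - g)) := by
      unfold tri
      refine tsum_congr fun p => ?_
      rw [hH.2, hHJ.2, hJ.2]
      simp only [sg, map_mul, Complex.conj_ofReal, map_neg, Complex.conj_I, Complex.ofReal_mul,
        Complex.ofReal_intCast, map_intCast, Complex.ofReal_one]
      linear_combination (-coeff f (p.1 - p.2) * (Int.sign p.2) * coeff (f - g) p.2 *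
        Int.sign p.1 * Jc p.1 * conj (coeff (f - g) p.1)) * Complex.I_mul_I
    rw [this]
    simp
  -- the second correction
  have hD := mult_spec (m := fun k : ℤ => (Complex.I * (k : ℂ)) ^ 1) (f := f) (by simp) (by
    refine hf1.congr fun k => ?_
    simp [Complex.norm_intCast])
  have hHD := mult_spec (m := fun k : ℤ => -Complex.I * (Int.sign k : ℂ)) (f := dx 1 f)
    hilb_symbol_neg (by
      refine hf1.congr fun k => ?_
      unfold dx
      rw [hD.2]
      simp only [norm_mul, norm_neg, Complex.norm_I, one_mul, pow_one, Complex.norm_intCast]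
      rcases eq_or_ne k 0 with rfl | hk
      · simp
      · have : |((Int.sign k : ℤ) : ℝ)| = 1 := by
          rw [← Int.cast_abs, Int.abs_sign_of_ne_zero hk]; simp
        rw [this, one_mul])
  have h2 : (∫ x, hilb (dx 1 f) x * opJ ψ (f - g) x ^ 2)
      = 2 * Real.pi * (tri th₂ (coeff f) (coeff (f - g)) (coeff (f - g))).re := by
    have e := integral_mul_mul hHD.1 hJ.1 hJ.1
    have e' : ∀ x, hilb (dx 1 f) x * opJ ψ (f - g) x ^ 2
        = mult (fun k : ℤ => -Complex.I * (Int.sign k : ℂ)) (dx 1 f) x * opJ ψ (f - g) x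
          * opJ ψ (f - g) x := fun x => by rw [sq, mul_assoc]; rfl
    simp_rw [e']
    rw [← Complex.ofReal_re (∫ x, _), e]
    have : tri (fun _ _ => 1) (coeff (mult (fun k : ℤ => -Complex.I * (Int.sign k : ℂ)) (dx 1 f)))
        (coeff (opJ ψ (f - g))) (coeff (opJ ψ (f - g)))
        = tri th₂ (coeff f) (coeff (f - g)) (coeff (f - g)) := by
      unfold tri
      refine tsum_congr fun p => ?_
      rw [hHD.2, hJ.2]
      unfold dx
      rw [hD.2]
      have hs : (Int.sign (p.1 - p.2) : ℂ) * ((p.1 - p.2 : ℤ) : ℂ)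
          = ((|(p.1 : ℝ) - p.2| : ℝ) : ℂ) := by
        have : (Int.sign (p.1 - p.2) * (p.1 - p.2) : ℤ) = |p.1 - p.2| := Int.sign_mul_self_eq_abs _
        have h' : (((Int.sign (p.1 - p.2) * (p.1 - p.2) : ℤ)) : ℝ) = |(p.1 : ℝ) - p.2| := by
          rw [this]; push_cast; rfl
        rw [← h']; push_cast; rfl
      simp only [th₂, map_mul, Complex.conj_ofReal, Complex.ofReal_mul, pow_one,
        Complex.ofReal_one]
      rw [← hs]
      linear_combination (-(Int.sign (p.1 - p.2) : ℂ) * ((p.1 - p.2 : ℤ) : ℂ) *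
        coeff f (p.1 - p.2) * Jc p.2 * coeff (f - g) p.2 * Jc p.1 *
        conj (coeff (f - g) p.1)) * Complex.I_mul_I
    rw [this]
    simp
  -- the third correction
  have h3 : (∫ x, f x ^ 2 * opJ ψ (f - g) x ^ 2) = 2 * Real.pi *
      (tri (fun k l => Jc k * Jc l) (conv (coeff f) (coeff f)) (coeff (f - g))
        (coeff (f - g))).re := by
    have e := integral_mul_mul hff.1 hJ.1 hJ.1
    have e' : ∀ x, f x ^ 2 * opJ ψ (f - g) x ^ 2
        = (f * f) x * opJ ψ (f - g) x * opJ ψ (f - g) x := fun x => by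
      rw [Pi.mul_apply]; ring
    simp_rw [e']
    rw [← Complex.ofReal_re (∫ x, _), e, coeff_mul hf.1 hf]
    have : tri (fun _ _ => 1) (conv (coeff f) (coeff f))
        (coeff (opJ ψ (f - g))) (coeff (opJ ψ (f - g)))
        = tri (fun k l => Jc k * Jc l) (conv (coeff f) (coeff f)) (coeff (f - g))
          (coeff (f - g)) := by
      unfold tri
      refine tsum_congr fun p => ?_
      rw [hJ.2]
      simp only [map_mul, Complex.conj_ofReal, Complex.ofReal_mul, Complex.ofReal_one]
      ring
    rw [this]
    simp
  unfold energy corr₁ corr₂ corr₃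
  rw [h1, h2, h3, l2norm_sq hw.1, hNegOneNorm_sq hw.1,
    show l2norm f ^ 4 = (l2norm f ^ 2) ^ 2 by ring, l2norm_sq hf.1, hwc]
  simp only [eSeq, corrSeq, wgt, sqn, mu₃, Complex.add_re, Complex.mul_re, Complex.div_ofNat_re,
    Complex.ofReal_re, Complex.ofReal_im, Complex.div_ofNat_im]
  ring
end BO4
end

noncomputable section
namespace BO4
open scoped ENNReal ComplexConjugate

/-! ### Sobolev spaces -/

lemma absD_spec {s : ℝ} {f : Torus → ℝ} (hf : MemHs s f) :
    MemLp (absD s f) 2 volume ∧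
      coeff (absD s f) = fun k : ℤ => ((|(k : ℝ)| ^ s : ℝ) : ℂ) * coeff f k := by
  refine mult_spec (m := fun k : ℤ => ((|(k : ℝ)| ^ s : ℝ) : ℂ))
    (fun k => by rw [Complex.conj_ofReal]; simp) (hf.2.congr fun k => ?_)
  rw [norm_mul, Complex.norm_real, Real.norm_of_nonneg (by positivity)]

lemma hsNorm_sq {s : ℝ} {f : Torus → ℝ} (hf : MemHs s f) :
    hsNorm s f ^ 2 = Real.pi * (sqn (coeff f) + ∑' k : ℤ, (|(k : ℝ)| ^ s * ‖coeff f k‖) ^ 2) := by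
  have h := absD_spec hf
  have e : ∀ k : ℤ, ‖((|(k : ℝ)| ^ s : ℝ) : ℂ) * coeff f k‖ = |(k : ℝ)| ^ s * ‖coeff f k‖ :=
    fun k => by rw [norm_mul, Complex.norm_real, Real.norm_of_nonneg (by positivity)]
  rw [hsNorm, mul_pow, inv_pow, Real.sq_sqrt (by norm_num), Real.sq_sqrt (by positivity),
    l2norm_sq hf.1, l2norm_sq h.1, h.2]
  simp_rw [e]
  rw [sqn]; ring

lemma hsNorm_nonneg (s : ℝ) (f : Torus → ℝ) : 0 ≤ hsNorm s f := by unfold hsNorm; positivity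

lemma summable_jb_rpow {r : ℝ} (hr : 1 < r) : Summable fun k : ℤ => jb k ^ (-r) := by
  refine Summable.of_norm_bounded_eventually (Real.summable_abs_int_rpow hr) ?_
  have : ∀ᶠ k : ℤ in cofinite, k ≠ 0 := by
    rw [eventually_cofinite]; simp
  filter_upwards [this] with k hk
  rw [Real.norm_of_nonneg (Real.rpow_nonneg (jb_pos k).le _)]
  exact Real.rpow_le_rpow_of_nonpos (by positivity) (abs_le_jb k) (by linarith)

lemma jb_rpow_le {s : ℝ} (hs : 0 ≤ s) (k : ℤ) :
    (jb k ^ s) ^ 2 ≤ (2 ^ s) ^ 2 * (1 + (|(k : ℝ)| ^ s) ^ 2) := by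
  have h0 : 0 ≤ |(k : ℝ)| := abs_nonneg _
  rcases le_total |(k : ℝ)| 1 with h | h
  · have : jb k ^ s ≤ 2 ^ s := Real.rpow_le_rpow (jb_pos k).le (by unfold jb; linarith) hs
    have h2 : 0 ≤ jb k ^ s := Real.rpow_nonneg (jb_pos k).le _
    calc (jb k ^ s) ^ 2 ≤ (2 ^ s) ^ 2 := by gcongr
      _ ≤ _ := le_mul_of_one_le_right (by positivity) (by nlinarith [sq_nonneg (|(k : ℝ)| ^ s)])
  · have : jb k ^ s ≤ (2 * |(k : ℝ)|) ^ s :=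
      Real.rpow_le_rpow (jb_pos k).le (by unfold jb; linarith) hs
    rw [Real.mul_rpow (by norm_num) h0] at this
    have h2 : 0 ≤ jb k ^ s := Real.rpow_nonneg (jb_pos k).le _
    calc (jb k ^ s) ^ 2 ≤ (2 ^ s * |(k : ℝ)| ^ s) ^ 2 := by gcongr
      _ = (2 ^ s) ^ 2 * (|(k : ℝ)| ^ s) ^ 2 := by ring
      _ ≤ _ := by gcongr; linarith

/-- Sobolev embedding into the weighted Wiener algebras. -/
lemma exists_nr_le (n : ℕ) {s : ℝ} (hs : n + 1 / 2 < s) :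
    ∃ C : ℝ, 0 < C ∧ ∀ f : Torus → ℝ, MemHs s f →
      nr n (coeff f) ≤ ENNReal.ofReal (C * hsNorm s f) := by
  have hs0 : 0 ≤ s := by have : (0 : ℝ) ≤ n := n.cast_nonneg; linarith
  -- Cauchy–Schwarz against `(1+|k|)^{-(s-n)}`, which is square summable exactly because `2(s - n) >
  -- 1`.
  set A := ∑' k : ℤ, jb k ^ (-(2 * (s - n))) with hA
  have hAs : Summable fun k : ℤ => jb k ^ (-(2 * (s - n))) := summable_jb_rpow (by linarith)
  have hA0 : 0 ≤ A := tsum_nonneg fun k => Real.rpow_nonneg (jb_pos k).le _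
  refine ⟨√A * 2 ^ s + 1, by positivity, fun f hf => ?_⟩
  have hsq : ∀ k : ℤ, (jb k ^ (-(s - n))) ^ (2 : ℝ) = jb k ^ (-(2 * (s - n))) := fun k => by
    rw [← Real.rpow_mul (jb_pos k).le]; congr 1; ring
  have h1 := summable_sq hf.1
  have h2 := hf.2
  have h3 : Summable fun k : ℤ => (jb k ^ s * ‖coeff f k‖) ^ 2 := by
    refine Summable.of_nonneg_of_le (fun k => by positivity) (fun k => ?_)
      ((h1.add h2).mul_left ((2 ^ s) ^ 2))
    rw [mul_pow]
    calc (jb k ^ s) ^ 2 * ‖coeff f k‖ ^ 2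
        ≤ (2 ^ s) ^ 2 * (1 + (|(k : ℝ)| ^ s) ^ 2) * ‖coeff f k‖ ^ 2 := by
          gcongr; exact jb_rpow_le hs0 k
      _ = _ := by ring
  have h4 : ∑' k : ℤ, (jb k ^ s * ‖coeff f k‖) ^ 2 ≤ (2 ^ s) ^ 2 * hsNorm s f ^ 2 := by
    rw [hsNorm_sq hf, sqn, ← h1.tsum_add h2]
    calc ∑' k : ℤ, (jb k ^ s * ‖coeff f k‖) ^ 2
        ≤ ∑' k : ℤ, (2 ^ s) ^ 2 * (‖coeff f k‖ ^ 2 + (|(k : ℝ)| ^ s * ‖coeff f k‖) ^ 2) := by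
          refine h3.tsum_le_tsum (fun k => ?_) ((h1.add h2).mul_left _)
          rw [mul_pow]
          calc (jb k ^ s) ^ 2 * ‖coeff f k‖ ^ 2
              ≤ (2 ^ s) ^ 2 * (1 + (|(k : ℝ)| ^ s) ^ 2) * ‖coeff f k‖ ^ 2 := by
                gcongr; exact jb_rpow_le hs0 k
            _ = _ := by ring
      _ = (2 ^ s) ^ 2 * ∑' k : ℤ, (‖coeff f k‖ ^ 2 + (|(k : ℝ)| ^ s * ‖coeff f k‖) ^ 2) :=
          tsum_mul_left
      _ ≤ _ := by
          gcongr
          refine le_mul_of_one_le_left (tsum_nonneg fun k => by positivity) ?_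
          linarith [Real.pi_gt_three]
  have hpq : Real.HolderConjugate 2 2 := Real.HolderConjugate.two_two
  have key := Real.summable_and_inner_le_Lp_mul_Lq_tsum_of_nonneg hpq
    (f := fun k : ℤ => jb k ^ (-(s - n))) (g := fun k : ℤ => jb k ^ s * ‖coeff f k‖)
    (fun k => Real.rpow_nonneg (jb_pos k).le _)
    (fun k => mul_nonneg (Real.rpow_nonneg (jb_pos k).le _) (norm_nonneg _))
    (by simp_rw [hsq]; exact hAs) (by simpa only [Real.rpow_two] using h3)
  have e : ∀ k : ℤ, jb k ^ (-(s - n)) * (jb k ^ s * ‖coeff f k‖) = jb k ^ n * ‖coeff f k‖ :=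
    fun k => by
      rw [← mul_assoc, ← Real.rpow_add (jb_pos k), ← Real.rpow_natCast]; congr 2; ring
  simp_rw [e, hsq] at key
  have h5 : ∑' k : ℤ, jb k ^ n * ‖coeff f k‖ ≤ (√A * 2 ^ s + 1) * hsNorm s f := by
    refine key.2.trans ?_
    simp only [Real.rpow_two]
    rw [← Real.sqrt_eq_rpow, ← Real.sqrt_eq_rpow]
    have h6 : √(∑' k : ℤ, (jb k ^ s * ‖coeff f k‖) ^ 2) ≤ 2 ^ s * hsNorm s f := by
      rw [Real.sqrt_le_left (mul_nonneg (by positivity) (hsNorm_nonneg _ _)), mul_pow]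
      exact h4
    calc √A * √(∑' k : ℤ, (jb k ^ s * ‖coeff f k‖) ^ 2) ≤ √A * (2 ^ s * hsNorm s f) := by gcongr
      _ ≤ _ := by nlinarith [hsNorm_nonneg s f]
  refine le_trans (le_of_eq ?_) (ENNReal.ofReal_le_ofReal h5)
  rw [ENNReal.ofReal_tsum_of_nonneg (fun k => mul_nonneg (pow_nonneg (jb_pos k).le _)
    (norm_nonneg _)) key.1]
  refine tsum_congr fun k => ?_
  rw [wt, ENNReal.ofReal_mul (pow_nonneg (jb_pos k).le _), ofReal_jb_pow, ofReal_norm]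

lemma MemHs.nr_ne_top {n : ℕ} {s : ℝ} (hs : n + 1 / 2 < s) {f : Torus → ℝ} (hf : MemHs s f) :
    nr n (coeff f) ≠ ⊤ := by
  obtain ⟨C, -, h⟩ := exists_nr_le n hs
  exact ne_top_of_le_ne_top ENNReal.ofReal_ne_top (h f hf)

lemma MemHs.wiener {s : ℝ} (hs : 1 / 2 < s) {f : Torus → ℝ} (hf : MemHs s f) : Wiener f :=
  ⟨hf.1, hf.nr_ne_top (n := 0) (by simpa using hs)⟩

lemma MemHs.sub {s : ℝ} {f g : Torus → ℝ} (hf : MemHs s f) (hg : MemHs s g) :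
    MemHs s (f - g) := by
  refine ⟨hf.1.sub hg.1, ?_⟩
  refine Summable.of_nonneg_of_le (fun k => by positivity) (fun k => ?_)
    ((hf.2.add hg.2).mul_left 2)
  rw [coeff_sub hf.1 hg.1, Pi.sub_apply]
  have h1 : ‖coeff f k - coeff g k‖ ≤ ‖coeff f k‖ + ‖coeff g k‖ := norm_sub_le _ _
  have h2 : 0 ≤ |(k : ℝ)| ^ s := by positivity
  have h3 : |(k : ℝ)| ^ s * ‖coeff f k - coeff g k‖
      ≤ |(k : ℝ)| ^ s * ‖coeff f k‖ + |(k : ℝ)| ^ s * ‖coeff g k‖ := by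
    rw [← mul_add]; gcongr
  calc (|(k : ℝ)| ^ s * ‖coeff f k - coeff g k‖) ^ 2
      ≤ (|(k : ℝ)| ^ s * ‖coeff f k‖ + |(k : ℝ)| ^ s * ‖coeff g k‖) ^ 2 := by gcongr
    _ ≤ _ := by nlinarith [sq_nonneg (|(k : ℝ)| ^ s * ‖coeff f k‖ - |(k : ℝ)| ^ s * ‖coeff g k‖)]

lemma MemHs.summable_one {s : ℝ} (hs : 1 ≤ s) {f : Torus → ℝ} (hf : MemHs s f) :
    Summable fun k : ℤ => (|(k : ℝ)| * ‖coeff f k‖) ^ 2 := by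
  refine Summable.of_nonneg_of_le (fun k => by positivity) (fun k => ?_) hf.2
  rcases eq_or_ne k 0 with rfl | hk
  · simp; positivity
  · have h1 : (1 : ℝ) ≤ |(k : ℝ)| := by exact_mod_cast Int.one_le_abs hk
    have : |(k : ℝ)| ≤ |(k : ℝ)| ^ s := by
      simpa using Real.rpow_le_rpow_of_exponent_le h1 hs
    gcongr

lemma ContInHs.tendsto {s : ℝ} {n : ℕ} (hs : n + 1 / 2 < s) {S : Set ℝ} {u : ℝ → Torus → ℝ}
    (hu : ContInHs s S u) {t : ℝ} (ht : t ∈ S) :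
    Tendsto (fun τ => nr n (coeff (u τ) - coeff (u t))) (𝓝[S] t) (𝓝 0) := by
  obtain ⟨C, -, h⟩ := exists_nr_le n hs
  have h1 : Tendsto (fun τ => ENNReal.ofReal (C * hsNorm s (u τ - u t))) (𝓝[S] t) (𝓝 0) := by
    have := ENNReal.tendsto_ofReal ((hu t ht).2.const_mul C)
    simpa using this
  refine tendsto_of_tendsto_of_tendsto_of_le_of_le' tendsto_const_nhds h1
    (Eventually.of_forall fun _ => zero_le) ?_
  filter_upwards [self_mem_nhdsWithin] with τ hτ
  rw [← coeff_sub (hu τ hτ).1.1 (hu t ht).1.1]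
  exact h _ ((hu τ hτ).1.sub (hu t ht).1)
end BO4
end

noncomputable section
namespace BO4
open scoped ENNReal ComplexConjugate

/-! ### Fourier multipliers on sequences -/

/-- Multiplication of a sequence by a symbol. -/
def ml (m : ℤ → ℂ) (a : ℤ → ℂ) (k : ℤ) : ℂ := m k * a k

/-- The symbol of the derivative. -/
def symD (k : ℤ) : ℂ := Complex.I * (k : ℂ)
/-- The symbol of `|D|`. -/
def symA (k : ℤ) : ℂ := ((|(k : ℝ)| : ℝ) : ℂ)
/-- The symbol of the Hilbert transform. -/
def symH (k : ℤ) : ℂ := -Complex.I * (Int.sign k : ℂ)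

lemma ml_add (m a b : ℤ → ℂ) : ml m (a + b) = ml m a + ml m b := by
  funext k; simp [ml, mul_add]
lemma ml_sub (m a b : ℤ → ℂ) : ml m (a - b) = ml m a - ml m b := by
  funext k; simp [ml, mul_sub]
lemma ml_smul (m : ℤ → ℂ) (r : ℂ) (a : ℤ → ℂ) : ml m (r • a) = r • ml m a := by
  funext k; simp [ml]; ring
lemma ml_ml (m m' a : ℤ → ℂ) : ml m (ml m' a) = ml (m * m') a := by
  funext k; simp [ml]; ring

lemma enorm_symD_le (k : ℤ) : ‖symD k‖ₑ ≤ jw k ^ 1 := by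
  rw [← ofReal_norm, pow_one, jw]
  refine ENNReal.ofReal_le_ofReal ?_
  rw [symD, norm_mul, Complex.norm_I, one_mul, Complex.norm_intCast]
  exact abs_le_jb k

lemma enorm_symA_le (k : ℤ) : ‖symA k‖ₑ ≤ jw k ^ 1 := by
  rw [pow_one, jw, symA]
  exact enorm_real_le (by rw [abs_abs]; exact abs_le_jb k)

lemma enorm_symH_le (k : ℤ) : ‖symH k‖ₑ ≤ jw k ^ 0 := by
  rw [pow_zero]; exact enorm_hilb_symbol_le k

lemma enorm_mul_symbol_le {m m' : ℤ → ℂ} {s s' : ℕ} (h : ∀ k, ‖m k‖ₑ ≤ jw k ^ s)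
    (h' : ∀ k, ‖m' k‖ₑ ≤ jw k ^ s') (k : ℤ) : ‖(m * m') k‖ₑ ≤ jw k ^ (s + s') := by
  rw [Pi.mul_apply, enorm_mul, pow_add]
  exact mul_le_mul' (h k) (h' k)

lemma enorm_symD_sq_le (k : ℤ) : ‖(symD * symD) k‖ₑ ≤ jw k ^ 2 :=
  enorm_mul_symbol_le enorm_symD_le enorm_symD_le k

lemma symH_mul_symD : symH * symD = symA := by
  funext k
  have : (Int.sign k : ℂ) * (k : ℂ) = ((|(k : ℝ)| : ℝ) : ℂ) := by
    have h : ((Int.sign k * k : ℤ) : ℝ) = |(k : ℝ)| := by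
      rw [Int.sign_mul_self_eq_abs]; push_cast; rfl
    rw [← h]; push_cast; rfl
  simp only [symH, symD, symA, Pi.mul_apply]
  rw [← this]
  linear_combination (-(Int.sign k : ℂ) * (k : ℂ)) * Complex.I_mul_I

lemma nr_ml_le {n s : ℕ} {m : ℤ → ℂ} (hm : ∀ k, ‖m k‖ₑ ≤ jw k ^ s) (a : ℤ → ℂ) :
    nr n (ml m a) ≤ nr (n + s) a := by
  have := nr_mul_le (n := n) (C := 1) (by simpa using hm) a
  rwa [one_mul] at this

lemma nr_ml_ne_top {n s N : ℕ} {m : ℤ → ℂ} (hm : ∀ k, ‖m k‖ₑ ≤ jw k ^ s) (h : n + s ≤ N)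
    {a : ℤ → ℂ} (ha : nr N a ≠ ⊤) : nr n (ml m a) ≠ ⊤ :=
  ne_top_of_le_ne_top (nr_ne_top_mono h ha) (nr_ml_le hm a)

/-- The Leibniz rule. -/
lemma symD_conv {a b : ℤ → ℂ} (ha : nr 1 a ≠ ⊤) (hb : nr 1 b ≠ ⊤) :
    ml symD (conv a b) = conv (ml symD a) b + conv a (ml symD b) := by
  have ha0 := nr_ne_top_mono zero_le_one ha
  have hb0 := nr_ne_top_mono zero_le_one hb
  funext k
  have h1 := summable_conv (nr_ml_ne_top (n := 0) enorm_symD_le le_rfl ha) hb0 k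
  have h2 := summable_conv ha0 (nr_ml_ne_top (n := 0) enorm_symD_le le_rfl hb) k
  rw [Pi.add_apply]
  unfold conv
  rw [← h1.tsum_add h2, ml, ← tsum_mul_left]
  refine tsum_congr fun j => ?_
  simp only [ml, symD]; push_cast; ring

/-- As `u²∂ₓu` is an exact derivative, the Hilbert transform in the `c₅` term combines with it to
`|D|(u³)/3`; `symD_square` does the same for `u∂ₓu` in the `c₆` term. -/
lemma symD_cube {a : ℤ → ℂ} (ha : nr 1 a ≠ ⊤) :
    conv (conv a a) (ml symD a) = (3⁻¹ : ℂ) • ml symD (conv (conv a a) a) := by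
  have ha0 := nr_ne_top_mono zero_le_one ha
  have hd := nr_ml_ne_top (n := 0) enorm_symD_le le_rfl ha
  have haa := nr_conv_ne_top ha ha
  rw [symD_conv haa ha, symD_conv ha ha]
  have key : ∀ A X : WA, (X * A + A * X) * A + A * A * X = A * A * X + A * A * X + A * A * X :=
    fun A X => by ring
  have h := congrArg WA.val (key ⟨a, ha0⟩ ⟨ml symD a, hd⟩)
  simp only [WA.val_add, WA.val_mul] at h
  rw [h]
  funext k
  simp only [Pi.smul_apply, Pi.add_apply, smul_eq_mul]; ring

lemma symD_square {a : ℤ → ℂ} (ha : nr 1 a ≠ ⊤) :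
    conv a (ml symD a) = (2⁻¹ : ℂ) • ml symD (conv a a) := by
  rw [symD_conv ha ha, conv_comm (ml symD a) a]
  funext k
  simp only [Pi.smul_apply, Pi.add_apply, smul_eq_mul]; ring

/-- The nonlinear part of `K` on the Fourier side. -/
def nlin (c : Coeffs) (a : ℤ → ℂ) : ℤ → ℂ :=
  (c.c₁ : ℂ) • conv a (ml (symD * symD) a) + (c.c₂ : ℂ) • conv (ml symD a) (ml symD a)
    + (c.c₃ : ℂ) • conv (ml symA a) (ml symA a)
    + (c.c₄ : ℂ) • ml symH (conv a (ml (symH * (symD * symD)) a))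
    + (c.c₅ / 3 : ℂ) • ml symA (conv (conv a a) a)
    + (c.c₆ / 2 : ℂ) • conv a (ml symA (conv a a))
    + (c.c₇ : ℂ) • conv (conv a a) (ml symA a) - conv (conv a a) (conv a a)

lemma Wiener.dx {n N : ℕ} (hn : n ≤ N) {f : Torus → ℝ} (_ : Wiener f)
    (h : nr N (coeff f) ≠ ⊤) :
    Wiener (dx n f) ∧ coeff (dx n f) = fun k : ℤ => (Complex.I * (k : ℂ)) ^ n * coeff f k := by
  refine Wiener.mult (m := fun k : ℤ => (Complex.I * (k : ℂ)) ^ n) (fun k => by simp) (nr_ml_ne_top (n := 0) (s := n) (fun k => ?_)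
    (by omega) h)
  rw [enorm_pow]
  exact pow_le_pow_left₀ zero_le ((enorm_symD_le k).trans (pow_one _).le) n

/-- The dispersive part `ℋ∂ₓ³` has symbol `-|k|³`, and all other terms are convolutions. Weight `3`
on the coefficients makes each derivative in `K` a function in the Wiener algebra, so that the
product formula applies to every term. -/
lemma coeff_opK (c : Coeffs) {u : Torus → ℝ} (hu : Wiener u) (h : nr 3 (coeff u) ≠ ⊤) (k : ℤ) :
    coeff (opK c u) k = -((|(k : ℝ)| ^ 3 : ℝ) : ℂ) * coeff u k + nlin c (coeff u) k := by
  have e1 : (fun k : ℤ => (Complex.I * (k : ℂ)) ^ 1 * coeff u k) = ml symD (coeff u) := by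
    funext k; simp [ml, symD]
  have e2 : (fun k : ℤ => (Complex.I * (k : ℂ)) ^ 2 * coeff u k)
      = ml (symD * symD) (coeff u) := by
    funext k; simp [ml, symD, sq]
  have h1 := hu.dx (n := 1) (by norm_num) h
  have h2 := hu.dx (n := 2) (by norm_num) h
  have h3 := hu.dx (n := 3) (by norm_num) h
  rw [e1] at h1
  rw [e2] at h2
  have eH : ∀ a : ℤ → ℂ, (fun k : ℤ => -Complex.I * (Int.sign k : ℂ) * a k) = ml symH a :=
    fun a => rfl
  have hH1 := h1.1.hilb
  have hH2 := h2.1.hilb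
  have hH3 := h3.1.hilb
  rw [eH, h1.2, ml_ml, symH_mul_symD] at hH1
  rw [eH, h2.2, ml_ml] at hH2
  have t1 := hu.mul h2.1
  have t2 := h1.1.mul h1.1
  have t3 := hH1.1.mul hH1.1
  have t4 := hu.mul hH2.1
  have t4' := t4.hilb
  have uu := hu.mul hu
  have t5 := uu.mul h1.1
  have t5' := t5.hilb
  have t6 := hu.mul h1.1
  have t6' := t6.hilb
  have t6'' := hu.mul t6'.1
  have t7 := uu.mul hH1.1
  have t8 := uu.mul uu
  have ha1 := nr_ne_top_mono (show 1 ≤ 3 by norm_num) h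
  rw [eH, coeff_mul hu.1 hH2.1, hH2.2] at t4'
  rw [eH, coeff_mul uu.1 h1.1, coeff_mul hu.1 hu, h1.2, symD_cube ha1, ml_smul, ml_ml,
    symH_mul_symD] at t5'
  rw [eH, coeff_mul hu.1 h1.1, h1.2, symD_square ha1, ml_smul, ml_ml, symH_mul_symD] at t6'
  have eq : opK c u = hilb (BO4.dx 3 u) + c.c₁ • (u * BO4.dx 2 u) + c.c₂ • (BO4.dx 1 u * BO4.dx 1 u)
      + c.c₃ • (hilb (BO4.dx 1 u) * hilb (BO4.dx 1 u)) + c.c₄ • hilb (u * hilb (BO4.dx 2 u))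
      + c.c₅ • hilb (u * u * BO4.dx 1 u) + c.c₆ • (u * hilb (u * BO4.dx 1 u))
      + c.c₇ • (u * u * hilb (BO4.dx 1 u)) - u * u * (u * u) := by
    unfold opK
    rw [show u ^ 4 = u * u * (u * u) by ring, sq, sq, sq]
  have s1 := hH3.1.add (t1.smul c.c₁)
  have s2 := s1.add (t2.smul c.c₂)
  have s3 := s2.add (t3.smul c.c₃)
  have s4 := s3.add (t4'.1.smul c.c₄)
  have s5 := s4.add (t5'.1.smul c.c₅)
  have s6 := s5.add (t6''.smul c.c₆)
  have s7 := s6.add (t7.smul c.c₇)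
  rw [eq, coeff_sub s7.1 t8.1, coeff_add s6.1 (t7.smul c.c₇).1, coeff_add s5.1 (t6''.smul c.c₆).1,
    coeff_add s4.1 (t5'.1.smul c.c₅).1, coeff_add s3.1 (t4'.1.smul c.c₄).1,
    coeff_add s2.1 (t3.smul c.c₃).1, coeff_add s1.1 (t2.smul c.c₂).1,
    coeff_add hH3.1.1 (t1.smul c.c₁).1]
  simp only [coeff_smul]
  rw [coeff_mul uu.1 uu, coeff_mul uu.1 hH1.1, coeff_mul hu.1 t6'.1, coeff_mul hu.1 hu,
    coeff_mul hH1.1.1 hH1.1, coeff_mul h1.1.1 h1.1, coeff_mul hu.1 h2.1, hH1.2, h1.2, h2.2,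
    t4'.2, t5'.2, t6'.2, hH3.2, h3.2]
  have lin : -Complex.I * (Int.sign k : ℂ) * ((Complex.I * (k : ℂ)) ^ 3 * coeff u k)
      = -((|(k : ℝ)| ^ 3 : ℝ) : ℂ) * coeff u k := by
    have hs := congrFun symH_mul_symD k
    simp only [Pi.mul_apply, symH, symD, symA] at hs
    have hk : (k : ℂ) ^ 2 = ((|(k : ℝ)| ^ 2 : ℝ) : ℂ) := by rw [sq_abs]; push_cast; rfl
    calc _ = (-Complex.I * (Int.sign k : ℂ) * (Complex.I * (k : ℂ))) * ((Complex.I * Complex.I)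
          * (k : ℂ) ^ 2) * coeff u k := by ring
      _ = _ := by rw [hs, hk, Complex.I_mul_I]; push_cast; ring
  have hsm : ∀ (r : ℂ) (a b : ℤ → ℂ), conv a (r • b) = r • conv a b := fun r a b => by
    funext k
    simp only [conv, Pi.smul_apply, smul_eq_mul]
    rw [← tsum_mul_left]
    exact tsum_congr fun j => by ring
  simp only [nlin, Pi.add_apply, Pi.sub_apply, Pi.smul_apply, smul_eq_mul, lin, hsm]
  ring
end BO4
end

noncomputable section
namespace BO4
open scoped ENNReal ComplexConjugate

/-! ### Continuity and differentiability of multilinear expressions -/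

/-- Convergence in a weighted Wiener algebra. -/
def CT (n : ℕ) (l : Filter ℝ) (A : ℝ → ℤ → ℂ) (a : ℤ → ℂ) : Prop :=
  nr n a ≠ ⊤ ∧ Tendsto (fun τ => nr n (A τ - a)) l (𝓝 0)

lemma tendsto_zero_of_le {l : Filter ℝ} {F G : ℝ → ℝ≥0∞} (hG : Tendsto G l (𝓝 0))
    (h : ∀ᶠ τ in l, F τ ≤ G τ) : Tendsto F l (𝓝 0) :=
  tendsto_of_tendsto_of_tendsto_of_le_of_le' tendsto_const_nhds hG
    (Eventually.of_forall fun _ => zero_le) h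

lemma tendsto_const_mul_zero {l : Filter ℝ} {F : ℝ → ℝ≥0∞} (hF : Tendsto F l (𝓝 0)) {C : ℝ≥0∞}
    (hC : C ≠ ⊤) : Tendsto (fun τ => C * F τ) l (𝓝 0) := by
  have := ENNReal.Tendsto.const_mul (a := C) hF (Or.inr hC)
  rwa [mul_zero] at this

lemma tendsto_mul_const_zero {l : Filter ℝ} {F : ℝ → ℝ≥0∞} (hF : Tendsto F l (𝓝 0)) {C : ℝ≥0∞}
    (hC : C ≠ ⊤) : Tendsto (fun τ => F τ * C) l (𝓝 0) := by
  simpa only [mul_comm] using tendsto_const_mul_zero hF hC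

lemma tendsto_add_zero {l : Filter ℝ} {F G : ℝ → ℝ≥0∞} (hF : Tendsto F l (𝓝 0))
    (hG : Tendsto G l (𝓝 0)) : Tendsto (fun τ => F τ + G τ) l (𝓝 0) := by
  simpa using hF.add hG

namespace CT
variable {n : ℕ} {l : Filter ℝ} {A B : ℝ → ℤ → ℂ} {a b : ℤ → ℂ}

lemma mono {m : ℕ} (h : m ≤ n) (hA : CT n l A a) : CT m l A a :=
  ⟨nr_ne_top_mono h hA.1,
    tendsto_zero_of_le hA.2 (Eventually.of_forall fun _ => nr_mono h _)⟩

lemma add (hA : CT n l A a) (hB : CT n l B b) : CT n l (fun τ => A τ + B τ) (a + b) := by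
  refine ⟨ne_top_of_le_ne_top (ENNReal.add_ne_top.2 ⟨hA.1, hB.1⟩) (nr_add_le _ _ _),
    tendsto_zero_of_le (tendsto_add_zero hA.2 hB.2) (Eventually.of_forall fun τ => ?_)⟩
  rw [add_sub_add_comm]; exact nr_add_le _ _ _

lemma sub (hA : CT n l A a) (hB : CT n l B b) : CT n l (fun τ => A τ - B τ) (a - b) := by
  refine ⟨ne_top_of_le_ne_top (ENNReal.add_ne_top.2 ⟨hA.1, hB.1⟩) (nr_sub_le _ _ _),
    tendsto_zero_of_le (tendsto_add_zero hA.2 hB.2) (Eventually.of_forall fun τ => ?_)⟩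
  rw [sub_sub_sub_comm]; exact nr_sub_le _ _ _

lemma smul (r : ℂ) (hA : CT n l A a) : CT n l (fun τ => r • A τ) (r • a) := by
  refine ⟨by rw [nr_smul]; exact ENNReal.mul_ne_top enorm_ne_top hA.1,
    tendsto_zero_of_le (tendsto_const_mul_zero hA.2 (enorm_ne_top (x := r)))
      (Eventually.of_forall fun τ => ?_)⟩
  rw [← smul_sub, nr_smul]

lemma ml {s N : ℕ} {m : ℤ → ℂ} (hm : ∀ k, ‖m k‖ₑ ≤ jw k ^ s) (h : n + s ≤ N)
    (hA : CT N l A a) : CT n l (fun τ => ml m (A τ)) (ml m a) := by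
  have hA := hA.mono h
  refine ⟨ne_top_of_le_ne_top hA.1 (nr_ml_le hm a),
    tendsto_zero_of_le hA.2 (Eventually.of_forall fun τ => ?_)⟩
  rw [← ml_sub]; exact nr_ml_le hm _

lemma conv (hA : CT n l A a) (hB : CT n l B b) :
    CT n l (fun τ => conv (A τ) (B τ)) (conv a b) := by
  refine ⟨nr_conv_ne_top hA.1 hB.1, ?_⟩
  have h1 : Tendsto (fun τ => nr n (A τ - a) * (nr n b + 1) + nr n a * nr n (B τ - b)) l (𝓝 0) :=
    tendsto_add_zero (tendsto_mul_const_zero hA.2 (ENNReal.add_ne_top.2 ⟨hB.1, ENNReal.one_ne_top⟩))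
      (tendsto_const_mul_zero hB.2 hA.1)
  refine tendsto_zero_of_le h1 ?_
  filter_upwards [hA.2.eventually_lt_const zero_lt_one, hB.2.eventually_lt_const zero_lt_one]
    with τ h2 h3
  have fA : nr 0 (A τ - a) ≠ ⊤ := nr_ne_top_mono (Nat.zero_le n) h2.ne_top
  have fB : nr 0 (B τ - b) ≠ ⊤ := nr_ne_top_mono (Nat.zero_le n) h3.ne_top
  have fa := nr_ne_top_mono (Nat.zero_le n) hA.1
  have fb := nr_ne_top_mono (Nat.zero_le n) hB.1
  have key : BO4.conv (A τ) (B τ) - BO4.conv a b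
      = BO4.conv (A τ - a) ((B τ - b) + b) + BO4.conv a (B τ - b) := by
    have h : ∀ p q r s : WA, (p + q) * (r + s) - q * s = p * (r + s) + q * r :=
      fun p q r s => by ring
    have := congrArg WA.val (h ⟨A τ - a, fA⟩ ⟨a, fa⟩ ⟨B τ - b, fB⟩ ⟨b, fb⟩)
    simpa only [WA.val_add, WA.val_mul, WA.val_sub, sub_add_cancel] using this
  rw [key]
  refine (nr_add_le _ _ _).trans (add_le_add ((nr_conv_le _ _ _).trans ?_) (nr_conv_le _ _ _))
  gcongr
  rw [add_comm]
  exact (nr_add_le _ _ _).trans (add_le_add le_rfl h3.le)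

end CT

lemma ct_nlin (c : Coeffs) {l : Filter ℝ} {A : ℝ → ℤ → ℂ} {a : ℤ → ℂ} (h : CT 3 l A a) :
    CT 0 l (fun τ => nlin c (A τ)) (nlin c a) := by
  have h0 := h.mono (Nat.zero_le 3)
  have h1 := h.mono (show 1 ≤ 3 by norm_num)
  have d1 := CT.ml (n := 0) enorm_symD_le (show 0 + 1 ≤ 3 by norm_num) h
  have d2 := CT.ml (n := 0) enorm_symD_sq_le (show 0 + 2 ≤ 3 by norm_num) h
  have a1 := CT.ml (n := 0) enorm_symA_le (show 0 + 1 ≤ 3 by norm_num) h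
  have h2 := CT.ml (n := 0) (enorm_mul_symbol_le enorm_symH_le enorm_symD_sq_le)
    (show 0 + (0 + 2) ≤ 3 by norm_num) h
  have e1 := h1.conv h1
  have e0 := h0.conv h0
  have H : ∀ {B : ℝ → ℤ → ℂ} {b : ℤ → ℂ}, CT 0 l B b → CT 0 l (fun τ => ml symH (B τ)) (ml symH b) :=
    fun hB => CT.ml enorm_symH_le le_rfl hB
  have M : ∀ {B : ℝ → ℤ → ℂ} {b : ℤ → ℂ}, CT 1 l B b → CT 0 l (fun τ => ml symA (B τ)) (ml symA b) :=
    fun hB => CT.ml enorm_symA_le le_rfl hB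
  unfold nlin
  exact (((((((h0.conv d2).smul _).add ((d1.conv d1).smul _)).add ((a1.conv a1).smul _)).add
    ((H (h0.conv h2)).smul _)).add ((M (e1.conv h1)).smul _)).add
    ((h0.conv (M e1)).smul _)).add ((e0.conv a1).smul _) |>.sub (e0.conv e0)

/-- The weight `(1 + |k|)⁻¹`. -/
def iw (k : ℤ) : ℝ≥0∞ := (jw k)⁻¹

lemma iw_le_one (k : ℤ) : iw k ≤ 1 := ENNReal.inv_le_one.2 (one_le_jw k)
lemma iw_mul (k : ℤ) : iw k * jw k = 1 := ENNReal.inv_mul_cancel (jw_ne_zero k) (jw_ne_top k)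

lemma wn_mono {ω ω' : ℤ → ℝ≥0∞} (h : ∀ k, ω k ≤ ω' k) (a : ℤ → ℂ) : wn ω a ≤ wn ω' a :=
  ENNReal.tsum_le_tsum fun k => mul_le_mul_left (h k) _

lemma wn_iw_le (n : ℕ) (a : ℤ → ℂ) : wn iw a ≤ nr n a :=
  wn_mono (fun k => (iw_le_one k).trans (one_le_jw_pow k n)) a

lemma wn_add_le (ω : ℤ → ℝ≥0∞) (a b : ℤ → ℂ) : wn ω (a + b) ≤ wn ω a + wn ω b := by
  unfold wn
  rw [← ENNReal.tsum_add]
  refine ENNReal.tsum_le_tsum fun k => ?_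
  rw [← mul_add]
  exact mul_le_mul_right (enorm_add_le _ _) _

lemma wn_neg (ω : ℤ → ℝ≥0∞) (a : ℤ → ℂ) : wn ω (-a) = wn ω a := by simp [wn]

lemma wn_sub_le (ω : ℤ → ℝ≥0∞) (a b : ℤ → ℂ) : wn ω (a - b) ≤ wn ω a + wn ω b := by
  rw [sub_eq_add_neg, ← wn_neg ω b]; exact wn_add_le ω a (-b)

lemma wn_smul (ω : ℤ → ℝ≥0∞) (r : ℂ) (a : ℤ → ℂ) : wn ω (r • a) = ‖r‖ₑ * wn ω a := by
  unfold wn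
  rw [← ENNReal.tsum_mul_left]
  refine tsum_congr fun k => ?_
  simp [enorm_mul]; ring

lemma wn_iw_ml_le {n : ℕ} {m : ℤ → ℂ} (hm : ∀ k, ‖m k‖ₑ ≤ jw k ^ (n + 1)) (a : ℤ → ℂ) :
    wn iw (ml m a) ≤ nr n a := by
  refine ENNReal.tsum_le_tsum fun k => ?_
  simp only [ml, enorm_mul, wt]
  calc iw k * (‖m k‖ₑ * ‖a k‖ₑ) ≤ iw k * (jw k ^ (n + 1) * ‖a k‖ₑ) := by gcongr; exact hm k
    _ = (iw k * jw k) * (jw k ^ n * ‖a k‖ₑ) := by rw [pow_succ]; ring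
    _ = _ := by rw [iw_mul, one_mul]

lemma tri_sub_one {θ : ℤ → ℤ → ℝ} {a b x v : ℤ → ℂ}
    (h1 : Summable fun p : ℤ × ℤ => a (p.1 - p.2) * (θ p.1 p.2 : ℂ) * x p.2 * conj (v p.1))
    (h2 : Summable fun p : ℤ × ℤ => b (p.1 - p.2) * (θ p.1 p.2 : ℂ) * x p.2 * conj (v p.1)) :
    tri θ (a - b) x v = tri θ a x v - tri θ b x v := by
  unfold tri
  rw [← h1.tsum_sub h2]
  exact tsum_congr fun p => by rw [Pi.sub_apply]; ring

lemma tri_sub_two {θ : ℤ → ℤ → ℝ} {a x y v : ℤ → ℂ}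
    (h1 : Summable fun p : ℤ × ℤ => a (p.1 - p.2) * (θ p.1 p.2 : ℂ) * x p.2 * conj (v p.1))
    (h2 : Summable fun p : ℤ × ℤ => a (p.1 - p.2) * (θ p.1 p.2 : ℂ) * y p.2 * conj (v p.1)) :
    tri θ a (x - y) v = tri θ a x v - tri θ a y v := by
  unfold tri
  rw [← h1.tsum_sub h2]
  exact tsum_congr fun p => by rw [Pi.sub_apply]; ring

lemma tri_sub_three {θ : ℤ → ℤ → ℝ} {a x v u : ℤ → ℂ}
    (h1 : Summable fun p : ℤ × ℤ => a (p.1 - p.2) * (θ p.1 p.2 : ℂ) * x p.2 * conj (v p.1))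
    (h2 : Summable fun p : ℤ × ℤ => a (p.1 - p.2) * (θ p.1 p.2 : ℂ) * x p.2 * conj (u p.1)) :
    tri θ a x (v - u) = tri θ a x v - tri θ a x u := by
  unfold tri
  rw [← h1.tsum_sub h2]
  exact tsum_congr fun p => by rw [Pi.sub_apply, map_sub]; ring

lemma tri_smul_one (θ : ℤ → ℤ → ℝ) (r : ℂ) (a x v : ℤ → ℂ) :
    tri θ (r • a) x v = r * tri θ a x v := by
  unfold tri
  rw [← tsum_mul_left]
  exact tsum_congr fun p => by simp only [Pi.smul_apply, smul_eq_mul]; ring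

lemma tri_smul_two (θ : ℤ → ℤ → ℝ) (r : ℂ) (a x v : ℤ → ℂ) :
    tri θ a (r • x) v = r * tri θ a x v := by
  unfold tri
  rw [← tsum_mul_left]
  exact tsum_congr fun p => by simp only [Pi.smul_apply, smul_eq_mul]; ring

lemma tri_smul_three (θ : ℤ → ℤ → ℝ) (r : ℝ) (a x v : ℤ → ℂ) :
    tri θ a x ((r : ℂ) • v) = r * tri θ a x v := by
  unfold tri
  rw [← tsum_mul_left]
  exact tsum_congr fun p => by
    simp only [Pi.smul_apply, smul_eq_mul, map_mul, Complex.conj_ofReal]; ring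

/-- A multilinear form bounded for some triple of weights is jointly continuous in the three
corresponding norms. The weights are left free because in a product rule a different slot carries
the derivative each time. -/
lemma tendsto_tri {θ : ℤ → ℤ → ℝ} {C : ℝ≥0∞} {ω₁ ω₂ ω₃ : ℤ → ℝ≥0∞}
    (h : ∀ k l, ‖(θ k l : ℂ)‖ₑ ≤ C * (ω₁ (k - l) * ω₂ l * ω₃ k)) (hC : C ≠ ⊤) {l : Filter ℝ}
    {A X V : ℝ → ℤ → ℂ} {a x v : ℤ → ℂ} (ha : wn ω₁ a ≠ ⊤) (hx : wn ω₂ x ≠ ⊤)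
    (hv : wn ω₃ v ≠ ⊤) (hA : Tendsto (fun τ => wn ω₁ (A τ - a)) l (𝓝 0))
    (hX : Tendsto (fun τ => wn ω₂ (X τ - x)) l (𝓝 0))
    (hV : Tendsto (fun τ => wn ω₃ (V τ - v)) l (𝓝 0)) :
    Tendsto (fun τ => tri θ (A τ) (X τ) (V τ)) l (𝓝 (tri θ a x v)) := by
  rw [tendsto_iff_edist_tendsto_0]
  have fx : wn ω₂ x + 1 ≠ ⊤ := ENNReal.add_ne_top.2 ⟨hx, ENNReal.one_ne_top⟩
  have fv : wn ω₃ v + 1 ≠ ⊤ := ENNReal.add_ne_top.2 ⟨hv, ENNReal.one_ne_top⟩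
  have lim : Tendsto (fun τ => C * (wn ω₁ (A τ - a) * (wn ω₂ x + 1) * (wn ω₃ v + 1))
      + C * (wn ω₁ a * wn ω₂ (X τ - x) * (wn ω₃ v + 1))
      + C * (wn ω₁ a * wn ω₂ x * wn ω₃ (V τ - v))) l (𝓝 0) :=
    tendsto_add_zero (tendsto_add_zero
      (tendsto_const_mul_zero (tendsto_mul_const_zero (tendsto_mul_const_zero hA fx) fv) hC)
      (tendsto_const_mul_zero (tendsto_mul_const_zero (tendsto_const_mul_zero hX ha) fv) hC))
      (tendsto_const_mul_zero (tendsto_const_mul_zero hV (ENNReal.mul_ne_top ha hx)) hC)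
  refine tendsto_zero_of_le lim ?_
  have bd : ∀ (ω : ℤ → ℝ≥0∞) (b c : ℤ → ℂ), wn ω (b - c) ≤ 1 → wn ω b ≤ wn ω c + 1 := by
    intro ω b c hb
    have := wn_add_le ω c (b - c)
    rw [add_sub_cancel] at this
    exact this.trans (add_le_add le_rfl hb)
  filter_upwards [hA.eventually_lt_const zero_lt_one, hX.eventually_lt_const zero_lt_one,
    hV.eventually_lt_const zero_lt_one] with τ h1 h2 h3
  have bA := ne_top_of_le_ne_top (ENNReal.add_ne_top.2 ⟨ha, ENNReal.one_ne_top⟩) (bd _ _ _ h1.le)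
  have bX := bd _ _ _ h2.le
  have bV := bd _ _ _ h3.le
  have fX := ne_top_of_le_ne_top fx bX
  have fV := ne_top_of_le_ne_top fv bV
  have s := fun {a x v : ℤ → ℂ} => summable_tri (a := a) (x := x) (v := v) h hC
  have e : tri θ (A τ) (X τ) (V τ) - tri θ a x v
      = tri θ (A τ - a) (X τ) (V τ) + tri θ a (X τ - x) (V τ) + tri θ a x (V τ - v) := by
    rw [tri_sub_one (s bA fX fV) (s ha fX fV), tri_sub_two (s ha fX fV) (s ha hx fV),
      tri_sub_three (s ha hx fV) (s ha hx hv)]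
    ring
  rw [edist_eq_enorm_sub, e]
  refine (enorm_add_le _ _).trans (add_le_add ((enorm_add_le _ _).trans (add_le_add ?_ ?_)) ?_)
  · exact (enorm_tri_le h _ _ _).trans (by gcongr)
  · exact (enorm_tri_le h _ _ _).trans (by gcongr)
  · exact enorm_tri_le h _ _ _

/-- Differentiability with values in sequences summable against `(1 + |k|)⁻¹`, of a curve
that is continuous with values in sequences summable against `1 + |k|`. -/
structure HD (S : Set ℝ) (t : ℝ) (A : ℝ → ℤ → ℂ) (a' : ℤ → ℂ) : Prop where
  fin : ∀ τ ∈ S, nr 1 (A τ) ≠ ⊤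
  mem : t ∈ S
  cont : Tendsto (fun τ => nr 1 (A τ - A t)) (𝓝[S] t) (𝓝 0)
  dfin : wn iw a' ≠ ⊤
  slope : Tendsto (fun τ => wn iw (((τ - t : ℝ) : ℂ)⁻¹ • (A τ - A t) - a')) (𝓝[S \ {t}] t) (𝓝 0)

/-- This and the two next lemmas say that a form with bounded symbol stays finite if one of its
three arguments has weight `-1` and the other two have weight `1`. -/
lemma one_le_iw_one (k l : ℤ) : 1 ≤ iw (k - l) * jw l * jw k := by
  rw [mul_assoc, mul_comm (jw l), ← iw_mul (k - l)]
  exact mul_le_mul_right (jw_sub_le k l) _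

lemma one_le_iw_two (k l : ℤ) : 1 ≤ jw (k - l) * iw l * jw k := by
  rw [mul_comm (jw (k - l)), mul_assoc, ← iw_mul l]
  refine mul_le_mul_right ?_ _
  have := jw_sub_le k (k - l)
  rwa [sub_sub_cancel, mul_comm] at this

lemma one_le_iw_three (k l : ℤ) : 1 ≤ jw (k - l) * jw l * iw k := by
  rw [mul_comm _ (iw k), ← iw_mul k]
  exact mul_le_mul_right (jw_le_sub_mul k l) _

/-- The product rule: the difference quotient of the form splits exactly into three forms with a
difference quotient in one slot, and each of them converges by continuity with its own triple of
weights. -/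
lemma HD.tri {S : Set ℝ} {t : ℝ} {A X V : ℝ → ℤ → ℂ} {a' x' v' : ℤ → ℂ} (hA : HD S t A a')
    (hX : HD S t X x') (hV : HD S t V v') {θ : ℤ → ℤ → ℝ} {C : ℝ≥0∞} (hC : C ≠ ⊤)
    (hθ : ∀ k l, ‖(θ k l : ℂ)‖ₑ ≤ C) :
    HasDerivWithinAt (fun τ => tri θ (A τ) (X τ) (V τ))
      (tri θ a' (X t) (V t) + tri θ (A t) x' (V t) + tri θ (A t) (X t) v') S t := by
  rw [hasDerivWithinAt_iff_tendsto_slope]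
  have b1 : ∀ k l, ‖(θ k l : ℂ)‖ₑ ≤ C * (iw (k - l) * jw l * jw k) := fun k l =>
    (hθ k l).trans (le_mul_of_one_le_right' (one_le_iw_one k l))
  have b2 : ∀ k l, ‖(θ k l : ℂ)‖ₑ ≤ C * (jw (k - l) * iw l * jw k) := fun k l =>
    (hθ k l).trans (le_mul_of_one_le_right' (one_le_iw_two k l))
  have b3 : ∀ k l, ‖(θ k l : ℂ)‖ₑ ≤ C * (jw (k - l) * jw l * iw k) := fun k l =>
    (hθ k l).trans (le_mul_of_one_le_right' (one_le_iw_three k l))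
  have b0 : ∀ k l, ‖(θ k l : ℂ)‖ₑ ≤ C * (jw (k - l) * jw l * jw k) := fun k l =>
    (b3 k l).trans (by gcongr; exact (iw_le_one k).trans (one_le_jw k))
  have nw : ∀ a : ℤ → ℂ, nr 1 a = wn jw a := fun a => by simp [nr_eq_wn]
  have sub : 𝓝[S \ {t}] t ≤ 𝓝[S] t := nhdsWithin_mono t sdiff_subset
  have fA := hA.fin t hA.mem
  have fX := hX.fin t hA.mem
  have fV := hV.fin t hA.mem
  have cX := hX.cont.mono_left sub
  have cV := hV.cont.mono_left sub
  simp only [nw] at fA fX fV cX cV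
  have z : ∀ (ω : ℤ → ℝ≥0∞) (b : ℤ → ℂ),
      Tendsto (fun _ : ℝ => wn ω (b - b)) (𝓝[S \ {t}] t) (𝓝 0) := fun ω b => by
    simp [wn, tendsto_const_nhds]
  have l1 := tendsto_tri b1 hC hA.dfin fX fV hA.slope cX cV
  have l2 := tendsto_tri b2 hC fA hX.dfin fV (z _ (A t)) hX.slope cV
  have l3 := tendsto_tri b3 hC fA fX hV.dfin (z _ (A t)) (z _ (X t)) hV.slope
  refine ((l1.add l2).add l3).congr' ?_
  filter_upwards [self_mem_nhdsWithin] with τ hτ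
  have gA := hA.fin τ hτ.1
  have gX := hX.fin τ hτ.1
  have gV := hV.fin τ hτ.1
  simp only [nw] at gA gX gV
  have s := fun {a x v : ℤ → ℂ} => summable_tri (a := a) (x := x) (v := v) b0 hC
  -- The scalar is real, so it passes through the conjugate in the third slot.
  have cast : ((τ - t : ℝ) : ℂ)⁻¹ = (((τ - t)⁻¹ : ℝ) : ℂ) := by push_cast; rfl
  rw [slope_def_module, tri_smul_one, tri_smul_two, cast, tri_smul_three,
    tri_sub_one (s gA gX gV) (s fA gX gV), tri_sub_two (s fA gX gV) (s fA fX gV),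
    tri_sub_three (s fA fX gV) (s fA fX fV), Complex.real_smul]
  ring
end BO4
end

/-! ### Differentiability in time of solutions -/

noncomputable section
namespace BO4
open scoped ENNReal ComplexConjugate

lemma exists_unimodular (z : ℂ) : ∃ c : ℂ, ‖c‖ ≤ 1 ∧ c * z = (‖z‖ : ℂ) := by
  rcases eq_or_ne z 0 with rfl | hz
  · exact ⟨0, by simp⟩
  · have h : (‖z‖ : ℂ) ≠ 0 := by simpa using hz
    refine ⟨conj z / ‖z‖, ?_, ?_⟩
    · rw [norm_div, RCLike.norm_conj, Complex.norm_real, norm_norm, div_self (by simpa using hz)]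
    · rw [div_mul_eq_mul_div, Complex.conj_mul', sq, mul_div_cancel_right₀ _ h]

lemma iw_eq (k : ℤ) : iw k = ENNReal.ofReal (jb k)⁻¹ := by
  rw [iw, jw, ENNReal.ofReal_inv_of_pos (jb_pos k)]

/-- Difference quotients converge if the componentwise derivative is continuous. -/
lemma tendsto_slope {S : Set ℝ} (hS : Convex ℝ S) {t : ℝ} (ht : t ∈ S) {A Y : ℝ → ℤ → ℂ}
    (hA : ∀ τ ∈ S, ∀ k, HasDerivWithinAt (fun σ => A σ k) (Y τ k) S τ)
    (hY : Tendsto (fun τ => wn iw (Y τ - Y t)) (𝓝[S] t) (𝓝 0)) :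
    Tendsto (fun τ => wn iw (((τ - t : ℝ) : ℂ)⁻¹ • (A τ - A t) - Y t)) (𝓝[S \ {t}] t) (𝓝 0) := by
  rw [ENNReal.tendsto_nhds_zero] at hY ⊢
  intro ε hε
  rcases eq_or_ne ε ⊤ with rfl | hεt
  · simp
  obtain ⟨δ, hδ, hball⟩ := Metric.mem_nhdsWithin_iff.1 (hY ε hε)
  have : Metric.ball t δ ∩ (S \ {t}) ∈ 𝓝[S \ {t}] t :=
    inter_mem (mem_nhdsWithin_of_mem_nhds (Metric.ball_mem_nhds t hδ)) self_mem_nhdsWithin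
  filter_upwards [this] with τ hτ
  have hne : τ - t ≠ 0 := sub_ne_zero.2 hτ.2.2
  unfold wn
  rw [ENNReal.tsum_eq_iSup_sum]
  refine iSup_le fun s => ?_
  set D : ℤ → ℂ := ((τ - t : ℝ) : ℂ)⁻¹ • (A τ - A t) - Y t with hD
  -- Unimodular factors turn a finite part of the weighted `ℓ¹` norm into one complex valued
  -- function of time. The mean value inequality applies to it with a bound that does not depend on
  -- the finite set.
  choose c hc1 hc2 using fun k => exists_unimodular (D k)
  have hcv : Convex ℝ (Metric.ball t δ ∩ S) := (convex_ball t δ).inter hS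
  have hder : ∀ σ ∈ Metric.ball t δ ∩ S, HasDerivWithinAt
      (fun σ => ∑ k ∈ s, (((jb k)⁻¹ : ℝ) : ℂ) * (c k * (A σ k - (σ : ℂ) * Y t k)))
      (∑ k ∈ s, (((jb k)⁻¹ : ℝ) : ℂ) * (c k * (Y σ k - Y t k))) (Metric.ball t δ ∩ S) σ := by
    intro σ hσ
    have h1 : ∀ k ∈ s, HasDerivWithinAt
        (fun σ : ℝ => (((jb k)⁻¹ : ℝ) : ℂ) * (c k * (A σ k - (σ : ℂ) * Y t k)))
        ((((jb k)⁻¹ : ℝ) : ℂ) * (c k * (Y σ k - Y t k))) (Metric.ball t δ ∩ S) σ := by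
      intro k _
      have h2 := (hA σ hσ.2 k).mono (inter_subset_right (s := Metric.ball t δ))
      have h3 : HasDerivWithinAt (fun σ : ℝ => (σ : ℂ) * Y t k) (Y t k)
          (Metric.ball t δ ∩ S) σ := by
        have := (Complex.ofRealCLM.hasDerivAt (x := σ)).hasDerivWithinAt (s := Metric.ball t δ ∩ S)
        simpa using this.mul_const (Y t k)
      exact ((h2.sub h3).const_mul _).const_mul _
    exact HasDerivWithinAt.fun_sum h1
  have hbd : ∀ σ ∈ Metric.ball t δ ∩ S,
      ‖∑ k ∈ s, (((jb k)⁻¹ : ℝ) : ℂ) * (c k * (Y σ k - Y t k))‖ ≤ ε.toReal := by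
    intro σ hσ
    have h1 : ∑ k ∈ s, iw k * ‖(Y σ - Y t) k‖ₑ ≤ ε :=
      (ENNReal.sum_le_tsum s).trans (hball hσ)
    have h2 : ‖∑ k ∈ s, (((jb k)⁻¹ : ℝ) : ℂ) * (c k * (Y σ k - Y t k))‖ₑ ≤ ε := by
      refine (enorm_sum_le _ _).trans (le_trans (Finset.sum_le_sum fun k _ => ?_) h1)
      rw [enorm_mul, enorm_mul, iw_eq, enorm_ofReal_eq, ← ofReal_norm (jb k)⁻¹,
        Real.norm_of_nonneg (inv_nonneg.2 (jb_pos k).le)]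
      refine mul_le_mul_right (mul_le_of_le_one_left' ?_) _
      rw [← ofReal_norm, ← ENNReal.ofReal_one]
      exact ENNReal.ofReal_le_ofReal (hc1 k)
    rw [← toReal_enorm]
    exact ENNReal.toReal_mono hεt h2
  have key := hcv.norm_image_sub_le_of_norm_hasDerivWithin_le hder hbd
    ⟨Metric.mem_ball_self hδ, ht⟩ ⟨hτ.1, hτ.2.1⟩
  have e : (∑ k ∈ s, (((jb k)⁻¹ : ℝ) : ℂ) * (c k * (A τ k - (τ : ℂ) * Y t k)))
      - (∑ k ∈ s, (((jb k)⁻¹ : ℝ) : ℂ) * (c k * (A t k - (t : ℂ) * Y t k)))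
      = (((τ - t) * ∑ k ∈ s, (jb k)⁻¹ * ‖D k‖ : ℝ) : ℂ) := by
    push_cast
    rw [← Finset.sum_sub_distrib, Finset.mul_sum]
    refine Finset.sum_congr rfl fun k _ => ?_
    rw [← hc2 k, hD]
    have hne' : (τ : ℂ) - t ≠ 0 := by exact_mod_cast hne
    simp only [Pi.sub_apply, Pi.smul_apply, smul_eq_mul]
    push_cast
    field_simp
    ring
  rw [e, Complex.norm_real, norm_mul, mul_comm] at key
  have key2 := le_of_mul_le_mul_right key (norm_pos_iff.2 hne)
  have e2 : ∑ k ∈ s, iw k * ‖D k‖ₑ = ENNReal.ofReal (∑ k ∈ s, (jb k)⁻¹ * ‖D k‖) := by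
    rw [ENNReal.ofReal_sum_of_nonneg fun k _ =>
      mul_nonneg (inv_nonneg.2 (jb_pos k).le) (norm_nonneg _)]
    refine Finset.sum_congr rfl fun k _ => ?_
    rw [ENNReal.ofReal_mul (inv_nonneg.2 (jb_pos k).le), iw_eq, ofReal_norm]
  rw [e2]
  exact ENNReal.ofReal_le_of_le_toReal ((le_abs_self _).trans key2)

lemma wn_iw_conv_le (a b : ℤ → ℂ) : wn iw (conv a b) ≤ nr 1 a * wn iw b := by
  refine le_trans (ENNReal.tsum_le_tsum fun k => ?_)
    (tsum_econv (wt 1 a) (fun k => iw k * ‖b k‖ₑ)).le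
  refine (mul_le_mul_right (enorm_conv_le a b k) _).trans ?_
  unfold econv
  rw [← ENNReal.tsum_mul_left]
  refine ENNReal.tsum_le_tsum fun j => ?_
  simp only [wt, pow_zero, one_mul, pow_one]
  have h : iw k ≤ jw (k - j) * iw j := by
    have := inv_jw_le k (k - j)
    rw [sub_sub_cancel] at this
    rw [mul_comm]; exact this
  calc iw k * (‖a (k - j)‖ₑ * ‖b j‖ₑ) ≤ jw (k - j) * iw j * (‖a (k - j)‖ₑ * ‖b j‖ₑ) := by gcongr
    _ = _ := by ring

lemma summable_conv_iw {a b : ℤ → ℂ} (ha : nr 1 a ≠ ⊤) (hb : wn iw b ≠ ⊤) (k : ℤ) :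
    Summable fun j => a (k - j) * b j := by
  apply summable_of_tsum_enorm
  refine ne_top_of_le_ne_top (ENNReal.mul_ne_top (jw_ne_top k) (ENNReal.mul_ne_top ha hb))
    (b := jw k * (nr 1 a * wn iw b)) ?_
  have h2 := ENNReal.le_tsum (f := econv (wt 1 a) (fun k => iw k * ‖b k‖ₑ)) k
  rw [tsum_econv] at h2
  refine le_trans ?_ (mul_le_mul_right h2 _)
  unfold econv
  rw [← ENNReal.tsum_mul_left]
  refine ENNReal.tsum_le_tsum fun j => ?_
  rw [enorm_mul, wt, pow_one]
  calc ‖a (k - j)‖ₑ * ‖b j‖ₑ = 1 * (‖a (k - j)‖ₑ * ‖b j‖ₑ) := (one_mul _).symm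
    _ ≤ jw (k - j) * iw j * jw k * (‖a (k - j)‖ₑ * ‖b j‖ₑ) := by gcongr; exact one_le_iw_two k j
    _ = _ := by ring

lemma HD.sub {S : Set ℝ} {t : ℝ} {A B : ℝ → ℤ → ℂ} {a' b' : ℤ → ℂ} (hA : HD S t A a')
    (hB : HD S t B b') : HD S t (fun τ => A τ - B τ) (a' - b') where
  fin τ hτ := ne_top_of_le_ne_top (ENNReal.add_ne_top.2 ⟨hA.fin τ hτ, hB.fin τ hτ⟩)
    (nr_sub_le _ _ _)
  mem := hA.mem
  cont := tendsto_zero_of_le (tendsto_add_zero hA.cont hB.cont) (Eventually.of_forall fun τ => by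
    rw [sub_sub_sub_comm]; exact nr_sub_le _ _ _)
  dfin := ne_top_of_le_ne_top (ENNReal.add_ne_top.2 ⟨hA.dfin, hB.dfin⟩) (wn_sub_le _ _ _)
  slope := tendsto_zero_of_le (tendsto_add_zero hA.slope hB.slope) (Eventually.of_forall fun τ => by
    refine le_trans (le_of_eq ?_) (wn_sub_le _ _ _)
    congr 1
    rw [sub_sub_sub_comm, smul_sub]; abel)

lemma HD.const {S : Set ℝ} {t : ℝ} (ht : t ∈ S) {a : ℤ → ℂ} (ha : nr 1 a ≠ ⊤) :
    HD S t (fun _ => a) 0 where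
  fin _ _ := ha
  mem := ht
  cont := by simp [nr_zero_fun, tendsto_const_nhds]
  dfin := by simp [wn]
  slope := by simp [wn, tendsto_const_nhds]

lemma conv_sub_right {a b b' : ℤ → ℂ} (h : ∀ k, Summable fun j => a (k - j) * b j)
    (h' : ∀ k, Summable fun j => a (k - j) * b' j) :
    conv a (b - b') = conv a b - conv a b' := by
  funext k
  simp only [conv, Pi.sub_apply, mul_sub]
  exact (h k).tsum_sub (h' k)

lemma conv_smul_right (r : ℂ) (a b : ℤ → ℂ) : conv a (r • b) = r • conv a b := by
  funext k
  simp only [conv, Pi.smul_apply, smul_eq_mul]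
  rw [← tsum_mul_left]
  exact tsum_congr fun j => by ring

lemma HD.square {S : Set ℝ} {t : ℝ} {A : ℝ → ℤ → ℂ} {a' : ℤ → ℂ} (hA : HD S t A a') :
    HD S t (fun τ => conv (A τ) (A τ)) ((2 : ℂ) • conv (A t) a') where
  fin τ hτ := nr_conv_ne_top (hA.fin τ hτ) (hA.fin τ hτ)
  mem := hA.mem
  cont := (CT.conv ⟨hA.fin t hA.mem, hA.cont⟩ ⟨hA.fin t hA.mem, hA.cont⟩).2
  dfin := by
    rw [wn_smul]
    exact ENNReal.mul_ne_top enorm_ne_top (ne_top_of_le_ne_top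
      (ENNReal.mul_ne_top (hA.fin t hA.mem) hA.dfin) (wn_iw_conv_le _ _))
  slope := by
    have sub : 𝓝[S \ {t}] t ≤ 𝓝[S] t := nhdsWithin_mono t sdiff_subset
    have fa := hA.fin t hA.mem
    have c0 := hA.cont.mono_left sub
    set D : ℝ → ℤ → ℂ := fun τ => ((τ - t : ℝ) : ℂ)⁻¹ • (A τ - A t) with hD
    have lim : Tendsto (fun τ => nr 1 (A τ - A t) * (wn iw a' + 1)
        + 2 * nr 1 (A t) * wn iw (D τ - a')) (𝓝[S \ {t}] t) (𝓝 0) :=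
      tendsto_add_zero
        (tendsto_mul_const_zero c0 (ENNReal.add_ne_top.2 ⟨hA.dfin, ENNReal.one_ne_top⟩))
        (tendsto_const_mul_zero hA.slope (ENNReal.mul_ne_top ENNReal.ofNat_ne_top fa))
    refine tendsto_zero_of_le lim ?_
    filter_upwards [self_mem_nhdsWithin, hA.slope.eventually_lt_const zero_lt_one] with τ hτ h1
    have fA := hA.fin τ hτ.1
    have fd : nr 1 (A τ - A t) ≠ ⊤ := ne_top_of_le_ne_top (ENNReal.add_ne_top.2 ⟨fA, fa⟩)
      (nr_sub_le _ _ _)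
    have bD : wn iw (D τ) ≤ wn iw a' + 1 := by
      have := wn_add_le iw a' (D τ - a')
      rw [add_sub_cancel] at this
      exact this.trans (add_le_add le_rfl h1.le)
    have fD : wn iw (D τ) ≠ ⊤ := ne_top_of_le_ne_top
      (ENNReal.add_ne_top.2 ⟨hA.dfin, ENNReal.one_ne_top⟩) bD
    -- In the first term the difference tends to zero with weight `1` while the quotient stays
    -- bounded with weight `-1`; in the second, the quotient converges.
    have e : ((τ - t : ℝ) : ℂ)⁻¹ • (conv (A τ) (A τ) - conv (A t) (A t))
        - (2 : ℂ) • conv (A t) a'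
        = conv (A τ - A t) (D τ) + (2 : ℂ) • conv (A t) (D τ - a') := by
      have g0 := nr_ne_top_mono zero_le_one fA
      have g1 := nr_ne_top_mono zero_le_one fa
      have g2 := nr_ne_top_mono zero_le_one fd
      have h : ∀ p q : WA, p * p - q * q = (p - q) * (p - q) + q * (p - q) + q * (p - q) :=
        fun p q => by ring
      have := congrArg WA.val (h ⟨A τ, g0⟩ ⟨A t, g1⟩)
      simp only [WA.val_add, WA.val_mul, WA.val_sub] at this
      rw [this, conv_sub_right (summable_conv_iw fa fD) (summable_conv_iw fa hA.dfin), hD]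
      simp only [conv_smul_right]
      funext k
      simp only [Pi.add_apply, Pi.sub_apply, Pi.smul_apply, smul_eq_mul]
      ring
    rw [e]
    refine (wn_add_le _ _ _).trans (add_le_add ((wn_iw_conv_le _ _).trans ?_) ?_)
    · gcongr
    · rw [wn_smul, mul_assoc]
      have h2 : ‖(2 : ℂ)‖ₑ = 2 := by
        rw [← ofReal_norm]; simp
      rw [h2]
      exact mul_le_mul_right (wn_iw_conv_le _ _) _

/-- The right-hand side of the equation on the Fourier side. -/
def rhs (c : Coeffs) (ε : ℝ) (a : ℤ → ℂ) : ℤ → ℂ :=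
  ml (fun k => -Complex.I * (phi k : ℂ)) a + ml symD (nlin c a)
    - (ε : ℂ) • ml (fun k => ((k : ℂ)) ^ 4) a

lemma enorm_phi_le (k : ℤ) : ‖-Complex.I * (phi k : ℂ)‖ₑ ≤ jw k ^ (3 + 1) := by
  rw [← ofReal_jb_pow, ← ofReal_norm, norm_mul, norm_neg, Complex.norm_I, one_mul,
    Complex.norm_real, Real.norm_eq_abs]
  refine ENNReal.ofReal_le_ofReal ?_
  unfold phi
  rw [abs_mul, abs_pow, abs_abs, ← pow_succ']
  exact pow_le_pow_left₀ (abs_nonneg _) (abs_le_jb k) 4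

lemma enorm_pow_four_le (k : ℤ) : ‖(k : ℂ) ^ 4‖ₑ ≤ jw k ^ (3 + 1) := by
  rw [← ofReal_jb_pow, ← ofReal_norm, norm_pow, Complex.norm_intCast]
  exact ENNReal.ofReal_le_ofReal (pow_le_pow_left₀ (abs_nonneg _) (abs_le_jb k) 4)

/-- The right-hand side has order four, in the dispersive and the viscous term, so it maps weight
`3` continuously to weight `-1`. The nonlinearity contains two derivatives before the outer one and
is no worse. -/
lemma rhs_ct (c : Coeffs) (ε : ℝ) {l : Filter ℝ} {A : ℝ → ℤ → ℂ} {a : ℤ → ℂ} (h : CT 3 l A a) :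
    wn iw (rhs c ε a) ≠ ⊤ ∧ Tendsto (fun τ => wn iw (rhs c ε (A τ) - rhs c ε a)) l (𝓝 0) := by
  have hn := ct_nlin c h
  have b : ∀ x n : ℤ → ℂ, wn iw (ml (fun k => -Complex.I * (phi k : ℂ)) x + ml symD n
      - (ε : ℂ) • ml (fun k => ((k : ℂ)) ^ 4) x) ≤ nr 3 x + nr 0 n + ‖(ε : ℂ)‖ₑ * nr 3 x := by
    intro x n
    refine (wn_sub_le _ _ _).trans (add_le_add ((wn_add_le _ _ _).trans (add_le_add
      (wn_iw_ml_le enorm_phi_le x) (wn_iw_ml_le enorm_symD_le n))) ?_)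
    rw [wn_smul]
    exact mul_le_mul_right (wn_iw_ml_le enorm_pow_four_le x) _
  refine ⟨ne_top_of_le_ne_top (ENNReal.add_ne_top.2 ⟨ENNReal.add_ne_top.2 ⟨h.1, hn.1⟩,
    ENNReal.mul_ne_top enorm_ne_top h.1⟩) (b a _), ?_⟩
  refine tendsto_zero_of_le (tendsto_add_zero (tendsto_add_zero h.2 hn.2)
    (tendsto_const_mul_zero h.2 (enorm_ne_top (x := (ε : ℂ))))) (Eventually.of_forall fun τ => ?_)
  refine le_trans (le_of_eq ?_) (b _ _)
  congr 1
  simp only [rhs, ml_sub, smul_sub]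
  abel

/-- Solutions are differentiable with values in weighted summable sequences. -/
lemma SolvesReg.hd {c : Coeffs} {ε T s₀ : ℝ} (hs : 7 / 2 < s₀) {u : ℝ → Torus → ℝ}
    (hu : ContInHs s₀ (Icc 0 T) u) (h : SolvesReg c ε T u) {t : ℝ} (ht : t ∈ Icc 0 T) :
    HD (Icc 0 T) t (fun τ => coeff (u τ)) (rhs c ε (coeff (u t))) := by
  have hs3 : ((3 : ℕ) : ℝ) + 1 / 2 < s₀ := by norm_num; linarith
  have fin3 : ∀ τ ∈ Icc 0 T, nr 3 (coeff (u τ)) ≠ ⊤ := fun τ hτ => (hu τ hτ).1.nr_ne_top hs3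
  have ct : CT 3 (𝓝[Icc 0 T] t) (fun τ => coeff (u τ)) (coeff (u t)) :=
    ⟨fin3 t ht, hu.tendsto hs3 ht⟩
  have r := rhs_ct c ε ct
  refine ⟨fun τ hτ => nr_ne_top_mono (by norm_num) (fin3 τ hτ), ht,
    (ct.mono (show 1 ≤ 3 by norm_num)).2, r.1, ?_⟩
  refine tendsto_slope (convex_Icc 0 T) ht (Y := fun τ => rhs c ε (coeff (u τ)))
    (fun τ hτ k => ?_) r.2
  convert h τ hτ k using 1
  rw [coeff_opK c ((hu τ hτ).1.wiener (by linarith)) (fin3 τ hτ)]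
  simp only [rhs, Pi.sub_apply, Pi.add_apply, ml, Pi.smul_apply, smul_eq_mul, symD, phi, mul_pow,
    Complex.I_pow_four]
  push_cast
  ring
end BO4
end

noncomputable section
namespace BO4
open scoped ENNReal ComplexConjugate

/-! ### The derivative of the energy -/

/-- The diagonal sesquilinear form with symbol `m`. -/
def pr (m : ℤ → ℝ) (x w : ℤ → ℂ) : ℂ := ∑' k, (m k : ℂ) * x k * conj (w k)

/-- A diagonal form is a trilinear form whose background is the constant function `1`. The
derivatives of `‖w‖²` and `‖w‖²_{H⁻¹}` are thereby special cases of the trilinear product rule. -/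
lemma tri_single (θ : ℤ → ℤ → ℝ) (x w : ℤ → ℂ) :
    tri θ (Pi.single 0 1) x w = pr (fun k => θ k k) x w := by
  unfold tri pr
  have hi : Function.Injective fun k : ℤ => (k, k) := fun a b h => congrArg Prod.fst h
  rw [← hi.tsum_eq]
  · refine tsum_congr fun k => ?_
    simp
  · intro p hp
    refine ⟨p.1, ?_⟩
    by_contra h
    apply hp
    have : p.1 - p.2 ≠ 0 := fun h0 => h (Prod.ext rfl (sub_eq_zero.1 h0))
    simp [Pi.single_eq_of_ne this]

lemma pr_self_re (m : ℤ → ℝ) (w : ℤ → ℂ) : (pr m w w).re = ∑' k, m k * ‖w k‖ ^ 2 := by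
  rw [← Complex.ofReal_re (∑' k, m k * ‖w k‖ ^ 2), Complex.ofReal_tsum]
  unfold pr
  congr 1
  refine tsum_congr fun k => ?_
  rw [mul_assoc, Complex.mul_conj']
  push_cast; rfl

lemma sqn_eq (w : ℤ → ℂ) : sqn w = (pr (fun _ => 1) w w).re := by
  rw [pr_self_re]; simp [sqn]

lemma omn_eq (w : ℤ → ℂ) : omn w = (pr om w w).re := (pr_self_re om w).symm

lemma nr_single (n : ℕ) : nr n (Pi.single 0 1) ≠ ⊤ := by
  unfold nr
  rw [tsum_eq_single 0]
  · simp [wt, jw]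
  · intro k hk; simp [wt, Pi.single_eq_of_ne hk]

lemma hasDerivWithinAt_re {F : ℝ → ℂ} {F' : ℂ} {S : Set ℝ} {t : ℝ}
    (h : HasDerivWithinAt F F' S t) : HasDerivWithinAt (fun τ => (F τ).re) F'.re S t := by
  have := Complex.reCLM.hasFDerivAt (x := F t)
  exact this.comp_hasDerivWithinAt t h

lemma hasDerivWithinAt_of_eq {F G : ℝ → ℝ} {F' G' : ℝ} {S : Set ℝ} {t : ℝ}
    (h : HasDerivWithinAt F F' S t) (e : ∀ τ, G τ = F τ) (e' : G' = F') :
    HasDerivWithinAt G G' S t := by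
  rw [funext e, e']; exact h

/-- The derivative of a real trilinear form that is symmetric in the last two arguments. -/
lemma HD.re_tri {S : Set ℝ} {t : ℝ} {A X : ℝ → ℤ → ℂ} {a' x' : ℤ → ℂ} (hA : HD S t A a')
    (hX : HD S t X x') (hr : RealSeq (A t)) {θ : ℤ → ℤ → ℝ} (hs : ∀ k l, θ k l = θ l k) {C : ℝ}
    (hθ : ∀ k l, |θ k l| ≤ C) :
    HasDerivWithinAt (fun τ => (BO4.tri θ (A τ) (X τ) (X τ)).re)
      ((BO4.tri θ a' (X t) (X t)).re + 2 * (BO4.tri θ (A t) x' (X t)).re) S t := by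
  have h := hasDerivWithinAt_re (hA.tri hX hX (ENNReal.ofReal_ne_top (r := C))
    fun k l => enorm_real_le (hθ k l))
  convert h using 1
  have e := conj_tri (θ := θ) hr (X t) x'
  have e2 : (fun k l => θ l k) = θ := by funext k l; exact hs l k
  rw [e2] at e
  rw [Complex.add_re, Complex.add_re, ← Complex.conj_re (BO4.tri θ (A t) (X t) x'), e]
  ring

lemma realSeq_single : RealSeq (Pi.single 0 1) := fun k => by
  rcases eq_or_ne k 0 with rfl | hk
  · simp
  · rw [Pi.single_eq_of_ne hk, Pi.single_eq_of_ne (neg_ne_zero.2 hk), map_zero]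

lemma HD.re_pr {S : Set ℝ} {t : ℝ} {X : ℝ → ℤ → ℂ} {x' : ℤ → ℂ} (hX : HD S t X x') {m : ℤ → ℝ}
    {C : ℝ} (hm : ∀ k, |m k| ≤ C) :
    HasDerivWithinAt (fun τ => (pr m (X τ) (X τ)).re) (2 * (pr m x' (X t)).re) S t := by
  have h := (HD.const hX.mem (nr_single 1)).re_tri hX realSeq_single
    (θ := fun k l => if k = l then m k else 0) (C := max C 0) (fun k l => by
      by_cases h : k = l
      · subst h; rfl
      · rw [if_neg h, if_neg (Ne.symm h)]) (fun k l => by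
      split_ifs
      · exact (hm k).trans (le_max_left _ _)
      · simp)
  simp only [tri_single, if_true] at h
  convert h using 1
  simp [BO4.tri]

/-- The derivative of the energy at `(a, w)` in the direction `(y, x)`. -/
def dE (c : Coeffs) (κ : ℝ) (a w y x : ℤ → ℂ) : ℝ :=
  (pr (fun _ => 1) x w).re + wgt κ a * (pr om x w).re
    + 1 / 2 * omn w * (κ * (4 * Real.pi * (pr (fun _ => 1) y a).re)
        * (1 + 2 * (2 * Real.pi * sqn a)))
    + lam₁ c 0 / 4 * ((tri th₁ y w w).re + 2 * (tri th₁ a x w).re)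
    + lam₂ c 0 / 4 * ((tri th₂ y w w).re + 2 * (tri th₂ a x w).re)
    + mu₃ c * ((tri (fun k l => Jc k * Jc l) ((2 : ℂ) • conv a y) w w).re
        + 2 * (tri (fun k l => Jc k * Jc l) (conv a a) x w).re)

lemma RealSeq.conv {a b : ℤ → ℂ} (ha : RealSeq a) (hb : RealSeq b) : RealSeq (conv a b) := by
  intro k
  unfold BO4.conv
  rw [Complex.conj_tsum, ← (Equiv.neg ℤ).tsum_eq]
  refine tsum_congr fun j => ?_
  rw [map_mul, ← ha, ← hb]
  simp only [Equiv.neg_apply]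
  congr 2
  ring

lemma abs_JJ_le (k l : ℤ) : |Jc k * Jc l| ≤ 1 := by
  rw [abs_of_nonneg (mul_nonneg (Jc_nonneg k) (Jc_nonneg l))]
  exact mul_le_one₀ (Jc_le_one k) (Jc_nonneg l) (Jc_le_one l)

lemma corrSeq_eq (c : Coeffs) (a w : ℤ → ℂ) : corrSeq c a w =
    lam₁ c 0 / 4 * (tri th₁ a w w).re + lam₂ c 0 / 4 * (tri th₂ a w w).re
      + mu₃ c * (tri (fun k l => Jc k * Jc l) (conv a a) w w).re := by
  simp [corrSeq]

lemma hasDerivWithinAt_eSeq (c : Coeffs) (κ : ℝ) {S : Set ℝ} {t : ℝ} {A X : ℝ → ℤ → ℂ}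
    {y x : ℤ → ℂ} (hA : HD S t A y) (hX : HD S t X x) (hr : RealSeq (A t)) :
    HasDerivWithinAt (fun τ => eSeq c κ (A τ) (X τ)) (dE c κ (A t) (X t) y x) S t := by
  have one : ∀ k : ℤ, |(fun _ => (1 : ℝ)) k| ≤ 1 := fun k => by simp
  have h1 := hX.re_pr one
  have h2 := hX.re_pr (m := om) (C := 1) fun k => by
    rw [abs_of_nonneg (om_nonneg k)]; exact om_le_one k
  have h3 := hA.re_pr one
  have h4 := hA.re_tri hX hr th₁_comm abs_th₁_le_one
  have h5 := hA.re_tri hX hr th₂_comm abs_th₂_le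
  have h6 := hA.square.re_tri hX (hr.conv hr) (θ := fun k l => Jc k * Jc l)
    (fun k l => mul_comm _ _) abs_JJ_le
  simp only [← sqn_eq, ← omn_eq] at h1 h2 h3
  have h7 : HasDerivWithinAt (fun τ => wgt κ (A τ))
      (κ * (4 * Real.pi * (pr (fun _ => 1) y (A t)).re) * (1 + 2 * (2 * Real.pi * sqn (A t)))) S t := by
    have h8 := (h3.const_mul (2 * Real.pi))
    have := ((h8.const_mul κ).const_add 1).add ((h8.pow 2).const_mul κ)
    refine hasDerivWithinAt_of_eq this (fun τ => ?_) ?_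
    · simp [wgt]
    · push_cast; ring
  have h8 := (((h1.const_mul (1 / 2)).add ((h2.const_mul (1 / 2)).mul h7)).add
    (((h4.const_mul (lam₁ c 0 / 4)).add (h5.const_mul (lam₂ c 0 / 4))).add
      (h6.const_mul (mu₃ c))))
  refine hasDerivWithinAt_of_eq h8 (fun τ => ?_) ?_
  · simp only [eSeq, corrSeq_eq, Pi.add_apply, Pi.mul_apply]
  · unfold dE
    ring
end BO4
end

noncomputable section
namespace BO4
open scoped ENNReal ComplexConjugate

/-! ### Trilinear and quadrilinear forms with unbounded symbols -/

/-- The operator with kernel `a (k - l) θ k l`. -/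
def op (θ : ℤ → ℤ → ℝ) (a x : ℤ → ℂ) (k : ℤ) : ℂ := ∑' l, a (k - l) * (θ k l : ℂ) * x l

/-- The quadrilinear form with symbol `Ψ`. -/
def quad (Ψ : ℤ → ℤ → ℤ → ℝ) (a b x v : ℤ → ℂ) : ℂ :=
  ∑' q : (ℤ × ℤ) × ℤ, a (q.1.1 - q.1.2) * b (q.1.2 - q.2) * (Ψ q.1.1 q.1.2 q.2 : ℂ) * x q.2
    * conj (v q.1.1)

/-- Symbols of trilinear forms on sequences of weight `n` and two sequences of weight `3`. -/
def Gd (n : ℕ) (θ : ℤ → ℤ → ℝ) : Prop :=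
  ∃ C : ℝ, ∀ k l, |θ k l| ≤ C * (jb (k - l) ^ n * jb l ^ 3 * jb k ^ 3)

/-- Symbols of quadrilinear forms on sequences of weights `n` and `m` and two of weight `3`. -/
def Gq (n m : ℕ) (Ψ : ℤ → ℤ → ℤ → ℝ) : Prop :=
  ∃ C : ℝ, ∀ k j l, |Ψ k j l| ≤ C * (jb (k - j) ^ n * jb (j - l) ^ m * jb l ^ 3 * jb k ^ 3)

lemma jb_sub_comm (k l : ℤ) : jb (k - l) = jb (l - k) := by rw [← jb_neg, neg_sub]

lemma Gd.add {n : ℕ} {θ η : ℤ → ℤ → ℝ} (h : Gd n θ) (h' : Gd n η) :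
    Gd n (fun k l => θ k l + η k l) := by
  obtain ⟨C, hC⟩ := h
  obtain ⟨D, hD⟩ := h'
  exact ⟨C + D, fun k l => (abs_add_le _ _).trans (by rw [add_mul]; exact add_le_add (hC k l) (hD k l))⟩

lemma Gd.const_mul {n : ℕ} {θ : ℤ → ℤ → ℝ} (r : ℝ) (h : Gd n θ) : Gd n (fun k l => r * θ k l) := by
  obtain ⟨C, hC⟩ := h
  refine ⟨|r| * C, fun k l => ?_⟩
  rw [abs_mul, mul_assoc]
  exact mul_le_mul_of_nonneg_left (hC k l) (abs_nonneg r)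

lemma Gd.swap {n : ℕ} {θ : ℤ → ℤ → ℝ} (h : Gd n θ) : Gd n (fun k l => θ l k) := by
  obtain ⟨C, hC⟩ := h
  refine ⟨C, fun k l => (hC l k).trans (le_of_eq ?_)⟩
  rw [jb_sub_comm]; ring

lemma Gq.add {n m : ℕ} {Ψ Ξ : ℤ → ℤ → ℤ → ℝ} (h : Gq n m Ψ) (h' : Gq n m Ξ) :
    Gq n m (fun k j l => Ψ k j l + Ξ k j l) := by
  obtain ⟨C, hC⟩ := h
  obtain ⟨D, hD⟩ := h'
  exact ⟨C + D, fun k j l =>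
    (abs_add_le _ _).trans (by rw [add_mul]; exact add_le_add (hC k j l) (hD k j l))⟩

lemma Gq.const_mul {n m : ℕ} {Ψ : ℤ → ℤ → ℤ → ℝ} (r : ℝ) (h : Gq n m Ψ) :
    Gq n m (fun k j l => r * Ψ k j l) := by
  obtain ⟨C, hC⟩ := h
  refine ⟨|r| * C, fun k j l => ?_⟩
  rw [abs_mul, mul_assoc]
  exact mul_le_mul_of_nonneg_left (hC k j l) (abs_nonneg r)

lemma Gq.swap {n m : ℕ} {Ψ : ℤ → ℤ → ℤ → ℝ} (h : Gq n m Ψ) : Gq m n (fun k j l => Ψ l j k) := by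
  obtain ⟨C, hC⟩ := h
  refine ⟨C, fun k j l => (hC l j k).trans (le_of_eq ?_)⟩
  rw [jb_sub_comm l j, jb_sub_comm j k]; ring

/-- The growth classes serve only to justify rearrangements: separate symbols may lose up to three
weights on each copy of `w`, which is affordable since `w` has weight `3`. The quantitative bounds
come later, for combined symbols, and use only the `ℓ²` norm of `w`. -/
lemma summable_gd {n : ℕ} {θ : ℤ → ℤ → ℝ} (h : Gd n θ) {a x v : ℤ → ℂ} (ha : nr n a ≠ ⊤)
    (hx : nr 3 x ≠ ⊤) (hv : nr 3 v ≠ ⊤) :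
    Summable fun p : ℤ × ℤ => a (p.1 - p.2) * (θ p.1 p.2 : ℂ) * x p.2 * conj (v p.1) := by
  obtain ⟨C, hC⟩ := h
  refine summable_tri (C := ENNReal.ofReal C) (ω₁ := fun k => jw k ^ n) (ω₂ := fun k => jw k ^ 3)
    (ω₃ := fun k => jw k ^ 3) (fun k l => ?_) ENNReal.ofReal_ne_top ha hx hv
  refine (enorm_real_le (hC k l)).trans (le_of_eq ?_)
  have h0 : ∀ (k : ℤ) (n : ℕ), 0 ≤ jb k ^ n := fun k n => pow_nonneg (jb_pos k).le n
  rw [ENNReal.ofReal_mul' (mul_nonneg (mul_nonneg (h0 _ _) (h0 _ _)) (h0 _ _)),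
    ENNReal.ofReal_mul (mul_nonneg (h0 _ _) (h0 _ _)), ENNReal.ofReal_mul (h0 _ _)]
  simp only [ofReal_jb_pow]

lemma tsum_quad_le (A B X V : ℤ → ℝ≥0∞) :
    ∑' q : (ℤ × ℤ) × ℤ, A (q.1.1 - q.1.2) * B (q.1.2 - q.2) * X q.2 * V q.1.1
      = ∑' k, econv A (econv B X) k * V k := by
  rw [ENNReal.tsum_prod', ENNReal.tsum_prod']
  refine tsum_congr fun k => ?_
  unfold econv
  rw [← ENNReal.tsum_mul_right]
  refine tsum_congr fun j => ?_
  simp_rw [mul_assoc]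
  rw [ENNReal.tsum_mul_left]
  congr 1
  simp_rw [← mul_assoc]
  rw [ENNReal.tsum_mul_right]

lemma tsum_mul_le_mul_tsum (A V : ℤ → ℝ≥0∞) : ∑' k, A k * V k ≤ (∑' k, A k) * ∑' k, V k := by
  rw [← ENNReal.tsum_mul_right]
  exact ENNReal.tsum_le_tsum fun k => mul_le_mul_right (ENNReal.le_tsum k) _

lemma summable_gq {n m : ℕ} {Ψ : ℤ → ℤ → ℤ → ℝ} (h : Gq n m Ψ) {a b x v : ℤ → ℂ}
    (ha : nr n a ≠ ⊤) (hb : nr m b ≠ ⊤) (hx : nr 3 x ≠ ⊤) (hv : nr 3 v ≠ ⊤) :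
    Summable fun q : (ℤ × ℤ) × ℤ => a (q.1.1 - q.1.2) * b (q.1.2 - q.2)
      * (Ψ q.1.1 q.1.2 q.2 : ℂ) * x q.2 * conj (v q.1.1) := by
  obtain ⟨C, hC⟩ := h
  apply summable_of_tsum_enorm
  have fin : ENNReal.ofReal C * ∑' q : (ℤ × ℤ) × ℤ, wt n a (q.1.1 - q.1.2) * wt m b (q.1.2 - q.2)
      * wt 3 x q.2 * wt 3 v q.1.1 ≠ ⊤ := by
    rw [tsum_quad_le]
    refine ENNReal.mul_ne_top ENNReal.ofReal_ne_top (ne_top_of_le_ne_top ?_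
      (tsum_mul_le_mul_tsum _ _))
    rw [tsum_econv, tsum_econv]
    exact ENNReal.mul_ne_top (ENNReal.mul_ne_top ha (ENNReal.mul_ne_top hb hx)) hv
  refine ne_top_of_le_ne_top fin ?_
  rw [← ENNReal.tsum_mul_left]
  refine ENNReal.tsum_le_tsum fun q => ?_
  have h0 : ∀ (k : ℤ) (n : ℕ), 0 ≤ jb k ^ n := fun k n => pow_nonneg (jb_pos k).le n
  have hb := enorm_real_le (hC q.1.1 q.1.2 q.2)
  rw [ENNReal.ofReal_mul' (mul_nonneg (mul_nonneg (mul_nonneg (h0 _ _) (h0 _ _)) (h0 _ _))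
    (h0 _ _)), ENNReal.ofReal_mul (mul_nonneg (mul_nonneg (h0 _ _) (h0 _ _)) (h0 _ _)),
    ENNReal.ofReal_mul (mul_nonneg (h0 _ _) (h0 _ _)), ENNReal.ofReal_mul (h0 _ _)] at hb
  simp only [ofReal_jb_pow] at hb
  simp only [enorm_mul, enorm_conj, wt]
  calc ‖a (q.1.1 - q.1.2)‖ₑ * ‖b (q.1.2 - q.2)‖ₑ * ‖(Ψ q.1.1 q.1.2 q.2 : ℂ)‖ₑ * ‖x q.2‖ₑ
        * ‖v q.1.1‖ₑ
      ≤ ‖a (q.1.1 - q.1.2)‖ₑ * ‖b (q.1.2 - q.2)‖ₑ * (ENNReal.ofReal C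
        * (jw (q.1.1 - q.1.2) ^ n * jw (q.1.2 - q.2) ^ m * jw q.2 ^ 3 * jw q.1.1 ^ 3)) * ‖x q.2‖ₑ
        * ‖v q.1.1‖ₑ := by gcongr
    _ = _ := by ring

lemma tri_add_symbol {θ η : ℤ → ℤ → ℝ} {n : ℕ} (h : Gd n θ) (h' : Gd n η) {a x v : ℤ → ℂ}
    (ha : nr n a ≠ ⊤) (hx : nr 3 x ≠ ⊤) (hv : nr 3 v ≠ ⊤) :
    tri (fun k l => θ k l + η k l) a x v = tri θ a x v + tri η a x v := by
  unfold tri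
  rw [← (summable_gd h ha hx hv).tsum_add (summable_gd h' ha hx hv)]
  exact tsum_congr fun p => by push_cast; ring

lemma tri_mul_symbol (r : ℝ) (θ : ℤ → ℤ → ℝ) (a x v : ℤ → ℂ) :
    tri (fun k l => r * θ k l) a x v = r * tri θ a x v := by
  unfold tri
  rw [← tsum_mul_left]
  exact tsum_congr fun p => by push_cast; ring

lemma quad_add_symbol {Ψ Ξ : ℤ → ℤ → ℤ → ℝ} {n m : ℕ} (h : Gq n m Ψ) (h' : Gq n m Ξ)
    {a b x v : ℤ → ℂ} (ha : nr n a ≠ ⊤) (hb : nr m b ≠ ⊤) (hx : nr 3 x ≠ ⊤) (hv : nr 3 v ≠ ⊤) :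
    quad (fun k j l => Ψ k j l + Ξ k j l) a b x v = quad Ψ a b x v + quad Ξ a b x v := by
  unfold quad
  rw [← (summable_gq h ha hb hx hv).tsum_add (summable_gq h' ha hb hx hv)]
  exact tsum_congr fun p => by push_cast; ring

lemma quad_mul_symbol (r : ℝ) (Ψ : ℤ → ℤ → ℤ → ℝ) (a b x v : ℤ → ℂ) :
    quad (fun k j l => r * Ψ k j l) a b x v = r * quad Ψ a b x v := by
  unfold quad
  rw [← tsum_mul_left]
  exact tsum_congr fun p => by push_cast; ring

lemma conj_quad {Ψ : ℤ → ℤ → ℤ → ℝ} {a b : ℤ → ℂ} (ha : RealSeq a) (hb : RealSeq b)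
    (x v : ℤ → ℂ) : conj (quad Ψ a b x v) = quad (fun k j l => Ψ l j k) b a v x := by
  unfold quad
  let E : (ℤ × ℤ) × ℤ ≃ (ℤ × ℤ) × ℤ :=
    { toFun := fun q => ((q.2, q.1.2), q.1.1)
      invFun := fun q => ((q.2, q.1.2), q.1.1)
      left_inv := fun q => rfl
      right_inv := fun q => rfl }
  rw [Complex.conj_tsum, ← E.tsum_eq]
  refine tsum_congr fun q => ?_
  simp only [E, Equiv.coe_fn_mk, map_mul, Complex.conj_conj, Complex.conj_ofReal]
  rw [← ha, ← hb, neg_sub, neg_sub]; ring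

lemma pr_op {m : ℤ → ℝ} {θ : ℤ → ℤ → ℝ} {n : ℕ} (h : Gd n fun k l => m k * θ k l)
    {a x v : ℤ → ℂ} (ha : nr n a ≠ ⊤) (hx : nr 3 x ≠ ⊤) (hv : nr 3 v ≠ ⊤) :
    pr m (op θ a x) v = tri (fun k l => m k * θ k l) a x v := by
  unfold tri pr op
  rw [(summable_gd h ha hx hv).tsum_prod]
  refine tsum_congr fun k => ?_
  rw [← tsum_mul_left, ← tsum_mul_right]
  refine tsum_congr fun l => ?_
  push_cast; ring

lemma tri_op {θ η : ℤ → ℤ → ℝ} {n m : ℕ} (h : Gq n m fun k j l => θ k j * η j l)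
    {a b x v : ℤ → ℂ} (ha : nr n a ≠ ⊤) (hb : nr m b ≠ ⊤) (hx : nr 3 x ≠ ⊤) (hv : nr 3 v ≠ ⊤) :
    tri θ a (op η b x) v = quad (fun k j l => θ k j * η j l) a b x v := by
  unfold tri quad op
  rw [(summable_gq h ha hb hx hv).tsum_prod]
  refine tsum_congr fun p => ?_
  rw [← tsum_mul_left, ← tsum_mul_right]
  refine tsum_congr fun l => ?_
  push_cast; ring

/-- A symbol that ignores the intermediate frequency is a trilinear form in the product of the two
backgrounds. This lets trilinear and quadrilinear terms be merged into one symbol, or a quadrilinear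
term be split off as a trilinear one. -/
lemma tri_conv {θ : ℤ → ℤ → ℝ} {a b x v : ℤ → ℂ}
    (h : Summable fun q : (ℤ × ℤ) × ℤ => a (q.1.1 - q.1.2) * b (q.1.2 - q.2)
      * (θ q.1.1 q.2 : ℂ) * x q.2 * conj (v q.1.1)) :
    tri θ (conv a b) x v = quad (fun k _ l => θ k l) a b x v := by
  unfold tri quad conv
  let E : (ℤ × ℤ) × ℤ ≃ (ℤ × ℤ) × ℤ :=
    { toFun := fun q => ((q.1.1, q.2 + q.1.2), q.1.2)
      invFun := fun q => ((q.1.1, q.2), q.1.2 - q.2)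
      left_inv := fun q => by simp
      right_inv := fun q => by simp }
  have h' := E.summable_iff.2 h
  rw [← E.tsum_eq]
  refine Eq.trans ?_ (Summable.tsum_prod (by exact h')).symm
  refine tsum_congr fun p => ?_
  rw [← tsum_mul_right, ← tsum_mul_right, ← tsum_mul_right]
  refine tsum_congr fun i => ?_
  simp only [E, Equiv.coe_fn_mk]
  rw [show p.1 - p.2 - i = p.1 - (i + p.2) by ring, show i + p.2 - p.2 = i by ring]

lemma tri_ml_two {θ : ℤ → ℤ → ℝ} (r : ℂ) (m : ℤ → ℝ) (a x v : ℤ → ℂ) :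
    tri θ a (ml (fun k => r * (m k : ℂ)) x) v = r * tri (fun k l => θ k l * m l) a x v := by
  unfold tri ml
  rw [← tsum_mul_left]
  exact tsum_congr fun p => by push_cast; ring

lemma tri_ml_one {θ : ℤ → ℤ → ℝ} (r : ℂ) (m : ℤ → ℝ) (a x v : ℤ → ℂ) :
    tri θ (ml (fun k => r * (m k : ℂ)) a) x v = r * tri (fun k l => θ k l * m (k - l)) a x v := by
  unfold tri ml
  rw [← tsum_mul_left]
  exact tsum_congr fun p => by push_cast; ring

lemma quad_ml_two {Ψ : ℤ → ℤ → ℤ → ℝ} (r : ℂ) (m : ℤ → ℝ) (a b x v : ℤ → ℂ) :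
    quad Ψ a (ml (fun k => r * (m k : ℂ)) b) x v
      = r * quad (fun k j l => Ψ k j l * m (j - l)) a b x v := by
  unfold quad ml
  rw [← tsum_mul_left]
  exact tsum_congr fun p => by push_cast; ring

lemma quad_ml_one {Ψ : ℤ → ℤ → ℤ → ℝ} (r : ℂ) (m : ℤ → ℝ) (a b x v : ℤ → ℂ) :
    quad Ψ (ml (fun k => r * (m k : ℂ)) a) b x v
      = r * quad (fun k j l => Ψ k j l * m (k - j)) a b x v := by
  unfold quad ml
  rw [← tsum_mul_left]
  exact tsum_congr fun p => by push_cast; ring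

/-! ### Schur bounds -/

/-- The square of the `ℓ²` norm with values in `[0,∞]`. -/
def ee (w : ℤ → ℂ) : ℝ≥0∞ := ∑' k, ‖w k‖ₑ ^ 2

lemma ee_eq {w : ℤ → ℂ} (h : nr 0 w ≠ ⊤) : ee w = ENNReal.ofReal (sqn w) := by
  rw [ee, sqn, ENNReal.ofReal_tsum_of_nonneg (fun k => sq_nonneg _) (summable_sq_of_nr h)]
  refine tsum_congr fun k => ?_
  rw [ENNReal.ofReal_pow (norm_nonneg _), ofReal_norm]

lemma mul_le_sq_add_sq (a b : ℝ≥0∞) : a * b ≤ a ^ 2 + b ^ 2 := by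
  rcases le_total a b with h | h
  · calc a * b ≤ b * b := mul_le_mul_left h b
      _ = b ^ 2 := (sq b).symm
      _ ≤ _ := le_add_self
  · calc a * b ≤ a * a := mul_le_mul_right h a
      _ = a ^ 2 := (sq a).symm
      _ ≤ _ := le_self_add

/-- Schur's test for the kernel `B(k - j)`, whose row and column sums are all equal to the mass of
`B`. -/
lemma schur_le (B V U : ℤ → ℝ≥0∞) :
    ∑' k, econv B V k * U k ≤ (∑' k, B k) * (∑' k, V k ^ 2 + ∑' k, U k ^ 2) := by
  calc ∑' k, econv B V k * U k ≤ ∑' k, (econv B (fun k => V k ^ 2) k + (∑' j, B j) * U k ^ 2) := by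
        refine ENNReal.tsum_le_tsum fun k => ?_
        unfold econv
        rw [← ENNReal.tsum_mul_right, ← tsum_sub_left B k, ← ENNReal.tsum_mul_right,
          ← ENNReal.tsum_add]
        refine ENNReal.tsum_le_tsum fun j => ?_
        rw [mul_assoc, ← mul_add]
        exact mul_le_mul_right (mul_le_sq_add_sq _ _) _
    _ = _ := by rw [ENNReal.tsum_add, tsum_econv, ENNReal.tsum_mul_left, mul_add]

lemma enorm_tri_schur {n : ℕ} {C : ℝ} {θ : ℤ → ℤ → ℝ} (h : ∀ k l, |θ k l| ≤ C * jb (k - l) ^ n)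
    (a x v : ℤ → ℂ) :
    ‖tri θ a x v‖ₑ ≤ ENNReal.ofReal C * nr n a * (ee x + ee v) := by
  refine (enorm_tsum_le _).trans ?_
  have := mul_le_mul_right (schur_le (wt n a) (fun k => ‖x k‖ₑ) (fun k => ‖v k‖ₑ))
    (ENNReal.ofReal C)
  rw [← mul_assoc] at this
  refine le_trans ?_ this
  unfold econv
  simp_rw [← ENNReal.tsum_mul_right]
  rw [← ENNReal.tsum_mul_left, ENNReal.tsum_prod']
  refine ENNReal.tsum_le_tsum fun k => ?_
  rw [← ENNReal.tsum_mul_left]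
  refine ENNReal.tsum_le_tsum fun l => ?_
  have hb := enorm_real_le (h k l)
  rw [ENNReal.ofReal_mul' (pow_nonneg (jb_pos _).le n), ofReal_jb_pow] at hb
  simp only [enorm_mul, enorm_conj, wt]
  calc ‖a (k - l)‖ₑ * ‖(θ k l : ℂ)‖ₑ * ‖x l‖ₑ * ‖v k‖ₑ
      ≤ ‖a (k - l)‖ₑ * (ENNReal.ofReal C * jw (k - l) ^ n) * ‖x l‖ₑ * ‖v k‖ₑ := by gcongr
    _ = _ := by ring

lemma enorm_quad_schur {n : ℕ} {C : ℝ} {Ψ : ℤ → ℤ → ℤ → ℝ}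
    (h : ∀ k j l, |Ψ k j l| ≤ C * (jb (k - j) * jb (j - l)) ^ n) (a b x v : ℤ → ℂ) :
    ‖quad Ψ a b x v‖ₑ ≤ ENNReal.ofReal C * (nr n a * nr n b) * (ee x + ee v) := by
  refine (enorm_tsum_le _).trans ?_
  have := mul_le_mul_right (schur_le (econv (wt n a) (wt n b)) (fun k => ‖x k‖ₑ)
    (fun k => ‖v k‖ₑ)) (ENNReal.ofReal C)
  rw [← mul_assoc, tsum_econv] at this
  refine le_trans ?_ this
  rw [econv_assoc, ← tsum_quad_le, ← ENNReal.tsum_mul_left]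
  refine ENNReal.tsum_le_tsum fun q => ?_
  have hb := enorm_real_le (h q.1.1 q.1.2 q.2)
  rw [ENNReal.ofReal_mul' (pow_nonneg (mul_nonneg (jb_pos _).le (jb_pos _).le) n), mul_pow,
    ENNReal.ofReal_mul (pow_nonneg (jb_pos _).le n), ofReal_jb_pow, ofReal_jb_pow] at hb
  simp only [enorm_mul, enorm_conj, wt]
  calc ‖a (q.1.1 - q.1.2)‖ₑ * ‖b (q.1.2 - q.2)‖ₑ * ‖(Ψ q.1.1 q.1.2 q.2 : ℂ)‖ₑ * ‖x q.2‖ₑ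
        * ‖v q.1.1‖ₑ
      ≤ ‖a (q.1.1 - q.1.2)‖ₑ * ‖b (q.1.2 - q.2)‖ₑ * (ENNReal.ofReal C
        * (jw (q.1.1 - q.1.2) ^ n * jw (q.1.2 - q.2) ^ n)) * ‖x q.2‖ₑ * ‖v q.1.1‖ₑ := by gcongr
    _ = _ := by ring
end BO4
end

noncomputable section
namespace BO4
open scoped ENNReal ComplexConjugate

/-! ### Classes of symbols -/

lemma jb_pow_nonneg (k : ℤ) (n : ℕ) : 0 ≤ jb k ^ n := pow_nonneg (jb_pos k).le n

lemma jb_pow_le (k : ℤ) {m n : ℕ} (h : m ≤ n) : jb k ^ m ≤ jb k ^ n :=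
  pow_le_pow_right₀ (one_le_jb k) h

lemma jb_le_sub_mul (k j : ℤ) : jb k ≤ jb (k - j) * jb j := by
  have := jb_add_le (k - j) j; rwa [sub_add_cancel] at this

lemma jb_le_sub_mul' (k j : ℤ) : jb j ≤ jb (k - j) * jb k := by
  rw [jb_sub_comm]; exact jb_le_sub_mul j k

lemma jb_sub_le_mul (k l : ℤ) : jb (k - l) ≤ jb k * jb l := by
  have := jb_add_le k (-l); rwa [jb_neg, ← sub_eq_add_neg] at this

lemma Gd.of_le {n a b d : ℕ} {C : ℝ} {θ : ℤ → ℤ → ℝ} (hC : 0 ≤ C) (ha : a ≤ n) (hb : b ≤ 3)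
    (hd : d ≤ 3) (h : ∀ k l, |θ k l| ≤ C * (jb (k - l) ^ a * jb l ^ b * jb k ^ d)) : Gd n θ :=
  ⟨C, fun k l => (h k l).trans (mul_le_mul_of_nonneg_left (mul_le_mul (mul_le_mul
    (jb_pow_le _ ha) (jb_pow_le _ hb) (jb_pow_nonneg _ _) (jb_pow_nonneg _ _)) (jb_pow_le _ hd)
    (jb_pow_nonneg _ _) (mul_nonneg (jb_pow_nonneg _ _) (jb_pow_nonneg _ _))) hC)⟩

lemma Gq.of_le {n m a b d e : ℕ} {C : ℝ} {Ψ : ℤ → ℤ → ℤ → ℝ} (hC : 0 ≤ C) (ha : a ≤ n)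
    (hb : b ≤ m) (hd : d ≤ 3) (he : e ≤ 3)
    (h : ∀ k j l, |Ψ k j l| ≤ C * (jb (k - j) ^ a * jb (j - l) ^ b * jb l ^ d * jb k ^ e)) :
    Gq n m Ψ :=
  ⟨C, fun k j l => (h k j l).trans (mul_le_mul_of_nonneg_left (mul_le_mul (mul_le_mul (mul_le_mul
    (jb_pow_le _ ha) (jb_pow_le _ hb) (jb_pow_nonneg _ _) (jb_pow_nonneg _ _)) (jb_pow_le _ hd)
    (jb_pow_nonneg _ _) (mul_nonneg (jb_pow_nonneg _ _) (jb_pow_nonneg _ _)))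
    (jb_pow_le _ he) (jb_pow_nonneg _ _) (mul_nonneg (mul_nonneg (jb_pow_nonneg _ _)
      (jb_pow_nonneg _ _)) (jb_pow_nonneg _ _))) hC)⟩

lemma Gd.toGq {n : ℕ} {θ : ℤ → ℤ → ℝ} (h : Gd n θ) : Gq n n fun k _ l => θ k l := by
  obtain ⟨C, hC⟩ := h
  refine ⟨|C|, fun k j l => (hC k l).trans ?_⟩
  have h1 : jb (k - l) ^ n ≤ jb (k - j) ^ n * jb (j - l) ^ n := by
    rw [← mul_pow]; exact pow_le_pow_left₀ (jb_pos _).le (jb_sub_le k j l) n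
  have h2 := jb_pow_nonneg l 3
  have h3 := jb_pow_nonneg k 3
  have h4 := jb_pow_nonneg (k - l) n
  calc C * (jb (k - l) ^ n * jb l ^ 3 * jb k ^ 3) ≤ |C| * (jb (k - l) ^ n * jb l ^ 3 * jb k ^ 3) := by
        gcongr; exact le_abs_self C
    _ ≤ _ := by gcongr

lemma Gd.bdd_mul {n : ℕ} {D : ℝ} {η θ : ℤ → ℤ → ℝ} (hη : ∀ k l, |η k l| ≤ D) (h : Gd n θ) :
    Gd n fun k l => η k l * θ k l := by
  obtain ⟨C, hC⟩ := h
  refine ⟨D * C, fun k l => ?_⟩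
  rw [abs_mul, mul_assoc]
  exact mul_le_mul (hη k l) (hC k l) (abs_nonneg _) ((abs_nonneg _).trans (hη k l))

lemma Gq.bdd_mul {n m : ℕ} {D : ℝ} {η : ℤ → ℤ → ℝ} {Ψ : ℤ → ℤ → ℤ → ℝ}
    (hη : ∀ k l, |η k l| ≤ D) (h : Gq n m Ψ) : Gq n m fun k j l => η k j * Ψ k j l := by
  obtain ⟨C, hC⟩ := h
  refine ⟨D * C, fun k j l => ?_⟩
  rw [abs_mul, mul_assoc]
  exact mul_le_mul (hη k j) (hC k j l) (abs_nonneg _) ((abs_nonneg _).trans (hη k j))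

lemma abs_pq_le_jb (c : Coeffs) (k l : ℤ) :
    |pq c k l| ≤ 2 * c.size * (jb (k - l) ^ 2 * jb l ^ 2 * jb k ^ 1) := by
  have h := abs_pq_le c k l (m := jb (k - l) * jb l)
    ((abs_le_jb l).trans (jb_le_mul_right _ _))
    (by simpa using (abs_le_jb (k - l)).trans (jb_le_mul_left (k - l) l))
  refine h.trans ?_
  have := c.size_nonneg
  have h1 := jb_pos (k - l)
  have h2 := jb_pos l
  calc c.size * (|(k : ℝ)| * (2 * (jb (k - l) * jb l) ^ 2))
      ≤ c.size * (jb k * (2 * (jb (k - l) * jb l) ^ 2)) := by gcongr; exact abs_le_jb k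
    _ = _ := by ring

lemma abs_pe_le_jb (c : Coeffs) (k l : ℤ) :
    |pe c k l| ≤ c.size * (jb (k - l) ^ 0 * jb l ^ 1 * jb k ^ 2) := by
  have h := abs_pe_le c k l (m := jb k * jb l) ((abs_le_jb k).trans (jb_le_mul_left _ _))
    ((abs_le_jb l).trans (jb_le_mul_right _ _))
  refine h.trans ?_
  have := c.size_nonneg
  have h1 := jb_pos k
  have h2 := jb_pos l
  calc c.size * (|(k : ℝ)| * (jb k * jb l)) ≤ c.size * (jb k * (jb k * jb l)) := by
        gcongr; exact abs_le_jb k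
    _ = _ := by ring

lemma gd_pq (c : Coeffs) : Gd 3 (pq c) :=
  Gd.of_le (mul_nonneg zero_le_two c.size_nonneg) (by norm_num) (by norm_num) (by norm_num)
    (abs_pq_le_jb c)

lemma gd_pe (c : Coeffs) : Gd 3 (pe c) :=
  Gd.of_le c.size_nonneg (by norm_num) (by norm_num) (by norm_num) (abs_pe_le_jb c)

lemma gd_left (n : ℕ) : Gd n fun k _ => (k : ℝ) :=
  Gd.of_le (a := 0) (b := 0) (d := 1) zero_le_one (by norm_num) (by norm_num) (by norm_num)
    fun k l => by simpa using abs_le_jb k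

lemma abs_phi_le_jb (k : ℤ) : |phi k| ≤ jb k ^ 4 := by
  unfold phi
  rw [abs_mul, abs_pow, abs_abs, ← pow_succ']
  exact pow_le_pow_left₀ (abs_nonneg _) (abs_le_jb k) 4

lemma gd_phi_right : Gd 3 fun _ l => phi l := by
  refine Gd.of_le (a := 1) (b := 3) (d := 1) zero_le_one (by norm_num) (by norm_num) (by norm_num)
    fun k l => (abs_phi_le_jb l).trans ?_
  have := jb_le_sub_mul' k l
  have h := jb_pow_nonneg l 3
  calc jb l ^ 4 = jb l ^ 3 * jb l := by ring
    _ ≤ jb l ^ 3 * (jb (k - l) * jb k) := by gcongr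
    _ = _ := by ring

lemma gd_phi_sub : Gd 3 fun k l => phi (k - l) := by
  refine Gd.of_le (a := 3) (b := 1) (d := 1) zero_le_one (by norm_num) (by norm_num) (by norm_num)
    fun k l => (abs_phi_le_jb _).trans ?_
  have := jb_sub_le_mul k l
  have h := jb_pow_nonneg (k - l) 3
  calc jb (k - l) ^ 4 = jb (k - l) ^ 3 * jb (k - l) := by ring
    _ ≤ jb (k - l) ^ 3 * (jb k * jb l) := by gcongr
    _ = _ := by ring

lemma gq_pq (c : Coeffs) : Gq 3 3 fun _ j l => pq c j l := by
  have hs := c.size_nonneg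
  refine Gq.of_le (a := 1) (b := 2) (d := 2) (e := 1) (mul_nonneg zero_le_two hs)
    (by norm_num) (by norm_num) (by norm_num) (by norm_num) fun k j l => (abs_pq_le_jb c j l).trans ?_
  have := jb_le_sub_mul' k j
  have h1 := jb_pow_nonneg (j - l) 2
  have h2 := jb_pow_nonneg l 2
  calc 2 * c.size * (jb (j - l) ^ 2 * jb l ^ 2 * jb j ^ 1)
      ≤ 2 * c.size * (jb (j - l) ^ 2 * jb l ^ 2 * (jb (k - j) * jb k)) := by rw [pow_one]; gcongr
    _ = _ := by ring

lemma gq_pe (c : Coeffs) : Gq 2 3 fun _ j l => pe c j l := by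
  have hs := c.size_nonneg
  refine Gq.of_le (a := 2) (b := 0) (d := 1) (e := 2) hs
    (by norm_num) (by norm_num) (by norm_num) (by norm_num) fun k j l => (abs_pe_le_jb c j l).trans ?_
  have := jb_le_sub_mul' k j
  have h0 := (jb_pos j).le
  have h2 := (jb_pos l).le
  calc c.size * (jb (j - l) ^ 0 * jb l ^ 1 * jb j ^ 2)
      ≤ c.size * (jb (j - l) ^ 0 * jb l ^ 1 * (jb (k - j) * jb k) ^ 2) := by
        rw [pow_zero, pow_one]; gcongr
    _ = _ := by ring

lemma gq_mid : Gq 2 2 fun _ j _ => (j : ℝ) := by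
  refine Gq.of_le (a := 1) (b := 0) (d := 0) (e := 1) zero_le_one
    (by norm_num) (by norm_num) (by norm_num) (by norm_num) fun k j l => ?_
  have := (abs_le_jb j).trans (jb_le_sub_mul' k j)
  simpa using this

lemma gq_phi_sub : Gq 3 3 fun _ j l => phi (j - l) := by
  refine Gq.of_le (a := 1) (b := 3) (d := 1) (e := 1) zero_le_one
    (by norm_num) (by norm_num) (by norm_num) (by norm_num)
    fun k j l => (abs_phi_le_jb _).trans ?_
  have h1 := jb_sub_le_mul j l
  have h2 := jb_le_sub_mul' k j
  have h := jb_pow_nonneg (j - l) 3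
  have h3 := (jb_pos l).le
  calc jb (j - l) ^ 4 = jb (j - l) ^ 3 * jb (j - l) := by ring
    _ ≤ jb (j - l) ^ 3 * (jb (k - j) * jb k * jb l) := by
      gcongr; exact h1.trans (by gcongr)
    _ = _ := by ring

/-! ### Real parts of forms with antisymmetric symbols -/

/-- The real part of `i` times a trilinear form. -/
def RI (θ : ℤ → ℤ → ℝ) (a w : ℤ → ℂ) : ℝ := (Complex.I * tri θ a w w).re

/-- The real part of `i` times a quadrilinear form. -/
def RQ (Ψ : ℤ → ℤ → ℤ → ℝ) (a b w : ℤ → ℂ) : ℝ := (Complex.I * quad Ψ a b w w).re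

lemma abs_re_I_mul_le {z : ℂ} {X : ℝ} (hX : 0 ≤ X) (h : ‖z‖ₑ ≤ ENNReal.ofReal X) :
    |(Complex.I * z).re| ≤ X := by
  refine (Complex.abs_re_le_norm _).trans ?_
  rw [norm_mul, Complex.norm_I, one_mul, ← toReal_enorm]
  exact ENNReal.toReal_le_of_le_ofReal hX h

lemma RI_add {n : ℕ} {θ η : ℤ → ℤ → ℝ} (h : Gd n θ) (h' : Gd n η) {a w : ℤ → ℂ}
    (ha : nr n a ≠ ⊤) (hw : nr 3 w ≠ ⊤) :
    RI (fun k l => θ k l + η k l) a w = RI θ a w + RI η a w := by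
  rw [RI, tri_add_symbol h h' ha hw hw, mul_add, Complex.add_re]; rfl

lemma RI_const_mul (r : ℝ) (θ : ℤ → ℤ → ℝ) (a w : ℤ → ℂ) :
    RI (fun k l => r * θ k l) a w = r * RI θ a w := by
  rw [RI, tri_mul_symbol, mul_left_comm, Complex.re_ofReal_mul]; rfl

lemma RQ_add {n m : ℕ} {Ψ Ξ : ℤ → ℤ → ℤ → ℝ} (h : Gq n m Ψ) (h' : Gq n m Ξ) {a b w : ℤ → ℂ}
    (ha : nr n a ≠ ⊤) (hb : nr m b ≠ ⊤) (hw : nr 3 w ≠ ⊤) :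
    RQ (fun k j l => Ψ k j l + Ξ k j l) a b w = RQ Ψ a b w + RQ Ξ a b w := by
  rw [RQ, quad_add_symbol h h' ha hb hw hw, mul_add, Complex.add_re]; rfl

lemma RQ_const_mul (r : ℝ) (Ψ : ℤ → ℤ → ℤ → ℝ) (a b w : ℤ → ℂ) :
    RQ (fun k j l => r * Ψ k j l) a b w = r * RQ Ψ a b w := by
  rw [RQ, quad_mul_symbol, mul_left_comm, Complex.re_ofReal_mul]; rfl

/-- Conjugation exchanges the arguments of the symbol and changes the sign of `i`. Hence only the
antisymmetric part of a symbol contributes. -/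
lemma RI_swap (θ : ℤ → ℤ → ℝ) {a : ℤ → ℂ} (ha : RealSeq a) (w : ℤ → ℂ) :
    RI (fun k l => θ l k) a w = -RI θ a w := by
  rw [RI, ← conj_tri ha, RI]; simp

lemma RQ_swap (Ψ : ℤ → ℤ → ℤ → ℝ) {a b : ℤ → ℂ} (ha : RealSeq a) (hb : RealSeq b)
    (w : ℤ → ℂ) : RQ (fun k j l => Ψ l j k) b a w = -RQ Ψ a b w := by
  rw [RQ, ← conj_quad ha hb, RQ]; simp

lemma RI_antisymm {n : ℕ} {θ : ℤ → ℤ → ℝ} (h : Gd n θ) {a w : ℤ → ℂ} (hr : RealSeq a)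
    (ha : nr n a ≠ ⊤) (hw : nr 3 w ≠ ⊤) :
    RI (fun k l => θ k l + (-1) * θ l k) a w = 2 * RI θ a w := by
  rw [RI_add h (h.swap.const_mul (-1)) ha hw, RI_const_mul, RI_swap θ hr]; ring

lemma RQ_antisymm {n : ℕ} {Ψ : ℤ → ℤ → ℤ → ℝ} (h : Gq n n Ψ) {a w : ℤ → ℂ} (hr : RealSeq a)
    (ha : nr n a ≠ ⊤) (hw : nr 3 w ≠ ⊤) :
    RQ (fun k j l => Ψ k j l + (-1) * Ψ l j k) a a w = 2 * RQ Ψ a a w := by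
  rw [RQ_add h (h.swap.const_mul (-1)) ha ha hw, RQ_const_mul, RQ_swap Ψ hr hr]; ring

lemma sqn_nonneg (w : ℤ → ℂ) : 0 ≤ sqn w := tsum_nonneg fun _ => sq_nonneg _

lemma abs_RI_le {n : ℕ} {C A : ℝ} {θ : ℤ → ℤ → ℝ} (h : ∀ k l, |θ k l| ≤ C * jb (k - l) ^ n)
    (hC : 0 ≤ C) (hA : 0 ≤ A) {a w : ℤ → ℂ} (ha : nr n a ≤ ENNReal.ofReal A) (hw : nr 0 w ≠ ⊤) :
    |RI θ a w| ≤ 2 * (C * A * sqn w) := by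
  have hs := sqn_nonneg w
  refine abs_re_I_mul_le (by positivity) ((enorm_tri_schur h a w w).trans ?_)
  rw [ee_eq hw, ← two_mul, ENNReal.ofReal_mul zero_le_two, ENNReal.ofReal_mul (by positivity),
    ENNReal.ofReal_mul hC, ENNReal.ofReal_ofNat, mul_left_comm]
  gcongr

lemma abs_RQ_le {n : ℕ} {C A B : ℝ} {Ψ : ℤ → ℤ → ℤ → ℝ}
    (h : ∀ k j l, |Ψ k j l| ≤ C * (jb (k - j) * jb (j - l)) ^ n)
    (hC : 0 ≤ C) (hA : 0 ≤ A) (hB : 0 ≤ B) {a b w : ℤ → ℂ} (ha : nr n a ≤ ENNReal.ofReal A)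
    (hb : nr n b ≤ ENNReal.ofReal B) (hw : nr 0 w ≠ ⊤) :
    |RQ Ψ a b w| ≤ 2 * (C * (A * B) * sqn w) := by
  have hs := sqn_nonneg w
  refine abs_re_I_mul_le (by positivity) ((enorm_quad_schur h a b w w).trans ?_)
  rw [ee_eq hw, ← two_mul, ENNReal.ofReal_mul zero_le_two, ENNReal.ofReal_mul (by positivity),
    ENNReal.ofReal_mul hC, ENNReal.ofReal_mul hA, ENNReal.ofReal_ofNat, mul_left_comm]
  gcongr

lemma ne_top_of_le_ofReal {x : ℝ≥0∞} {A : ℝ} (h : x ≤ ENNReal.ofReal A) : x ≠ ⊤ :=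
  ne_top_of_le_ne_top ENNReal.ofReal_ne_top h

/-- A symbol close to a multiple of `k` is bounded after antisymmetrization. -/
lemma abs_RI_le_of_near {n : ℕ} (hn : 1 ≤ n) {α C A : ℝ} {θ : ℤ → ℤ → ℝ}
    (h : ∀ k l, |θ k l - α * k| ≤ C * jb (k - l) ^ n) (hC : 0 ≤ C) (hA : 0 ≤ A) {a w : ℤ → ℂ}
    (hr : RealSeq a) (ha : nr n a ≤ ENNReal.ofReal A) (hw : nr 3 w ≠ ⊤) :
    |RI θ a w| ≤ (|α| + 2 * C) * (A * sqn w) := by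
  have hg : Gd n θ := by
    have h1 : Gd n fun k l => θ k l - α * k := Gd.of_le (a := n) (b := 0) (d := 0) hC le_rfl
      (by norm_num) (by norm_num) fun k l => by simpa using h k l
    have := h1.add ((gd_left n).const_mul α)
    simpa using this
  have h2 := RI_antisymm hg hr (ne_top_of_le_ofReal ha) hw
  have h3 : ∀ k l, |θ k l + (-1) * θ l k| ≤ (|α| + 2 * C) * jb (k - l) ^ n := by
    intro k l
    -- The main parts combine to `α(k - l)`, which costs one background weight; this is why `n` must
    -- be at least `1`.
    have e : θ k l + (-1) * θ l k = (θ k l - α * k) - (θ l k - α * l) + α * (k - l) := by ring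
    have h4 : |α * ((k : ℝ) - l)| ≤ |α| * jb (k - l) ^ n := by
      rw [abs_mul]
      gcongr
      exact (abs_sub_le_jb k l).trans (by simpa using jb_pow_le (k - l) hn)
    rw [e]
    calc _ ≤ |θ k l - α * k| + |θ l k - α * l| + |α * ((k : ℝ) - l)| :=
          (abs_add_le _ _).trans (add_le_add (abs_sub _ _) le_rfl)
      _ ≤ C * jb (k - l) ^ n + C * jb (l - k) ^ n + |α| * jb (k - l) ^ n :=
          add_le_add (add_le_add (h k l) (h l k)) h4
      _ = _ := by rw [jb_sub_comm l k]; ring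
  have h5 := abs_RI_le h3 (by positivity) hA ha (nr_ne_top_mono (by norm_num) hw)
  rw [h2, abs_mul, abs_two] at h5
  linarith

lemma quad_eq_tri_conv {n : ℕ} {θ : ℤ → ℤ → ℝ} (h : Gd n θ) {a b x v : ℤ → ℂ} (ha : nr n a ≠ ⊤)
    (hb : nr n b ≠ ⊤) (hx : nr 3 x ≠ ⊤) (hv : nr 3 v ≠ ⊤) :
    tri θ (conv a b) x v = quad (fun k _ l => θ k l) a b x v :=
  tri_conv (summable_gq h.toGq ha hb hx hv)

/-- A symbol close to a multiple of `k` is bounded after antisymmetrization. -/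
lemma abs_RQ_le_of_near {n : ℕ} (hn : 1 ≤ n) {α C A B : ℝ} {Ψ : ℤ → ℤ → ℤ → ℝ}
    (h : ∀ k j l, |Ψ k j l - α * k| ≤ C * (jb (k - j) * jb (j - l)) ^ n) (hC : 0 ≤ C)
    (hA : 0 ≤ A) (hB : 0 ≤ B) {a b w : ℤ → ℂ} (hr : RealSeq a) (hr' : RealSeq b)
    (ha : nr n a ≤ ENNReal.ofReal A) (hb : nr n b ≤ ENNReal.ofReal B) (hw : nr 3 w ≠ ⊤) :
    |RQ Ψ a b w| ≤ (|α| + 2 * C) * (A * B * sqn w) := by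
  have h1 : Gq n n fun k j l => Ψ k j l - α * k :=
    Gq.of_le (a := n) (b := n) (d := 0) (e := 0) hC le_rfl le_rfl (by norm_num) (by norm_num)
      fun k j l => by simpa [mul_pow] using h k j l
  have fa := ne_top_of_le_ofReal ha
  have fb := ne_top_of_le_ofReal hb
  have h2 := RQ_add h1 ((gd_left n).toGq.const_mul α) fa fb hw
  have e : (fun k j l => Ψ k j l - α * (k : ℝ) + α * (k : ℝ)) = Ψ := by
    funext k j l; ring
  -- The symbol `k` ignores the intermediate frequency, so its form is trilinear with background `a
  -- * b`. There antisymmetrization is possible even though the two backgrounds differ.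
  have h3 : RQ (fun k _ _ => (k : ℝ)) a b w = RI (fun k _ => (k : ℝ)) (conv a b) w := by
    rw [RQ, RI, quad_eq_tri_conv (gd_left n) fa fb hw hw]
  have hcv : nr n (conv a b) ≤ ENNReal.ofReal (A * B) := by
    rw [ENNReal.ofReal_mul hA]
    exact (nr_conv_le n a b).trans (mul_le_mul' ha hb)
  have h4 := abs_RI_le_of_near (θ := fun k _ => (k : ℝ)) (α := 1) (C := 0) hn
    (fun k l => by simp) le_rfl (mul_nonneg hA hB) (hr.conv hr') hcv hw
  have h5 := abs_RQ_le h hC hA hB ha hb (nr_ne_top_mono (by norm_num) hw)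
  rw [e, RQ_const_mul, h3] at h2
  rw [h2]
  calc _ ≤ |RQ (fun k j l => Ψ k j l - α * (k : ℝ)) a b w|
        + |α| * |RI (fun k _ => (k : ℝ)) (conv a b) w| := by
        rw [← abs_mul]; exact abs_add_le _ _
    _ ≤ 2 * (C * (A * B) * sqn w) + |α| * ((|1| + 2 * 0) * (A * B * sqn w)) := by gcongr
    _ = _ := by rw [abs_one]; ring
end BO4
end

noncomputable section
namespace BO4
open scoped ENNReal ComplexConjugate

/-! ### The derivative of the energy along the linearized flow -/

/-- The part of the derivative of the energy that is linear in the derivative of the difference. -/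
def Gx (c : Coeffs) (κ : ℝ) (a w x : ℤ → ℂ) : ℝ :=
  (pr (fun _ => 1) x w).re + wgt κ a * (pr om x w).re
    + lam₁ c 0 / 4 * (2 * (tri th₁ a x w).re) + lam₂ c 0 / 4 * (2 * (tri th₂ a x w).re)
    + mu₃ c * (2 * (tri (fun k l => Jc k * Jc l) (conv a a) x w).re)

/-- The part of the derivative of the energy from the time dependence of the background in the
correction terms. -/
def Ty (c : Coeffs) (a w y : ℤ → ℂ) : ℝ :=
  lam₁ c 0 / 4 * (tri th₁ y w w).re + lam₂ c 0 / 4 * (tri th₂ y w w).re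
    + mu₃ c * (tri (fun k l => Jc k * Jc l) ((2 : ℂ) • conv a y) w w).re

lemma dE_eq (c : Coeffs) (κ : ℝ) (a w y x : ℤ → ℂ) : dE c κ a w y x = Gx c κ a w x + Ty c a w y
    + 1 / 2 * omn w * (κ * (4 * Real.pi * (pr (fun _ => 1) y a).re)
        * (1 + 2 * (2 * Real.pi * sqn a))) := by
  unfold dE Gx Ty; ring

lemma tsum_enorm_pr_le {m : ℤ → ℝ} {C : ℝ} (hm : ∀ k, |m k| ≤ C) (x w : ℤ → ℂ) :
    ∑' k, ‖(m k : ℂ) * x k * conj (w k)‖ₑ ≤ ENNReal.ofReal C * (wn iw x * nr 1 w) := by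
  refine le_trans ?_ (mul_le_mul_right (tsum_mul_le_mul_tsum (fun k => iw k * ‖x k‖ₑ) (wt 1 w)) _)
  rw [← ENNReal.tsum_mul_left]
  refine ENNReal.tsum_le_tsum fun k => ?_
  have e : ‖x k‖ₑ * ‖w k‖ₑ = iw k * ‖x k‖ₑ * wt 1 w k := by
    rw [wt, pow_one, show iw k * ‖x k‖ₑ * (jw k * ‖w k‖ₑ)
      = (iw k * jw k) * (‖x k‖ₑ * ‖w k‖ₑ) by ring, iw_mul, one_mul]
  rw [enorm_mul, enorm_mul, enorm_conj, mul_assoc, e]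
  exact mul_le_mul_left (enorm_real_le (hm k)) _

lemma pr_add {m : ℤ → ℝ} {C : ℝ} (hm : ∀ k, |m k| ≤ C) {x y w : ℤ → ℂ} (hx : wn iw x ≠ ⊤)
    (hy : wn iw y ≠ ⊤) (hw : nr 1 w ≠ ⊤) : pr m (x + y) w = pr m x w + pr m y w := by
  have s := fun {x : ℤ → ℂ} (hx : wn iw x ≠ ⊤) => summable_of_tsum_enorm (ne_top_of_le_ne_top
    (ENNReal.mul_ne_top ENNReal.ofReal_ne_top (ENNReal.mul_ne_top hx hw)) (tsum_enorm_pr_le hm x w))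
  unfold pr
  rw [← (s hx).tsum_add (s hy)]
  exact tsum_congr fun k => by rw [Pi.add_apply]; ring

lemma pr_smul (m : ℤ → ℝ) (r : ℂ) (x w : ℤ → ℂ) : pr m (r • x) w = r * pr m x w := by
  unfold pr
  rw [← tsum_mul_left]
  exact tsum_congr fun k => by rw [Pi.smul_apply, smul_eq_mul]; ring

lemma enorm_le_iw_two {θ : ℤ → ℤ → ℝ} {C : ℝ} (hθ : ∀ k l, |θ k l| ≤ C) (k l : ℤ) :
    ‖(θ k l : ℂ)‖ₑ ≤ ENNReal.ofReal C * (jw (k - l) * iw l * jw k) :=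
  (enorm_real_le (hθ k l)).trans (le_mul_of_one_le_right' (one_le_iw_two k l))

lemma enorm_le_iw_one {θ : ℤ → ℤ → ℝ} {C : ℝ} (hθ : ∀ k l, |θ k l| ≤ C) (k l : ℤ) :
    ‖(θ k l : ℂ)‖ₑ ≤ ENNReal.ofReal C * (iw (k - l) * jw l * jw k) :=
  (enorm_real_le (hθ k l)).trans (le_mul_of_one_le_right' (one_le_iw_one k l))

lemma nr_one_eq (a : ℤ → ℂ) : nr 1 a = wn jw a := by simp [nr_eq_wn]

lemma tri_add_two {θ : ℤ → ℤ → ℝ} {C : ℝ} (hθ : ∀ k l, |θ k l| ≤ C) {a x y w : ℤ → ℂ}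
    (ha : nr 1 a ≠ ⊤) (hx : wn iw x ≠ ⊤) (hy : wn iw y ≠ ⊤) (hw : nr 1 w ≠ ⊤) :
    tri θ a (x + y) w = tri θ a x w + tri θ a y w := by
  rw [nr_one_eq] at ha hw
  have s := fun {x : ℤ → ℂ} (hx : wn iw x ≠ ⊤) => summable_tri (a := a) (x := x) (v := w)
    (enorm_le_iw_two hθ) ENNReal.ofReal_ne_top ha hx hw
  unfold tri
  rw [← (s hx).tsum_add (s hy)]
  exact tsum_congr fun p => by rw [Pi.add_apply]; ring

lemma tri_add_one {θ : ℤ → ℤ → ℝ} {C : ℝ} (hθ : ∀ k l, |θ k l| ≤ C) {a b x w : ℤ → ℂ}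
    (ha : wn iw a ≠ ⊤) (hb : wn iw b ≠ ⊤) (hx : nr 1 x ≠ ⊤) (hw : nr 1 w ≠ ⊤) :
    tri θ (a + b) x w = tri θ a x w + tri θ b x w := by
  rw [nr_one_eq] at hx hw
  have s := fun {a : ℤ → ℂ} (ha : wn iw a ≠ ⊤) => summable_tri (a := a) (x := x) (v := w)
    (enorm_le_iw_one hθ) ENNReal.ofReal_ne_top ha hx hw
  unfold tri
  rw [← (s ha).tsum_add (s hb)]
  exact tsum_congr fun p => by rw [Pi.add_apply]; ring

lemma abs_one_fun_le (k : ℤ) : |(fun _ : ℤ => (1 : ℝ)) k| ≤ 1 := by simp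
lemma abs_om_le (k : ℤ) : |om k| ≤ 1 := by rw [abs_of_nonneg (om_nonneg k)]; exact om_le_one k

lemma Gx_add (c : Coeffs) (κ : ℝ) {a w x y : ℤ → ℂ} (ha : nr 1 a ≠ ⊤) (hw : nr 1 w ≠ ⊤)
    (hx : wn iw x ≠ ⊤) (hy : wn iw y ≠ ⊤) :
    Gx c κ a w (x + y) = Gx c κ a w x + Gx c κ a w y := by
  unfold Gx
  rw [pr_add abs_one_fun_le hx hy hw, pr_add abs_om_le hx hy hw, tri_add_two abs_th₁_le_one ha hx hy hw,
    tri_add_two abs_th₂_le ha hx hy hw, tri_add_two abs_JJ_le (nr_conv_ne_top ha ha) hx hy hw]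
  simp only [Complex.add_re]
  ring

lemma Ty_add (c : Coeffs) {a w x y : ℤ → ℂ} (ha : nr 1 a ≠ ⊤) (hw : nr 1 w ≠ ⊤)
    (hx : wn iw x ≠ ⊤) (hy : wn iw y ≠ ⊤) : Ty c a w (x + y) = Ty c a w x + Ty c a w y := by
  have e : (2 : ℂ) • conv a (x + y) = (2 : ℂ) • conv a x + (2 : ℂ) • conv a y := by
    rw [← smul_add]
    congr 1
    funext k
    simp only [conv, Pi.add_apply, mul_add]
    exact (summable_conv_iw ha hx k).tsum_add (summable_conv_iw ha hy k)
  have f : ∀ {x : ℤ → ℂ}, wn iw x ≠ ⊤ → wn iw ((2 : ℂ) • conv a x) ≠ ⊤ := fun {x} hx => by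
    rw [wn_smul]
    exact ENNReal.mul_ne_top enorm_ne_top
      (ne_top_of_le_ne_top (ENNReal.mul_ne_top ha hx) (wn_iw_conv_le a x))
  unfold Ty
  rw [e, tri_add_one abs_th₁_le_one hx hy hw hw, tri_add_one abs_th₂_le hx hy hw hw,
    tri_add_one abs_JJ_le (f hx) (f hy) hw hw]
  simp only [Complex.add_re]
  ring

/-- The part of the equation for the difference that is linear in the difference. -/
def linOp (c : Coeffs) (a h w : ℤ → ℂ) : ℤ → ℂ :=
  Complex.I • op (pq c) a w + Complex.I • op (pe c) (conv a a) w
    + Complex.I • op (fun k _ => (k : ℝ)) h w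

/-- The outer derivative contributes one factor `1 + |k|`, which the weight of order `-1` on the
output absorbs. -/
lemma wn_iw_op_le {n : ℕ} {C : ℝ} {θ : ℤ → ℤ → ℝ} (hC : 0 ≤ C)
    (h : ∀ k l, |θ k l| ≤ C * (jb (k - l) ^ n * jb l ^ 3 * jb k)) (a x : ℤ → ℂ) :
    wn iw (op θ a x) ≤ ENNReal.ofReal C * (nr n a * nr 3 x) := by
  have key := (tsum_econv (wt n a) (wt 3 x)).le
  refine le_trans ?_ (mul_le_mul_right key _)
  rw [← ENNReal.tsum_mul_left]
  refine ENNReal.tsum_le_tsum fun k => ?_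
  unfold econv
  refine (mul_le_mul_right (enorm_tsum_le _) _).trans ?_
  rw [← ENNReal.tsum_mul_left, ← ENNReal.tsum_mul_left]
  refine ENNReal.tsum_le_tsum fun l => ?_
  have hb := enorm_real_le (h k l)
  rw [ENNReal.ofReal_mul hC, ENNReal.ofReal_mul (mul_nonneg (jb_pow_nonneg _ _) (jb_pow_nonneg _ _)),
    ENNReal.ofReal_mul (jb_pow_nonneg _ _), ofReal_jb_pow, ofReal_jb_pow] at hb
  change _ ≤ _ * (_ * jw k) at hb
  simp only [enorm_mul, wt]
  calc iw k * (‖a (k - l)‖ₑ * ‖(θ k l : ℂ)‖ₑ * ‖x l‖ₑ)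
      ≤ iw k * (‖a (k - l)‖ₑ * (ENNReal.ofReal C * (jw (k - l) ^ n * jw l ^ 3 * jw k)) * ‖x l‖ₑ) := by
        gcongr
    _ = (iw k * jw k) * (ENNReal.ofReal C * (jw (k - l) ^ n * ‖a (k - l)‖ₑ
        * (jw l ^ 3 * ‖x l‖ₑ))) := by ring
    _ = _ := by rw [iw_mul, one_mul]

lemma wn_iw_op_pq (c : Coeffs) {a w : ℤ → ℂ} (ha : nr 3 a ≠ ⊤) (hw : nr 3 w ≠ ⊤) :
    wn iw (op (pq c) a w) ≠ ⊤ := by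
  have hs := c.size_nonneg
  refine ne_top_of_le_ne_top (ENNReal.mul_ne_top ENNReal.ofReal_ne_top (ENNReal.mul_ne_top ha hw))
    (wn_iw_op_le (n := 3) (C := 2 * c.size) (by positivity) (fun k l => ?_) a w)
  refine (abs_pq_le_jb c k l).trans ?_
  have h1 := jb_pow_nonneg (k - l) 3
  have h2 := jb_pow_nonneg l 2
  have h3 := (jb_pos k).le
  rw [pow_one]
  gcongr 2 * c.size * (?_ * ?_ * _)
  · exact jb_pow_le _ (by norm_num)
  · exact jb_pow_le _ (by norm_num)

lemma wn_iw_op_pe (c : Coeffs) {a w : ℤ → ℂ} (ha : nr 3 a ≠ ⊤) (hw : nr 3 w ≠ ⊤) :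
    wn iw (op (pe c) a w) ≠ ⊤ := by
  have hs := c.size_nonneg
  refine ne_top_of_le_ne_top (ENNReal.mul_ne_top ENNReal.ofReal_ne_top (ENNReal.mul_ne_top ha hw))
    (wn_iw_op_le (n := 3) (C := c.size) hs (fun k l => ?_) a w)
  refine (abs_pe_le_jb c k l).trans ?_
  have h1 := one_le_jb (k - l)
  have h2 := one_le_jb l
  have h3 := (jb_pos k).le
  have h4 := jb_le_sub_mul k l
  have h5 : jb (k - l) ≤ jb (k - l) ^ 3 := by simpa using jb_pow_le (k - l) (show 1 ≤ 3 by norm_num)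
  have h6 : jb l ^ 2 ≤ jb l ^ 3 := jb_pow_le l (by norm_num)
  calc c.size * (jb (k - l) ^ 0 * jb l ^ 1 * jb k ^ 2) = c.size * (jb l * (jb k * jb k)) := by ring
    _ ≤ c.size * (jb l * ((jb (k - l) * jb l) * jb k)) := by gcongr
    _ = c.size * (jb (k - l) * jb l ^ 2 * jb k) := by ring
    _ ≤ _ := by gcongr

lemma wn_iw_op_left {a w : ℤ → ℂ} (ha : nr 2 a ≠ ⊤) (hw : nr 3 w ≠ ⊤) :
    wn iw (op (fun k _ => (k : ℝ)) a w) ≠ ⊤ := by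
  refine ne_top_of_le_ne_top (ENNReal.mul_ne_top ENNReal.ofReal_ne_top (ENNReal.mul_ne_top ha hw))
    (wn_iw_op_le (n := 2) (C := 1) zero_le_one (fun k l => (abs_le_jb k).trans ?_) a w)
  rw [one_mul]
  exact le_mul_of_one_le_left (jb_pos k).le
    (one_le_mul_of_one_le_of_one_le (one_le_pow₀ (one_le_jb _)) (one_le_pow₀ (one_le_jb _)))

lemma wn_smul_ne_top {ω : ℤ → ℝ≥0∞} {a : ℤ → ℂ} (r : ℂ) (h : wn ω a ≠ ⊤) : wn ω (r • a) ≠ ⊤ := by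
  rw [wn_smul]; exact ENNReal.mul_ne_top enorm_ne_top h

lemma wn_add_ne_top {ω : ℤ → ℝ≥0∞} {a b : ℤ → ℂ} (h : wn ω a ≠ ⊤) (h' : wn ω b ≠ ⊤) :
    wn ω (a + b) ≠ ⊤ :=
  ne_top_of_le_ne_top (ENNReal.add_ne_top.2 ⟨h, h'⟩) (wn_add_le _ _ _)

lemma wn_iw_linOp (c : Coeffs) {a h w : ℤ → ℂ} (ha : nr 3 a ≠ ⊤) (hh : nr 2 h ≠ ⊤)
    (hw : nr 3 w ≠ ⊤) : wn iw (linOp c a h w) ≠ ⊤ :=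
  wn_add_ne_top (wn_add_ne_top (wn_smul_ne_top _ (wn_iw_op_pq c ha hw))
    (wn_smul_ne_top _ (wn_iw_op_pe c (nr_conv_ne_top ha ha) hw)))
    (wn_smul_ne_top _ (wn_iw_op_left hh hw))

lemma re_pr_linOp (c : Coeffs) {m : ℤ → ℝ} {C : ℝ} (hm : ∀ k, |m k| ≤ C) {a h w : ℤ → ℂ}
    (ha : nr 3 a ≠ ⊤) (hh : nr 2 h ≠ ⊤) (hw : nr 3 w ≠ ⊤) :
    (pr m (linOp c a h w) w).re = RI (fun k l => m k * pq c k l) a w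
      + RI (fun k l => m k * pe c k l) (conv a a) w + RI (fun k _ => m k * k) h w := by
  have he := nr_conv_ne_top ha ha
  have hw1 := nr_ne_top_mono (show 1 ≤ 3 by norm_num) hw
  have p1 := wn_smul_ne_top Complex.I (wn_iw_op_pq c ha hw)
  have p2 := wn_smul_ne_top Complex.I (wn_iw_op_pe c he hw)
  have p3 := wn_smul_ne_top Complex.I (wn_iw_op_left hh hw)
  rw [linOp, pr_add hm (wn_add_ne_top p1 p2) p3 hw1, pr_add hm p1 p2 hw1, pr_smul, pr_smul, pr_smul,
    pr_op ((gd_pq c).bdd_mul (η := fun k _ => m k) fun k _ => hm k) ha hw hw,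
    pr_op ((gd_pe c).bdd_mul (η := fun k _ => m k) fun k _ => hm k) he hw hw,
    pr_op ((gd_left 2).bdd_mul (η := fun k _ => m k) fun k _ => hm k) hh hw hw]
  simp only [Complex.add_re]; rfl

lemma re_tri_linOp (c : Coeffs) {θ : ℤ → ℤ → ℝ} {C : ℝ} (hθ : ∀ k l, |θ k l| ≤ C)
    {b a h w : ℤ → ℂ} (hb : nr 3 b ≠ ⊤) (ha : nr 3 a ≠ ⊤) (hh : nr 2 h ≠ ⊤) (hw : nr 3 w ≠ ⊤) :
    (tri θ b (linOp c a h w) w).re = RQ (fun k j l => θ k j * pq c j l) b a w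
      + RQ (fun k j l => θ k j * pe c j l) b (conv a a) w + RQ (fun k j _ => θ k j * j) b h w := by
  have he := nr_conv_ne_top ha ha
  have hb1 := nr_ne_top_mono (show 1 ≤ 3 by norm_num) hb
  have hb2 := nr_ne_top_mono (show 2 ≤ 3 by norm_num) hb
  have hw1 := nr_ne_top_mono (show 1 ≤ 3 by norm_num) hw
  have p1 := wn_smul_ne_top Complex.I (wn_iw_op_pq c ha hw)
  have p2 := wn_smul_ne_top Complex.I (wn_iw_op_pe c he hw)
  have p3 := wn_smul_ne_top Complex.I (wn_iw_op_left hh hw)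
  rw [linOp, tri_add_two hθ hb1 (wn_add_ne_top p1 p2) p3 hw1, tri_add_two hθ hb1 p1 p2 hw1,
    tri_smul_two, tri_smul_two, tri_smul_two, tri_op (η := pq c) ((gq_pq c).bdd_mul hθ) hb ha hw hw,
    tri_op (η := pe c) ((gq_pe c).bdd_mul hθ) hb2 he hw hw, tri_op (η := fun j _ => (j : ℝ)) (gq_mid.bdd_mul hθ) hb2 hh hw hw]
  simp only [Complex.add_re]; rfl

/-- The linear flow acts by phases: the pairing is `-i` times a real number, so diagonal quantities
are conserved by the dispersive part. -/
lemma re_pr_phi (m : ℤ → ℝ) (w : ℤ → ℂ) :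
    (pr m (ml (fun k => -Complex.I * (phi k : ℂ)) w) w).re = 0 := by
  have h : pr m (ml (fun k => -Complex.I * (phi k : ℂ)) w) w
      = -Complex.I * pr (fun k => m k * phi k) w w := by
    unfold pr ml
    rw [← tsum_mul_left]
    exact tsum_congr fun k => by push_cast; ring
  have h2 : pr (fun k => m k * phi k) w w = ((∑' k, m k * phi k * ‖w k‖ ^ 2 : ℝ) : ℂ) := by
    rw [Complex.ofReal_tsum]
    unfold pr
    refine tsum_congr fun k => ?_
    rw [mul_assoc, Complex.mul_conj']
    push_cast; rfl
  rw [h, h2]; simp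

lemma re_tri_phi_two (θ : ℤ → ℤ → ℝ) (b w : ℤ → ℂ) :
    (tri θ b (ml (fun k => -Complex.I * (phi k : ℂ)) w) w).re
      = -RI (fun k l => θ k l * phi l) b w := by
  rw [tri_ml_two, RI, neg_mul, Complex.neg_re]

lemma re_tri_phi_one (θ : ℤ → ℤ → ℝ) (b w : ℤ → ℂ) :
    (tri θ (ml (fun k => -Complex.I * (phi k : ℂ)) b) w w).re
      = -RI (fun k l => θ k l * phi (k - l)) b w := by
  rw [tri_ml_one, RI, neg_mul, Complex.neg_re]

lemma re_tri_conv_phi {θ : ℤ → ℤ → ℝ} {C : ℝ} (hθ : ∀ k l, |θ k l| ≤ C) {a w : ℤ → ℂ}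
    (ha : nr 3 a ≠ ⊤) (hw : nr 3 w ≠ ⊤) :
    (tri θ ((2 : ℂ) • conv a (ml (fun k => -Complex.I * (phi k : ℂ)) a)) w w).re
      = -2 * RQ (fun k j l => θ k l * phi (j - l)) a a w := by
  have hg : Gq 3 3 fun k j l => θ k l * phi (j - l) := by
    obtain ⟨D, hD⟩ := gq_phi_sub
    refine ⟨C * D, fun k j l => ?_⟩
    rw [abs_mul, mul_assoc]
    exact mul_le_mul (hθ k l) (hD k j l) (abs_nonneg _) ((abs_nonneg _).trans (hθ k l))
  have hs := (summable_gq hg ha ha hw hw).mul_left (-Complex.I)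
  rw [tri_smul_one, tri_conv, quad_ml_two, RQ]
  · simp
  · refine hs.congr fun q => ?_
    simp only [ml]; push_cast; ring
end BO4
end

/-! ### Cancellations and bounds along the linearized flow -/

noncomputable section
namespace BO4
open scoped ENNReal ComplexConjugate

lemma symA_eq : symA = fun k : ℤ => 1 * ((|(k : ℝ)| : ℝ) : ℂ) := by funext k; simp [symA]

lemma RealSeq.ml_symA {a : ℤ → ℂ} (ha : RealSeq a) : RealSeq (ml symA a) := fun k => by
  simp [ml, symA, ha k]

lemma RQ_ml_one (Ψ : ℤ → ℤ → ℤ → ℝ) (a b w : ℤ → ℂ) :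
    RQ Ψ (ml symA a) b w = RQ (fun k j l => Ψ k j l * |((k - j : ℤ) : ℝ)|) a b w := by
  rw [RQ, symA_eq, quad_ml_one, one_mul, RQ]

lemma RQ_ml_two (Ψ : ℤ → ℤ → ℤ → ℝ) (a b w : ℤ → ℂ) :
    RQ Ψ a (ml symA b) w = RQ (fun k j l => Ψ k j l * |((j - l : ℤ) : ℝ)|) a b w := by
  rw [RQ, symA_eq, quad_ml_two, one_mul, RQ]

/-- Both sides are the trilinear form with symbol `k` and background the product of `a` and `|D|a`,
which does not depend on the order of the factors. This exchange symmetry disposes of the `c₃` terms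
that do not cancel pointwise. -/
lemma RQ_left_abs_sub {a w : ℤ → ℂ} (ha : nr 3 a ≠ ⊤) (hw : nr 3 w ≠ ⊤) :
    RQ (fun k j l => (k : ℝ) * |((j - l : ℤ) : ℝ)|) a a w
      = RQ (fun k j _ => (k : ℝ) * |((k - j : ℤ) : ℝ)|) a a w := by
  have ha2 := nr_ne_top_mono (show 2 ≤ 3 by norm_num) ha
  have hA : nr 2 (ml symA a) ≠ ⊤ := nr_ml_ne_top enorm_symA_le le_rfl ha
  rw [← RQ_ml_two (fun k _ _ => (k : ℝ)), ← RQ_ml_one (fun k _ _ => (k : ℝ)), RQ, RQ,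
    ← quad_eq_tri_conv (gd_left 2) ha2 hA hw hw, ← quad_eq_tri_conv (gd_left 2) hA ha2 hw hw,
    conv_comm]

lemma gq_left_abs_sub : Gq 3 3 fun k j l => (k : ℝ) * |((j - l : ℤ) : ℝ)| :=
  Gq.of_le (a := 0) (b := 1) (d := 0) (e := 1) zero_le_one (by norm_num) (by norm_num) (by norm_num)
    (by norm_num) fun k j l => by
      rw [abs_mul, abs_abs]
      calc |(k : ℝ)| * |((j - l : ℤ) : ℝ)| ≤ jb k * jb (j - l) :=
            mul_le_mul (abs_le_jb k) (abs_le_jb _) (abs_nonneg _) (jb_pos k).le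
        _ = _ := by ring

lemma gq_left_abs_sub' : Gq 3 3 fun k j _ => (k : ℝ) * |((k - j : ℤ) : ℝ)| :=
  Gq.of_le (a := 1) (b := 0) (d := 0) (e := 1) zero_le_one (by norm_num) (by norm_num) (by norm_num)
    (by norm_num) fun k j l => by
      rw [abs_mul, abs_abs]
      calc |(k : ℝ)| * |((k - j : ℤ) : ℝ)| ≤ jb k * jb (k - j) :=
            mul_le_mul (abs_le_jb k) (abs_le_jb _) (abs_nonneg _) (jb_pos k).le
        _ = _ := by ring

/-- The terms that are linear in the background. -/
lemma abs_linear_group_le (c : Coeffs) {M : ℝ} (hM : 0 ≤ M) {a w : ℤ → ℂ} (hr : RealSeq a)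
    (ha : nr 3 a ≤ ENNReal.ofReal M) (hw : nr 3 w ≠ ⊤) :
    |RI (pq c) a w - lam₁ c 0 / 2 * RI (fun k l => th₁ k l * phi l) a w
      - lam₁ c 0 / 4 * RI (fun k l => th₁ k l * phi (k - l)) a w
      - lam₂ c 0 / 2 * RI (fun k l => th₂ k l * phi l) a w
      - lam₂ c 0 / 4 * RI (fun k l => th₂ k l * phi (k - l)) a w|
      ≤ 40 * c.size * (M * sqn w) := by
  have fa := ne_top_of_le_ofReal ha
  have g1 := gd_phi_right.bdd_mul abs_th₁_le_one
  have g2 := gd_phi_sub.bdd_mul abs_th₁_le_one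
  have g3 := gd_phi_right.bdd_mul abs_th₂_le
  have g4 := gd_phi_sub.bdd_mul abs_th₂_le
  have h1 := (gd_pq c).add (g1.const_mul (-(lam₁ c 0 / 2)))
  have h2 := h1.add (g2.const_mul (-(lam₁ c 0 / 4)))
  have h3 := h2.add (g3.const_mul (-(lam₂ c 0 / 2)))
  have h4 := h3.add (g4.const_mul (-(lam₂ c 0 / 4)))
  have e := RI_antisymm h4 hr fa hw
  rw [RI_add h3 (g4.const_mul _) fa hw, RI_add h2 (g3.const_mul _) fa hw,
    RI_add h1 (g2.const_mul _) fa hw, RI_add (gd_pq c) (g1.const_mul _) fa hw, RI_const_mul,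
    RI_const_mul, RI_const_mul, RI_const_mul] at e
  have hb := abs_RI_le (n := 3) (C := 40 * c.size) (A := M) (a := a) (w := w) (θ := symLin c)
    (fun k l => (abs_symLin_le c k l).trans (le_of_eq (by ring)))
    (mul_nonneg (by norm_num) c.size_nonneg) hM ha (nr_ne_top_mono (by norm_num) hw)
  -- `θ₁` and `θ₂` are symmetric and `φ` is odd, so antisymmetrizing collects the three values of
  -- `φ` into `Φ`.
  have es : symLin c = fun k l =>
      (pq c k l + -(lam₁ c 0 / 2) * (th₁ k l * phi l) + -(lam₁ c 0 / 4) * (th₁ k l * phi (k - l))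
        + -(lam₂ c 0 / 2) * (th₂ k l * phi l) + -(lam₂ c 0 / 4) * (th₂ k l * phi (k - l)))
      + -1 * (pq c l k + -(lam₁ c 0 / 2) * (th₁ l k * phi k)
        + -(lam₁ c 0 / 4) * (th₁ l k * phi (l - k))
        + -(lam₂ c 0 / 2) * (th₂ l k * phi k) + -(lam₂ c 0 / 4) * (th₂ l k * phi (l - k))) := by
    funext k l
    rw [th₁_comm l k, th₂_comm l k, ← neg_sub k l, phi_neg, symLin, Phi, th₂]
    ring
  rw [es, e, abs_mul, abs_two] at hb
  have : ∀ p q r s t : ℝ, p - lam₁ c 0 / 2 * q - lam₁ c 0 / 4 * r - lam₂ c 0 / 2 * s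
      - lam₂ c 0 / 4 * t = p + -(lam₁ c 0 / 2) * q + -(lam₁ c 0 / 4) * r + -(lam₂ c 0 / 2) * s
      + -(lam₂ c 0 / 4) * t := fun p q r s t => by ring
  rw [this]
  linarith

/-- The terms that are quadratic in the background and of the highest order. -/
lemma abs_quadratic_group_le (c : Coeffs) {M : ℝ} (hM : 0 ≤ M) {a w : ℤ → ℂ} (hr : RealSeq a)
    (ha : nr 3 a ≤ ENNReal.ofReal M) (hw : nr 3 w ≠ ⊤) :
    |RI (pe c) (conv a a) w - 2 * mu₃ c * RI (fun k l => Jc k * Jc l * phi l) (conv a a) w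
      - 2 * mu₃ c * RQ (fun k j l => Jc k * Jc l * phi (j - l)) a a w
      + lam₁ c 0 / 2 * RQ (fun k j l => th₁ k j * pq c j l) a a w|
      ≤ 200 * c.size ^ 2 * (M * M * sqn w) := by
  have fa := ne_top_of_le_ofReal ha
  have g1 := gd_phi_right.bdd_mul abs_JJ_le
  have g2 : Gq 3 3 fun k j l => Jc k * Jc l * phi (j - l) := by
    obtain ⟨D, hD⟩ := gq_phi_sub
    refine ⟨1 * D, fun k j l => ?_⟩
    rw [abs_mul, mul_assoc]
    exact mul_le_mul (abs_JJ_le k l) (hD k j l) (abs_nonneg _) zero_le_one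
  have g3 := (gq_pq c).bdd_mul abs_th₁_le_one
  have t1 : RI (pe c) (conv a a) w = RQ (fun k _ l => pe c k l) a a w := by
    rw [RI, RQ, quad_eq_tri_conv (gd_pe c) fa fa hw hw]
  have t2 : RI (fun k l => Jc k * Jc l * phi l) (conv a a) w
      = RQ (fun k _ l => Jc k * Jc l * phi l) a a w := by
    rw [RI, RQ, quad_eq_tri_conv g1 fa fa hw hw]
  have h1 := (gd_pe c).toGq.add (g1.toGq.const_mul (-(2 * mu₃ c)))
  have h2 := h1.add (g2.const_mul (-(2 * mu₃ c)))
  have h3 := h2.add (g3.const_mul (lam₁ c 0 / 2))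
  have e := RQ_antisymm h3 hr fa hw
  rw [RQ_add h2 (g3.const_mul _) fa fa hw, RQ_add h1 (g2.const_mul _) fa fa hw,
    RQ_add (gd_pe c).toGq (g1.toGq.const_mul _) fa fa hw, RQ_const_mul, RQ_const_mul,
    RQ_const_mul, ← t1, ← t2] at e
  have hg : Gq 3 3 (symQuad c) :=
    Gq.of_le (a := 3) (b := 3) (d := 0) (e := 0) (C := c.size ^ 2 * 200) (by positivity) le_rfl
      le_rfl (by norm_num) (by norm_num) fun k j l => (abs_symQuad_le c k j l).trans
        (le_of_eq (by ring))
  have hb := abs_RQ_le (n := 3) (C := 200 * c.size ^ 2) (A := M) (B := M) (a := a) (b := a) (w := w)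
    (Ψ := symQuad c) (fun k j l => (abs_symQuad_le c k j l).trans (le_of_eq (by ring)))
    (by positivity) hM hM ha ha (nr_ne_top_mono (by norm_num) hw)
  have es : (fun k j l => (pe c k l + -(2 * mu₃ c) * (Jc k * Jc l * phi l)
        + -(2 * mu₃ c) * (Jc k * Jc l * phi (j - l)) + lam₁ c 0 / 2 * (th₁ k j * pq c j l))
      + -1 * (pe c l k + -(2 * mu₃ c) * (Jc l * Jc k * phi k)
        + -(2 * mu₃ c) * (Jc l * Jc k * phi (j - k)) + lam₁ c 0 / 2 * (th₁ l j * pq c j k)))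
      = fun k j l => symQuad c k j l + ((lam₁ c 0 * c.c₃) * ((k : ℝ) * |((j - l : ℤ) : ℝ)|)
        + -(lam₁ c 0 * c.c₃) * ((k : ℝ) * |((k - j : ℤ) : ℝ)|)) := by
    funext k j l
    rw [← neg_sub k j, phi_neg, symQuad]
    push_cast
    ring
  rw [es, RQ_add hg ((gq_left_abs_sub.const_mul _).add (gq_left_abs_sub'.const_mul _)) fa fa hw,
    RQ_add (gq_left_abs_sub.const_mul _) (gq_left_abs_sub'.const_mul _) fa fa hw, RQ_const_mul,
    RQ_const_mul, RQ_left_abs_sub fa hw] at e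
  -- The two extra forms with coefficients `±λ₁c₃` have the same value and disappear.
  have e2 : RQ (symQuad c) a a w = 2 * (RI (pe c) (conv a a) w
      - 2 * mu₃ c * RI (fun k l => Jc k * Jc l * phi l) (conv a a) w
      - 2 * mu₃ c * RQ (fun k j l => Jc k * Jc l * phi (j - l)) a a w
      + lam₁ c 0 / 2 * RQ (fun k j l => th₁ k j * pq c j l) a a w) := by linarith
  rw [e2, abs_mul, abs_two] at hb
  linarith

lemma abs_lin_coeff_le (c : Coeffs) : |-(c.c₁ - c.c₄)| ≤ c.size := by
  rw [abs_neg]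
  refine (abs_sub _ _).trans ?_
  unfold Coeffs.size
  linarith [abs_nonneg c.c₂, abs_nonneg c.c₃, abs_nonneg c.c₅, abs_nonneg c.c₆, abs_nonneg c.c₇]

lemma abs_quad_coeff_le (c : Coeffs) : |c.c₅ + c.c₆ + c.c₇| ≤ c.size := by
  refine (abs_add_three _ _ _).trans ?_
  unfold Coeffs.size
  linarith [abs_nonneg c.c₁, abs_nonneg c.c₂, abs_nonneg c.c₃, abs_nonneg c.c₄]

/-- The factor `|k - j|` of `θ₂` is a derivative of the background and is moved there, so the bounds
for `J_k J_j` apply to the second correction with `|D|a` for `a`. -/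
lemma RQ_th₂ (η : ℤ → ℤ → ℝ) (a b w : ℤ → ℂ) :
    RQ (fun k j l => th₂ k j * η j l) a b w
      = RQ (fun k j l => Jc k * Jc j * η j l) (ml symA a) b w := by
  rw [RQ_ml_one]
  congr 1
  funext k j l
  rw [th₂]; push_cast; ring

/-- The first two groups contain the forms that lose derivatives and must be estimated jointly. All
others have symbols close to a multiple of `k` and are estimated one at a time. -/
lemma main_eq (c : Coeffs) (κ : ℝ) {a h w : ℤ → ℂ} (fa : nr 3 a ≠ ⊤) (fh : nr 2 h ≠ ⊤)
    (hw : nr 3 w ≠ ⊤) :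
    Gx c κ a w (ml (fun k => -Complex.I * (phi k : ℂ)) w) + Gx c κ a w (linOp c a h w)
      + Ty c a w (ml (fun k => -Complex.I * (phi k : ℂ)) a)
    = (RI (pq c) a w - lam₁ c 0 / 2 * RI (fun k l => th₁ k l * phi l) a w
        - lam₁ c 0 / 4 * RI (fun k l => th₁ k l * phi (k - l)) a w
        - lam₂ c 0 / 2 * RI (fun k l => th₂ k l * phi l) a w
        - lam₂ c 0 / 4 * RI (fun k l => th₂ k l * phi (k - l)) a w)
      + (RI (pe c) (conv a a) w - 2 * mu₃ c * RI (fun k l => Jc k * Jc l * phi l) (conv a a) w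
        - 2 * mu₃ c * RQ (fun k j l => Jc k * Jc l * phi (j - l)) a a w
        + lam₁ c 0 / 2 * RQ (fun k j l => th₁ k j * pq c j l) a a w)
      + wgt κ a * RI (fun k l => om k * pq c k l) a w
      + wgt κ a * RI (fun k l => om k * pe c k l) (conv a a) w
      + RI (fun k _ => (k : ℝ)) h w + wgt κ a * RI (fun k _ => om k * k) h w
      + lam₂ c 0 / 2 * RQ (fun k j l => Jc k * Jc j * pq c j l) (ml symA a) a w
      + lam₁ c 0 / 2 * RQ (fun k j l => th₁ k j * pe c j l) a (conv a a) w
      + lam₁ c 0 / 2 * RQ (fun k j _ => th₁ k j * j) a h w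
      + lam₂ c 0 / 2 * RQ (fun k j l => Jc k * Jc j * pe c j l) (ml symA a) (conv a a) w
      + lam₂ c 0 / 2 * RQ (fun k j _ => Jc k * Jc j * j) (ml symA a) h w
      + 2 * mu₃ c * RQ (fun k j l => Jc k * Jc j * pq c j l) (conv a a) a w
      + 2 * mu₃ c * RQ (fun k j l => Jc k * Jc j * pe c j l) (conv a a) (conv a a) w
      + 2 * mu₃ c * RQ (fun k j _ => Jc k * Jc j * j) (conv a a) h w := by
  have fe := nr_conv_ne_top fa fa
  unfold Gx Ty
  rw [re_pr_phi, re_pr_phi, re_tri_phi_two, re_tri_phi_two, re_tri_phi_two,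
    re_pr_linOp c abs_one_fun_le fa fh hw, re_pr_linOp c abs_om_le fa fh hw,
    re_tri_linOp c abs_th₁_le_one fa fa fh hw, re_tri_linOp c abs_th₂_le fa fa fh hw,
    re_tri_linOp c abs_JJ_le fe fa fh hw, re_tri_phi_one, re_tri_phi_one,
    re_tri_conv_phi abs_JJ_le fa hw, RQ_th₂ (pq c), RQ_th₂ (pe c), RQ_th₂ fun j _ => (j : ℝ)]
  simp only [one_mul]
  ring

lemma group_le {r k x y z X Y S K p : ℝ} (hz : |z| ≤ k * (x * y * S)) (hk : |r| * k ≤ K)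
    (hk0 : 0 ≤ k) (hx0 : 0 ≤ x) (hx : x ≤ X) (hy0 : 0 ≤ y) (hy : y ≤ Y) (hS : 0 ≤ S)
    (hp : p = r * z) : |p| ≤ K * (X * Y * S) := by
  rw [hp, abs_mul]
  have hxy : x * y * S ≤ X * Y * S :=
    mul_le_mul_of_nonneg_right (mul_le_mul hx hy hy0 (hx0.trans hx)) hS
  calc |r| * |z| ≤ |r| * (k * (x * y * S)) := by gcongr
    _ = |r| * k * (x * y * S) := by ring
    _ ≤ K * (X * Y * S) := mul_le_mul hk hxy (by positivity)
      ((mul_nonneg (abs_nonneg r) hk0).trans hk)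

lemma weighted_group_le {W Wm k x z X Y S K : ℝ} (hz : |z| ≤ k * (x * S)) (hW : |W| ≤ Wm)
    (hk : k ≤ K) (hk0 : 0 ≤ k) (hx0 : 0 ≤ x) (hx : x ≤ X) (hy : Wm ≤ Y) (hS : 0 ≤ S) :
    |W * z| ≤ K * (X * Y * S) := by
  have hW0 := (abs_nonneg W).trans hW
  refine group_le (r := 1) (k := k) (x := x) (y := Wm) ?_ (by simpa using hk) hk0 hx0 hx hW0 hy hS
    (one_mul _).symm
  rw [abs_mul]
  calc |W| * |z| ≤ Wm * (k * (x * S)) := mul_le_mul hW hz (abs_nonneg _) hW0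
    _ = _ := by ring

/-- The derivative of the energy along the linearized flow loses no derivatives. -/
lemma abs_main_le (c : Coeffs) {κ M H Wm : ℝ} (hM : 1 ≤ M) (hH : 0 ≤ H) {a h w : ℤ → ℂ}
    (hr : RealSeq a) (hrh : RealSeq h) (ha : nr 3 a ≤ ENNReal.ofReal M)
    (hh : nr 2 h ≤ ENNReal.ofReal H) (hw : nr 3 w ≠ ⊤) (hW : |wgt κ a| ≤ Wm) :
    |Gx c κ a w (ml (fun k => -Complex.I * (phi k : ℂ)) w) + Gx c κ a w (linOp c a h w)
      + Ty c a w (ml (fun k => -Complex.I * (phi k : ℂ)) a)|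
      ≤ 500 * c.size ^ 3 * ((M ^ 2 + H) * (Wm + M ^ 2) * sqn w) := by
  have hM0 : 0 ≤ M := by linarith
  have fa := ne_top_of_le_ofReal ha
  have fh := ne_top_of_le_ofReal hh
  have hre := hr.conv hr
  have he : nr 3 (conv a a) ≤ ENNReal.ofReal (M * M) := by
    rw [ENNReal.ofReal_mul hM0]; exact (nr_conv_le _ _ _).trans (mul_le_mul' ha ha)
  have hA : nr 2 (ml symA a) ≤ ENNReal.ofReal M := (nr_ml_le enorm_symA_le a).trans ha
  have hrA := hr.ml_symA
  have ha2 := (nr_mono (show 2 ≤ 3 by norm_num) a).trans ha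
  have ha1 := (nr_mono (show 1 ≤ 3 by norm_num) a).trans ha
  have he2 := (nr_mono (show 2 ≤ 3 by norm_num) _).trans he
  have he1 := (nr_mono (show 1 ≤ 3 by norm_num) _).trans he
  have hh1 := (nr_mono (show 1 ≤ 2 by norm_num) _).trans hh
  have hA1 := (nr_mono (show 1 ≤ 2 by norm_num) _).trans hA
  have hMM : 0 ≤ M * M := mul_nonneg hM0 hM0
  have s1 := c.one_le_size
  have s0 := c.size_nonneg
  have hS := sqn_nonneg w
  have hW0 := (abs_nonneg _).trans hW
  have M2 : M ≤ M ^ 2 := by nlinarith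
  have M1 : (1 : ℝ) ≤ M ^ 2 := by nlinarith
  have sq1 : c.size ≤ c.size ^ 3 := le_self_pow₀ s1 (by norm_num)
  have sq2 : c.size ^ 2 ≤ c.size ^ 3 := pow_le_pow_right₀ s1 (by norm_num)
  have sq3 : 1 ≤ c.size ^ 3 := one_le_pow₀ s1
  have sp2 : c.size * c.size = c.size ^ 2 := (sq _).symm
  have sp3 : c.size ^ 2 * c.size = c.size ^ 3 := (pow_succ _ _).symm
  have al := abs_lin_coeff_le c
  have aq := abs_quad_coeff_le c
  have r1 : |lam₁ c 0 / 2| ≤ c.size := by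
    rw [abs_div, abs_two]; linarith [abs_lam₁_le c]
  have r2 : |lam₂ c 0 / 2| ≤ c.size := by
    rw [abs_div, abs_two]; linarith [abs_lam₂_le c]
  have r3 : |2 * mu₃ c| ≤ 2 * c.size ^ 2 := by
    rw [abs_mul, abs_two]; linarith [abs_mu₃_le c]
  have xM : M ≤ M ^ 2 + H := by linarith
  have xMM : M * M ≤ M ^ 2 + H := by nlinarith
  have xH : H ≤ M ^ 2 + H := by nlinarith
  have y1 : 1 ≤ Wm + M ^ 2 := by linarith
  have yM : M ≤ Wm + M ^ 2 := by linarith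
  have yMM : M * M ≤ Wm + M ^ 2 := by nlinarith
  have yW : Wm ≤ Wm + M ^ 2 := by linarith [sq_nonneg M]
  have kk : ∀ {r k R D : ℝ}, |r| ≤ R → k ≤ D → 0 ≤ k → |r| * k ≤ R * D :=
    fun hr hk hk0 => mul_le_mul hr hk hk0 ((abs_nonneg _).trans hr)
  have nn : ∀ α : ℝ, ∀ C : ℝ, 0 ≤ C → 0 ≤ |α| + 2 * C := fun α C hC => by positivity
  have c5 : 0 ≤ 5 * c.size := by positivity
  have c2 : 0 ≤ 2 * c.size := by positivity
  have q11 : |-(c.c₁ - c.c₄)| + 2 * (5 * c.size) ≤ 11 * c.size := by linarith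
  have z4 : |(0 : ℝ)| + 2 * (2 * c.size) ≤ 4 * c.size := by rw [abs_zero]; linarith
  have z2 : |(0 : ℝ)| + 2 * 1 ≤ 2 := by rw [abs_zero]; linarith
  -- Every term is at most a constant times `x y ‖w‖²` with `x` one of `M`, `M²`, `H` and `y` one of
  -- `1`, `M`, `M²`, `Wm`. The numerical constants below add up to less than `500`.
  set X := M ^ 2 + H with hX
  set Y := Wm + M ^ 2 with hY
  set S := sqn w with hSd
  have B1 := group_le (r := 1) (K := 40 * c.size ^ 3) (y := 1) (X := X) (Y := Y)
    (by rw [mul_one]; exact abs_linear_group_le c hM0 hr ha hw) (by rw [abs_one]; linarith)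
    (by positivity) hM0 xM zero_le_one y1 hS (one_mul _).symm
  have B5 := group_le (r := 1) (K := 200 * c.size ^ 3) (y := 1) (X := X) (Y := Y)
    (by rw [mul_one]; exact abs_quadratic_group_le c hM0 hr ha hw) (by rw [abs_one]; linarith)
    (by positivity) hMM xMM zero_le_one y1 hS (one_mul _).symm
  have B2 := weighted_group_le (K := 29 * c.size ^ 3) (abs_RI_le_of_near
    (θ := fun k l => om k * pq c k l) (n := 3) (by norm_num)
    (α := -(c.c₁ - c.c₄)) (C := 14 * c.size) (fun k l => by
      rw [neg_mul, sub_neg_eq_add]; exact (abs_om_pq_add_le c k l).trans (le_of_eq (by ring)))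
    (by positivity) hM0 hr ha hw) hW (by linarith) (nn _ _ (by positivity)) hM0 xM yW hS
  have B3 := weighted_group_le (K := 4 * c.size ^ 3) (abs_RI_le_of_near
    (θ := fun k l => om k * pe c k l) (n := 1) le_rfl (α := 0) (C := 2 * c.size) (fun k l => by
      rw [zero_mul, sub_zero]; exact (abs_om_pe_le c k l).trans (le_of_eq (by ring)))
    c2 hMM hre he1 hw) hW (by linarith) (nn _ _ c2) hMM xMM yW hS
  have B4 := group_le (r := 1) (K := c.size ^ 3) (y := 1) (X := X) (Y := Y)
    (by
      rw [mul_one]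
      exact abs_RI_le_of_near (θ := fun k _ => (k : ℝ)) (n := 1) le_rfl (α := 1) (C := 0)
        (fun k l => by simp) le_rfl hH hrh hh1 hw)
    (by rw [abs_one]; linarith) (nn _ _ le_rfl) hH xH zero_le_one y1 hS (one_mul _).symm
  have B4' := weighted_group_le (K := 2 * c.size ^ 3) (abs_RI_le_of_near
    (θ := fun k _ => om k * k) (n := 1) le_rfl (α := 0) (C := 1) (fun k l => by
      rw [zero_mul, sub_zero, one_mul, pow_one]
      exact (abs_om_mul_self_le k).trans (one_le_jb _)) zero_le_one hH hrh hh1 hw)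
    hW (by linarith) (nn _ _ zero_le_one) hH xH yW hS
  have B6 := group_le (r := lam₂ c 0 / 2) (K := 11 * c.size ^ 3) (X := X) (Y := Y)
    (abs_RQ_le_of_near (Ψ := fun k j l => Jc k * Jc j * pq c j l) (n := 2) (by norm_num)
    (α := -(c.c₁ - c.c₄)) (C := 5 * c.size) (fun k j l => by
      rw [neg_mul, sub_neg_eq_add]; exact (abs_JJ_pq_add_le c k j l).trans (le_of_eq (by ring)))
    c5 hM0 hM0 hrA hr hA ha2 hw) ((kk r2 q11 (nn _ _ c5)).trans (by linarith))
    (nn _ _ c5) hM0 xM hM0 yM hS rfl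
  have B7 := group_le (r := lam₁ c 0 / 2) (K := 7 * c.size ^ 3) (X := X) (Y := Y)
    (by
      have := abs_RQ_le_of_near (Ψ := fun k j l => th₁ k j * pe c j l) (n := 2) (by norm_num)
        (α := c.c₅ + c.c₆ + c.c₇) (C := 3 * c.size) (fun k j l =>
        (abs_th₁_pe_sub_le c k j l).trans (le_of_eq (by ring))) (by positivity) hM0 hMM
        hr hre ha2 he2 hw
      rwa [mul_comm M] at this)
    ((kk r1 (show _ ≤ 7 * c.size by linarith) (nn _ _ (by positivity))).trans (by linarith))
    (nn _ _ (by positivity)) hMM xMM hM0 yM hS rfl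
  have B8 := group_le (r := lam₁ c 0 / 2) (K := 2 * c.size ^ 3) (X := X) (Y := Y)
    (by
      have := abs_RQ_le_of_near (Ψ := fun k j _ => th₁ k j * j) (n := 1) le_rfl
        (α := 0) (C := 1) (fun k j l => by
        rw [zero_mul, sub_zero, one_mul, pow_one]
        exact (abs_th₁_mul_le k j).trans (jb_le_mul_left _ _)) zero_le_one hM0 hH
        hr hrh ha1 hh1 hw
      rwa [mul_comm M] at this)
    ((kk r1 z2 (nn _ _ zero_le_one)).trans (by linarith)) (nn _ _ zero_le_one) hH xH hM0 yM hS rfl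
  have B9 := group_le (r := lam₂ c 0 / 2) (K := 4 * c.size ^ 3) (X := X) (Y := Y)
    (by
      have := abs_RQ_le_of_near (Ψ := fun k j l => Jc k * Jc j * pe c j l) (n := 1) le_rfl
        (α := 0) (C := 2 * c.size) (fun k j l => by
        rw [zero_mul, sub_zero, pow_one]
        exact (abs_JJ_pe_le c k j l).trans (le_of_eq (by ring))) c2 hM0 hMM
        hrA hre hA1 he1 hw
      rwa [mul_comm M] at this)
    ((kk r2 z4 (nn _ _ c2)).trans (by linarith)) (nn _ _ c2) hMM xMM hM0 yM hS rfl
  have B9' := group_le (r := lam₂ c 0 / 2) (K := 2 * c.size ^ 3) (X := X) (Y := Y)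
    (by
      have := abs_RQ_le_of_near (Ψ := fun k j _ => Jc k * Jc j * j) (n := 1) le_rfl
        (α := 0) (C := 1) (fun k j l => by
        rw [zero_mul, sub_zero, one_mul, pow_one]
        exact (abs_JJ_mul_le k j).trans (one_le_jb_mul _ _)) zero_le_one hM0 hH
        hrA hrh hA1 hh1 hw
      rwa [mul_comm M] at this)
    ((kk r2 z2 (nn _ _ zero_le_one)).trans (by linarith)) (nn _ _ zero_le_one) hH xH hM0 yM hS rfl
  have B10 := group_le (r := 2 * mu₃ c) (K := 22 * c.size ^ 3) (X := X) (Y := Y)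
    (abs_RQ_le_of_near (Ψ := fun k j l => Jc k * Jc j * pq c j l) (n := 2) (by norm_num)
    (α := -(c.c₁ - c.c₄)) (C := 5 * c.size) (fun k j l => by
      rw [neg_mul, sub_neg_eq_add]; exact (abs_JJ_pq_add_le c k j l).trans (le_of_eq (by ring)))
    c5 hMM hM0 hre hr he2 ha2 hw) ((kk r3 q11 (nn _ _ c5)).trans (by linarith))
    (nn _ _ c5) hMM xMM hM0 yM hS rfl
  have B11 := group_le (r := 2 * mu₃ c) (K := 8 * c.size ^ 3) (X := X) (Y := Y)
    (abs_RQ_le_of_near (Ψ := fun k j l => Jc k * Jc j * pe c j l) (n := 1) le_rfl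
    (α := 0) (C := 2 * c.size) (fun k j l => by
      rw [zero_mul, sub_zero, pow_one]
      exact (abs_JJ_pe_le c k j l).trans (le_of_eq (by ring))) c2 hMM hMM
    hre hre he1 he1 hw) ((kk r3 z4 (nn _ _ c2)).trans (by linarith))
    (nn _ _ c2) hMM xMM hMM yMM hS rfl
  have B12 := group_le (r := 2 * mu₃ c) (K := 4 * c.size ^ 3) (X := X) (Y := Y)
    (by
      have := abs_RQ_le_of_near (Ψ := fun k j _ => Jc k * Jc j * j) (n := 1) le_rfl
        (α := 0) (C := 1) (fun k j l => by
        rw [zero_mul, sub_zero, one_mul, pow_one]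
        exact (abs_JJ_mul_le k j).trans (one_le_jb_mul _ _)) zero_le_one hMM hH
        hre hrh he1 hh1 hw
      rwa [mul_comm (M * M) H] at this)
    ((kk r3 z2 (nn _ _ zero_le_one)).trans (by linarith)) (nn _ _ zero_le_one) hH xH hMM yMM hS rfl
  rw [main_eq c κ fa fh hw]
  have hZ : 0 ≤ c.size ^ 3 * (X * Y * S) := by positivity
  have st : ∀ {p q A B : ℝ}, |p| ≤ A → |q| ≤ B → |p + q| ≤ A + B :=
    fun hp hq => (abs_add_le _ _).trans (add_le_add hp hq)
  refine (st (st (st (st (st (st (st (st (st (st (st (st (st B1 B5) B2) B3) B4) B4') B6) B7) B8) B9)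
    B9') B10) B11) B12).trans ?_
  linarith
end BO4
end

noncomputable section
namespace BO4
open scoped ENNReal ComplexConjugate

/-! ### Sequences dominated by a convolution with the difference -/

/-- The sequence `x`, with `n` derivatives, is dominated by the convolution of `w` with a sequence
of mass at most `R`. -/
def Dm (n : ℕ) (R : ℝ) (w x : ℤ → ℂ) : Prop :=
  ∃ B : ℤ → ℝ≥0∞, ∑' k, B k ≤ ENNReal.ofReal R ∧ ∀ k, wt n x k ≤ econv B (wt 0 w) k

lemma econv_add_left (A A' B : ℤ → ℝ≥0∞) (k : ℤ) :
    econv (fun k => A k + A' k) B k = econv A B k + econv A' B k := by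
  unfold econv
  rw [← ENNReal.tsum_add]
  exact tsum_congr fun j => add_mul _ _ _

lemma econv_mul_left (c : ℝ≥0∞) (A B : ℤ → ℝ≥0∞) (k : ℤ) :
    econv (fun k => c * A k) B k = c * econv A B k := by
  unfold econv
  rw [← ENNReal.tsum_mul_left]
  exact tsum_congr fun j => mul_assoc _ _ _

lemma wt_add_le (n : ℕ) (x y : ℤ → ℂ) (k : ℤ) : wt n (x + y) k ≤ wt n x k + wt n y k := by
  rw [wt, wt, wt, ← mul_add]
  exact mul_le_mul_right (enorm_add_le _ _) _

lemma enorm_ofReal_abs (r : ℝ) : ‖(r : ℂ)‖ₑ = ENNReal.ofReal |r| := by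
  rw [enorm_ofReal_eq, ← ofReal_norm, Real.norm_eq_abs]

namespace Dm
variable {n : ℕ} {R R' : ℝ} {w x y : ℤ → ℂ}

lemma add (hR : 0 ≤ R) (hR' : 0 ≤ R') (h : Dm n R w x) (h' : Dm n R' w y) :
    Dm n (R + R') w (x + y) := by
  obtain ⟨B, hB, hx⟩ := h
  obtain ⟨B', hB', hy⟩ := h'
  refine ⟨fun k => B k + B' k, ?_, fun k => ?_⟩
  · rw [ENNReal.tsum_add, ENNReal.ofReal_add hR hR']; exact add_le_add hB hB'
  · rw [econv_add_left]
    exact (wt_add_le n x y k).trans (add_le_add (hx k) (hy k))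

lemma smul (r : ℝ) (h : Dm n R w x) : Dm n (|r| * R) w ((r : ℂ) • x) := by
  obtain ⟨B, hB, hx⟩ := h
  refine ⟨fun k => ENNReal.ofReal |r| * B k, ?_, fun k => ?_⟩
  · rw [ENNReal.tsum_mul_left, ENNReal.ofReal_mul (abs_nonneg r)]; exact mul_le_mul_right hB _
  · rw [econv_mul_left]
    refine le_trans (le_of_eq ?_) (mul_le_mul_right (hx k) _)
    rw [wt, wt, Pi.smul_apply, smul_eq_mul, enorm_mul, enorm_ofReal_abs]; ring

lemma neg (h : Dm n R w x) : Dm n R w (-x) := by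
  obtain ⟨B, hB, hx⟩ := h
  exact ⟨B, hB, fun k => by simpa [wt] using hx k⟩

lemma le (hR : R ≤ R') (h : Dm n R w x) : Dm n R' w x := by
  obtain ⟨B, hB, hx⟩ := h
  exact ⟨B, hB.trans (ENNReal.ofReal_le_ofReal hR), hx⟩

lemma ml {s : ℕ} {m : ℤ → ℂ} (hm : ∀ k, ‖m k‖ₑ ≤ jw k ^ s) (h : Dm (n + s) R w x) :
    Dm n R w (ml m x) := by
  obtain ⟨B, hB, hx⟩ := h
  refine ⟨B, hB, fun k => le_trans ?_ (hx k)⟩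
  simp only [wt, BO4.ml, enorm_mul]
  rw [pow_add, mul_assoc]
  gcongr
  exact hm k

lemma conv {A : ℝ} {a : ℤ → ℂ} (hA : 0 ≤ A) (ha : nr n a ≤ ENNReal.ofReal A) (h : Dm n R w x) :
    Dm n (A * R) w (conv a x) := by
  obtain ⟨B, hB, hx⟩ := h
  refine ⟨econv (wt n a) B, ?_, fun k => ?_⟩
  · rw [tsum_econv, ENNReal.ofReal_mul hA]; exact mul_le_mul' ha hB
  · rw [econv_assoc]
    exact (wt_conv_le n a x k).trans (econv_mono (fun _ => le_rfl) hx k)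

end Dm

lemma jw_le_add (k j : ℤ) : jw k ≤ jw (k - j) + jw j := by
  rw [jw, jw, jw, ← ENNReal.ofReal_add (jb_pos _).le (jb_pos _).le]
  refine ENNReal.ofReal_le_ofReal ?_
  have := abs_add_le ((k : ℝ) - j) j
  unfold jb
  push_cast
  rw [sub_add_cancel] at this
  linarith

/-- Up to three derivatives distributed over a product and its factors can all be put on the factor
of larger frequency. -/
lemma add_pow_mul_le {p q : ℝ≥0∞} (hp : 1 ≤ p) {n a b : ℕ} (h : n + a + b ≤ 3) :
    (p + q) ^ n * (p ^ a * q ^ b) ≤ 8 * (p ^ 3 + q ^ 3) := by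
  have hs : 1 ≤ p + q := hp.trans le_self_add
  calc (p + q) ^ n * (p ^ a * q ^ b) ≤ (p + q) ^ n * ((p + q) ^ a * (p + q) ^ b) := by
        gcongr <;> simp
    _ = (p + q) ^ (n + a + b) := by ring
    _ ≤ (p + q) ^ 3 := pow_le_pow_right₀ hs h
    _ ≤ (2 * max p q) ^ 3 := by
        gcongr; rw [two_mul]; exact add_le_add (le_max_left _ _) (le_max_right _ _)
    _ = 8 * (max p q) ^ 3 := by ring
    _ ≤ 8 * (p ^ 3 + q ^ 3) := by
        gcongr
        rcases le_total p q with h | h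
        · rw [max_eq_right h]; exact le_add_self
        · rw [max_eq_left h]; exact le_self_add

lemma jw_pow_mul_econv_wt_le {n a b : ℕ} (h : n + a + b ≤ 3) (w : ℤ → ℂ) (k : ℤ) :
    jw k ^ n * econv (wt a w) (wt b w) k ≤ econv (fun k => 16 * wt 3 w k) (wt 0 w) k := by
  -- The constant `16` is twice the `8` of the elementary inequality: by commutativity the two
  -- choices of the factor with three derivatives give the same convolution.
  have e : econv (fun k => 16 * wt 3 w k) (wt 0 w) k
      = 8 * (econv (wt 3 w) (wt 0 w) k + econv (wt 0 w) (wt 3 w) k) := by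
    rw [econv_mul_left, econv_comm (wt 0 w)]; ring
  rw [e]
  unfold econv
  rw [← ENNReal.tsum_add, ← ENNReal.tsum_mul_left, ← ENNReal.tsum_mul_left]
  refine ENNReal.tsum_le_tsum fun j => ?_
  have := add_pow_mul_le (q := jw j) (one_le_jw (k - j)) h
  simp only [wt, pow_zero, one_mul]
  calc jw k ^ n * (jw (k - j) ^ a * ‖w (k - j)‖ₑ * (jw j ^ b * ‖w j‖ₑ))
      ≤ (jw (k - j) + jw j) ^ n * (jw (k - j) ^ a * ‖w (k - j)‖ₑ * (jw j ^ b * ‖w j‖ₑ)) := by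
        gcongr; exact jw_le_add k j
    _ = (jw (k - j) + jw j) ^ n * (jw (k - j) ^ a * jw j ^ b) * (‖w (k - j)‖ₑ * ‖w j‖ₑ) := by ring
    _ ≤ 8 * (jw (k - j) ^ 3 + jw j ^ 3) * (‖w (k - j)‖ₑ * ‖w j‖ₑ) := by gcongr
    _ = _ := by ring

lemma tsum_wt_le {w : ℤ → ℂ} {M : ℝ} (hw : nr 3 w ≤ ENNReal.ofReal M) :
    ∑' k, 16 * wt 3 w k ≤ ENNReal.ofReal (16 * M) := by
  rw [ENNReal.tsum_mul_left, ENNReal.ofReal_mul (by norm_num), ENNReal.ofReal_ofNat]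
  exact mul_le_mul_right hw _

/-- Products of two derivatives of the difference. -/
lemma Dm.of_mul {n a b : ℕ} (h : n + a + b ≤ 3) {w x y : ℤ → ℂ} {M : ℝ}
    (hw : nr 3 w ≤ ENNReal.ofReal M) (hx : ∀ k, ‖x k‖ₑ ≤ wt a w k) (hy : ∀ k, ‖y k‖ₑ ≤ wt b w k) :
    Dm n (16 * M) w (BO4.conv x y) := by
  refine ⟨fun k => 16 * wt 3 w k, tsum_wt_le hw, fun k => ?_⟩
  refine le_trans ?_ (jw_pow_mul_econv_wt_le h w k)
  refine mul_le_mul_right ((enorm_conv_le x y k).trans (econv_mono (fun k => ?_) (fun k => ?_) k)) _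
  · simpa [wt] using hx k
  · simpa [wt] using hy k

/-- Products of two derivatives of the difference, one of them after a product. -/
lemma Dm.of_mul_conv {n a b : ℕ} (h : n + a + b ≤ 3) {w x y q : ℤ → ℂ} {M Q : ℝ} {d : ℕ}
    (hQ : 0 ≤ Q) (hw : nr 3 w ≤ ENNReal.ofReal M) (hq : nr (n + d) q ≤ ENNReal.ofReal Q)
    (hx : ∀ k, ‖x k‖ₑ ≤ wt a w k) (hy : ∀ k, ‖y k‖ₑ ≤ econv (wt d q) (wt b w) k) :
    Dm n (Q * (16 * M)) w (BO4.conv x y) := by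
  refine ⟨econv (wt (n + d) q) fun k => 16 * wt 3 w k, ?_, fun k => ?_⟩
  · rw [tsum_econv, ENNReal.ofReal_mul hQ]
    exact mul_le_mul' hq (tsum_wt_le hw)
  · have h1 : wt n (BO4.conv x y) k ≤ jw k ^ n * econv (wt d q) (econv (wt a w) (wt b w)) k := by
      rw [← econv_assoc, econv_comm (wt d q), econv_assoc]
      refine mul_le_mul_right ((enorm_conv_le x y k).trans
        (econv_mono (fun k => ?_) (fun k => ?_) k)) _
      · simpa [wt] using hx k
      · simpa [wt] using hy k
    refine h1.trans ((jw_pow_mul_econv_le n _ _ k).trans ?_)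
    rw [econv_assoc]
    refine econv_mono (fun k => le_of_eq ?_) (fun k => jw_pow_mul_econv_wt_le h w k) k
    rw [wt, wt, pow_add, mul_assoc]

lemma enorm_ml_le_wt {s : ℕ} {m : ℤ → ℂ} (hm : ∀ k, ‖m k‖ₑ ≤ jw k ^ s) (w : ℤ → ℂ) (k : ℤ) :
    ‖ml m w k‖ₑ ≤ wt s w k := by
  rw [ml, enorm_mul]; exact mul_le_mul_left (hm k) _

lemma enorm_ml_conv_le {s : ℕ} {m : ℤ → ℂ} (hm : ∀ k, ‖m k‖ₑ ≤ jw k ^ s) (q w : ℤ → ℂ) (k : ℤ) :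
    ‖ml m (conv q w) k‖ₑ ≤ econv (wt s q) (wt s w) k :=
  (enorm_ml_le_wt hm _ k).trans (wt_conv_le s q w k)

/-! ### The double commutator -/

/-- The second difference of the absolute value vanishes as soon as `|l|` exceeds `|x| + |y|`, and
is always at most twice the smaller step. On its support the outer frequency is at most `2(|x| +
|y|)`. -/
lemma abs_double_diff_le (x y l : ℝ) :
    |l + x + y| * |(|l + y| + |l + x| - |l + x + y| - |l|)| ≤ 8 * (|x| * |y|) := by
  have h1 : |(|l + y| + |l + x| - |l + x + y| - |l|)| ≤ 2 * |x| := by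
    have a1 := abs_abs_sub_abs_le (l + x) l
    have a2 := abs_abs_sub_abs_le (l + y) (l + x + y)
    rw [show l + x - l = x by ring] at a1
    rw [show l + y - (l + x + y) = -x by ring, abs_neg] at a2
    rw [abs_le] at *
    constructor <;> linarith
  have h2 : |(|l + y| + |l + x| - |l + x + y| - |l|)| ≤ 2 * |y| := by
    have a1 := abs_abs_sub_abs_le (l + y) l
    have a2 := abs_abs_sub_abs_le (l + x) (l + x + y)
    rw [show l + y - l = y by ring] at a1
    rw [show l + x - (l + x + y) = -y by ring, abs_neg] at a2
    rw [abs_le] at *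
    constructor <;> linarith
  -- In this case all four arguments have the sign of `l`, and the absolute value is linear on them.
  by_cases hl : |x| + |y| < |l|
  · have hz : |l + y| + |l + x| - |l + x + y| - |l| = 0 := by
      have hx := abs_le.1 (le_refl |x|)
      have hy := abs_le.1 (le_refl |y|)
      have nx := abs_nonneg x
      have ny := abs_nonneg y
      rcases lt_abs.1 hl with h | h
      · rw [abs_of_nonneg (by linarith : 0 ≤ l + y), abs_of_nonneg (by linarith : 0 ≤ l + x),
          abs_of_nonneg (by linarith : 0 ≤ l + x + y), abs_of_nonneg (by linarith : 0 ≤ l)]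
        ring
      · rw [abs_of_nonpos (by linarith : l + y ≤ 0), abs_of_nonpos (by linarith : l + x ≤ 0),
          abs_of_nonpos (by linarith : l + x + y ≤ 0), abs_of_nonpos (by linarith : l ≤ 0)]
        ring
    rw [hz, abs_zero, mul_zero]; positivity
  · rw [not_lt] at hl
    have h3 : |l + x + y| ≤ 2 * (|x| + |y|) := by
      linarith [abs_add_le (l + x) y, abs_add_le l x]
    have nx := abs_nonneg x
    have ny := abs_nonneg y
    have nq := abs_nonneg (|l + y| + |l + x| - |l + x + y| - |l|)
    calc _ ≤ 2 * (|x| + |y|) * |(|l + y| + |l + x| - |l + x + y| - |l|)| := by gcongr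
      _ = 2 * (|x| * |(|l + y| + |l + x| - |l + x + y| - |l|)|
          + |y| * |(|l + y| + |l + x| - |l + x + y| - |l|)|) := by ring
      _ ≤ 2 * (|x| * (2 * |y|) + |y| * (2 * |x|)) := by gcongr
      _ = _ := by ring

lemma summable_conv_conv {a b x : ℤ → ℂ} {m₁ m₂ : ℤ → ℂ} (hm₁ : ∀ k, ‖m₁ k‖ₑ ≤ jw k ^ 1)
    (hm₂ : ∀ k, ‖m₂ k‖ₑ ≤ jw k ^ 1) (ha : nr 2 a ≠ ⊤) (hb : nr 2 b ≠ ⊤) (hx : nr 2 x ≠ ⊤) (k : ℤ) :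
    Summable fun p : ℤ × ℤ => a (k - p.1) * (m₁ p.1 * (b (p.1 - p.2) * (m₂ p.2 * x p.2))) := by
  apply summable_of_tsum_enorm
  have fin : econv (wt 0 a) (econv (wt 2 b) (wt 2 x)) k ≠ ⊤ := by
    refine ne_top_of_le_ne_top ?_ (ENNReal.le_tsum (f := econv (wt 0 a) (econv (wt 2 b) (wt 2 x))) k)
    rw [tsum_econv, tsum_econv]
    exact ENNReal.mul_ne_top (nr_ne_top_mono (by norm_num) ha) (ENNReal.mul_ne_top hb hx)
  refine ne_top_of_le_ne_top fin ?_
  rw [ENNReal.tsum_prod']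
  unfold econv
  refine ENNReal.tsum_le_tsum fun j => ?_
  rw [← ENNReal.tsum_mul_left]
  refine ENNReal.tsum_le_tsum fun l => ?_
  simp only [enorm_mul, wt, pow_zero, one_mul]
  refine mul_le_mul_right ?_ _
  calc ‖m₁ j‖ₑ * (‖b (j - l)‖ₑ * (‖m₂ l‖ₑ * ‖x l‖ₑ))
      ≤ (jw (j - l) * jw l) * (‖b (j - l)‖ₑ * (jw l * ‖x l‖ₑ)) := by
        gcongr
        · exact (hm₁ j).trans ((pow_one _).le.trans (jw_le_sub_mul j l))
        · exact (hm₂ l).trans (pow_one _).le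
    _ = jw (j - l) * ‖b (j - l)‖ₑ * (jw l ^ 2 * ‖x l‖ₑ) := by ring
    _ ≤ _ := by
        gcongr
        calc jw (j - l) = jw (j - l) ^ 1 := (pow_one _).symm
          _ ≤ _ := jw_pow_mono _ (by norm_num)

lemma conv_conv_eq {a b x : ℤ → ℂ} {m₁ m₂ : ℤ → ℂ} (hm₁ : ∀ k, ‖m₁ k‖ₑ ≤ jw k ^ 1)
    (hm₂ : ∀ k, ‖m₂ k‖ₑ ≤ jw k ^ 1) (ha : nr 2 a ≠ ⊤) (hb : nr 2 b ≠ ⊤) (hx : nr 2 x ≠ ⊤) (k : ℤ) :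
    conv a (ml m₁ (conv b (ml m₂ x))) k
      = ∑' p : ℤ × ℤ, a (k - p.1) * (m₁ p.1 * (b (p.1 - p.2) * (m₂ p.2 * x p.2))) := by
  rw [(summable_conv_conv hm₁ hm₂ ha hb hx k).tsum_prod]
  unfold conv ml
  refine tsum_congr fun j => ?_
  rw [← tsum_mul_left, ← tsum_mul_left]

/-- The double commutator of `|D|` with a function, differentiated once. -/
def comm (a w : ℤ → ℂ) : ℤ → ℂ :=
  ml symD ((2 : ℂ) • conv a (ml symA (conv a w)) - ml symA (conv (conv a a) w)
    - conv (conv a a) (ml symA w))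

lemma enorm_one_le (k : ℤ) : ‖(1 : ℤ → ℂ) k‖ₑ ≤ jw k ^ 1 := by
  simpa using one_le_jw k

lemma ml_one (a : ℤ → ℂ) : ml 1 a = a := by funext k; simp [ml]

/-- The term `a|D|(aw)` occurs twice; in one copy the intermediate frequency is reflected, which
symmetrizes in the two copies of `a` and produces a genuine second difference of `|·|`. -/
lemma comm_eq {a w : ℤ → ℂ} (ha : nr 2 a ≠ ⊤) (hw : nr 2 w ≠ ⊤) (k : ℤ) :
    comm a w k = ∑' p : ℤ × ℤ, symD k * ((symA p.1 + symA (k + p.2 - p.1) - symA k - symA p.2)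
      * (a (k - p.1) * (a (p.1 - p.2) * w p.2))) := by
  have ha0 := nr_ne_top_mono (Nat.zero_le 2) ha
  have hw0 := nr_ne_top_mono (Nat.zero_le 2) hw
  have e1 := conv_conv_eq enorm_symA_le enorm_one_le ha ha hw k
  have e2 := conv_conv_eq enorm_one_le enorm_one_le ha ha hw k
  have e3 := conv_conv_eq enorm_one_le enorm_symA_le ha ha hw k
  have s1 := summable_conv_conv enorm_symA_le enorm_one_le ha ha hw k
  have s2 := summable_conv_conv enorm_one_le enorm_one_le ha ha hw k
  have s3 := summable_conv_conv enorm_one_le enorm_symA_le ha ha hw k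
  simp only [ml_one, Pi.one_apply, one_mul] at e1 e2 e3 s1 s2 s3
  have hA0 : nr 0 (ml symA w) ≠ ⊤ := nr_ml_ne_top (n := 0) enorm_symA_le (by norm_num) hw
  -- The reflection `j ↦ k + l - j` exchanges `k - j` and `j - l`, the frequencies of the two copies
  -- of `a`.
  let E : ℤ × ℤ ≃ ℤ × ℤ :=
    { toFun := fun p => (k + p.2 - p.1, p.2)
      invFun := fun p => (k + p.2 - p.1, p.2)
      left_inv := fun p => by simp
      right_inv := fun p => by simp }
  have s1' := E.summable_iff.2 s1
  have e1' : conv a (ml symA (conv a w)) k = ∑' p : ℤ × ℤ,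
      a (k - (k + p.2 - p.1)) * (symA (k + p.2 - p.1) * (a (k + p.2 - p.1 - p.2) * w p.2)) := by
    rw [e1, ← E.tsum_eq]; rfl
  have s1'' : Summable fun p : ℤ × ℤ =>
      a (k - (k + p.2 - p.1)) * (symA (k + p.2 - p.1) * (a (k + p.2 - p.1 - p.2) * w p.2)) := s1'
  have key : comm a w k = symD k * ((conv a (ml symA (conv a w)) k + conv a (ml symA (conv a w)) k)
      - symA k * conv a (conv a w) k - conv a (conv a (ml symA w)) k) := by
    simp only [comm, ml, Pi.sub_apply, Pi.smul_apply, smul_eq_mul, conv_assoc ha0 ha0 hw0]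
    rw [conv_assoc ha0 ha0 hA0]; ring
  rw [key]
  nth_rw 2 [e1']
  rw [e1, e2, e3, ← tsum_mul_left, ← s1.tsum_add s1'', ← (s1.add s1'').tsum_sub (s2.mul_left _),
    ← ((s1.add s1'').sub (s2.mul_left _)).tsum_sub s3, ← tsum_mul_left]
  refine tsum_congr fun p => ?_
  rw [show k - (k + p.2 - p.1) = p.1 - p.2 by ring, show k + p.2 - p.1 - p.2 = k - p.1 by ring]
  ring

/-- Even with a derivative in front, the double commutator is bounded on `w`: its kernel costs one
weight on each copy of `a` and none on `w`. -/
lemma dm_comm {a w : ℤ → ℂ} {M : ℝ} (hM : 0 ≤ M) (ha : nr 2 a ≤ ENNReal.ofReal M)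
    (hw : nr 2 w ≠ ⊤) : Dm 0 (8 * (M * M)) w (comm a w) := by
  have ha' := ne_top_of_le_ofReal ha
  have ha1 := (nr_mono (show 1 ≤ 2 by norm_num) a).trans ha
  refine ⟨fun k => 8 * econv (wt 1 a) (wt 1 a) k, ?_, fun k => ?_⟩
  · rw [ENNReal.tsum_mul_left, tsum_econv, ENNReal.ofReal_mul (by norm_num), ENNReal.ofReal_mul hM,
      ENNReal.ofReal_ofNat]
    exact mul_le_mul_right (mul_le_mul' ha1 ha1) _
  · rw [econv_mul_left, econv_assoc, wt, pow_zero, one_mul, comm_eq ha' hw k]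
    refine (enorm_tsum_le _).trans ?_
    rw [ENNReal.tsum_prod']
    unfold econv
    rw [← ENNReal.tsum_mul_left]
    refine ENNReal.tsum_le_tsum fun j => ?_
    rw [← ENNReal.tsum_mul_left, ← ENNReal.tsum_mul_left]
    refine ENNReal.tsum_le_tsum fun l => ?_
    have hk : ‖symD k * (symA j + symA (k + l - j) - symA k - symA l)‖ₑ
        ≤ 8 * (jw (k - j) * jw (j - l)) := by
      have e : ‖symD k * (symA j + symA (k + l - j) - symA k - symA l)‖
          = |(k : ℝ)| * |(|(j : ℝ)| + |(k : ℝ) + l - j| - |(k : ℝ)| - |(l : ℝ)|)| := by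
        rw [norm_mul]
        congr 1
        · rw [symD, norm_mul, Complex.norm_I, one_mul, Complex.norm_intCast]
        · rw [show symA j + symA (k + l - j) - symA k - symA l
            = ((|(j : ℝ)| + |(k : ℝ) + l - j| - |(k : ℝ)| - |(l : ℝ)| : ℝ) : ℂ) by
              simp [symA], Complex.norm_real, Real.norm_eq_abs]
      have h := abs_double_diff_le ((k : ℝ) - j) (j - l) l
      rw [show (l : ℝ) + (k - j) + (j - l) = k by ring, show (l : ℝ) + (j - l) = j by ring,
        show (l : ℝ) + (k - j) = k + l - j by ring] at h
      have a1 := abs_le_jb (k - j)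
      have a2 := abs_le_jb (j - l)
      push_cast at a1 a2
      rw [← ofReal_norm, e, jw, jw, ← ENNReal.ofReal_mul (jb_pos _).le,
        ← ENNReal.ofReal_ofNat 8, ← ENNReal.ofReal_mul (by norm_num)]
      refine ENNReal.ofReal_le_ofReal (h.trans ?_)
      gcongr
      exact (jb_pos _).le
    rw [← mul_assoc, enorm_mul]
    refine (mul_le_mul_left hk _).trans (le_of_eq ?_)
    simp only [enorm_mul, wt, pow_one, pow_zero, one_mul]
    ring
end BO4
end

noncomputable section
namespace BO4
open scoped ENNReal ComplexConjugate

/-! ### The equation for the difference -/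

/-- The zeroth order coefficient in the linearized equation. -/
def potential (c : Coeffs) (a : ℤ → ℂ) : ℤ → ℂ :=
  (c.c₆ / 2 : ℂ) • ml symA (conv a a) + (2 * c.c₇ : ℂ) • conv a (ml symA a)
    - (4 : ℂ) • conv (conv a a) a

/-- The linearization of `nlin` at `a` in the direction `w`. -/
def linK (c : Coeffs) (a w : ℤ → ℂ) : ℤ → ℂ :=
  (c.c₁ : ℂ) • (conv a (ml (symD * symD) w) + conv (ml (symD * symD) a) w)
    + (2 * c.c₂ : ℂ) • conv (ml symD a) (ml symD w)
    + (2 * c.c₃ : ℂ) • conv (ml symA a) (ml symA w)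
    + (c.c₄ : ℂ) • ml symH (conv a (ml (symH * (symD * symD)) w)
      + conv (ml (symH * (symD * symD)) a) w)
    + (c.c₅ : ℂ) • ml symA (conv (conv a a) w)
    + (c.c₆ : ℂ) • conv a (ml symA (conv a w))
    + (c.c₇ : ℂ) • conv (conv a a) (ml symA w) + conv (potential c a) w

/-- The terms of `nlin` that are at least quadratic in the difference. -/
def remK (c : Coeffs) (a q w : ℤ → ℂ) : ℤ → ℂ :=
  (c.c₁ : ℂ) • -conv w (ml (symD * symD) w) + (c.c₂ : ℂ) • -conv (ml symD w) (ml symD w)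
    + (c.c₃ : ℂ) • -conv (ml symA w) (ml symA w)
    + (c.c₄ : ℂ) • -ml symH (conv w (ml (symH * (symD * symD)) w))
    + ((c.c₅ / 3 : ℝ) : ℂ) • -ml symA (conv (a + q) (conv w w))
    + ((c.c₆ / 2 : ℝ) : ℂ) • -(conv a (ml symA (conv w w)) + conv w (ml symA (conv q w)))
    + (c.c₇ : ℂ) • -(conv (ml symA a) (conv w w) + conv (ml symA w) (conv q w))
    + (conv (conv a (a + a)) (conv w w) + conv q (conv w (conv q w)))

lemma conv_sub_sub {a x b y : ℤ → ℂ} (ha : nr 0 a ≠ ⊤) (hx : nr 0 x ≠ ⊤) (hb : nr 0 b ≠ ⊤)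
    (hy : nr 0 y ≠ ⊤) :
    conv (a - b) (x - y) = conv a x - (conv a y + conv x b - conv b y) := by
  have := congrArg WA.val (show ((⟨a, ha⟩ : WA) - ⟨b, hb⟩) * (⟨x, hx⟩ - ⟨y, hy⟩)
    = ⟨a, ha⟩ * ⟨x, hx⟩ - (⟨a, ha⟩ * ⟨y, hy⟩ + ⟨x, hx⟩ * ⟨b, hb⟩ - ⟨b, hb⟩ * ⟨y, hy⟩) by ring)
  simpa only [WA.val_add, WA.val_sub, WA.val_mul] using this

lemma conv_add_left {a a' b : ℤ → ℂ} (ha : nr 0 a ≠ ⊤) (ha' : nr 0 a' ≠ ⊤) (hb : nr 0 b ≠ ⊤) :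
    conv (a + a') b = conv a b + conv a' b := by
  rw [conv_comm, conv_add_right hb ha ha', conv_comm b, conv_comm b]

lemma conv_smul_left (r : ℂ) (a b : ℤ → ℂ) : conv (r • a) b = r • conv a b := by
  rw [conv_comm, conv_smul_right, conv_comm]

lemma nr_smul_ne_top {n : ℕ} {a : ℤ → ℂ} (r : ℂ) (h : nr n a ≠ ⊤) : nr n (r • a) ≠ ⊤ := by
  rw [nr_smul]; exact ENNReal.mul_ne_top enorm_ne_top h

lemma nr_add_ne_top {n : ℕ} {a b : ℤ → ℂ} (h : nr n a ≠ ⊤) (h' : nr n b ≠ ⊤) :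
    nr n (a + b) ≠ ⊤ :=
  ne_top_of_le_ne_top (ENNReal.add_ne_top.2 ⟨h, h'⟩) (nr_add_le _ _ _)

lemma nr_sub_ne_top {n : ℕ} {a b : ℤ → ℂ} (h : nr n a ≠ ⊤) (h' : nr n b ≠ ⊤) :
    nr n (a - b) ≠ ⊤ :=
  ne_top_of_le_ne_top (ENNReal.add_ne_top.2 ⟨h, h'⟩) (nr_sub_le _ _ _)

lemma enorm_symHDD_le (k : ℤ) : ‖(symH * (symD * symD)) k‖ₑ ≤ jw k ^ 2 := by
  simpa using enorm_mul_symbol_le enorm_symH_le enorm_symD_sq_le k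

/-- An exact Taylor expansion of the polynomial `N`. With `q = f + g` one has `(a-w)² = a² - q w`,
so the higher order remainder can be written with at least two explicit factors `w` and coefficients
built from `a` and `q`. -/
lemma nlin_sub (c : Coeffs) {a w : ℤ → ℂ} (ha : nr 3 a ≠ ⊤) (hw : nr 3 w ≠ ⊤) :
    nlin c (a - w) = nlin c a - (linK c a w + remK c a (a + (a - w)) w) := by
  have a0 := nr_ne_top_mono (Nat.zero_le 3) ha
  have w0 := nr_ne_top_mono (Nat.zero_le 3) hw
  have f := fun {x : ℤ → ℂ} (hx : nr 3 x ≠ ⊤) => nr_ml_ne_top (n := 0) (N := 3) enorm_symD_le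
    (by norm_num) hx
  have f2 := fun {x : ℤ → ℂ} (hx : nr 3 x ≠ ⊤) => nr_ml_ne_top (n := 0) (N := 3) enorm_symD_sq_le
    (by norm_num) hx
  have fA := fun {x : ℤ → ℂ} (hx : nr 3 x ≠ ⊤) => nr_ml_ne_top (n := 0) (N := 3) enorm_symA_le
    (by norm_num) hx
  have fH := fun {x : ℤ → ℂ} (hx : nr 3 x ≠ ⊤) => nr_ml_ne_top (n := 0) (N := 3) enorm_symHDD_le
    (by norm_num) hx
  set q := a + (a - w) with hq
  have q3 : nr 3 q ≠ ⊤ := nr_add_ne_top ha (nr_sub_ne_top ha hw)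
  have q0 := nr_ne_top_mono (Nat.zero_le 3) q3
  -- The undifferentiated identities between products hold in any commutative ring and are checked
  -- in the Wiener algebra.
  let A : WA := ⟨a, a0⟩
  let W : WA := ⟨w, w0⟩
  let Q : WA := A + (A - W)
  have hQ : Q.val = q := by rw [WA.val_add, WA.val_sub]
  have hA : A.val = a := rfl
  have hW : W.val = w := rfl
  have sq : conv (a - w) (a - w) = conv a a - conv q w := by
    have := congrArg WA.val (show (A - W) * (A - W) = A * A - Q * W by simp only [Q]; ring)
    simpa only [WA.val_sub, WA.val_mul, hQ, hA, hW] using this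
  have cu : conv (conv a a - conv q w) (a - w) = conv (conv a a) a
      - ((conv (conv a a) w + conv (conv a a) w + conv (conv a a) w)
        - conv (a + q) (conv w w)) := by
    have := congrArg WA.val (show (A * A - Q * W) * (A - W)
      = A * A * A - ((A * A * W + A * A * W + A * A * W) - (A + Q) * (W * W)) by
        simp only [Q]; ring)
    simpa only [WA.val_sub, WA.val_mul, WA.val_add, hQ, hA, hW] using this
  have qw : conv q w = (2 : ℂ) • conv a w - conv w w := by
    have := congrArg WA.val (show Q * W = A * W + A * W - W * W by simp only [Q]; ring)
    rw [two_smul]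
    simpa only [WA.val_sub, WA.val_mul, WA.val_add, hQ, hA, hW] using this
  have s7 : conv (ml symA a) (conv q w) = (2 : ℂ) • conv (conv a (ml symA a)) w
      - conv (ml symA a) (conv w w) := by
    let X : WA := ⟨ml symA a, fA ha⟩
    have hX : X.val = ml symA a := rfl
    have := congrArg WA.val (show X * (Q * W) = A * X * W + A * X * W - X * (W * W) by
      simp only [Q]; ring)
    rw [two_smul]
    simpa only [WA.val_sub, WA.val_mul, WA.val_add, hQ, hA, hW, hX] using this
  have s8 : conv (conv a a) (conv q w) + conv (conv a a) (conv q w)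
        - conv (conv q w) (conv q w)
      = (4 : ℂ) • conv (conv (conv a a) a) w
        - (conv (conv a (a + a)) (conv w w) + conv q (conv w (conv q w))) := by
    have := congrArg WA.val (show (A * A) * (Q * W) + (A * A) * (Q * W) - (Q * W) * (Q * W)
      = (A * A * A * W + A * A * A * W + (A * A * A * W + A * A * A * W))
        - (A * (A + A) * (W * W) + Q * (W * (Q * W))) by simp only [Q]; ring)
    rw [show (4 : ℂ) = 2 + 2 by norm_num, add_smul, two_smul]
    simpa only [WA.val_sub, WA.val_mul, WA.val_add, hQ, hA, hW] using this
  have aa := nr_conv_ne_top ha ha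
  have qwf := nr_conv_ne_top q3 hw
  have aa0 := nr_conv_ne_top a0 a0
  have qw0 := nr_conv_ne_top q0 w0
  have pot : conv (potential c a) w = (c.c₆ / 2 : ℂ) • conv (ml symA (conv a a)) w
      + (2 * c.c₇ : ℂ) • conv (conv a (ml symA a)) w - (4 : ℂ) • conv (conv (conv a a) a) w := by
    have p1 := nr_smul_ne_top (c.c₆ / 2 : ℂ) (fA aa)
    have p2 := nr_smul_ne_top (2 * c.c₇ : ℂ) (nr_conv_ne_top a0 (fA ha))
    have p3 := nr_smul_ne_top (-4 : ℂ) (nr_conv_ne_top aa0 a0)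
    rw [potential, sub_eq_add_neg, ← neg_smul, conv_add_left (nr_add_ne_top p1 p2) p3 w0,
      conv_add_left p1 p2 w0, conv_smul_left, conv_smul_left, conv_smul_left]
    module
  have l6 : conv a (ml symA (conv q w))
      = (2 : ℂ) • conv a (ml symA (conv a w)) - conv a (ml symA (conv w w)) := by
    rw [qw, ml_sub, ml_smul, conv_sub_right (summable_conv a0 (nr_smul_ne_top _ (fA (nr_conv_ne_top ha hw))))
      (summable_conv a0 (fA (nr_conv_ne_top hw hw))), conv_smul_right]
  have t1 := conv_sub_sub a0 (f2 ha) w0 (f2 hw)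
  have t2 := conv_sub_sub (f ha) (f ha) (f hw) (f hw)
  have t3 := conv_sub_sub (fA ha) (fA ha) (fA hw) (fA hw)
  have t4 := conv_sub_sub a0 (fH ha) w0 (fH hw)
  have t6 := conv_sub_sub a0 (fA aa) w0 (fA qwf)
  have t7 := conv_sub_sub aa0 (fA ha) qw0 (fA hw)
  have t8 := conv_sub_sub aa0 aa0 qw0 qw0
  rw [add_sub_assoc] at t8
  have s8' : conv (conv a a) (conv q w) + (conv (conv a a) (conv q w)
        - conv (conv q w) (conv q w))
      = (4 : ℂ) • conv (conv (conv a a) a) w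
        - (conv (conv a (a + a)) (conv w w) + conv q (conv w (conv q w))) := by
    rw [← s8]; abel
  rw [s8'] at t8
  rw [l6] at t6
  rw [s7] at t7
  unfold nlin linK remK
  rw [pot]
  simp only [ml_sub]
  rw [sq, cu]
  simp only [ml_sub]
  rw [t1, t2, t3, t4, t6, t7, t8]
  simp only [ml_sub, ml_add]
  rw [conv_comm (conv q w) (ml symA w)]
  push_cast
  module

lemma conv_hasSum {a x : ℤ → ℂ} (ha : nr 0 a ≠ ⊤) (hx : nr 0 x ≠ ⊤) (k : ℤ) :
    HasSum (fun l => a (k - l) * x l) (conv a x k) := (summable_conv ha hx k).hasSum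

lemma symA_eq_mul (k : ℤ) : symA k = symH k * symD k := (congrFun symH_mul_symD k).symm

/-- The symbols are matched termwise. The only term that is not an operator with kernel `(a*a)(k-l)`
times a symbol of `k` and `l` is `c₆ a|D|(a w)`; it is replaced by the average of `|D|(a² w)` and
`a²|D|w`, and the difference is the double commutator. -/
lemma ml_symD_linK (c : Coeffs) {a w : ℤ → ℂ} (ha : nr 3 a ≠ ⊤) (hw : nr 3 w ≠ ⊤)
    (hp : nr 0 (potential c a) ≠ ⊤) :
    ml symD (linK c a w) = linOp c a (potential c a) w + (c.c₆ / 2 : ℂ) • comm a w := by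
  have a0 := nr_ne_top_mono (Nat.zero_le 3) ha
  have w0 := nr_ne_top_mono (Nat.zero_le 3) hw
  have f := fun {x : ℤ → ℂ} (hx : nr 3 x ≠ ⊤) => nr_ml_ne_top (n := 0) (N := 3) enorm_symD_le
    (by norm_num) hx
  have f2 := fun {x : ℤ → ℂ} (hx : nr 3 x ≠ ⊤) => nr_ml_ne_top (n := 0) (N := 3) enorm_symD_sq_le
    (by norm_num) hx
  have fA := fun {x : ℤ → ℂ} (hx : nr 3 x ≠ ⊤) => nr_ml_ne_top (n := 0) (N := 3) enorm_symA_le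
    (by norm_num) hx
  have fH := fun {x : ℤ → ℂ} (hx : nr 3 x ≠ ⊤) => nr_ml_ne_top (n := 0) (N := 3) enorm_symHDD_le
    (by norm_num) hx
  have aa0 := nr_conv_ne_top a0 a0
  funext k
  have h1 := ((((((conv_hasSum a0 (f2 hw) k).add (conv_hasSum (f2 ha) w0 k)).mul_left (c.c₁ : ℂ)).add
    ((conv_hasSum (f ha) (f hw) k).mul_left (2 * c.c₂ : ℂ))).add
    ((conv_hasSum (fA ha) (fA hw) k).mul_left (2 * c.c₃ : ℂ))).add
    ((((conv_hasSum a0 (fH hw) k).add (conv_hasSum (fH ha) w0 k)).mul_left (symH k)).mul_left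
      (c.c₄ : ℂ))).mul_left (symD k)
  have h2 := ((((conv_hasSum aa0 w0 k).mul_left (c.c₅ * symA k)).add
    ((((conv_hasSum aa0 w0 k).mul_left (symA k)).add (conv_hasSum aa0 (fA hw) k)).mul_left
      (c.c₆ / 2 : ℂ))).add ((conv_hasSum aa0 (fA hw) k).mul_left (c.c₇ : ℂ))).mul_left (symD k)
  have h3 := (conv_hasSum hp w0 k).mul_left (symD k)
  have g1 : Complex.I * op (pq c) a w k = symD k *
      (c.c₁ * (conv a (ml (symD * symD) w) k + conv (ml (symD * symD) a) w k) +
        2 * c.c₂ * conv (ml symD a) (ml symD w) k + 2 * c.c₃ * conv (ml symA a) (ml symA w) k +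
        c.c₄ * (symH k * (conv a (ml (symH * (symD * symD)) w) k
          + conv (ml (symH * (symD * symD)) a) w k))) := by
    refine Eq.trans ?_ h1.tsum_eq
    rw [op, ← tsum_mul_left]
    refine tsum_congr fun l => ?_
    have e4 : symD k * symH k = ((|(k : ℝ)| : ℝ) : ℂ) := by rw [mul_comm, ← symA_eq_mul, symA]
    have e5 : ∀ l, symH l * (symD l * symD l) = Complex.I * (l : ℂ) * ((|(l : ℝ)| : ℝ) : ℂ) :=
      fun l => by rw [← mul_assoc, ← symA_eq_mul, symA, symD]; ring
    simp only [ml, Pi.mul_apply]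
    rw [e5, e5]
    rw [symD] at e4
    simp only [pq, symA, symD]
    push_cast
    linear_combination (Complex.I * k * a (k - l) * w l * (-c.c₁ * (l ^ 2 + (k - l) ^ 2)
      - 2 * c.c₂ * ((k - l) * l))) * Complex.I_sq
      - (Complex.I * a (k - l) * c.c₄ * w l * (l * ((|(l : ℝ)| : ℝ) : ℂ)
        + (k - l) * ((|(k : ℝ) - l| : ℝ) : ℂ))) * e4
  have g2 : Complex.I * op (pe c) (conv a a) w k = symD k *
      (c.c₅ * symA k * conv (conv a a) w k +
        c.c₆ / 2 * (symA k * conv (conv a a) w k + conv (conv a a) (ml symA w) k) +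
        c.c₇ * conv (conv a a) (ml symA w) k) := by
    refine Eq.trans ?_ h2.tsum_eq
    rw [op, ← tsum_mul_left]
    refine tsum_congr fun l => ?_
    simp only [ml, pe, symA, symD]
    push_cast
    ring
  have g3 : Complex.I * op (fun k _ => (k : ℝ)) (potential c a) w k
      = symD k * conv (potential c a) w k := by
    refine Eq.trans ?_ h3.tsum_eq
    rw [op, ← tsum_mul_left]
    refine tsum_congr fun l => ?_
    simp only [symD]
    push_cast
    ring
  simp only [linOp, Pi.add_apply, Pi.smul_apply, smul_eq_mul]
  rw [g1, g2, g3]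
  simp only [linK, comm, ml, Pi.add_apply, Pi.sub_apply, Pi.smul_apply, smul_eq_mul]
  ring
end BO4
end

noncomputable section
namespace BO4
open scoped ENNReal ComplexConjugate

/-! ### Bounds for the bounded parts of the equation -/

section bounds
variable {n : ℕ} {A B : ℝ} {a b : ℤ → ℂ}

lemma nr_add_le_ofReal (hA : 0 ≤ A) (hB : 0 ≤ B) (ha : nr n a ≤ ENNReal.ofReal A)
    (hb : nr n b ≤ ENNReal.ofReal B) : nr n (a + b) ≤ ENNReal.ofReal (A + B) := by
  rw [ENNReal.ofReal_add hA hB]; exact (nr_add_le n a b).trans (add_le_add ha hb)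

lemma nr_sub_le_ofReal (hA : 0 ≤ A) (hB : 0 ≤ B) (ha : nr n a ≤ ENNReal.ofReal A)
    (hb : nr n b ≤ ENNReal.ofReal B) : nr n (a - b) ≤ ENNReal.ofReal (A + B) := by
  rw [ENNReal.ofReal_add hA hB]; exact (nr_sub_le n a b).trans (add_le_add ha hb)

lemma nr_conv_le_ofReal (hA : 0 ≤ A) (ha : nr n a ≤ ENNReal.ofReal A)
    (hb : nr n b ≤ ENNReal.ofReal B) : nr n (conv a b) ≤ ENNReal.ofReal (A * B) := by
  rw [ENNReal.ofReal_mul hA]; exact (nr_conv_le n a b).trans (mul_le_mul' ha hb)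

lemma nr_smul_le_ofReal (r : ℝ) (ha : nr n a ≤ ENNReal.ofReal A) :
    nr n ((r : ℂ) • a) ≤ ENNReal.ofReal (|r| * A) := by
  rw [nr_smul, enorm_ofReal_abs, ENNReal.ofReal_mul (abs_nonneg r)]; exact mul_le_mul_right ha _

lemma nr_ml_le_ofReal {s N : ℕ} {m : ℤ → ℂ} (hm : ∀ k, ‖m k‖ₑ ≤ jw k ^ s) (h : n + s ≤ N)
    (ha : nr N a ≤ ENNReal.ofReal A) : nr n (ml m a) ≤ ENNReal.ofReal A :=
  (nr_ml_le hm a).trans ((nr_mono h a).trans ha)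

end bounds

/-- The potential contains one derivative of `a`, hence is bounded with weight `2`. It is at most
cubic in size, which is the `M³` in the final power `M⁷`. -/
lemma nr_potential_le (c : Coeffs) {a : ℤ → ℂ} {M : ℝ} (hM : 1 ≤ M)
    (ha : nr 3 a ≤ ENNReal.ofReal M) : nr 2 (potential c a) ≤ ENNReal.ofReal (6 * c.size * M ^ 3) := by
  have hM0 : 0 ≤ M := zero_le_one.trans hM
  have h2 := (nr_mono (show 2 ≤ 3 by norm_num) a).trans ha
  have e : potential c a = (((c.c₆ / 2 : ℝ) : ℂ) • ml symA (conv a a)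
      + ((2 * c.c₇ : ℝ) : ℂ) • conv a (ml symA a)) - ((4 : ℝ) : ℂ) • conv (conv a a) a := by
    unfold potential; push_cast; rfl
  rw [e]
  have p1 := nr_smul_le_ofReal (c.c₆ / 2) (nr_ml_le_ofReal (n := 2) enorm_symA_le le_rfl
    (nr_conv_le_ofReal hM0 ha ha))
  have p2 := nr_smul_le_ofReal (2 * c.c₇) (nr_conv_le_ofReal hM0 h2
    (nr_ml_le_ofReal (n := 2) enorm_symA_le le_rfl ha))
  have p3 := nr_smul_le_ofReal 4 (nr_conv_le_ofReal (mul_nonneg hM0 hM0)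
    (nr_conv_le_ofReal hM0 h2 h2) h2)
  refine (nr_sub_le_ofReal (by positivity) (by positivity) (nr_add_le_ofReal (by positivity)
    (by positivity) p1 p2) p3).trans (ENNReal.ofReal_le_ofReal ?_)
  have h3 : M * M ≤ M ^ 3 := by nlinarith
  have hs : |c.c₆ / 2| + |2 * c.c₇| + 4 ≤ 6 * c.size := by
    rw [abs_div, abs_mul, abs_of_pos (zero_lt_two' ℝ)]
    unfold Coeffs.size
    linarith [abs_nonneg c.c₁, abs_nonneg c.c₂, abs_nonneg c.c₃, abs_nonneg c.c₄, abs_nonneg c.c₅,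
      abs_nonneg c.c₆, abs_nonneg c.c₇]
  have h6 := mul_le_mul_of_nonneg_left h3 (abs_nonneg (c.c₆ / 2))
  have h7 := mul_le_mul_of_nonneg_left h3 (abs_nonneg (2 * c.c₇))
  have h8 := mul_le_mul_of_nonneg_right hs (pow_nonneg hM0 3)
  rw [abs_of_pos (show (0 : ℝ) < 4 by norm_num)]
  nlinarith

lemma RealSeq.smul {a : ℤ → ℂ} (r : ℝ) (ha : RealSeq a) : RealSeq ((r : ℂ) • a) := fun k => by
  simp [ha k]

lemma RealSeq.add {a b : ℤ → ℂ} (ha : RealSeq a) (hb : RealSeq b) : RealSeq (a + b) := fun k => by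
  simp [ha k, hb k]

lemma realSeq_potential (c : Coeffs) {a : ℤ → ℂ} (ha : RealSeq a) : RealSeq (potential c a) := by
  have e : potential c a = (((c.c₆ / 2 : ℝ) : ℂ) • ml symA (BO4.conv a a)
      + ((2 * c.c₇ : ℝ) : ℂ) • BO4.conv a (ml symA a))
        + ((-4 : ℝ) : ℂ) • BO4.conv (BO4.conv a a) a := by
    unfold potential; push_cast; module
  rw [e]
  exact (((ha.conv ha).ml_symA.smul _).add ((ha.conv ha.ml_symA).smul _)).add
    (((ha.conv ha).conv ha).smul _)

lemma nr_nlin_le (c : Coeffs) {a : ℤ → ℂ} {M : ℝ} (hM : 1 ≤ M) (ha : nr 3 a ≤ ENNReal.ofReal M) :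
    nr 1 (nlin c a) ≤ ENNReal.ofReal (c.size * M ^ 4) := by
  have hM0 : 0 ≤ M := zero_le_one.trans hM
  have h1 := (nr_mono (show 1 ≤ 3 by norm_num) a).trans ha
  have h2 := (nr_mono (show 2 ≤ 3 by norm_num) a).trans ha
  have e : nlin c a = ((c.c₁ : ℂ) • conv a (ml (symD * symD) a)
      + (c.c₂ : ℂ) • conv (ml symD a) (ml symD a) + (c.c₃ : ℂ) • conv (ml symA a) (ml symA a)
      + (c.c₄ : ℂ) • ml symH (conv a (ml (symH * (symD * symD)) a))
      + ((c.c₅ / 3 : ℝ) : ℂ) • ml symA (conv (conv a a) a)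
      + ((c.c₆ / 2 : ℝ) : ℂ) • conv a (ml symA (conv a a))
      + (c.c₇ : ℂ) • conv (conv a a) (ml symA a)) - conv (conv a a) (conv a a) := by
    unfold nlin; push_cast; rfl
  rw [e]
  have dD := nr_ml_le_ofReal (n := 1) enorm_symD_le (by norm_num) ha
  have dA := nr_ml_le_ofReal (n := 1) enorm_symA_le (by norm_num) ha
  have dDD := nr_ml_le_ofReal (n := 1) enorm_symD_sq_le le_rfl ha
  have dH := nr_ml_le_ofReal (n := 1) enorm_symHDD_le le_rfl ha
  have aa1 := nr_conv_le_ofReal hM0 h1 h1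
  have aa2 := nr_conv_le_ofReal hM0 h2 h2
  have q1 := nr_smul_le_ofReal c.c₁ (nr_conv_le_ofReal hM0 h1 dDD)
  have q2 := nr_smul_le_ofReal c.c₂ (nr_conv_le_ofReal hM0 dD dD)
  have q3 := nr_smul_le_ofReal c.c₃ (nr_conv_le_ofReal hM0 dA dA)
  have q4 := nr_smul_le_ofReal c.c₄ (nr_ml_le_ofReal (n := 1) enorm_symH_le le_rfl
    (nr_conv_le_ofReal hM0 h1 dH))
  have q5 := nr_smul_le_ofReal (c.c₅ / 3) (nr_ml_le_ofReal (n := 1) enorm_symA_le le_rfl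
    (nr_conv_le_ofReal (mul_nonneg hM0 hM0) aa2 h2))
  have q6 := nr_smul_le_ofReal (c.c₆ / 2) (nr_conv_le_ofReal hM0 h1
    (nr_ml_le_ofReal (n := 1) enorm_symA_le le_rfl aa2))
  have q7 := nr_smul_le_ofReal c.c₇ (nr_conv_le_ofReal (mul_nonneg hM0 hM0) aa1 dA)
  have q8 := nr_conv_le_ofReal (mul_nonneg hM0 hM0) aa1 aa1
  have ad := fun {x y : ℤ → ℂ} {X Y : ℝ} (hX : 0 ≤ X) (hY : 0 ≤ Y) => nr_add_le_ofReal
    (n := 1) (a := x) (b := y) hX hY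
  refine (nr_sub_le_ofReal (by positivity) (by positivity) (ad (by positivity) (by positivity)
    (ad (by positivity) (by positivity) (ad (by positivity) (by positivity)
    (ad (by positivity) (by positivity) (ad (by positivity) (by positivity)
    (ad (by positivity) (by positivity) q1 q2) q3) q4) q5) q6) q7) q8).trans
    (ENNReal.ofReal_le_ofReal ?_)
  have hM2 : 1 ≤ M * M := one_le_mul_of_one_le_of_one_le hM hM
  have k2 : M * M ≤ M ^ 4 := by
    calc M * M ≤ (M * M) * (M * M) := le_mul_of_one_le_left (by positivity) hM2
      _ = M ^ 4 := by ring
  have k3 : M * M * M ≤ M ^ 4 := by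
    calc M * M * M ≤ M * M * (M * M) := by
          gcongr; exact le_mul_of_one_le_left hM0 hM
      _ = M ^ 4 := by ring
  have k3' : M * (M * M) ≤ M ^ 4 := by rw [← mul_assoc]; exact k3
  have c5 : |c.c₅ / 3| ≤ |c.c₅| := by
    rw [abs_div, abs_of_pos (zero_lt_three' ℝ)]; linarith [abs_nonneg c.c₅]
  have c6 : |c.c₆ / 2| ≤ |c.c₆| := by
    rw [abs_div, abs_of_pos (zero_lt_two' ℝ)]; linarith [abs_nonneg c.c₆]
  have e8 : M * M * (M * M) = M ^ 4 := by ring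
  have m := fun (r : ℝ) {x : ℝ} (h : x ≤ M ^ 4) => mul_le_mul_of_nonneg_left h (abs_nonneg r)
  have m1 := m c.c₁ k2
  have m2 := m c.c₂ k2
  have m3 := m c.c₃ k2
  have m4 := m c.c₄ k2
  have m5 : |c.c₅ / 3| * (M * M * M) ≤ |c.c₅| * M ^ 4 :=
    mul_le_mul c5 k3 (by positivity) (abs_nonneg _)
  have m6 : |c.c₆ / 2| * (M * (M * M)) ≤ |c.c₆| * M ^ 4 :=
    mul_le_mul c6 k3' (by positivity) (abs_nonneg _)
  have m7 := m c.c₇ k3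
  unfold Coeffs.size
  linarith

/-- The remainder in the equation for the difference. -/
def remD (c : Coeffs) (a q w : ℤ → ℂ) : ℤ → ℂ :=
  ml symD (remK c a q w) + ((c.c₆ / 2 : ℝ) : ℂ) • comm a w

/-- Each quadratic term has at most two derivatives inside `K` and one outside, so three in all fall
on two copies of `w`. One copy with weight `3` is bounded by `M`, the other remains in `ℓ²`; no
structure of the nonlinearity is used. -/
lemma dm_remD (c : Coeffs) {a q w : ℤ → ℂ} {M : ℝ} (hM : 1 ≤ M) (ha : nr 3 a ≤ ENNReal.ofReal M)
    (hq : nr 3 q ≤ ENNReal.ofReal M) (hw : nr 3 w ≤ ENNReal.ofReal M) :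
    Dm 0 (52 * c.size * M ^ 3) w (remD c a q w) := by
  have hM0 : 0 ≤ M := zero_le_one.trans hM
  have a1 := (nr_mono (show 1 ≤ 3 by norm_num) a).trans ha
  have a2 := (nr_mono (show 2 ≤ 3 by norm_num) a).trans ha
  have q1 := (nr_mono (show 1 ≤ 3 by norm_num) q).trans hq
  have q2 := (nr_mono (show 2 ≤ 3 by norm_num) q).trans hq
  have w1 := (nr_mono (show 1 ≤ 3 by norm_num) w).trans hw
  have w0 : ∀ k, ‖w k‖ₑ ≤ wt 0 w k := fun k => by simp [wt]
  have wD := enorm_ml_le_wt enorm_symD_le w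
  have wA := enorm_ml_le_wt enorm_symA_le w
  have wDD := enorm_ml_le_wt enorm_symD_sq_le w
  have wH := enorm_ml_le_wt enorm_symHDD_le w
  have aq : nr 2 (a + q) ≤ ENNReal.ofReal (M + M) := nr_add_le_ofReal hM0 hM0 a2 q2
  have aa : nr 1 (conv a (a + a)) ≤ ENNReal.ofReal (M * (M + M)) :=
    nr_conv_le_ofReal hM0 a1 (nr_add_le_ofReal hM0 hM0 a1 a1)
  have Aa : nr 1 (ml symA a) ≤ ENNReal.ofReal M := nr_ml_le_ofReal enorm_symA_le (by norm_num) ha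
  have r1 : Dm 1 _ w _ := Dm.of_mul (by norm_num) hw w0 wDD
  have r2 : Dm 1 _ w _ := Dm.of_mul (by norm_num) hw wD wD
  have r3 : Dm 1 _ w _ := Dm.of_mul (by norm_num) hw wA wA
  have r4 : Dm 1 _ w _ := Dm.ml enorm_symH_le (Dm.of_mul (n := 1) (by norm_num) hw w0 wH)
  have ww : Dm 2 _ w _ := Dm.of_mul (by norm_num) hw w0 w0
  have ww1 : Dm 1 _ w _ := Dm.of_mul (by norm_num) hw w0 w0
  have r5 : Dm 1 _ w _ := Dm.ml (n := 1) enorm_symA_le (Dm.conv (by positivity) aq ww)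
  have r6 : Dm 1 _ w _ := Dm.conv hM0 a1 (Dm.ml (n := 1) enorm_symA_le ww)
  have r6' : Dm 1 _ w _ := Dm.of_mul_conv (d := 1) (by norm_num) hM0 hw q2 w0
    (enorm_ml_conv_le enorm_symA_le q w)
  have r7 : Dm 1 _ w _ := Dm.conv hM0 Aa ww1
  have qw0 : ∀ k, ‖conv q w k‖ₑ ≤ econv (wt 0 q) (wt 0 w) k := enorm_conv_le q w
  have r7' : Dm 1 _ w _ := Dm.of_mul_conv (d := 0) (by norm_num) hM0 hw q1 wA qw0
  have r8 : Dm 1 _ w _ := Dm.conv (by positivity) aa ww1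
  have r8' : Dm 1 _ w _ := Dm.conv hM0 q1 (Dm.of_mul_conv (d := 0) (by norm_num) hM0 hw q1 w0 qw0)
  have k1 : M ≤ M ^ 3 := le_self_pow₀ hM (by norm_num)
  have k2 : M ^ 2 ≤ M ^ 3 := pow_le_pow_right₀ hM (by norm_num)
  have k0 : 0 ≤ M ^ 3 := by positivity
  have u := fun {x y : ℤ → ℂ} {X Y : ℝ} (hX : 0 ≤ X) (hY : 0 ≤ Y) => Dm.add
    (n := 1) (w := w) (x := x) (y := y) hX hY
  have z1 := (r1.neg.le (show 16 * M ≤ 48 * M ^ 3 by linarith)).smul c.c₁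
  have z2 := (r2.neg.le (show 16 * M ≤ 48 * M ^ 3 by linarith)).smul c.c₂
  have z3 := (r3.neg.le (show 16 * M ≤ 48 * M ^ 3 by linarith)).smul c.c₃
  have z4 := (r4.neg.le (show 16 * M ≤ 48 * M ^ 3 by linarith)).smul c.c₄
  have z5 := (r5.neg.le (show (M + M) * (16 * M) ≤ 48 * M ^ 3 by nlinarith)).smul (c.c₅ / 3)
  have z6 := ((u (by positivity) (by positivity) r6 r6').neg.le
    (show M * (16 * M) + M * (16 * M) ≤ 48 * M ^ 3 by nlinarith)).smul (c.c₆ / 2)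
  have z7 := ((u (by positivity) (by positivity) r7 r7').neg.le
    (show M * (16 * M) + M * (16 * M) ≤ 48 * M ^ 3 by nlinarith)).smul c.c₇
  -- The largest of the eight terms: `2·16 + 16 = 48`. The commutator adds the remaining `4` of the
  -- constant `52`.
  have z8 := (u (by positivity) (by positivity) r8 r8').le
    (show M * (M + M) * (16 * M) + M * (M * (16 * M)) ≤ 48 * M ^ 3 by nlinarith)
  have z := u (by positivity) (by positivity) (u (by positivity) (by positivity)
    (u (by positivity) (by positivity) (u (by positivity) (by positivity)
    (u (by positivity) (by positivity) (u (by positivity) (by positivity)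
    (u (by positivity) (by positivity) z1 z2) z3) z4) z5) z6) z7) z8
  have zc := (dm_comm hM0 a2 (nr_ne_top_mono (show 2 ≤ 3 by norm_num)
    (ne_top_of_le_ofReal hw))).smul (c.c₆ / 2)
  have c5 : |c.c₅ / 3| ≤ |c.c₅| := by
    rw [abs_div, abs_of_pos (zero_lt_three' ℝ)]; linarith [abs_nonneg c.c₅]
  have c6 : |c.c₆ / 2| ≤ |c.c₆| := by
    rw [abs_div, abs_of_pos (zero_lt_two' ℝ)]; linarith [abs_nonneg c.c₆]
  have c6' : |c.c₆ / 2| * 2 ≤ c.size := by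
    rw [abs_div, abs_of_pos (zero_lt_two' ℝ)]
    unfold Coeffs.size
    linarith [abs_nonneg c.c₁, abs_nonneg c.c₂, abs_nonneg c.c₃, abs_nonneg c.c₄, abs_nonneg c.c₅,
      abs_nonneg c.c₆, abs_nonneg c.c₇]
  refine ((Dm.ml (n := 0) enorm_symD_le z).add (by positivity) (by positivity) zc).le ?_
  have m5 := mul_le_mul_of_nonneg_right c5 k0
  have m6 := mul_le_mul_of_nonneg_right c6 k0
  have m8 : |c.c₆ / 2| * (8 * (M * M)) ≤ 4 * c.size * M ^ 3 := by
    calc |c.c₆ / 2| * (8 * (M * M)) = 4 * (|c.c₆ / 2| * 2) * M ^ 2 := by ring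
      _ ≤ 4 * c.size * M ^ 3 := by have := c.size_nonneg; gcongr
  have hsz : c.size * M ^ 3 = (1 + |c.c₁| + |c.c₂| + |c.c₃| + |c.c₄| + |c.c₅| + |c.c₆| + |c.c₇|)
    * M ^ 3 := rfl
  linarith

lemma ml_symD_nlin_sub (c : Coeffs) {a w : ℤ → ℂ} (ha : nr 3 a ≠ ⊤) (hw : nr 3 w ≠ ⊤)
    (hp : nr 0 (potential c a) ≠ ⊤) :
    ml symD (nlin c a) - ml symD (nlin c (a - w))
      = linOp c a (potential c a) w + remD c a (a + (a - w)) w := by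
  have h := ml_symD_linK c ha hw hp
  rw [nlin_sub c ha hw, ml_sub, ml_add, h, remD]
  push_cast
  abel

/-! Pairings with dominated sequences -/

lemma Dm.enorm_pr_le {R : ℝ} {w x : ℤ → ℂ} {m : ℤ → ℝ} (hm : ∀ k, |m k| ≤ 1) (hx : Dm 0 R w x) :
    ‖pr m x w‖ₑ ≤ ENNReal.ofReal R * (2 * ee w) := by
  obtain ⟨B, hB, hx⟩ := hx
  refine (enorm_tsum_le _).trans ?_
  calc ∑' k, ‖(m k : ℂ) * x k * conj (w k)‖ₑ ≤ ∑' k, econv B (wt 0 w) k * ‖w k‖ₑ := by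
        refine ENNReal.tsum_le_tsum fun k => ?_
        rw [enorm_mul, enorm_mul, enorm_conj]
        gcongr
        have h1 := enorm_real_le (hm k)
        rw [ENNReal.ofReal_one] at h1
        calc ‖(m k : ℂ)‖ₑ * ‖x k‖ₑ ≤ 1 * wt 0 x k := mul_le_mul' h1 (by simp [wt])
          _ ≤ _ := by rw [one_mul]; exact hx k
    _ ≤ (∑' k, B k) * (∑' k, wt 0 w k ^ 2 + ∑' k, ‖w k‖ₑ ^ 2) := schur_le _ _ _
    _ = (∑' k, B k) * (2 * ee w) := by simp [wt, ee, two_mul]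
    _ ≤ _ := mul_le_mul_left hB _

lemma Dm.enorm_tri_le {R C : ℝ} {b w x : ℤ → ℂ} {θ : ℤ → ℤ → ℝ} (hθ : ∀ k l, |θ k l| ≤ C)
    (hx : Dm 0 R w x) :
    ‖tri θ b x w‖ₑ ≤ ENNReal.ofReal C * (nr 0 b * ENNReal.ofReal R) * (2 * ee w) := by
  obtain ⟨B, hB, hx⟩ := hx
  refine (enorm_tsum_le _).trans ?_
  rw [ENNReal.tsum_prod']
  calc ∑' k, ∑' l, ‖b (k - l) * (θ k l : ℂ) * x l * conj (w k)‖ₑ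
      ≤ ∑' k, ENNReal.ofReal C * (econv (econv (wt 0 b) B) (wt 0 w) k * ‖w k‖ₑ) := by
        refine ENNReal.tsum_le_tsum fun k => ?_
        rw [econv_assoc]
        unfold econv
        rw [← ENNReal.tsum_mul_right, ← ENNReal.tsum_mul_left]
        refine ENNReal.tsum_le_tsum fun l => ?_
        simp only [enorm_mul, enorm_conj]
        have h1 := enorm_real_le (hθ k l)
        have h2 := hx l
        simp only [econv] at h2
        calc ‖b (k - l)‖ₑ * ‖(θ k l : ℂ)‖ₑ * ‖x l‖ₑ * ‖w k‖ₑ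
            ≤ wt 0 b (k - l) * ENNReal.ofReal C * wt 0 x l * ‖w k‖ₑ := by
              gcongr <;> simp [wt]
          _ ≤ wt 0 b (k - l) * ENNReal.ofReal C * (∑' j, B (l - j) * wt 0 w j) * ‖w k‖ₑ := by
              gcongr
          _ = _ := by ring
    _ = ENNReal.ofReal C * ∑' k, econv (econv (wt 0 b) B) (wt 0 w) k * ‖w k‖ₑ :=
        ENNReal.tsum_mul_left
    _ ≤ ENNReal.ofReal C * ((∑' k, econv (wt 0 b) B k)
          * (∑' k, wt 0 w k ^ 2 + ∑' k, ‖w k‖ₑ ^ 2)) := mul_le_mul_right (schur_le _ _ _) _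
    _ = ENNReal.ofReal C * (nr 0 b * ∑' k, B k) * (2 * ee w) := by
        rw [tsum_econv, mul_assoc]
        simp [wt, ee, two_mul, nr, mul_assoc]
    _ ≤ _ := by gcongr

lemma abs_re_le_of_enorm {z : ℂ} {X : ℝ} (hX : 0 ≤ X) (h : ‖z‖ₑ ≤ ENNReal.ofReal X) :
    |z.re| ≤ X := by
  refine (Complex.abs_re_le_norm _).trans ?_
  rw [← toReal_enorm]
  exact ENNReal.toReal_le_of_le_ofReal hX h

lemma Dm.abs_re_pr_le {R : ℝ} {w x : ℤ → ℂ} {m : ℤ → ℝ} (hm : ∀ k, |m k| ≤ 1) (hR : 0 ≤ R)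
    (hw : nr 0 w ≠ ⊤) (hx : Dm 0 R w x) : |(pr m x w).re| ≤ 2 * (R * sqn w) := by
  have hs := sqn_nonneg w
  refine abs_re_le_of_enorm (by positivity) ((hx.enorm_pr_le hm).trans (le_of_eq ?_))
  rw [ee_eq hw, ENNReal.ofReal_mul zero_le_two, ENNReal.ofReal_mul hR, ENNReal.ofReal_ofNat]
  ring

lemma Dm.abs_re_tri_le {R C A : ℝ} {b w x : ℤ → ℂ} {θ : ℤ → ℤ → ℝ} (hθ : ∀ k l, |θ k l| ≤ C)
    (hC : 0 ≤ C) (hA : 0 ≤ A) (hR : 0 ≤ R) (hb : nr 0 b ≤ ENNReal.ofReal A)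
    (hw : nr 0 w ≠ ⊤) (hx : Dm 0 R w x) : |(tri θ b x w).re| ≤ 2 * (C * A * (R * sqn w)) := by
  have hs := sqn_nonneg w
  refine abs_re_le_of_enorm (by positivity) ((hx.enorm_tri_le hθ).trans ?_)
  rw [ee_eq hw, ENNReal.ofReal_mul zero_le_two, ENNReal.ofReal_mul (by positivity),
    ENNReal.ofReal_mul hC, ENNReal.ofReal_mul hR, ENNReal.ofReal_ofNat]
  calc _ ≤ ENNReal.ofReal C * (ENNReal.ofReal A * ENNReal.ofReal R)
        * (2 * ENNReal.ofReal (sqn w)) := by gcongr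
    _ = _ := by ring

lemma abs_re_tri_le {A C : ℝ} {a w : ℤ → ℂ} {θ : ℤ → ℤ → ℝ} (hθ : ∀ k l, |θ k l| ≤ C)
    (hC : 0 ≤ C) (hA : 0 ≤ A) (ha : nr 0 a ≤ ENNReal.ofReal A) (hw : nr 0 w ≠ ⊤) :
    |(tri θ a w w).re| ≤ 2 * (C * A * sqn w) := by
  have hs := sqn_nonneg w
  refine abs_re_le_of_enorm (by positivity) ((enorm_tri_schur (n := 0) (C := C)
    (fun k l => by simpa using hθ k l) a w w).trans ?_)
  rw [ee_eq hw, ← two_mul, ENNReal.ofReal_mul zero_le_two, ENNReal.ofReal_mul (by positivity),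
    ENNReal.ofReal_mul hC, ENNReal.ofReal_ofNat]
  calc _ ≤ ENNReal.ofReal C * ENNReal.ofReal A * (2 * ENNReal.ofReal (sqn w)) := by gcongr
    _ = _ := by ring

lemma abs_add_le_add {x y X Y : ℝ} (hx : |x| ≤ X) (hy : |y| ≤ Y) : |x + y| ≤ X + Y :=
  (abs_add_le _ _).trans (add_le_add hx hy)

lemma Dm.abs_Gx_le (c : Coeffs) {κ R M Wm : ℝ} {a w x : ℤ → ℂ} (hM : 1 ≤ M) (hR : 0 ≤ R)
    (ha : nr 0 a ≤ ENNReal.ofReal M) (hw : nr 0 w ≠ ⊤) (hW : |wgt κ a| ≤ Wm) (hx : Dm 0 R w x) :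
    |Gx c κ a w x| ≤ 2 * (R * sqn w) * (Wm + 6 * c.size ^ 2 * M ^ 2) := by
  have hM0 : 0 ≤ M := zero_le_one.trans hM
  have hs := sqn_nonneg w
  have hsz := c.one_le_size
  have hz0 := c.size_nonneg
  have h1 := hx.abs_re_pr_le abs_one_fun_le hR hw
  have h2 := hx.abs_re_pr_le abs_om_le hR hw
  have h3 := hx.abs_re_tri_le abs_th₁_le_one zero_le_one hM0 hR ha hw
  have h4 := hx.abs_re_tri_le abs_th₂_le zero_le_two hM0 hR ha hw
  have h5 := hx.abs_re_tri_le abs_JJ_le zero_le_one (mul_nonneg hM0 hM0) hR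
    (nr_conv_le_ofReal hM0 ha ha) hw
  have l1 : |lam₁ c 0 / 4| ≤ c.size / 2 := by
    rw [abs_div, abs_of_pos (show (0 : ℝ) < 4 by norm_num)]; linarith [abs_lam₁_le c]
  have l2 : |lam₂ c 0 / 4| ≤ c.size / 4 := by
    rw [abs_div, abs_of_pos (show (0 : ℝ) < 4 by norm_num)]; linarith [abs_lam₂_le c]
  have t2 : |(2 : ℝ)| ≤ 2 := by norm_num
  unfold Gx
  refine (abs_add_le_add (abs_add_le_add (abs_add_le_add (abs_add_le_add h1
    (abs_mul_le_of_le hW h2)) (abs_mul_le_of_le l1 (abs_mul_le_of_le t2 h3)))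
    (abs_mul_le_of_le l2 (abs_mul_le_of_le t2 h4)))
    (abs_mul_le_of_le (abs_mu₃_le c) (abs_mul_le_of_le t2 h5))).trans ?_
  have hM2 : M ≤ M ^ 2 := le_self_pow₀ hM (by norm_num)
  have hz2 : c.size ≤ c.size ^ 2 := le_self_pow₀ hsz (by norm_num)
  have p1 : c.size * M ≤ c.size ^ 2 * M ^ 2 := mul_le_mul hz2 hM2 hM0 (by positivity)
  have p0 : 1 ≤ c.size ^ 2 * M ^ 2 :=
    one_le_mul_of_one_le_of_one_le (one_le_pow₀ hsz) (one_le_pow₀ hM)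
  have hRS : 0 ≤ R * sqn w := by positivity
  have q1 := mul_le_mul_of_nonneg_left p1 hRS
  have q0 := mul_le_mul_of_nonneg_left p0 hRS
  nlinarith

lemma abs_Ty_le (c : Coeffs) {M N : ℝ} {a w y : ℤ → ℂ} (hM : 1 ≤ M) (hN : 0 ≤ N)
    (ha : nr 0 a ≤ ENNReal.ofReal M) (hw : nr 0 w ≠ ⊤) (hy : nr 0 y ≤ ENNReal.ofReal N) :
    |Ty c a w y| ≤ 6 * c.size ^ 2 * M * N * sqn w := by
  have hM0 : 0 ≤ M := zero_le_one.trans hM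
  have hs := sqn_nonneg w
  have hsz := c.one_le_size
  have h3 := abs_re_tri_le abs_th₁_le_one zero_le_one hN hy hw
  have h4 := abs_re_tri_le abs_th₂_le zero_le_two hN hy hw
  have hay : nr 0 ((2 : ℂ) • conv a y) ≤ ENNReal.ofReal (2 * (M * N)) := by
    have := nr_smul_le_ofReal 2 (nr_conv_le_ofReal hM0 ha hy)
    rw [abs_of_pos (zero_lt_two' ℝ)] at this
    simpa using this
  have h5 := abs_re_tri_le abs_JJ_le zero_le_one (by positivity) hay hw
  have l1 : |lam₁ c 0 / 4| ≤ c.size / 2 := by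
    rw [abs_div, abs_of_pos (show (0 : ℝ) < 4 by norm_num)]; linarith [abs_lam₁_le c]
  have l2 : |lam₂ c 0 / 4| ≤ c.size / 4 := by
    rw [abs_div, abs_of_pos (show (0 : ℝ) < 4 by norm_num)]; linarith [abs_lam₂_le c]
  unfold Ty
  refine (abs_add_le_add (abs_add_le_add (abs_mul_le_of_le l1 h3) (abs_mul_le_of_le l2 h4))
    (abs_mul_le_of_le (abs_mu₃_le c) h5)).trans ?_
  have p1 : c.size * 1 ≤ c.size ^ 2 * M :=
    mul_le_mul (le_self_pow₀ hsz (by norm_num)) hM zero_le_one (by positivity)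
  have q1 := mul_le_mul_of_nonneg_right p1 (mul_nonneg hN hs)
  nlinarith
end BO4
end

noncomputable section
namespace BO4
open scoped ENNReal ComplexConjugate

/-! ### Weighted Schur bounds -/

lemma mul_le_young (a b : ℝ≥0∞) {s : ℝ} (hs : 0 < s) :
    a * b ≤ ENNReal.ofReal s * a ^ 2 + ENNReal.ofReal s⁻¹ * b ^ 2 := by
  have hr : 0 < √s := Real.sqrt_pos.2 hs
  have h1 : ENNReal.ofReal (√s) * ENNReal.ofReal (√s)⁻¹ = 1 := by
    rw [← ENNReal.ofReal_mul hr.le, mul_inv_cancel₀ hr.ne', ENNReal.ofReal_one]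
  calc a * b = (ENNReal.ofReal (√s) * ENNReal.ofReal (√s)⁻¹) * (a * b) := by rw [h1, one_mul]
    _ = (ENNReal.ofReal (√s) * a) * (ENNReal.ofReal (√s)⁻¹ * b) := by ring
    _ ≤ (ENNReal.ofReal (√s) * a) ^ 2 + (ENNReal.ofReal (√s)⁻¹ * b) ^ 2 := mul_le_sq_add_sq _ _
    _ = _ := by
      rw [mul_pow, mul_pow, ← ENNReal.ofReal_pow hr.le, ← ENNReal.ofReal_pow (inv_nonneg.2 hr.le),
        inv_pow, Real.sq_sqrt hs.le]

lemma schur_young (B V U : ℤ → ℝ≥0∞) {s : ℝ} (hs : 0 < s) :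
    ∑' k, econv B V k * U k
      ≤ (∑' k, B k) * (ENNReal.ofReal s * ∑' k, V k ^ 2 + ENNReal.ofReal s⁻¹ * ∑' k, U k ^ 2) := by
  calc ∑' k, econv B V k * U k ≤ ∑' k, (ENNReal.ofReal s * econv B (fun k => V k ^ 2) k
        + (∑' j, B j) * (ENNReal.ofReal s⁻¹ * U k ^ 2)) := by
        refine ENNReal.tsum_le_tsum fun k => ?_
        unfold econv
        rw [← ENNReal.tsum_mul_right, ← tsum_sub_left B k, ← ENNReal.tsum_mul_right,
          ← ENNReal.tsum_mul_left, ← ENNReal.tsum_add]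
        refine ENNReal.tsum_le_tsum fun j => ?_
        calc B (k - j) * V j * U k = B (k - j) * (V j * U k) := by ring
          _ ≤ B (k - j) * (ENNReal.ofReal s * V j ^ 2 + ENNReal.ofReal s⁻¹ * U k ^ 2) :=
              mul_le_mul_right (mul_le_young _ _ hs) _
          _ = _ := by ring
    _ = _ := by
        rw [ENNReal.tsum_add, ENNReal.tsum_mul_left, tsum_econv, ENNReal.tsum_mul_left,
          ENNReal.tsum_mul_left]
        ring

/-- The square of the weighted `ℓ²` norm. -/
def wsq (n : ℕ) (w : ℤ → ℂ) : ℝ := ∑' k, (jb k ^ n * ‖w k‖) ^ 2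

lemma wsq_nonneg (n : ℕ) (w : ℤ → ℂ) : 0 ≤ wsq n w := tsum_nonneg fun _ => sq_nonneg _

lemma wsq_zero (w : ℤ → ℂ) : wsq 0 w = sqn w := by simp [wsq, sqn]

lemma summable_wsq {n : ℕ} {w : ℤ → ℂ} (h : nr n w ≠ ⊤) :
    Summable fun k => (jb k ^ n * ‖w k‖) ^ 2 := by
  have h0 : nr 0 (fun k => ((jb k ^ n : ℝ) : ℂ) * w k) ≠ ⊤ := by
    have := nr_mul_le (n := 0) (s := n) (C := 1) (m := fun k => ((jb k ^ n : ℝ) : ℂ)) (fun k => by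
      rw [enorm_ofReal_abs, abs_of_nonneg (jb_pow_nonneg k n), ofReal_jb_pow, one_mul]) w
    rw [one_mul, zero_add] at this
    exact ne_top_of_le_ne_top h this
  refine (summable_sq_of_nr h0).congr fun k => ?_
  rw [norm_mul, Complex.norm_real, Real.norm_of_nonneg (jb_pow_nonneg k n)]

lemma tsum_wt_sq {n : ℕ} {w : ℤ → ℂ} (h : nr n w ≠ ⊤) :
    ∑' k, wt n w k ^ 2 = ENNReal.ofReal (wsq n w) := by
  rw [wsq, ENNReal.ofReal_tsum_of_nonneg (fun k => sq_nonneg _) (summable_wsq h)]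
  refine tsum_congr fun k => ?_
  rw [ENNReal.ofReal_pow (mul_nonneg (jb_pow_nonneg k n) (norm_nonneg _)),
    ENNReal.ofReal_mul (jb_pow_nonneg k n), ofReal_jb_pow, ofReal_norm, wt]

lemma enorm_tri_young {θ : ℤ → ℤ → ℝ} {C : ℝ≥0∞} {ω : ℤ → ℝ≥0∞} {b d : ℕ}
    (h : ∀ k l, ‖(θ k l : ℂ)‖ₑ ≤ C * (ω (k - l) * jw l ^ b * jw k ^ d)) (a x v : ℤ → ℂ) {s : ℝ}
    (hs : 0 < s) : ‖tri θ a x v‖ₑ ≤ C * (wn ω a * (ENNReal.ofReal s * ∑' k, wt b x k ^ 2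
      + ENNReal.ofReal s⁻¹ * ∑' k, wt d v k ^ 2)) := by
  refine (enorm_tsum_le _).trans (le_trans ?_ (mul_le_mul_right
    (schur_young (fun k => ω k * ‖a k‖ₑ) (wt b x) (wt d v) hs) C))
  unfold econv
  simp_rw [← ENNReal.tsum_mul_right]
  rw [← ENNReal.tsum_mul_left, ENNReal.tsum_prod']
  refine ENNReal.tsum_le_tsum fun k => ?_
  rw [← ENNReal.tsum_mul_left]
  refine ENNReal.tsum_le_tsum fun l => ?_
  simp only [enorm_mul, enorm_conj, wt]
  calc ‖a (k - l)‖ₑ * ‖(θ k l : ℂ)‖ₑ * ‖x l‖ₑ * ‖v k‖ₑ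
      ≤ ‖a (k - l)‖ₑ * (C * (ω (k - l) * jw l ^ b * jw k ^ d)) * ‖x l‖ₑ * ‖v k‖ₑ := by
        gcongr; exact h k l
    _ = _ := by ring

lemma abs_re_tri_young {θ : ℤ → ℤ → ℝ} {C A X V : ℝ} {ω : ℤ → ℝ≥0∞} {b d : ℕ}
    (h : ∀ k l, ‖(θ k l : ℂ)‖ₑ ≤ ENNReal.ofReal C * (ω (k - l) * jw l ^ b * jw k ^ d))
    {a x v : ℤ → ℂ} (hC : 0 ≤ C) (hA : 0 ≤ A) (hX : 0 ≤ X) (hV : 0 ≤ V)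
    (ha : wn ω a ≤ ENNReal.ofReal A) (hx : ∑' k, wt b x k ^ 2 ≤ ENNReal.ofReal X)
    (hv : ∑' k, wt d v k ^ 2 ≤ ENNReal.ofReal V) {s : ℝ} (hs : 0 < s) :
    |(tri θ a x v).re| ≤ C * (A * (s * X + s⁻¹ * V)) := by
  refine abs_re_le_of_enorm (by positivity) ((enorm_tri_young h a x v hs).trans ?_)
  rw [ENNReal.ofReal_mul hC, ENNReal.ofReal_mul hA, ENNReal.ofReal_add (by positivity)
    (by positivity), ENNReal.ofReal_mul hs.le, ENNReal.ofReal_mul (inv_pos.2 hs).le]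
  gcongr

/-! ### The dissipative terms -/

/-- The symbol of `∂ₓ⁴`. -/
def symQ (k : ℤ) : ℂ := (k : ℂ) ^ 4

lemma symQ_eq : symQ = fun k : ℤ => (1 : ℂ) * (((k : ℝ) ^ 4 : ℝ) : ℂ) := by
  funext k; simp [symQ]

lemma Jc_mul_jb_le (k : ℤ) : Jc k * jb k ≤ 2 := by
  unfold jb
  linarith [Jc_mul_abs_le k, Jc_le_one k]

/-- Of the four derivatives one is absorbed by `J`; the others are split as two on `w_l` and one on
`w_k`, at the expense of background weights. -/
lemma pow_four_le (k l : ℤ) :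
    (Jc k + Jc l) * (l : ℝ) ^ 4 ≤ 3 * (jb (k - l) ^ 2 * jb l ^ 2 * jb k) := by
  have hl := abs_le_jb l
  have a0 := abs_nonneg (l : ℝ)
  have j1 := (jb_pos k).le
  have j2 := (jb_pos l).le
  have j3 := one_le_jb (k - l)
  have j4 := (jb_pos (k - l)).le
  have e : (l : ℝ) ^ 4 = |(l : ℝ)| ^ 4 := by rw [← abs_pow, abs_of_nonneg (by positivity)]
  have h1 : Jc k * (l : ℝ) ^ 4 ≤ 2 * (jb (k - l) ^ 2 * jb l ^ 2 * jb k) := by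
    calc Jc k * (l : ℝ) ^ 4 ≤ Jc k * (jb l ^ 2 * (jb (k - l) * jb k) ^ 2) := by
          rw [e]
          have := Jc_nonneg k
          gcongr
          calc |(l : ℝ)| ^ 4 ≤ jb l ^ 4 := by gcongr
            _ = jb l ^ 2 * jb l ^ 2 := by ring
            _ ≤ _ := by gcongr; exact jb_le_sub_mul' k l
      _ = (Jc k * jb k) * (jb (k - l) ^ 2 * jb l ^ 2 * jb k) := by ring
      _ ≤ _ := by gcongr; exact Jc_mul_jb_le k
  have h2 : Jc l * (l : ℝ) ^ 4 ≤ jb (k - l) ^ 2 * jb l ^ 2 * jb k := by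
    calc Jc l * (l : ℝ) ^ 4 = (Jc l * |(l : ℝ)|) * |(l : ℝ)| ^ 3 := by rw [e]; ring
      _ ≤ 1 * jb l ^ 3 := by gcongr; exact Jc_mul_abs_le l
      _ = jb l ^ 2 * jb l := by ring
      _ ≤ jb l ^ 2 * (jb (k - l) ^ 2 * jb k) := by
          gcongr
          refine (jb_le_sub_mul' k l).trans ?_
          gcongr
          exact le_self_pow₀ j3 (by norm_num)
      _ = _ := by ring
  linarith

lemma JJ_pow_four_le (k l : ℤ) :
    Jc k * Jc l * (l : ℝ) ^ 4 ≤ 2 * (jb (k - l) ^ 2 * jb l * jb k) := by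
  have hl := abs_le_jb l
  have a0 := abs_nonneg (l : ℝ)
  have j1 := (jb_pos k).le
  have j2 := (jb_pos l).le
  have j4 := (jb_pos (k - l)).le
  have J1 := Jc_nonneg k
  have J2 := Jc_nonneg l
  have e : (l : ℝ) ^ 4 = |(l : ℝ)| ^ 4 := by rw [← abs_pow, abs_of_nonneg (by positivity)]
  calc Jc k * Jc l * (l : ℝ) ^ 4 = Jc k * (Jc l * |(l : ℝ)|) * |(l : ℝ)| ^ 3 := by rw [e]; ring
    _ ≤ Jc k * 1 * (jb l * (jb (k - l) * jb k) ^ 2) := by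
        gcongr
        · exact Jc_mul_abs_le l
        · calc |(l : ℝ)| ^ 3 ≤ jb l ^ 3 := by gcongr
            _ = jb l * jb l ^ 2 := by ring
            _ ≤ _ := by gcongr; exact jb_le_sub_mul' k l
    _ = (Jc k * jb k) * (jb (k - l) ^ 2 * jb l * jb k) := by ring
    _ ≤ _ := by gcongr; exact Jc_mul_jb_le k

lemma enorm_symbol_le {r C : ℝ} {p q n : ℕ} {k l : ℤ}
    (h : |r| ≤ C * (jb (k - l) ^ n * jb l ^ p * jb k ^ q)) :
    ‖(r : ℂ)‖ₑ ≤ ENNReal.ofReal C * (jw (k - l) ^ n * jw l ^ p * jw k ^ q) := by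
  refine (enorm_real_le h).trans (le_of_eq ?_)
  rw [ENNReal.ofReal_mul' (mul_nonneg (mul_nonneg (jb_pow_nonneg _ _) (jb_pow_nonneg _ _))
    (jb_pow_nonneg _ _)), ENNReal.ofReal_mul (mul_nonneg (jb_pow_nonneg _ _) (jb_pow_nonneg _ _)),
    ENNReal.ofReal_mul (jb_pow_nonneg _ _)]
  simp only [ofReal_jb_pow]

/-- Forms of order one, applied to the fourth derivative of the difference. -/
lemma abs_re_tri_symQ_le {θ : ℤ → ℤ → ℝ} (hθ : ∀ k l, |θ k l| ≤ Jc k + Jc l) {a w : ℤ → ℂ}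
    {A : ℝ} (hA : 0 ≤ A) (ha : nr 2 a ≤ ENNReal.ofReal A) (hw : nr 3 w ≠ ⊤) {s : ℝ} (hs : 0 < s) :
    |(tri θ a (ml symQ w) w).re| ≤ 3 * (A * (s * wsq 2 w + s⁻¹ * wsq 1 w)) := by
  rw [symQ_eq, tri_ml_two (1 : ℂ) (fun k : ℤ => (k : ℝ) ^ 4), one_mul]
  have := nr_eq_wn 2 a
  rw [this] at ha
  refine abs_re_tri_young (b := 2) (d := 1) (fun k l => enorm_symbol_le (n := 2) ?_) (by norm_num)
    hA (wsq_nonneg _ _) (wsq_nonneg _ _) ha (tsum_wt_sq (nr_ne_top_mono (by norm_num) hw)).le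
    (tsum_wt_sq (nr_ne_top_mono (by norm_num) hw)).le hs
  have h4 : 0 ≤ (l : ℝ) ^ 4 := by positivity
  rw [abs_mul, abs_of_nonneg h4, pow_one]
  exact (mul_le_mul_of_nonneg_right (hθ k l) h4).trans (pow_four_le k l)

lemma abs_re_tri_JJ_symQ_le {a w : ℤ → ℂ}
    {A : ℝ} (hA : 0 ≤ A) (ha : nr 2 a ≤ ENNReal.ofReal A) (hw : nr 3 w ≠ ⊤) :
    |(tri (fun k l => Jc k * Jc l) a (ml symQ w) w).re| ≤ 4 * (A * wsq 1 w) := by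
  rw [symQ_eq, tri_ml_two (1 : ℂ) (fun k : ℤ => (k : ℝ) ^ 4), one_mul]
  have := nr_eq_wn 2 a
  rw [this] at ha
  have hw1 := (tsum_wt_sq (nr_ne_top_mono (show 1 ≤ 3 by norm_num) hw)).le
  refine (abs_re_tri_young (b := 1) (d := 1) (C := 2) (fun k l => enorm_symbol_le (n := 2) ?_)
    (by norm_num) hA (wsq_nonneg _ _) (wsq_nonneg _ _) ha hw1 hw1 one_pos).trans
    (le_of_eq (by ring))
  rw [abs_of_nonneg (mul_nonneg (mul_nonneg (Jc_nonneg k) (Jc_nonneg l)) (by positivity)), pow_one,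
    pow_one]
  exact JJ_pow_four_le k l

/-- Bounded forms, applied to a background of negative order. -/
lemma abs_re_tri_iw_le {θ : ℤ → ℤ → ℝ} {C A : ℝ} (hθ : ∀ k l, |θ k l| ≤ C) (hC : 0 ≤ C)
    (hA : 0 ≤ A) {y w : ℤ → ℂ} (hy : wn iw y ≤ ENNReal.ofReal A) (hw : nr 3 w ≠ ⊤) :
    |(tri θ y w w).re| ≤ 2 * C * (A * wsq 1 w) := by
  have hw1 := (tsum_wt_sq (nr_ne_top_mono (show 1 ≤ 3 by norm_num) hw)).le
  refine (abs_re_tri_young (b := 1) (d := 1) (fun k l => ?_)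
    hC hA (wsq_nonneg _ _) (wsq_nonneg _ _) hy hw1 hw1 one_pos).trans (le_of_eq (by ring))
  simpa only [pow_one] using enorm_le_iw_one hθ k l

lemma summable_pow_four {w : ℤ → ℂ} (hw : nr 3 w ≠ ⊤) {m : ℤ → ℝ} (hm : ∀ k, |m k| ≤ 1) :
    Summable fun k : ℤ => m k * (k : ℝ) ^ 4 * ‖w k‖ ^ 2 := by
  refine Summable.of_norm_bounded (summable_wsq (n := 2) (nr_ne_top_mono (by norm_num) hw))
    fun k => ?_
  have h4 : 0 ≤ (k : ℝ) ^ 4 := by positivity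
  rw [norm_mul, norm_mul, Real.norm_eq_abs, Real.norm_of_nonneg h4,
    Real.norm_of_nonneg (sq_nonneg ‖w k‖), mul_pow]
  gcongr
  calc |m k| * (k : ℝ) ^ 4 ≤ 1 * |(k : ℝ)| ^ 4 := by
        rw [← abs_pow, abs_of_nonneg h4]; gcongr; exact hm k
    _ ≤ (jb k ^ 2) ^ 2 := by
        rw [one_mul, ← pow_mul]; gcongr; exact abs_le_jb k

lemma re_pr_symQ (m : ℤ → ℝ) (w : ℤ → ℂ) :
    (pr m (ml symQ w) w).re = ∑' k : ℤ, m k * (k : ℝ) ^ 4 * ‖w k‖ ^ 2 := by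
  rw [← pr_self_re]
  congr 1
  unfold pr
  exact tsum_congr fun k => by simp only [ml, symQ]; push_cast; ring

/-- The dissipation `∑ k⁴|w_k|²` controls the full `H²` norm up to the zeroth order part. The factor
`8` is `(1+x)⁴ ≤ 8(1+x⁴)`. -/
lemma wsq_two_le {w : ℤ → ℂ} (hw : nr 3 w ≠ ⊤) :
    wsq 2 w ≤ 8 * ((pr (fun _ => 1) (ml symQ w) w).re + sqn w) := by
  rw [re_pr_symQ, sqn, ← (summable_pow_four hw abs_one_fun_le).tsum_add
    (summable_sq_of_nr (nr_ne_top_mono (Nat.zero_le 3) hw)), ← tsum_mul_left]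
  refine (summable_wsq (nr_ne_top_mono (by norm_num) hw)).tsum_le_tsum (fun k => ?_)
    (((summable_pow_four hw abs_one_fun_le).add
    (summable_sq_of_nr (nr_ne_top_mono (Nat.zero_le 3) hw))).mul_left 8)
  have h : (jb k ^ 2) ^ 2 ≤ 8 * ((k : ℝ) ^ 4 + 1) := by
    have e : (k : ℝ) ^ 4 = |(k : ℝ)| ^ 4 := by rw [← abs_pow, abs_of_nonneg (by positivity)]
    rw [e]
    unfold jb
    nlinarith [sq_nonneg (|(k : ℝ)| - 1), sq_nonneg (|(k : ℝ)| ^ 2 - 1), sq_nonneg (|(k : ℝ)| + 1),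
      sq_nonneg ((|(k : ℝ)| - 1) * (|(k : ℝ)| + 1)), sq_nonneg ((|(k : ℝ)| - 1) * |(k : ℝ)|),
      sq_nonneg ((|(k : ℝ)| - 1) ^ 2)]
  rw [mul_pow]
  calc (jb k ^ 2) ^ 2 * ‖w k‖ ^ 2 ≤ 8 * ((k : ℝ) ^ 4 + 1) * ‖w k‖ ^ 2 := by gcongr
    _ = _ := by ring

/-- Interpolation of `H¹` between `H²` and `L²`, from `b ≤ s b² + s⁻¹` with `b = (1+|k|)²`. -/
lemma wsq_one_le {w : ℤ → ℂ} (hw : nr 3 w ≠ ⊤) {s : ℝ} (hs : 0 < s) :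
    wsq 1 w ≤ s * wsq 2 w + s⁻¹ * sqn w := by
  have s2 := summable_wsq (n := 2) (nr_ne_top_mono (by norm_num) hw)
  have s0 := summable_sq_of_nr (nr_ne_top_mono (Nat.zero_le 3) hw)
  unfold wsq sqn
  rw [← tsum_mul_left, ← tsum_mul_left, ← (s2.mul_left s).tsum_add (s0.mul_left s⁻¹)]
  refine (summable_wsq (nr_ne_top_mono (by norm_num) hw)).tsum_le_tsum (fun k => ?_)
    ((s2.mul_left s).add (s0.mul_left s⁻¹))
  have h : jb k ^ 2 ≤ s * (jb k ^ 2) ^ 2 + s⁻¹ := by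
    have h1 : s * s⁻¹ = 1 := mul_inv_cancel₀ hs.ne'
    have h2 : 0 < s⁻¹ := inv_pos.2 hs
    have h3 := sq_nonneg (s * jb k ^ 2 - 1)
    have h4 : s⁻¹ * (s * jb k ^ 2 - 1) ^ 2 = s * (jb k ^ 2) ^ 2 - 2 * jb k ^ 2 + s⁻¹ := by
      field_simp
      ring
    have h5 := mul_nonneg h2.le h3
    nlinarith [jb_pow_nonneg k 2]
  calc (jb k ^ 1 * ‖w k‖) ^ 2 = jb k ^ 2 * ‖w k‖ ^ 2 := by ring
    _ ≤ (s * (jb k ^ 2) ^ 2 + s⁻¹) * ‖w k‖ ^ 2 := by gcongr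
    _ = _ := by ring

lemma abs_th₁_le_add (k l : ℤ) : |th₁ k l| ≤ Jc k + Jc l := by
  linarith [abs_th₁_le k l, Jc_nonneg k, Jc_nonneg l]

lemma abs_th₂_le_add (k l : ℤ) : |th₂ k l| ≤ Jc k + Jc l := by
  rw [abs_of_nonneg (th₂_nonneg k l)]; exact th₂_le k l

lemma enorm_symQ_le (k : ℤ) : ‖symQ k‖ₑ ≤ jw k ^ (3 + 1) := enorm_pow_four_le k

/-- The dissipation controls the terms that it produces in the correction terms. -/
lemma neg_dissipation_le (c : Coeffs) {κ M : ℝ} {a w : ℤ → ℂ} (hκ : 0 ≤ wgt κ a) (hM : 1 ≤ M)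
    (ha : nr 3 a ≤ ENNReal.ofReal M) (hw : nr 3 w ≠ ⊤) :
    -(Gx c κ a w (ml symQ w) + Ty c a w (ml symQ a)) ≤ 30000000 * c.size ^ 4 * M ^ 4 * sqn w := by
  have hM0 : 0 ≤ M := zero_le_one.trans hM
  have hsz := c.one_le_size
  have hz0 := c.size_nonneg
  have hS := sqn_nonneg w
  have ha2 := (nr_mono (show 2 ≤ 3 by norm_num) a).trans ha
  have ha1 := (nr_mono (show 1 ≤ 3 by norm_num) a).trans ha
  set z := c.size * M with hz
  have hz1 : 1 ≤ z := one_le_mul_of_one_le_of_one_le hsz hM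
  have hz' : 0 < z := by linarith
  -- Small enough that the first two corrections cost `P/32` directly and `P/32` through
  -- interpolation of `Q`. The remaining terms take `P/16`, so `P/8` in all, which is what the
  -- dissipation provides.
  set δ := (160 * z)⁻¹ with hδ
  have hδ0 : 0 < δ := by positivity
  set P := wsq 2 w with hP
  set Q := wsq 1 w with hQ
  have hP0 : 0 ≤ P := wsq_nonneg _ _
  have hQ0 : 0 ≤ Q := wsq_nonneg _ _
  have t1 := abs_re_tri_symQ_le abs_th₁_le_add hM0 ha2 hw hδ0
  have t2 := abs_re_tri_symQ_le abs_th₂_le_add hM0 ha2 hw hδ0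
  have t3 := abs_re_tri_JJ_symQ_le (mul_nonneg hM0 hM0) (nr_conv_le_ofReal hM0 ha2 ha2) hw
  have hy : wn iw (ml symQ a) ≤ ENNReal.ofReal M := (wn_iw_ml_le enorm_symQ_le a).trans ha
  have hay : wn iw ((2 : ℂ) • conv a (ml symQ a)) ≤ ENNReal.ofReal (2 * (M * M)) := by
    rw [wn_smul, ENNReal.ofReal_mul zero_le_two, ENNReal.ofReal_mul hM0]
    refine mul_le_mul' (le_of_eq (by rw [show (2 : ℂ) = ((2 : ℝ) : ℂ) by simp, enorm_ofReal_abs,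
      abs_two])) ((wn_iw_conv_le _ _).trans (mul_le_mul' ha1 hy))
  have t4 := abs_re_tri_iw_le abs_th₁_le_one zero_le_one hM0 hy hw
  have t5 := abs_re_tri_iw_le abs_th₂_le zero_le_two hM0 hy hw
  have t6 := abs_re_tri_iw_le abs_JJ_le zero_le_one (by positivity) hay hw
  have l1 : |lam₁ c 0 / 4| ≤ c.size / 2 := by
    rw [abs_div, abs_of_pos (show (0 : ℝ) < 4 by norm_num)]; linarith [abs_lam₁_le c]
  have l2 : |lam₂ c 0 / 4| ≤ c.size / 4 := by
    rw [abs_div, abs_of_pos (show (0 : ℝ) < 4 by norm_num)]; linarith [abs_lam₂_le c]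
  have l3 := abs_mu₃_le c
  have two : |(2 : ℝ)| ≤ 2 := by norm_num
  rw [← hP, ← hQ] at t1 t2
  have b1 := neg_le_of_abs_le (abs_mul_le_of_le l1 (abs_mul_le_of_le two t1))
  have b2 := neg_le_of_abs_le (abs_mul_le_of_le l2 (abs_mul_le_of_le two t2))
  have b3 := neg_le_of_abs_le (abs_mul_le_of_le l3 (abs_mul_le_of_le two t3))
  have b4 := neg_le_of_abs_le (abs_mul_le_of_le l1 t4)
  have b5 := neg_le_of_abs_le (abs_mul_le_of_le l2 t5)
  have b6 := neg_le_of_abs_le (abs_mul_le_of_le l3 t6)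
  -- The dissipation in the `H⁻¹` part has a good sign and is dropped.
  have p2 : 0 ≤ (pr om (ml symQ w) w).re := by
    rw [re_pr_symQ]
    exact tsum_nonneg fun k => mul_nonneg (mul_nonneg (om_nonneg k) (by positivity)) (sq_nonneg _)
  have p2' := mul_nonneg hκ p2
  have hp := wsq_two_le hw
  have q1 := wsq_one_le hw (pow_pos hδ0 2)
  -- The interpolation parameter is chosen from `14/224 = 1/16`.
  have hδ' : 0 < (224 * z ^ 2)⁻¹ := by positivity
  have q2 := wsq_one_le hw hδ'
  rw [← hP, ← hQ, inv_inv] at q2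
  rw [← hP, ← hQ] at q1
  have e1 : δ⁻¹ = 160 * z := inv_inv _
  have e2 : (δ ^ 2)⁻¹ = (160 * z) ^ 2 := by rw [← inv_pow, e1]
  rw [e2] at q1
  rw [e1] at b1 b2
  have w1 : 5 * z * (δ * P + 160 * z * Q) ≤ P / 16 + 20480000 * z ^ 4 * sqn w := by
    have h1 : z * δ = 1 / 160 := by rw [hδ]; field_simp
    calc 5 * z * (δ * P + 160 * z * Q)
        ≤ 5 * z * (δ * P + 160 * z * (δ ^ 2 * P + (160 * z) ^ 2 * sqn w)) := by gcongr
      _ = 5 * (z * δ) * P + 800 * (z * δ) ^ 2 * P + 20480000 * z ^ 4 * sqn w := by ring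
      _ = _ := by rw [h1]; ring
  have w2 : 14 * z ^ 2 * Q ≤ P / 16 + 3136 * z ^ 4 * sqn w := by
    have h1 : z ^ 2 * (224 * z ^ 2)⁻¹ = 1 / 224 := by field_simp
    calc 14 * z ^ 2 * Q ≤ 14 * z ^ 2 * ((224 * z ^ 2)⁻¹ * P + 224 * z ^ 2 * sqn w) := by gcongr
      _ = 14 * (z ^ 2 * (224 * z ^ 2)⁻¹) * P + 3136 * z ^ 4 * sqn w := by ring
      _ = _ := by rw [h1]; ring
  have hz4 : 1 ≤ z ^ 4 := one_le_pow₀ hz1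
  have hzS := mul_le_mul_of_nonneg_right hz4 hS
  have zz : z ≤ z ^ 2 := le_self_pow₀ hz1 (by norm_num)
  have zQ := mul_le_mul_of_nonneg_right zz hQ0
  have zY : 0 ≤ z * (δ * P + 160 * z * Q) := by positivity
  have f1 : c.size / 2 * (2 * (3 * (M * (δ * P + 160 * z * Q)))) = 3 * (z * (δ * P + 160 * z * Q)) := by
    rw [hz]; ring
  have f2 : c.size / 4 * (2 * (3 * (M * (δ * P + 160 * z * Q))))
      = 3 / 2 * (z * (δ * P + 160 * z * Q)) := by
    rw [hz]; ring
  have f3 : c.size ^ 2 * (2 * (4 * (M * M * Q))) = 8 * (z ^ 2 * Q) := by rw [hz]; ring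
  have f4 : c.size / 2 * (2 * 1 * (M * Q)) = z * Q := by rw [hz]; ring
  have f5 : c.size / 4 * (2 * 2 * (M * Q)) = z * Q := by rw [hz]; ring
  have f6 : c.size ^ 2 * (2 * 1 * (2 * (M * M) * Q)) = 4 * (z ^ 2 * Q) := by rw [hz]; ring
  rw [f1] at b1
  rw [f2] at b2
  rw [f3] at b3
  rw [f4] at b4
  rw [f5] at b5
  rw [f6] at b6
  rw [show 30000000 * c.size ^ 4 * M ^ 4 = 30000000 * z ^ 4 by rw [hz]; ring]
  unfold Gx Ty
  have r1 : -((pr (fun _ => 1) (ml symQ w) w).re + wgt κ a * (pr om (ml symQ w) w).re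
      + lam₁ c 0 / 4 * (2 * (tri th₁ a (ml symQ w) w).re)
      + lam₂ c 0 / 4 * (2 * (tri th₂ a (ml symQ w) w).re)
      + mu₃ c * (2 * (tri (fun k l => Jc k * Jc l) (conv a a) (ml symQ w) w).re)
      + (lam₁ c 0 / 4 * (tri th₁ (ml symQ a) w w).re + lam₂ c 0 / 4 * (tri th₂ (ml symQ a) w w).re
      + mu₃ c * (tri (fun k l => Jc k * Jc l) ((2 : ℂ) • conv a (ml symQ a)) w w).re))
      ≤ -(pr (fun _ => 1) (ml symQ w) w).re + 5 * (z * (δ * P + 160 * z * Q))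
        + 14 * (z ^ 2 * Q) := by linarith
  linarith

/-! ### Square integrable forcing -/

lemma abs_re_pr_young {m : ℤ → ℝ} {x w : ℤ → ℂ} {X V s : ℝ} (hs : 0 < s) (hX : 0 ≤ X)
    (hV : 0 ≤ V) (hx : ee x ≤ ENNReal.ofReal X)
    (hv : ∑' k, (‖(m k : ℂ)‖ₑ * ‖w k‖ₑ) ^ 2 ≤ ENNReal.ofReal V) :
    |(pr m x w).re| ≤ s * X + s⁻¹ * V := by
  refine abs_re_le_of_enorm (by positivity) ((enorm_tsum_le _).trans ?_)
  rw [ENNReal.ofReal_add (by positivity) (by positivity), ENNReal.ofReal_mul hs.le,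
    ENNReal.ofReal_mul (inv_pos.2 hs).le]
  calc ∑' k, ‖(m k : ℂ) * x k * conj (w k)‖ₑ
      ≤ ∑' k, (ENNReal.ofReal s * ‖x k‖ₑ ^ 2
          + ENNReal.ofReal s⁻¹ * (‖(m k : ℂ)‖ₑ * ‖w k‖ₑ) ^ 2) := by
        refine ENNReal.tsum_le_tsum fun k => ?_
        rw [enorm_mul, enorm_mul, enorm_conj, mul_comm ‖(m k : ℂ)‖ₑ, mul_assoc]
        exact mul_le_young _ _ hs
    _ = ENNReal.ofReal s * ee x
          + ENNReal.ofReal s⁻¹ * ∑' k, (‖(m k : ℂ)‖ₑ * ‖w k‖ₑ) ^ 2 := by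
        rw [ENNReal.tsum_add, ENNReal.tsum_mul_left, ENNReal.tsum_mul_left, ee]
    _ ≤ _ := by gcongr

lemma summable_omn {w : ℤ → ℂ} (hw : Summable fun k => ‖w k‖ ^ 2) :
    Summable fun k => om k * ‖w k‖ ^ 2 :=
  hw.of_nonneg_of_le (fun k => mul_nonneg (om_nonneg k) (sq_nonneg _))
    fun k => mul_le_of_le_one_left (sq_nonneg _) (om_le_one k)

lemma omn_nonneg (w : ℤ → ℂ) : 0 ≤ omn w :=
  tsum_nonneg fun k => mul_nonneg (om_nonneg k) (sq_nonneg _)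

lemma omn_le_sqn {w : ℤ → ℂ} (hw : Summable fun k => ‖w k‖ ^ 2) : omn w ≤ sqn w :=
  (summable_omn hw).tsum_le_tsum (fun k => mul_le_of_le_one_left (sq_nonneg _) (om_le_one k)) hw

lemma tsum_om_sq_le {w : ℤ → ℂ} (hw : Summable fun k => ‖w k‖ ^ 2) :
    ∑' k, (‖(om k : ℂ)‖ₑ * ‖w k‖ₑ) ^ 2 ≤ ENNReal.ofReal (omn w) := by
  rw [omn, ENNReal.ofReal_tsum_of_nonneg (fun k => mul_nonneg (om_nonneg k) (sq_nonneg _))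
    (summable_omn hw)]
  refine ENNReal.tsum_le_tsum fun k => ?_
  rw [enorm_ofReal_abs, abs_of_nonneg (om_nonneg k), ← ofReal_norm,
    ← ENNReal.ofReal_mul (om_nonneg k),
    ← ENNReal.ofReal_pow (mul_nonneg (om_nonneg k) (norm_nonneg _))]
  refine ENNReal.ofReal_le_ofReal ?_
  rw [mul_pow, sq (om k)]
  exact mul_le_mul_of_nonneg_right (mul_le_of_le_one_left (om_nonneg k) (om_le_one k))
    (sq_nonneg _)

/-- The forcing is only square integrable, and half of its square is allowed: `X/8` for the `L²`
pairing, `X/8` for the `H⁻¹` pairing and `X/4` for the corrections. The `H⁻¹` pairing carries the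
weight, and Young's inequality there leaves `W²‖w‖²_{H⁻¹}`, of which one factor `W` belongs to the
energy. -/
lemma abs_Gx_young (c : Coeffs) {κ M X : ℝ} {a w x : ℤ → ℂ} (hW : 1 ≤ wgt κ a) (hM : 1 ≤ M)
    (hX : 0 ≤ X) (ha : nr 0 a ≤ ENNReal.ofReal M) (hw : nr 0 w ≠ ⊤)
    (hx : ee x ≤ ENNReal.ofReal X) :
    |Gx c κ a w x| ≤ X / 2 + 72 * c.size ^ 4 * M ^ 4 * sqn w + 8 * wgt κ a ^ 2 * omn w := by
  have hM0 : 0 ≤ M := zero_le_one.trans hM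
  have hsz := c.one_le_size
  have hz0 := c.size_nonneg
  have hS := sqn_nonneg w
  have hw2 := summable_sq_of_nr hw
  have hO := omn_nonneg w
  set W := wgt κ a with hWd
  have hW0 : 0 < W := by linarith
  have hee : ∑' k, wt 0 w k ^ 2 ≤ ENNReal.ofReal (sqn w) := by rw [tsum_wt_sq hw, wsq_zero]
  have hex : ∑' k, wt 0 x k ^ 2 ≤ ENNReal.ofReal X := by simpa [wt, ee] using hx
  have ha0 : wn (fun _ => 1) a ≤ ENNReal.ofReal M := by simpa [wn, nr_zero_eq] using ha
  have he0 : wn (fun _ => 1) (conv a a) ≤ ENNReal.ofReal (M * M) := by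
    simpa [wn, nr_zero_eq] using nr_conv_le_ofReal hM0 ha ha
  have h1 := abs_re_pr_young (m := fun _ => 1) (w := w) (s := 1 / 8) (by norm_num) hX hS hx
    (by simpa [wt] using hee)
  have h2 := abs_re_pr_young (m := om) (w := w) (s := 1 / (8 * W)) (by positivity) hX hO hx
    (tsum_om_sq_le hw2)
  set z := c.size ^ 2 * M ^ 2 with hz
  have hz1 : 1 ≤ z := one_le_mul_of_one_le_of_one_le (one_le_pow₀ hsz) (one_le_pow₀ hM)
  have hz' : 0 < z := by linarith
  have hs : 0 < 1 / (16 * z) := by positivity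
  have tr := fun {θ : ℤ → ℤ → ℝ} {C A : ℝ} {b : ℤ → ℂ} (hθ : ∀ k l, |θ k l| ≤ C) (hC : 0 ≤ C)
    (hA : 0 ≤ A) (hb : wn (fun _ => 1) b ≤ ENNReal.ofReal A) =>
    abs_re_tri_young (ω := fun _ => 1) (b := 0) (d := 0) (fun k l => by
      simpa using enorm_real_le (hθ k l)) hC hA hX hS hb hex hee hs
  have h3 := tr abs_th₁_le_one zero_le_one hM0 ha0
  have h4 := tr abs_th₂_le zero_le_two hM0 ha0
  have h5 := tr abs_JJ_le zero_le_one (mul_nonneg hM0 hM0) he0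
  have l1 : |lam₁ c 0 / 4| ≤ c.size / 2 := by
    rw [abs_div, abs_of_pos (show (0 : ℝ) < 4 by norm_num)]; linarith [abs_lam₁_le c]
  have l2 : |lam₂ c 0 / 4| ≤ c.size / 4 := by
    rw [abs_div, abs_of_pos (show (0 : ℝ) < 4 by norm_num)]; linarith [abs_lam₂_le c]
  have two : |(2 : ℝ)| ≤ 2 := by norm_num
  have hWa : |W| ≤ W := (abs_of_pos hW0).le
  unfold Gx
  refine (abs_add_le_add (abs_add_le_add (abs_add_le_add (abs_add_le_add h1
    (abs_mul_le_of_le hWa h2)) (abs_mul_le_of_le l1 (abs_mul_le_of_le two h3)))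
    (abs_mul_le_of_le l2 (abs_mul_le_of_le two h4)))
    (abs_mul_le_of_le (abs_mu₃_le c) (abs_mul_le_of_le two h5))).trans ?_
  set Y := 1 / (16 * z) * X + (1 / (16 * z))⁻¹ * sqn w with hY
  have hY0 : 0 ≤ Y := by positivity
  have g2 : W * (1 / (8 * W) * X + (1 / (8 * W))⁻¹ * omn w) = X / 8 + 8 * W ^ 2 * omn w := by
    field_simp
  have gz : c.size * M ≤ z := mul_le_mul (le_self_pow₀ hsz (by norm_num))
    (le_self_pow₀ hM (by norm_num)) hM0 (by positivity)
  have gY : 4 * z * Y = X / 4 + 64 * z ^ 2 * sqn w := by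
    rw [hY]; field_simp; ring
  have gs := mul_le_mul_of_nonneg_right gz hY0
  have e3 : c.size / 2 * (2 * (1 * (M * Y))) = c.size * M * Y := by ring
  have e4 : c.size / 4 * (2 * (2 * (M * Y))) = c.size * M * Y := by ring
  have e5 : c.size ^ 2 * (2 * (1 * (M * M * Y))) = 2 * (z * Y) := by rw [hz]; ring
  rw [g2, e3, e4, e5, show 72 * c.size ^ 4 * M ^ 4 = 72 * z ^ 2 by rw [hz]; ring]
  have hz2 : 1 ≤ z ^ 2 := one_le_pow₀ hz1
  have hzS := mul_le_mul_of_nonneg_right hz2 hS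
  have e1 : (1 / 8 : ℝ)⁻¹ = 8 := by norm_num
  rw [e1]
  linarith
end BO4
end

noncomputable section
namespace BO4
open scoped ENNReal ComplexConjugate

/-! ### The energy estimate on the Fourier side -/

lemma sqn_le_sq {a : ℤ → ℂ} {M : ℝ} (hM : 0 ≤ M) (ha : nr 0 a ≤ ENNReal.ofReal M) :
    sqn a ≤ M ^ 2 := by
  have h0 := ne_top_of_le_ofReal ha
  rw [← ENNReal.ofReal_le_ofReal_iff (sq_nonneg M), ← ee_eq h0, ENNReal.ofReal_pow hM]
  refine le_trans ?_ (pow_le_pow_left₀ zero_le ha 2)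
  rw [nr_zero_eq, sq, ← ENNReal.tsum_mul_right]
  refine ENNReal.tsum_le_tsum fun k => ?_
  rw [sq]
  exact mul_le_mul_right (ENNReal.le_tsum (f := fun k => ‖a k‖ₑ) k) _

/-- The constant in the bound for the weight of the energy. -/
def wc (κ : ℝ) : ℝ := 1 + κ * (2 * Real.pi) + κ * (2 * Real.pi) ^ 2

lemma one_le_wgt {κ : ℝ} (hκ : 0 ≤ κ) (a : ℤ → ℂ) : 1 ≤ wgt κ a := by
  have h := sqn_nonneg a
  have hp := Real.pi_pos
  have h1 : 0 ≤ κ * (2 * Real.pi * sqn a) := by positivity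
  have h2 : 0 ≤ κ * (2 * Real.pi * sqn a) ^ 2 := by positivity
  unfold wgt; linarith

lemma one_le_wc {κ : ℝ} (hκ : 0 ≤ κ) : 1 ≤ wc κ := by
  have hp := Real.pi_pos
  have h1 : 0 ≤ κ * (2 * Real.pi) := by positivity
  have h2 : 0 ≤ κ * (2 * Real.pi) ^ 2 := by positivity
  unfold wc; linarith

lemma wgt_le {κ M : ℝ} (hκ : 0 ≤ κ) (hM : 1 ≤ M) {a : ℤ → ℂ} (ha : nr 0 a ≤ ENNReal.ofReal M) :
    wgt κ a ≤ wc κ * M ^ 4 := by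
  have hp := Real.pi_pos
  have hs := sqn_le_sq (zero_le_one.trans hM) ha
  have h0 := sqn_nonneg a
  have h1 : κ * (2 * Real.pi * sqn a) ≤ κ * (2 * Real.pi * M ^ 4) := by
    gcongr
    exact hs.trans (pow_le_pow_right₀ hM (by norm_num))
  have h2 : κ * (2 * Real.pi * sqn a) ^ 2 ≤ κ * (2 * Real.pi * M ^ 2) ^ 2 := by gcongr
  have h3 : 1 ≤ M ^ 4 := one_le_pow₀ hM
  unfold wgt wc
  linarith

lemma Gx_smul (c : Coeffs) (κ r : ℝ) (a w x : ℤ → ℂ) :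
    Gx c κ a w ((r : ℂ) • x) = r * Gx c κ a w x := by
  unfold Gx
  rw [pr_smul, pr_smul, tri_smul_two, tri_smul_two, tri_smul_two]
  simp only [Complex.re_ofReal_mul]
  ring

lemma Ty_smul (c : Coeffs) (r : ℝ) (a w y : ℤ → ℂ) :
    Ty c a w ((r : ℂ) • y) = r * Ty c a w y := by
  unfold Ty
  rw [tri_smul_one, tri_smul_one, conv_smul_right, tri_smul_one, tri_smul_one, tri_smul_one]
  have : ((2 : ℂ) * ((r : ℂ) * tri (fun k l => Jc k * Jc l) (conv a y) w w)).re
      = r * ((2 : ℂ) * tri (fun k l => Jc k * Jc l) (conv a y) w w).re := by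
    rw [mul_left_comm, Complex.re_ofReal_mul]
  rw [this, Complex.re_ofReal_mul, Complex.re_ofReal_mul]
  ring

lemma Dm.nr_ne_top {R : ℝ} {w x : ℤ → ℂ} (hw : nr 0 w ≠ ⊤) (h : Dm 0 R w x) : nr 0 x ≠ ⊤ := by
  obtain ⟨B, hB, hx⟩ := h
  refine ne_top_of_le_ne_top ?_ (ENNReal.tsum_le_tsum hx)
  rw [tsum_econv]
  exact ENNReal.mul_ne_top (ne_top_of_le_ofReal hB) hw

/-- The viscosities are distributed so that the dissipation `ε₁` acts on the difference and only `g
= u₂` receives the fourth derivative as a forcing, with the small factor `ε₂ - ε₁`. -/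
lemma rhs_sub_rhs (c : Coeffs) (ε₁ ε₂ : ℝ) {a g : ℤ → ℂ} (ha : nr 3 a ≠ ⊤) (hg : nr 3 g ≠ ⊤)
    (hp : nr 0 (potential c a) ≠ ⊤) :
    rhs c ε₁ a - rhs c ε₂ g = ml (fun k => -Complex.I * (phi k : ℂ)) (a - g)
      + linOp c a (potential c a) (a - g) + remD c a (a + g) (a - g)
      + (((-ε₁ : ℝ) : ℂ) • ml symQ (a - g) + ((ε₂ - ε₁ : ℝ) : ℂ) • ml symQ g) := by
  have h := ml_symD_nlin_sub c ha (nr_sub_ne_top ha hg) hp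
  rw [sub_sub_cancel] at h
  rw [add_assoc (ml _ (a - g)), ← h, ml_sub, ml_sub]
  unfold rhs
  change _ - (ε₁ : ℂ) • ml symQ a - (_ - (ε₂ : ℂ) • ml symQ g) = _
  push_cast
  module

/-- The power `M⁷` is reached in the terms where the potential, of size `M³`, or the remainder of
the same size meets the weight of the energy, of size `M⁴`. It is reached again in the derivative of
the weight, as `M⁴·M·M²`. -/
lemma dE_le (c : Coeffs) {κ ε₁ ε₂ M X : ℝ} (hκ : 0 ≤ κ) (hε : 0 ≤ ε₁) (hε' : ε₁ ≤ 1) (hM : 1 ≤ M)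
    (hX : 0 ≤ X) {a g : ℤ → ℂ} (hr : RealSeq a) (ha : nr 3 a ≤ ENNReal.ofReal M)
    (hg : nr 3 g ≤ ENNReal.ofReal M) (hw : nr 3 (a - g) ≤ ENNReal.ofReal M)
    (hq : nr 3 (a + g) ≤ ENNReal.ofReal M)
    (hx : ee (((ε₂ - ε₁ : ℝ) : ℂ) • ml symQ g) ≤ ENNReal.ofReal X) :
    dE c κ a (a - g) (rhs c ε₁ a) (rhs c ε₁ a - rhs c ε₂ g)
      ≤ X / 2 + 40000000 * c.size ^ 4 * wc κ * M ^ 7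
        * (sqn (a - g) + wgt κ a * omn (a - g)) := by
  have hM0 : 0 ≤ M := zero_le_one.trans hM
  set w := a - g with hwd
  set z := c.size with hz
  set W := wgt κ a with hW
  set V := wc κ with hV
  have z1 : 1 ≤ z := c.one_le_size
  have z0 : 0 ≤ z := c.size_nonneg
  have V1 : 1 ≤ V := one_le_wc hκ
  have V0 : 0 ≤ V := by linarith
  have W1 : 1 ≤ W := one_le_wgt hκ a
  have W0 : 0 ≤ W := by linarith
  have fa := ne_top_of_le_ofReal ha
  have fg := ne_top_of_le_ofReal hg
  have fw := ne_top_of_le_ofReal hw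
  have fw0 := nr_ne_top_mono (Nat.zero_le 3) fw
  have fw1 := nr_ne_top_mono (show 1 ≤ 3 by norm_num) fw
  have fa1 := nr_ne_top_mono (show 1 ≤ 3 by norm_num) fa
  have ha0 := (nr_mono (Nat.zero_le 3) a).trans ha
  have ha1 := (nr_mono (show 1 ≤ 3 by norm_num) a).trans ha
  have hS := sqn_nonneg w
  have hO := omn_nonneg w
  have hOS := omn_le_sqn (summable_sq_of_nr fw0)
  have hWle : W ≤ V * M ^ 4 := wgt_le hκ hM ha0
  have hWabs : |W| ≤ V * M ^ 4 := by rwa [abs_of_nonneg W0]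
  have hpot := nr_potential_le c hM ha
  have fpot := ne_top_of_le_ofReal hpot
  have hnl := nr_nlin_le c hM ha
  have fnl := nr_ne_top_mono (Nat.zero_le 1) (ne_top_of_le_ofReal hnl)
  have hrem := dm_remD c hM ha hq hw
  have hDn : nr 0 (ml symD (nlin c a)) ≤ ENNReal.ofReal (z * M ^ 4) :=
    nr_ml_le_ofReal (n := 0) enorm_symD_le le_rfl hnl
  have i1 : wn iw (ml (fun k => -Complex.I * (phi k : ℂ)) w) ≠ ⊤ :=
    ne_top_of_le_ne_top fw (wn_iw_ml_le enorm_phi_le w)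
  have i2 : wn iw (linOp c a (potential c a) w) ≠ ⊤ := wn_iw_linOp c fa fpot fw
  have i3 : wn iw (remD c a (a + g) w) ≠ ⊤ :=
    ne_top_of_le_ne_top (hrem.nr_ne_top fw0) (wn_iw_le 0 _)
  have i4 : wn iw (((-ε₁ : ℝ) : ℂ) • ml symQ w) ≠ ⊤ :=
    wn_smul_ne_top _ (ne_top_of_le_ne_top fw (wn_iw_ml_le enorm_symQ_le w))
  have i5 : wn iw (((ε₂ - ε₁ : ℝ) : ℂ) • ml symQ g) ≠ ⊤ :=
    wn_smul_ne_top _ (ne_top_of_le_ne_top fg (wn_iw_ml_le enorm_symQ_le g))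
  have j1 : wn iw (ml (fun k => -Complex.I * (phi k : ℂ)) a) ≠ ⊤ :=
    ne_top_of_le_ne_top fa (wn_iw_ml_le enorm_phi_le a)
  have j2 : wn iw (ml symD (nlin c a)) ≠ ⊤ :=
    ne_top_of_le_ne_top (ne_top_of_le_ofReal hDn) (wn_iw_le 0 _)
  have j3 : wn iw (((-ε₁ : ℝ) : ℂ) • ml symQ a) ≠ ⊤ :=
    wn_smul_ne_top _ (ne_top_of_le_ne_top fa (wn_iw_ml_le enorm_symQ_le a))
  have ey : rhs c ε₁ a = ml (fun k => -Complex.I * (phi k : ℂ)) a + ml symD (nlin c a)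
      + ((-ε₁ : ℝ) : ℂ) • ml symQ a := by
    unfold rhs
    change _ - (ε₁ : ℂ) • ml symQ a = _
    push_cast
    module
  have eG : Gx c κ a w (rhs c ε₁ a - rhs c ε₂ g)
      = Gx c κ a w (ml (fun k => -Complex.I * (phi k : ℂ)) w)
        + Gx c κ a w (linOp c a (potential c a) w) + Gx c κ a w (remD c a (a + g) w)
        + (-ε₁ * Gx c κ a w (ml symQ w) + Gx c κ a w (((ε₂ - ε₁ : ℝ) : ℂ) • ml symQ g)) := by
    rw [rhs_sub_rhs c ε₁ ε₂ fa fg (nr_ne_top_mono (Nat.zero_le 2) fpot),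
      Gx_add c κ fa1 fw1 (wn_add_ne_top (wn_add_ne_top i1 i2) i3) (wn_add_ne_top i4 i5),
      Gx_add c κ fa1 fw1 (wn_add_ne_top i1 i2) i3, Gx_add c κ fa1 fw1 i1 i2,
      Gx_add c κ fa1 fw1 i4 i5, Gx_smul c κ (-ε₁)]
  have eT : Ty c a w (rhs c ε₁ a) = Ty c a w (ml (fun k => -Complex.I * (phi k : ℂ)) a)
      + Ty c a w (ml symD (nlin c a)) + -ε₁ * Ty c a w (ml symQ a) := by
    rw [ey, Ty_add c fa1 fw1 (wn_add_ne_top j1 j2) j3, Ty_add c fa1 fw1 j1 j2, Ty_smul]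
  have b1 := (le_abs_self _).trans (abs_main_le (κ := κ) c hM (by positivity) hr
    (realSeq_potential c hr) ha hpot fw hWabs)
  have b2 := (le_abs_self _).trans (hrem.abs_Gx_le c hM (by positivity) ha0 fw0 hWabs)
  have b3 := (le_abs_self _).trans (abs_Ty_le c hM (by positivity) ha0 fw0 hDn)
  have b4 := mul_le_mul_of_nonneg_left (neg_dissipation_le c (κ := κ) W0 hM ha fw) hε
  have b5 := (le_abs_self _).trans (abs_Gx_young c (κ := κ) W1 hM hX ha0 fw0 hx)
  have hy : wn iw (rhs c ε₁ a) ≤ ENNReal.ofReal (3 * z * M ^ 4) := by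
    have e1 : wn iw (rhs c ε₁ a) ≤ ENNReal.ofReal M + ENNReal.ofReal (z * M ^ 4)
        + ENNReal.ofReal |(-ε₁)| * ENNReal.ofReal M := by
      rw [ey]
      refine (wn_add_le _ _ _).trans (add_le_add ((wn_add_le _ _ _).trans (add_le_add
        ((wn_iw_ml_le enorm_phi_le a).trans ha) ((wn_iw_le 0 _).trans hDn))) ?_)
      rw [wn_smul, enorm_ofReal_abs]
      exact mul_le_mul_right ((wn_iw_ml_le enorm_symQ_le a).trans ha) _
    refine e1.trans ?_
    rw [← ENNReal.ofReal_mul (abs_nonneg _), ← ENNReal.ofReal_add hM0 (by positivity),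
      ← ENNReal.ofReal_add (by positivity) (by positivity)]
    refine ENNReal.ofReal_le_ofReal ?_
    have h4 : M ≤ z * M ^ 4 := by
      calc M ≤ M ^ 4 := le_self_pow₀ hM (by norm_num)
        _ ≤ _ := le_mul_of_one_le_left (by positivity) z1
    have h5 : |(-ε₁)| * M ≤ 1 * M := by
      rw [abs_neg, abs_of_nonneg hε]; gcongr
    linarith
  -- The time derivative of `‖f‖²` pairs the right-hand side, of weight `-1`, with `a` in weight
  -- `1`.
  have hpr : |(pr (fun _ => 1) (rhs c ε₁ a) a).re| ≤ 3 * z * M ^ 4 * M := by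
    refine abs_re_le_of_enorm (by positivity) ((enorm_tsum_le _).trans
      ((tsum_enorm_pr_le abs_one_fun_le _ a).trans ?_))
    rw [ENNReal.ofReal_one, one_mul, ENNReal.ofReal_mul (by positivity)]
    exact mul_le_mul' hy ha1
  have hp := Real.pi_pos
  have hp4 := Real.pi_lt_four
  have hsa := sqn_le_sq hM0 ha0
  have hsa0 := sqn_nonneg a
  have hM2 : 1 ≤ M ^ 2 := one_le_pow₀ hM
  have b6 : 1 / 2 * omn w * (κ * (4 * Real.pi * (pr (fun _ => 1) (rhs c ε₁ a) a).re)
      * (1 + 2 * (2 * Real.pi * sqn a))) ≤ 51 * z * V * M ^ 7 * sqn w := by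
    have k1 : κ * (4 * Real.pi * (pr (fun _ => 1) (rhs c ε₁ a) a).re)
        ≤ 2 * V * (3 * z * M ^ 4 * M) := by
      calc κ * (4 * Real.pi * (pr (fun _ => 1) (rhs c ε₁ a) a).re)
          ≤ κ * (4 * Real.pi * (3 * z * M ^ 4 * M)) := by
            gcongr; exact (le_abs_self _).trans hpr
        _ = 2 * (κ * (2 * Real.pi)) * (3 * z * M ^ 4 * M) := by ring
        _ ≤ _ := by
            have : κ * (2 * Real.pi) ≤ V := by
              have : 0 ≤ κ * (2 * Real.pi) ^ 2 := by positivity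
              rw [hV, wc]; linarith
            gcongr
    -- From `π < 4` and `‖a‖² ≤ M²`: `1 + 16M² ≤ 17M²`.
    have k2 : 1 + 2 * (2 * Real.pi * sqn a) ≤ 17 * M ^ 2 := by nlinarith
    have k3 : 0 ≤ 1 + 2 * (2 * Real.pi * sqn a) := by positivity
    calc 1 / 2 * omn w * (κ * (4 * Real.pi * (pr (fun _ => 1) (rhs c ε₁ a) a).re)
          * (1 + 2 * (2 * Real.pi * sqn a)))
        ≤ 1 / 2 * omn w * (2 * V * (3 * z * M ^ 4 * M) * (1 + 2 * (2 * Real.pi * sqn a))) := by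
          gcongr
      _ ≤ 1 / 2 * sqn w * (2 * V * (3 * z * M ^ 4 * M) * (17 * M ^ 2)) := by gcongr
      _ = _ := by ring
  have Y0 : 0 ≤ z ^ 4 * V * M ^ 7 * sqn w := by positivity
  have m3 : M ^ 2 ≤ z * M ^ 3 := by
    calc M ^ 2 ≤ M ^ 3 := pow_le_pow_right₀ hM (by norm_num)
      _ ≤ _ := le_mul_of_one_le_left (by positivity) z1
  have m4 : M ^ 2 ≤ V * M ^ 4 := by
    calc M ^ 2 ≤ M ^ 4 := pow_le_pow_right₀ hM (by norm_num)
      _ ≤ _ := le_mul_of_one_le_left (by positivity) V1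
  have d1 : 500 * z ^ 3 * ((M ^ 2 + 6 * z * M ^ 3) * (V * M ^ 4 + M ^ 2) * sqn w)
      ≤ 7000 * (z ^ 4 * V * M ^ 7 * sqn w) := by
    calc _ ≤ 500 * z ^ 3 * ((z * M ^ 3 + 6 * z * M ^ 3) * (V * M ^ 4 + V * M ^ 4) * sqn w) := by
          gcongr
      _ = _ := by ring
  have d2 : 2 * (52 * z * M ^ 3 * sqn w) * (V * M ^ 4 + 6 * z ^ 2 * M ^ 2)
      ≤ 728 * (z ^ 4 * V * M ^ 7 * sqn w) := by
    have e1 : V * M ^ 4 ≤ z ^ 3 * (V * M ^ 4) :=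
      le_mul_of_one_le_left (by positivity) (one_le_pow₀ z1)
    calc _ ≤ 2 * (52 * z * M ^ 3 * sqn w) * (z ^ 3 * (V * M ^ 4) + 6 * z ^ 3 * (V * M ^ 4)) := by
          gcongr
          norm_num
      _ = _ := by ring
  have d3 : 6 * z ^ 2 * M * (z * M ^ 4) * sqn w ≤ 6 * (z ^ 4 * V * M ^ 7 * sqn w) := by
    calc _ = 6 * (z ^ 3 * 1 * M ^ 5 * sqn w) := by ring
      _ ≤ _ := by gcongr <;> norm_num
  have d4 : ε₁ * (30000000 * z ^ 4 * M ^ 4 * sqn w) ≤ 30000000 * (z ^ 4 * V * M ^ 7 * sqn w) := by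
    calc _ ≤ 1 * (30000000 * z ^ 4 * M ^ 4 * sqn w) := by gcongr
      _ = 30000000 * (z ^ 4 * 1 * M ^ 4 * sqn w) := by ring
      _ ≤ _ := by gcongr; norm_num
  have d5 : 72 * z ^ 4 * M ^ 4 * sqn w ≤ 72 * (z ^ 4 * V * M ^ 7 * sqn w) := by
    calc _ = 72 * (z ^ 4 * 1 * M ^ 4 * sqn w) := by ring
      _ ≤ _ := by gcongr; norm_num
  have d6 : 51 * z * V * M ^ 7 * sqn w ≤ 51 * (z ^ 4 * V * M ^ 7 * sqn w) := by
    calc _ = 51 * (z ^ 1 * V * M ^ 7 * sqn w) := by ring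
      _ ≤ _ := by gcongr; norm_num
  have d7 : 8 * W ^ 2 * omn w ≤ 8 * (z ^ 4 * V * M ^ 7 * (W * omn w)) := by
    calc _ = 8 * (1 * W * (W * omn w)) := by ring
      _ ≤ 8 * (z ^ 4 * (V * M ^ 7) * (W * omn w)) := by
          gcongr
          · exact one_le_pow₀ z1
          · exact hWle.trans (by gcongr; norm_num)
      _ = _ := by ring
  have Y1 : 0 ≤ z ^ 4 * V * M ^ 7 * (W * omn w) := by positivity
  rw [dE_eq, eG, eT]
  linarith
end BO4
end

noncomputable section
namespace BO4
open scoped ENNReal ComplexConjugate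

/-! ### The energy estimate -/

lemma MemHs.one {s : ℝ} (hs : 1 ≤ s) {f : Torus → ℝ} (hf : MemHs s f) : MemHs 1 f :=
  ⟨hf.1, by simpa only [Real.rpow_one] using hf.summable_one hs⟩

/-- The quantity that is comparable to the energy, on the Fourier side. -/
lemma weighted_norm_eq {κ : ℝ} {f g : Torus → ℝ} (hf : MemLp f 2 volume)
    (hg : MemLp g 2 volume) :
    hNegOneNorm (f - g) ^ 2 * (1 + κ * l2norm f ^ 2 + κ * l2norm f ^ 4) + l2norm (f - g) ^ 2
      = 2 * Real.pi * (sqn (coeff f - coeff g)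
        + wgt κ (coeff f) * omn (coeff f - coeff g)) := by
  rw [show l2norm f ^ 4 = (l2norm f ^ 2) ^ 2 by ring, hNegOneNorm_sq (hf.sub hg),
    l2norm_sq (hf.sub hg), l2norm_sq hf, coeff_sub hf hg]
  change _ = 2 * Real.pi * ((∑' k, ‖(coeff f - coeff g) k‖ ^ 2) + (1
    + κ * (2 * Real.pi * ∑' k, ‖coeff f k‖ ^ 2) + κ * (2 * Real.pi * ∑' k, ‖coeff f k‖ ^ 2) ^ 2)
      * omn (coeff f - coeff g))
  ring

lemma MemHs.summable_pow_four {s : ℝ} (hs : 4 ≤ s) {f : Torus → ℝ} (hf : MemHs s f) :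
    Summable (fun k : ℤ => ((k : ℝ) ^ 4 * ‖coeff f k‖) ^ 2) ∧
      Real.pi * ∑' k : ℤ, ((k : ℝ) ^ 4 * ‖coeff f k‖) ^ 2 ≤ hsNorm s f ^ 2 := by
  have h : ∀ k : ℤ, ((k : ℝ) ^ 4 * ‖coeff f k‖) ^ 2 ≤ (|(k : ℝ)| ^ s * ‖coeff f k‖) ^ 2 := by
    intro k
    rcases eq_or_ne k 0 with rfl | hk
    · simp; positivity
    · have h1 : (1 : ℝ) ≤ |(k : ℝ)| := by exact_mod_cast Int.one_le_abs hk
      have h2 : (k : ℝ) ^ 4 ≤ |(k : ℝ)| ^ s := by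
        have := Real.rpow_le_rpow_of_exponent_le h1 hs
        rw [show (4 : ℝ) = ((4 : ℕ) : ℝ) by norm_num, Real.rpow_natCast, ← abs_pow,
          abs_of_nonneg (by positivity)] at this
        exact this
      have h3 : 0 ≤ (k : ℝ) ^ 4 := by positivity
      gcongr
  have hsum := hf.2.of_nonneg_of_le (fun k => sq_nonneg _) h
  refine ⟨hsum, ?_⟩
  rw [hsNorm_sq hf]
  have h1 := hsum.tsum_le_tsum h hf.2
  have h2 := sqn_nonneg (coeff f)
  exact mul_le_mul_of_nonneg_left (by linarith) Real.pi_pos.le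

lemma ee_smul_symQ {g : ℤ → ℂ} (h : Summable fun k : ℤ => ((k : ℝ) ^ 4 * ‖g k‖) ^ 2) (r : ℝ) :
    ee ((r : ℂ) • ml symQ g)
      ≤ ENNReal.ofReal (r ^ 2 * ∑' k : ℤ, ((k : ℝ) ^ 4 * ‖g k‖) ^ 2) := by
  rw [ee, ← tsum_mul_left, ENNReal.ofReal_tsum_of_nonneg (fun k => by positivity) (h.mul_left _)]
  refine ENNReal.tsum_le_tsum fun k => le_of_eq ?_
  rw [← ofReal_norm, ← ENNReal.ofReal_pow (norm_nonneg _)]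
  congr 1
  have h4 : |(k : ℝ)| ^ 4 = (k : ℝ) ^ 4 := by rw [← abs_pow, abs_of_nonneg (by positivity)]
  simp only [Pi.smul_apply, ml, smul_eq_mul, norm_mul, symQ, norm_pow, Complex.norm_real,
    Complex.norm_intCast, Real.norm_eq_abs, h4, mul_pow, sq_abs]

lemma sub_sq_le_max {ε₁ ε₂ : ℝ} (h₁ : 0 ≤ ε₁) (h₂ : 0 ≤ ε₂) :
    (ε₂ - ε₁) ^ 2 ≤ max (ε₁ ^ 2) (ε₂ ^ 2) := by
  rcases le_total ε₁ ε₂ with h | h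
  · exact (pow_le_pow_left₀ (by linarith) (by linarith) 2).trans (le_max_right _ _)
  · rw [← neg_sub, neg_sq]
    exact (pow_le_pow_left₀ (by linarith) (by linarith) 2).trans (le_max_left _ _)

/-- The bound on the Fourier side is translated back: Sobolev embedding bounds the algebra norms by
`I`, and the lower half of admissibility replaces the weighted norms by the energy. -/
theorem energy_estimate (c : Coeffs) {ψ : ℝ → ℝ} (hψ : IsLowCut ψ) {κ : ℝ} (hκ : 0 < κ)
    (hadm : Admissible c ψ κ) {s₀ : ℝ} (hs : 7 / 2 < s₀) :
    ∃ C : ℝ, 0 < C ∧ ∀ (T : ℝ) (ε₁ ε₂ : ℝ) (u₁ u₂ : ℝ → Torus → ℝ),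
      ε₁ ∈ Ioo (0 : ℝ) 1 → ε₂ ∈ Ioo (0 : ℝ) 1 →
      ContInHs s₀ (Icc 0 T) u₁ → ContInHs s₀ (Icc 0 T) u₂ →
      SolvesReg c ε₁ T u₁ → SolvesReg c ε₂ T u₂ →
      ∀ t ∈ Icc (0 : ℝ) T, ∃ E' : ℝ,
        HasDerivWithinAt (fun τ => energy c ψ κ (u₁ τ) (u₂ τ)) E' (Icc 0 T) t ∧
        (MemHs (s₀ + 1) (u₂ t) →
          E' ≤ C * sizeI s₀ (u₁ t) (u₂ t) ^ 7 * energy c ψ κ (u₁ t) (u₂ t)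
            + max (ε₁ ^ 2) (ε₂ ^ 2) * hsNorm (s₀ + 1) (u₂ t) ^ 2) := by
  obtain ⟨B, hB, hnr⟩ := exists_nr_le 3 (s := s₀) (by norm_num; linarith)
  have hwc := one_le_wc hκ.le
  have hsz := c.one_le_size
  -- The `4` is that of admissibility and `(B + 1)⁷` comes from the embedding constant.
  refine ⟨4 * (40000000 * c.size ^ 4 * wc κ * (B + 1) ^ 7), by positivity,
    fun T ε₁ ε₂ u₁ u₂ hε₁ hε₂ h₁ h₂ hu₁ hu₂ t ht => ?_⟩
  have D₁ := hu₁.hd hs h₁ ht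
  have D := hasDerivWithinAt_eSeq c κ D₁ (D₁.sub (hu₂.hd hs h₂ ht)) (realSeq_coeff (u₁ t))
  have hE : ∀ τ ∈ Icc 0 T, energy c ψ κ (u₁ τ) (u₂ τ)
      = 2 * Real.pi * eSeq c κ (coeff (u₁ τ)) (coeff (u₁ τ) - coeff (u₂ τ)) := fun τ hτ =>
    energy_eq c hψ κ ((h₁ τ hτ).1.wiener (by linarith)) ((h₂ τ hτ).1.wiener (by linarith))
      ((h₁ τ hτ).1.summable_one (by linarith))
  refine ⟨_, (D.const_mul (2 * Real.pi)).congr hE (hE t ht), fun hm => ?_⟩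
  have m₁ := (h₁ t ht).1
  have m₂ := (h₂ t ht).1
  set a := coeff (u₁ t)
  set g := coeff (u₂ t)
  set I := sizeI s₀ (u₁ t) (u₂ t) with hI
  have n₁ := hsNorm_nonneg s₀ (u₁ t)
  have n₂ := hsNorm_nonneg s₀ (u₂ t)
  have hI1 : 1 ≤ I := by rw [hI, sizeI]; linarith
  -- One number `M` serves for `a`, `g`, `a - g` and `a + g`, and is at least `1`.
  have hM : 1 ≤ (B + 1) * I := one_le_mul_of_one_le_of_one_le (by linarith) hI1
  have hle : B * hsNorm s₀ (u₁ t) + B * hsNorm s₀ (u₂ t) ≤ (B + 1) * I := by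
    rw [hI, sizeI]; nlinarith
  have b₁ := mul_nonneg hB.le n₁
  have b₂ := mul_nonneg hB.le n₂
  have ha := hnr _ m₁
  have hg := hnr _ m₂
  have up := fun {x : ℝ} (h : x ≤ (B + 1) * I) => ENNReal.ofReal_le_ofReal h
  obtain ⟨hsum, hG⟩ := hm.summable_pow_four (by linarith)
  set G := ∑' k : ℤ, ((k : ℝ) ^ 4 * ‖coeff (u₂ t) k‖) ^ 2 with hGd
  have hG0 : 0 ≤ G := tsum_nonneg fun k => sq_nonneg _
  have main := dE_le c hκ.le hε₁.1.le hε₁.2.le hM (mul_nonneg (sq_nonneg (ε₂ - ε₁)) hG0)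
    (realSeq_coeff (u₁ t)) (ha.trans (up (by linarith))) (hg.trans (up (by linarith)))
    ((nr_sub_le_ofReal b₁ b₂ ha hg).trans (up hle)) ((nr_add_le_ofReal b₁ b₂ ha hg).trans (up hle))
    (ee_smul_symQ hsum _)
  have hadm' := (hadm (u₁ t) (u₂ t) (m₁.one (by linarith)) (m₂.one (by linarith))).2
  rw [weighted_norm_eq m₁.1 m₂.1] at hadm'
  set K := 40000000 * c.size ^ 4 * wc κ with hK
  have hK0 : 0 ≤ K := by positivity
  have hmax := sub_sq_le_max hε₁.1.le hε₂.1.le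
  have hpi := Real.pi_pos
  -- The normalizations fit: `2π` times half the forcing is `π(ε₂-ε₁)²∑k⁸|g_k|²`, and
  -- `‖u₂‖²_{H^{s₀+1}}` contains `π∑|k|^{2(s₀+1)}|g_k|²` with `s₀ + 1 ≥ 4`. Hence the coefficient of
  -- the last term is exactly `1`.
  calc 2 * Real.pi * dE c κ a (a - g) (rhs c ε₁ a) (rhs c ε₁ a - rhs c ε₂ g)
      ≤ 2 * Real.pi * ((ε₂ - ε₁) ^ 2 * G / 2 + K * ((B + 1) * I) ^ 7
          * (sqn (a - g) + wgt κ a * omn (a - g))) := by gcongr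
    _ = (ε₂ - ε₁) ^ 2 * (Real.pi * G) + K * ((B + 1) * I) ^ 7
          * (2 * Real.pi * (sqn (a - g) + wgt κ a * omn (a - g))) := by ring
    _ ≤ max (ε₁ ^ 2) (ε₂ ^ 2) * hsNorm (s₀ + 1) (u₂ t) ^ 2 + K * ((B + 1) * I) ^ 7
          * (4 * energy c ψ κ (u₁ t) (u₂ t)) := by
        have : 0 ≤ max (ε₁ ^ 2) (ε₂ ^ 2) := (sq_nonneg _).trans hmax
        gcongr
    _ = _ := by ring
end BO4
end

noncomputable section
namespace BO4
open scoped ENNReal ComplexConjugate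

/-! ### Admissibility of large constants -/

/-- A summable weight on the integers concentrated on `|k| ≤ m`. -/
def tau (m : ℝ) (k : ℤ) : ℝ := m / (m + |(k : ℝ)|) ^ 2

lemma tau_nonneg {m : ℝ} (hm : 0 ≤ m) (k : ℤ) : 0 ≤ tau m k := by unfold tau; positivity

/-- A telescoping bound: `m/(m+n)²` is at most `2m/((m+n)(m+n+1))` because `m + n ≥ 1`. The total is
bounded uniformly in `m`. -/
lemma sum_range_div_sq_le {m : ℝ} (hm : 1 ≤ m) (n : ℕ) :
    ∑ i ∈ Finset.range n, m / (m + i) ^ 2 ≤ 2 - 2 * m / (m + n) := by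
  induction n with
  | zero =>
    have : m ≠ 0 := by linarith
    simp; field_simp; norm_num
  | succ n ih =>
    rw [Finset.sum_range_succ]
    have hn : (0 : ℝ) ≤ n := n.cast_nonneg
    have h1 : 0 < m + n := by linarith
    have h : m / (m + n) ^ 2 ≤ 2 * m / (m + n) - 2 * m / (m + n + 1) := by
      rw [div_sub_div _ _ h1.ne' (by positivity), div_le_div_iff₀ (by positivity) (by positivity)]
      have : 0 ≤ m * (m + n) := by positivity
      nlinarith [mul_nonneg this (mul_nonneg h1.le (show 0 ≤ m + n - 1 by linarith))]
    push_cast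
    rw [← add_assoc]
    linarith

lemma tau_natCast (m : ℝ) (n : ℕ) : tau m n = m / (m + n) ^ 2 := by simp [tau]

lemma tau_neg_natCast (m : ℝ) (n : ℕ) : tau m (-((n : ℤ) + 1)) = m / (m + (n + 1 : ℕ)) ^ 2 := by
  unfold tau
  push_cast
  rw [abs_neg, abs_of_nonneg (by positivity)]

lemma summable_tau {m : ℝ} (hm : 1 ≤ m) : Summable (tau m) ∧ ∑' k, tau m k ≤ 4 := by
  have hm0 : 0 ≤ m := by linarith
  have nn : ∀ n : ℕ, 0 ≤ m / (m + n) ^ 2 := fun n => by positivity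
  have b1 : ∀ n : ℕ, ∑ i ∈ Finset.range n, m / (m + i) ^ 2 ≤ 2 := fun n =>
    (sum_range_div_sq_le hm n).trans (by have : 0 ≤ 2 * m / (m + n) := by positivity
                                         linarith)
  have b2 : ∀ n : ℕ, ∑ i ∈ Finset.range n, m / (m + (i + 1 : ℕ)) ^ 2 ≤ 2 := fun n => by
    refine le_trans ?_ (b1 (n + 1))
    rw [Finset.sum_range_succ' _ n]
    exact le_add_of_nonneg_right (nn _)
  have s1 : Summable fun n : ℕ => m / (m + n) ^ 2 := summable_of_sum_range_le nn b1
  have s2 : Summable fun n : ℕ => m / (m + (n + 1 : ℕ)) ^ 2 :=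
    summable_of_sum_range_le (fun n => nn _) b2
  have t1 := Real.tsum_le_of_sum_range_le nn b1
  have t2 := Real.tsum_le_of_sum_range_le (fun n => nn (n + 1)) b2
  have h := HasSum.of_nat_of_neg_add_one (f := tau m) (m := ∑' n : ℕ, m / (m + n) ^ 2)
    (m' := ∑' n : ℕ, m / (m + (n + 1 : ℕ)) ^ 2)
    (by simpa only [tau_natCast] using s1.hasSum) (by simpa only [tau_neg_natCast] using s2.hasSum)
  exact ⟨h.summable, by rw [h.tsum_eq]; linarith⟩

/-- Since `J² ≈ k⁻²`, dividing by the weight `m/(m+|k|)²` leaves `(m+|k|)²/(m k²)`, of size `m`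
times the `H⁻¹` symbol plus `1/m` times the `L²` symbol. -/
lemma Jc_sq_le {m : ℝ} (hm : 1 ≤ m) (k : ℤ) : Jc k ^ 2 ≤ tau m k * (4 * m * om k + 2 / m) := by
  have hm0 : 0 < m := by linarith
  have hom := om_nonneg k
  unfold Jc
  split_ifs with h
  · have hk : (2 : ℝ) ≤ |(k : ℝ)| := by exact_mod_cast h
    have ho : om k = (1 + |(k : ℝ)| ^ 2)⁻¹ := by rw [om, sq_abs]
    rw [ho, tau]
    set x := |(k : ℝ)|
    have hx : 0 < x := by linarith
    have h1 : (m + x) ^ 2 / x ^ 2 ≤ 4 * m ^ 2 * (1 + x ^ 2)⁻¹ + 2 := by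
      have h2 : 2 / x ^ 2 ≤ 4 * (1 + x ^ 2)⁻¹ := by
        rw [← div_eq_mul_inv, div_le_div_iff₀ (by positivity) (by positivity)]
        nlinarith
      have h3 : (m + x) ^ 2 ≤ 2 * m ^ 2 + 2 * x ^ 2 := by nlinarith [sq_nonneg (m - x)]
      calc (m + x) ^ 2 / x ^ 2 ≤ (2 * m ^ 2 + 2 * x ^ 2) / x ^ 2 := by gcongr
        _ = m ^ 2 * (2 / x ^ 2) + 2 := by field_simp
        _ ≤ m ^ 2 * (4 * (1 + x ^ 2)⁻¹) + 2 := by gcongr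
        _ = _ := by ring
    calc x⁻¹ ^ 2 = ((m + x) ^ 2 / x ^ 2) / (m + x) ^ 2 := by field_simp
      _ ≤ (4 * m ^ 2 * (1 + x ^ 2)⁻¹ + 2) / (m + x) ^ 2 := by gcongr
      _ = _ := by field_simp
  · rw [zero_pow two_ne_zero]
    have := tau_nonneg hm0.le k
    positivity

/-- The `ℓ¹` norm of `J w`. -/
def nJ (w : ℤ → ℂ) : ℝ := ∑' k, Jc k * ‖w k‖

lemma nJ_nonneg (w : ℤ → ℂ) : 0 ≤ nJ w :=
  tsum_nonneg fun k => mul_nonneg (Jc_nonneg k) (norm_nonneg _)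

/-- Cauchy–Schwarz against `tau m`, in the additive form of Young's inequality. The free parameter
`m` interpolates: the `L²` part can be made as small as desired at the price of a larger multiple of
the `H⁻¹` part. -/
lemma nJ_sq_le {m : ℝ} (hm : 1 ≤ m) {w : ℤ → ℂ} (hw : nr 0 w ≠ ⊤) :
    nJ w ^ 2 ≤ 64 * m * omn w + 32 / m * sqn w := by
  have hm0 : 0 < m := by linarith
  have hw2 := summable_sq_of_nr hw
  have hsJ : Summable fun k => Jc k * ‖w k‖ := (nr_zero_ne_top_iff.1 hw).of_nonneg_of_le
    (fun k => mul_nonneg (Jc_nonneg k) (norm_nonneg _))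
    fun k => mul_le_of_le_one_left (norm_nonneg _) (Jc_le_one k)
  have hz : Summable fun k => (4 * m * om k + 2 / m) * ‖w k‖ ^ 2 := by
    refine (((summable_omn hw2).mul_left (4 * m)).add (hw2.mul_left (2 / m))).congr fun k => ?_
    ring
  have hZ : ∑' k, (4 * m * om k + 2 / m) * ‖w k‖ ^ 2 = 4 * m * omn w + 2 / m * sqn w := by
    rw [omn, sqn, ← tsum_mul_left, ← tsum_mul_left,
      ← ((summable_omn hw2).mul_left (4 * m)).tsum_add (hw2.mul_left (2 / m))]
    exact tsum_congr fun k => by ring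
  obtain ⟨hτ, hτ4⟩ := summable_tau hm
  have key : ∀ s : ℝ, 0 < s → nJ w ≤ s * 4 + s⁻¹ * (4 * m * omn w + 2 / m * sqn w) := by
    intro s hs
    have hs' := inv_pos.2 hs
    have h1 : nJ w ≤ ∑' k, (s * tau m k + s⁻¹ * ((4 * m * om k + 2 / m) * ‖w k‖ ^ 2)) := by
      refine hsJ.tsum_le_tsum (fun k => ?_) ((hτ.mul_left s).add (hz.mul_left s⁻¹))
      have hom := om_nonneg k
      have ht := tau_nonneg hm0.le k
      have hnn : 0 ≤ s * tau m k + s⁻¹ * ((4 * m * om k + 2 / m) * ‖w k‖ ^ 2) := by positivity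
      refine (le_abs_self _).trans (abs_le_of_sq_le_sq ?_ hnn)
      have e : s * s⁻¹ = 1 := mul_inv_cancel₀ hs.ne'
      have hJ := mul_le_mul_of_nonneg_right (Jc_sq_le hm k) (sq_nonneg ‖w k‖)
      calc (Jc k * ‖w k‖) ^ 2 ≤ tau m k * (4 * m * om k + 2 / m) * ‖w k‖ ^ 2 := by
            rw [mul_pow]; exact hJ
        _ ≤ 4 * (s * s⁻¹) * (tau m k * ((4 * m * om k + 2 / m) * ‖w k‖ ^ 2)) := by
            rw [e]
            have : 0 ≤ tau m k * ((4 * m * om k + 2 / m) * ‖w k‖ ^ 2) := by positivity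
            linarith
        _ ≤ _ := by
            nlinarith [sq_nonneg (s * tau m k - s⁻¹ * ((4 * m * om k + 2 / m) * ‖w k‖ ^ 2))]
    rw [(hτ.mul_left s).tsum_add (hz.mul_left s⁻¹), tsum_mul_left, tsum_mul_left, hZ] at h1
    exact h1.trans (by gcongr)
  have hN := nJ_nonneg w
  have hO := omn_nonneg w
  have hS := sqn_nonneg w
  rcases hN.eq_or_lt with h0 | h0
  · rw [← h0, zero_pow two_ne_zero]; positivity
  -- With this `s` the term `4s` is half of the left-hand side and is absorbed; what remains is `nJ²
  -- ≤ 16(4m·omn + (2/m)·sqn)`.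
  · have h := key (nJ w / 8) (by positivity)
    have h2 : nJ w * nJ w ≤ nJ w * (nJ w / 8 * 4 + (nJ w / 8)⁻¹ * (4 * m * omn w + 2 / m * sqn w)) :=
      mul_le_mul_of_nonneg_left h hN
    have e : nJ w * (nJ w / 8)⁻¹ = 8 := by field_simp
    rw [mul_add, ← mul_assoc (nJ w) (nJ w / 8)⁻¹, e] at h2
    have e2 : 32 / m = 16 * (2 / m) := by ring
    rw [e2]
    linarith

lemma tsum_nJ {w : ℤ → ℂ} (hw : nr 0 w ≠ ⊤) :
    ∑' k, ENNReal.ofReal (Jc k) * ‖w k‖ₑ = ENNReal.ofReal (nJ w) := by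
  have hsJ : Summable fun k => Jc k * ‖w k‖ := (nr_zero_ne_top_iff.1 hw).of_nonneg_of_le
    (fun k => mul_nonneg (Jc_nonneg k) (norm_nonneg _))
    fun k => mul_le_of_le_one_left (norm_nonneg _) (Jc_le_one k)
  rw [nJ, ENNReal.ofReal_tsum_of_nonneg (fun k => mul_nonneg (Jc_nonneg k) (norm_nonneg _)) hsJ]
  exact tsum_congr fun k => by rw [ENNReal.ofReal_mul (Jc_nonneg k), ofReal_norm]

/-- The argument that carries `J` is taken in `ℓ¹`, the background and the other argument in `ℓ²`.
So only `‖f‖` in `L²` enters, as the weight of the energy demands. -/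
lemma abs_re_tri_nJ_le {θ : ℤ → ℤ → ℝ} (hθ : ∀ k l, |θ k l| ≤ Jc k + Jc l) {a w : ℤ → ℂ}
    (ha : nr 0 a ≠ ⊤) (hw : nr 0 w ≠ ⊤) {s : ℝ} (hs : 0 < s) :
    |(tri θ a w w).re| ≤ 2 * (nJ w * (s * sqn a + s⁻¹ * sqn w)) := by
  have hN := nJ_nonneg w
  have hF := sqn_nonneg a
  have hS := sqn_nonneg w
  have hs' := inv_pos.2 hs
  refine abs_re_le_of_enorm (by positivity) ((enorm_tsum_le _).trans ?_)
  rw [ENNReal.ofReal_mul zero_le_two, ENNReal.ofReal_mul hN,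
    ENNReal.ofReal_add (by positivity) (by positivity), ENNReal.ofReal_mul hs.le,
    ENNReal.ofReal_mul hs'.le, ← ee_eq ha, ← ee_eq hw, ← tsum_nJ hw, ENNReal.ofReal_ofNat]
  set Q := ENNReal.ofReal s * ee a + ENNReal.ofReal s⁻¹ * ee w with hQ
  have inner : ∀ (φ : ℤ → ℤ), (∀ g : ℤ → ℝ≥0∞, ∑' l, g (φ l) = ∑' l, g l) →
      ∑' l, ‖a (φ l)‖ₑ * ‖w l‖ₑ ≤ Q := fun φ hφ => by
    rw [hQ, ee, ee, ← hφ fun l => ‖a l‖ₑ ^ 2, ← ENNReal.tsum_mul_left, ← ENNReal.tsum_mul_left,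
      ← ENNReal.tsum_add]
    exact ENNReal.tsum_le_tsum fun l => mul_le_young _ _ hs
  have p1 : ∑' k, ∑' l, (ENNReal.ofReal (Jc k) * ‖w k‖ₑ) * (‖a (k - l)‖ₑ * ‖w l‖ₑ)
      ≤ (∑' k, ENNReal.ofReal (Jc k) * ‖w k‖ₑ) * Q := by
    rw [← ENNReal.tsum_mul_right]
    refine ENNReal.tsum_le_tsum fun k => ?_
    rw [ENNReal.tsum_mul_left]
    exact mul_le_mul_right (inner (fun l => k - l) fun g => tsum_sub_left g k) _
  have p2 : ∑' k, ∑' l, (ENNReal.ofReal (Jc l) * ‖w l‖ₑ) * (‖a (k - l)‖ₑ * ‖w k‖ₑ)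
      ≤ (∑' k, ENNReal.ofReal (Jc k) * ‖w k‖ₑ) * Q := by
    rw [ENNReal.tsum_comm, ← ENNReal.tsum_mul_right]
    refine ENNReal.tsum_le_tsum fun l => ?_
    rw [ENNReal.tsum_mul_left]
    exact mul_le_mul_right (inner (fun k => k - l) fun g => tsum_sub_right g l) _
  rw [two_mul]
  refine le_trans ?_ (add_le_add p1 p2)
  rw [← ENNReal.tsum_add, ENNReal.tsum_prod']
  refine ENNReal.tsum_le_tsum fun k => ?_
  rw [← ENNReal.tsum_add]
  refine ENNReal.tsum_le_tsum fun l => ?_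
  have h1 := enorm_real_le (hθ k l)
  rw [ENNReal.ofReal_add (Jc_nonneg k) (Jc_nonneg l)] at h1
  simp only [enorm_mul, enorm_conj]
  calc ‖a (k - l)‖ₑ * ‖(θ k l : ℂ)‖ₑ * ‖w l‖ₑ * ‖w k‖ₑ
      ≤ ‖a (k - l)‖ₑ * (ENNReal.ofReal (Jc k) + ENNReal.ofReal (Jc l)) * ‖w l‖ₑ * ‖w k‖ₑ := by
        gcongr
    _ = _ := by ring

/-- Both arguments carry `J` and are taken in `ℓ¹`; the coefficients of `f²` are bounded by the `L²`
norm of `f`. -/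
lemma abs_re_tri_JJ_nJ_le {a w : ℤ → ℂ} (ha : nr 0 a ≠ ⊤) (hw : nr 0 w ≠ ⊤) :
    |(tri (fun k l => Jc k * Jc l) (conv a a) w w).re| ≤ 2 * (sqn a * nJ w ^ 2) := by
  have hN := nJ_nonneg w
  have hF := sqn_nonneg a
  refine abs_re_le_of_enorm (by positivity) ((enorm_tsum_le _).trans ?_)
  rw [ENNReal.ofReal_mul zero_le_two, ENNReal.ofReal_mul hF, ENNReal.ofReal_pow hN, ← ee_eq ha,
    ← tsum_nJ hw, ENNReal.ofReal_ofNat]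
  have hc : ∀ k, ‖conv a a k‖ₑ ≤ 2 * ee a := fun k => by
    refine (enorm_tsum_le _).trans ?_
    calc ∑' j, ‖a (k - j) * a j‖ₑ ≤ ∑' j, (‖a (k - j)‖ₑ ^ 2 + ‖a j‖ₑ ^ 2) :=
          ENNReal.tsum_le_tsum fun j => by rw [enorm_mul]; exact mul_le_sq_add_sq _ _
      _ = 2 * ee a := by
          rw [ENNReal.tsum_add, tsum_sub_left (fun j => ‖a j‖ₑ ^ 2) k, two_mul, ee]
  rw [sq, ← ENNReal.tsum_mul_right, ← ENNReal.tsum_mul_left, ← ENNReal.tsum_mul_left,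
    ENNReal.tsum_prod']
  refine ENNReal.tsum_le_tsum fun k => ?_
  rw [← ENNReal.tsum_mul_left, ← ENNReal.tsum_mul_left, ← ENNReal.tsum_mul_left]
  refine ENNReal.tsum_le_tsum fun l => ?_
  simp only [enorm_mul, enorm_conj]
  rw [Complex.ofReal_mul, enorm_mul, enorm_ofReal_abs, enorm_ofReal_abs,
    abs_of_nonneg (Jc_nonneg k), abs_of_nonneg (Jc_nonneg l)]
  calc ‖conv a a (k - l)‖ₑ * (ENNReal.ofReal (Jc k) * ENNReal.ofReal (Jc l)) * ‖w l‖ₑ * ‖w k‖ₑ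
      ≤ 2 * ee a * (ENNReal.ofReal (Jc k) * ENNReal.ofReal (Jc l)) * ‖w l‖ₑ * ‖w k‖ₑ := by
        gcongr; exact hc _
    _ = _ := by ring

/-- The corrections are bounded by a small multiple of `‖w‖²` plus `‖f‖²‖Jw‖²_{ℓ¹}`. Interpolating
the latter with a parameter proportional to `1 + ‖f‖²` leaves a multiple of `(‖f‖² +
‖f‖⁴)‖w‖²_{H⁻¹}`, which a large `κ` absorbs. -/
lemma abs_corrSeq_le (c : Coeffs) {κ : ℝ} (hκ : 10000000 * c.size ^ 4 ≤ κ) {a w : ℤ → ℂ}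
    (ha : nr 0 a ≠ ⊤) (hw : nr 0 w ≠ ⊤) :
    |corrSeq c a w| ≤ (sqn w + wgt κ a * omn w) / 4 := by
  have hN := nJ_nonneg w
  have hF := sqn_nonneg a
  have hS := sqn_nonneg w
  have hO := omn_nonneg w
  have z1 := c.one_le_size
  have z0 : 0 < c.size := by linarith
  set z := c.size with hz
  set F := sqn a with hFd
  set S := sqn w with hSd
  set O := omn w with hOd
  set N := nJ w with hNd
  have l1 : |lam₁ c 0 / 4| ≤ z / 2 := by
    rw [abs_div, abs_of_pos (show (0 : ℝ) < 4 by norm_num)]; linarith [abs_lam₁_le c]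
  have l2 : |lam₂ c 0 / 4| ≤ z / 4 := by
    rw [abs_div, abs_of_pos (show (0 : ℝ) < 4 by norm_num)]; linarith [abs_lam₂_le c]
  have key : ∀ s : ℝ, 0 < s → |corrSeq c a w|
      ≤ 3 / 2 * z * (N * (s * F + s⁻¹ * S)) + 2 * z ^ 2 * (F * N ^ 2) := fun s hs => by
    rw [corrSeq_eq]
    refine (abs_add_le_add (abs_add_le_add
      (abs_mul_le_of_le l1 (abs_re_tri_nJ_le abs_th₁_le_add ha hw hs))
      (abs_mul_le_of_le l2 (abs_re_tri_nJ_le abs_th₂_le_add ha hw hs)))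
      (abs_mul_le_of_le (abs_mu₃_le c) (abs_re_tri_JJ_nJ_le ha hw))).trans (le_of_eq ?_)
    ring
  have b1 : |corrSeq c a w| ≤ S / 8 + 20 * z ^ 2 * (F * N ^ 2) := by
    rcases hN.eq_or_lt with h0 | h0
    · have := key 1 one_pos
      rw [← h0] at this ⊢
      linarith
    -- Chosen so that the `S` term is `S/8`; the other becomes `18z²FN²`, and with the third
    -- correction `20z²FN²`.
    · refine (key (12 * z * N) (by positivity)).trans (le_of_eq ?_)
      field_simp
      ring
  -- `5120 = 8·640` makes the coefficient of `S` after interpolation at most `1/8`.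
  set m := 1 + 5120 * z ^ 2 * F with hm
  have hm1 : 1 ≤ m := by rw [hm]; have : 0 ≤ 5120 * z ^ 2 * F := by positivity
                         linarith
  have hm0 : 0 < m := by linarith
  have b2 := nJ_sq_le hm1 hw
  have b3 : 20 * z ^ 2 * (F * N ^ 2)
      ≤ 1280 * (z ^ 2 * F) * m * O + 640 * (z ^ 2 * F) / m * S := by
    calc 20 * z ^ 2 * (F * N ^ 2) ≤ 20 * z ^ 2 * (F * (64 * m * O + 32 / m * S)) := by gcongr
      _ = _ := by ring
  have b4 : 640 * (z ^ 2 * F) / m ≤ 1 / 8 := by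
    rw [div_le_div_iff₀ hm0 (by norm_num), hm]; linarith
  have b5 : 1280 * (z ^ 2 * F) * m ≤ wgt κ a / 4 := by
    have hp := Real.pi_gt_three
    have hz4 : z ^ 2 ≤ z ^ 4 := pow_le_pow_right₀ z1 (by norm_num)
    have hκ0 : 0 ≤ κ := le_trans (by positivity) hκ
    have e1 : 10000000 * z ^ 4 * F ≤ κ * F := mul_le_mul_of_nonneg_right hκ hF
    have e2 : 10000000 * z ^ 4 * F ^ 2 ≤ κ * F ^ 2 := mul_le_mul_of_nonneg_right hκ (sq_nonneg F)
    have e3 : κ * F * 4 ≤ κ * (2 * Real.pi * F) := by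
      have : 0 ≤ κ * F := by positivity
      nlinarith
    have e4 : κ * F ^ 2 * 4 ≤ κ * (2 * Real.pi * F) ^ 2 := by
      calc κ * F ^ 2 * 4 = κ * (2 * F) ^ 2 := by ring
        _ ≤ κ * (2 * Real.pi * F) ^ 2 := by gcongr; linarith
    have e5 : z ^ 2 * F ≤ z ^ 4 * F := mul_le_mul_of_nonneg_right hz4 hF
    have e6 : 0 ≤ z ^ 4 * F ^ 2 := by positivity
    have e7 : 0 ≤ z ^ 4 * F := by positivity
    have e8 : 1280 * (z ^ 2 * F) * m = 1280 * (z ^ 2 * F) + 6553600 * (z ^ 4 * F ^ 2) := by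
      rw [hm]; ring
    rw [e8]
    change _ ≤ (1 + κ * (2 * Real.pi * F) + κ * (2 * Real.pi * F) ^ 2) / 4
    linarith
  have b6 := mul_le_mul_of_nonneg_right b4 hS
  have b7 := mul_le_mul_of_nonneg_right b5 hO
  linarith

/-- The energy without corrections is half of the weighted norm, and the corrections are at most a
quarter of it; so the energy lies between a quarter and three quarters. -/
lemma admissible_of_le (c : Coeffs) {ψ : ℝ → ℝ} (hψ : IsLowCut ψ) {κ : ℝ}
    (hκ : 10000000 * c.size ^ 4 ≤ κ) : Admissible c ψ κ := by
  intro f g hf hg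
  have wf := hf.wiener (by norm_num)
  have wg := hg.wiener (by norm_num)
  have h := abs_le.1 (abs_corrSeq_le c hκ wf.2 (nr_sub_ne_top wf.2 wg.2))
  have hp := Real.pi_pos
  rw [weighted_norm_eq hf.1 hg.1, energy_eq c hψ κ wf wg (hf.summable_one le_rfl), eSeq]
  set S := sqn (coeff f - coeff g)
  set O := omn (coeff f - coeff g) with hO
  have hS : 0 ≤ S := sqn_nonneg _
  have hO0 : 0 ≤ O := omn_nonneg _
  have hW := one_le_wgt (κ := κ) (le_trans (by have := c.size_nonneg; positivity) hκ) (coeff f)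
  have hWO : 0 ≤ wgt κ (coeff f) * O := mul_nonneg (by linarith) hO0
  constructor
  · refine mul_le_mul_of_nonneg_left ?_ (by positivity)
    linarith [h.2]
  · rw [mul_left_comm]
    refine mul_le_mul_of_nonneg_left ?_ (by positivity)
    linarith [h.1]
end BO4
end

theorem mainTheorem4 (c : BO4.Coeffs) (ψ : ℝ → ℝ) (hψ : BO4.IsLowCut ψ) :
    -- every sufficiently large constant is admissible in the energy
    (∃ κ₀ : ℝ, 0 < κ₀ ∧ ∀ κ : ℝ, κ₀ ≤ κ → BO4.Admissible c ψ κ) ∧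
    -- the energy estimate, for every admissible constant
    ∀ κ : ℝ, 0 < κ → BO4.Admissible c ψ κ →
      ∀ s₀ : ℝ, 7 / 2 < s₀ →
        ∃ C : ℝ, 0 < C ∧
          ∀ (T : ℝ) (ε₁ ε₂ : ℝ) (u₁ u₂ : ℝ → BO4.Torus → ℝ),
            0 < T → ε₁ ∈ Set.Ioo (0 : ℝ) 1 → ε₂ ∈ Set.Ioo (0 : ℝ) 1 →
            BO4.ContInHs s₀ (Set.Icc 0 T) u₁ → BO4.ContInHs (s₀ + 1) (Set.Ioo 0 T) u₁ →
            BO4.ContInHs s₀ (Set.Icc 0 T) u₂ → BO4.ContInHs (s₀ + 1) (Set.Ioo 0 T) u₂ →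
            BO4.SolvesReg c ε₁ T u₁ → BO4.SolvesReg c ε₂ T u₂ →
            ∀ t ∈ Set.Icc (0 : ℝ) T, ∃ E' : ℝ,
              HasDerivWithinAt (fun τ => BO4.energy c ψ κ (u₁ τ) (u₂ τ)) E' (Set.Icc 0 T) t ∧
              -- if `u₂ t` is not in `H^{s₀+1}` (possible only at `t = 0` and `t = T`), then the
              -- right-hand side is `+∞`
              (BO4.MemHs (s₀ + 1) (u₂ t) →
                E' ≤ C * BO4.sizeI s₀ (u₁ t) (u₂ t) ^ 7 * BO4.energy c ψ κ (u₁ t) (u₂ t)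
                  + max (ε₁ ^ 2) (ε₂ ^ 2) * BO4.hsNorm (s₀ + 1) (u₂ t) ^ 2) := by
  refine ⟨⟨10000000 * c.size ^ 4, by have := c.one_le_size; positivity,
    fun κ hκ => BO4.admissible_of_le c hψ hκ⟩, fun κ hκ hadm s₀ hs => ?_⟩
  obtain ⟨C, hC, h⟩ := BO4.energy_estimate c hψ hκ hadm hs
  exact ⟨C, hC, fun T ε₁ ε₂ u₁ u₂ _ hε₁ hε₂ h₁ _ h₂ _ hu₁ hu₂ =>
    h T ε₁ ε₂ u₁ u₂ hε₁ hε₂ h₁ h₂ hu₁ hu₂⟩
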